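/- **Setting.** Let $N\ge 2$, $q\in\mathbb C$, $0<|q|<1$, with a fixed logarithm $\log q$ (so $q^x:=e^{x\log q}$), $k\in\mathbb R$ with $k\neq 0,-N$, $r\in\mathbb R$ with $r>0$ and $r^*:=r-k>0$, and let $\lambda^1,\dots,\lambda^{N-1}\in\mathbb C$. Put $[x]=\frac{q^x-q^{-x}}{q-q^{-1}}$, let $(a_{ij})_{1\le i,j\le N-1}$ be the Cartan matrix of $sl_N$, $(z;t)_\infty=\prod_{n\ge0}(1-zt^n)$, $\Theta_t(z)=(z;t)_\infty(t/z;t)_\infty(t;t)_\infty$ and $$\theta_\nu(u)=q^{\frac{u^2}{\nu}-u}\,\frac{\Theta_{q^{2\nu}}(q^{2u})}{(q^{2\nu};q^{2\nu})_\infty^3}.$$ Throughout $z=q^{2u}$, $w=q^{2v}$, $\ln z=2u\log q$. *Bosons.* Let $a_n^i,p_a^i,q_a^i$ ($1\le i\le N-1$) and $b_n^{ij},p_b^{ij},q_b^{ij},c_n^{ij},p_c^{ij},q_c^{ij}$ ($1\le i<j\le N$), $n\in\mathbb Z\setminus\{0\}$, satisfy $[a^i_n,a^j_m]=\frac{[(k+N)n][a_{ij}n]}{n}\delta_{n+m,0}$,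 $[p_a^i,q_a^j]=a_{ij}(k+N)$, $[b_n^{ij},b_m^{i'j'}]=-\frac{[n]^2}{n}\delta^{ii'}\delta^{jj'}\delta_{n+m,0}$, $[p_b^{ij},q_b^{i'j'}]=-\delta^{ii'}\delta^{jj'}$, $[c_n^{ij},c_m^{i'j'}]=\frac{[n]^2}{n}\delta^{ii'}\delta^{jj'}\delta_{n+m,0}$, $[p_c^{ij},q_c^{i'j'}]=\delta^{ii'}\delta^{jj'}$, and let $\hat p_i,\hat q_i$ ($1\le i\le N-1$) satisfy $[\hat q_i,\hat p_j]=\frac{a_{ij}}2$; all other commutators vanish, and $b^{ii}=c^{ii}=0$. They act on the direct sum of the Fock spaces of all momenta (eigenvalues of the $p$'s and $\hat p$'s). Normal ordering $:\ :$ puts modes with $n<0$ and the $q,\hat q$ to the left of modes with $n>0$ and the $p,\hat p$. For a boson (or a sum of bosons) $x$ put $x(z)=-\sum_{n\ne0}\frac{x_n}{[n]}z^{-n}+q_x+p_x\ln z$ and $x_\pm(z)=\pm\big((q-q^{-1})\sum_{n>0}x_{\pm n}z^{\mp n}+p_x\ln q\big)$. *Currents of $U_q(\widehat{sl}_N)$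 (Wakimoto realization).* For $1\le i\le N-1$, $$\psi^i_\pm(z)=\;:\!\exp\Big(\sum_{j=1}^i\big(b_\pm^{j,i+1}(q^{\pm(\frac k2+j-1)}z)-b_\pm^{j,i}(q^{\pm(\frac k2+j)}z)\big)+a^i_\pm(q^{\pm\frac N2}z)+\sum_{j=i+1}^N\big(b_\pm^{i,j}(q^{\pm(\frac k2+j)}z)-b_\pm^{i+1,j}(q^{\pm(\frac k2+j-1)}z)\big)\Big)\!:,$$ $$e^{+,i}(z)=\tfrac{-1}{(q-q^{-1})z}\sum_{j=1}^i:\!e^{(b+c)^{j,i}(q^{j-1}z)}\Big(e^{b_+^{j,i+1}(q^{j-1}z)-(b+c)^{j,i+1}(q^jz)}-e^{b_-^{j,i+1}(q^{j-1}z)-(b+c)^{j,i+1}(q^{j-2}z)}\Big)e^{\sum_{l=1}^{j-1}(b_+^{l,i+1}(q^{l-1}z)-b_+^{l,i}(q^lz))}\!:,$$ and, with $\tau^{i}_{\pm,m}=a^i_\pm(q^{\pm\frac{k+N}2}z)+\sum_{l=m}^N\big(b_\pm^{i,l}(q^{\pm(k+l)}z)-b_\pm^{i+1,l}(q^{\pm(k+l-1)}z)\big)$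 and $\mu^i_j=\sum_{l=j+1}^i\big(b_-^{l,i+1}(q^{-(k+l-1)}z)-b_-^{l,i}(q^{-(k+l)}z)\big)$, $$\begin{aligned}e^{-,i}(z)=\tfrac{-1}{(q-q^{-1})z}\Big\{&\sum_{j=1}^{i-1}:\!e^{(b+c)^{j,i+1}(q^{-(k+j)}z)}\Big(e^{-b_-^{j,i}(q^{-(k+j)}z)-(b+c)^{j,i}(q^{-(k+j-1)}z)}-e^{-b_+^{j,i}(q^{-(k+j)}z)-(b+c)^{j,i}(q^{-(k+j+1)}z)}\Big)e^{\mu^i_j+\tau^i_{-,i+1}}\!:\\&+:\!e^{(b+c)^{i,i+1}(q^{-(k+i)}z)+\tau^i_{-,i+1}}\!:-:\!e^{(b+c)^{i,i+1}(q^{k+i}z)+\tau^i_{+,i+1}}\!:\\&-\sum_{j=i+2}^N:\!e^{(b+c)^{i,j}(q^{k+j-1}z)}\Big(e^{b_+^{i+1,j}(q^{k+j-1}z)-(b+c)^{i+1,j}(q^{k+j}z)}-e^{b_-^{i+1,j}(q^{k+j-1}z)-(b+c)^{i+1,j}(q^{k+j-2}z)}\Big)e^{\tau^i_{+,j}}\!:\Big\}.\end{aligned}$$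 *Total currents.* Let $H_n^i=\sum_{j=1}^i\big(b_n^{j,i+1}q^{-(\frac k2+j-1)|n|}-b_n^{j,i}q^{-(\frac k2+j)|n|}\big)+a_n^iq^{-\frac N2|n|}+\sum_{j=i+1}^N\big(b_n^{i,j}q^{-(\frac k2+j)|n|}-b_n^{i+1,j}q^{-(\frac k2+j-1)|n|}\big)$, $h_i=\sum_{l=1}^i(p_b^{l,i+1}-p_b^{l,i})+p_a^i+\sum_{l=i+1}^N(p_b^{i,l}-p_b^{i+1,l})$, $D_i^+(z)=\exp\big(\sum_{n>0}\frac{q^{(r-\frac k2)n}}{[r^*n]}H^i_{-n}z^n\big)$, $D_i^-(z)=\exp\big(-\sum_{n>0}\frac{q^{(r-\frac k2)n}}{[rn]}H^i_nz^{-n}\big)$, and $$H_i^\pm(u)=D_i^+(q^{\pm\frac k2}z)\psi_\pm^i(z)D_i^-(q^{\mp\frac k2}z)\,e^{2\hat q_i}q^{\mp h_i}(q^{\pm(r-\frac k2)}z)^{\frac{\hat p_i+h_i-1}r-\frac{\hat p_i-1}{r^*}},$$ $$E_i(u)=D_i^+(z)e^{+,i}(z)e^{2\hat q_i}z^{-\frac{\hat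 p_i-1}{r^*}},\qquad F_i(u)=e^{-,i}(z)D_i^-(z)z^{\frac{h_i+\hat p_i-1}r}.$$ *Vertex operators.* Put $m_{ij}=\min(i,j)$, $M_{ij}=N-\max(i,j)$, $\check a_n^i=\sum_{j=1}^{N-1}\frac{n[m_{ij}n][M_{ij}n]}{[(k+N)n][Nn][n]^2}a_n^j$, $\check H_n^i=\sum_{j=1}^{N-1}\frac{n[m_{ij}n][M_{ij}n]}{[kn][Nn][n]^2}H_n^j$, $(\check p_a^i,\check q_a^i)=\sum_{j=1}^{N-1}\frac{m_{ij}M_{ij}}{(k+N)N}(p_a^j,q_a^j)$, $(\check h_i,\check p_i,\check q_i)=\sum_{j=1}^{N-1}\frac{m_{ij}M_{ij}}N(h_j,\hat p_j,\hat q_j)$. Let $$\phi_{\lambda^i}(z)=\,:\!\exp\Big\{-\sum_{n\neq0}\tfrac{[\lambda^i|n|]}{|n|}\check a^i_nq^{\frac{k+N}2|n|}z^{-n}+\lambda^i(\check q_a^i+\check p_a^i\ln z)\Big\}\!:,$$ $$\begin{aligned}\psi_{\lambda^i}(z)=\,:\!\exp\Big\{&-\sum_{n\neq0}\tfrac{[\lambda^{N-i}|n|]}{|n|}\check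 a^i_nq^{-\frac{k+N}2|n|}z^{-n}+\lambda^{N-i}(\check q_a^i+\check p_a^i\ln z)\\&+\sum_{j=i+1}^N\Big(\sum_{n>0}\tfrac{[\lambda^{j-i}n]}{[n]^2}\big((b+c)^{i,j}_{-n}z^n-(b+c)^{i,j}_nz^{-n}\big)+\lambda^{j-i}\big(q_b^{i,j}+q_c^{i,j}+(p_b^{i,j}+p_c^{i,j})\ln z\big)\Big)\Big\}\!:,\end{aligned}$$ $$T_+^i(z)=\exp\Big\{\sum_{n>0}\tfrac1n\tfrac{[\lambda^in][kn]}{[rn]}\check H^i_nq^{(r-\frac k2)n}z^{-n}\Big\}\exp\Big\{-\tfrac{\lambda^i}r\big(\check p_i+\check h_i-(k+N)\check p_a^i\big)\ln z\Big\},$$ $$T_-^i(z)=\exp\Big\{\sum_{n>0}\tfrac1n\tfrac{[\lambda^in][kn]}{[r^*n]}\check H^i_{-n}q^{(r-\frac k2)n}z^n\Big\}\exp\Big\{-2\lambda^i\check q_i+\tfrac{\lambda^i}{r^*}\check p_i\ln z\Big\},$$ and, with $\Lambda=(\lambda^1,\dots,\lambda^{N-1})$, $$\Phi_\Lambda(u)=\,:\!\prod_{i=1}^{N-1}\phi_{\lambda^i}(z)T_+^i(z)\!:,\qquad\Psi_\Lambda(u)=\,:\!\prod_{i=1}^{N-1}T_-^i(z)\psi_{\lambda^i}(z)\!:.$$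 An equality $A(u)B(v)=c(u-v)B(v)A(u)$ of fields means: every matrix element of $A(u)B(v)$ between Fock basis vectors converges absolutely for $|z|>R|w|$ and every matrix element of $B(v)A(u)$ for $|w|>R|z|$, with one constant $R>0$ for all matrix elements; for each fixed $v$ both extend to meromorphic functions of $u\in\mathbb C$; and the first equals $c(u-v)$ times the second as meromorphic functions. **Theorem.** For all $1\le i\le N-1$ and both choices of the sign, $$H_i^\pm(u)\Phi_\Lambda(v)=\frac{\theta_r(u-v+\frac{\lambda^i}2\mp\frac k4)}{\theta_r(u-v-\frac{\lambda^i}2\mp\frac k4)}\Phi_\Lambda(v)H_i^\pm(u),$$ $$E_i(u)\Phi_\Lambda(v)=\Phi_\Lambda(v)E_i(u),$$ $$F_i(u)\Phi_\Lambda(v)=\frac{\theta_r(u-v+\frac{\lambda^i}2)}{\theta_r(u-v-\frac{\lambda^i}2)}\Phi_\Lambda(v)F_i(u),$$ $$H_i^\pm(u)\Psi_\Lambda(v)=\frac{\theta_{r^*}(u-v-\frac{\lambda^i}2\pm\frac k4)}{\theta_{r^*}(u-v+\frac{\lambda^i}2\pm\frac k4)}\Psi_\Lambda(v)H_i^\pm(u),$$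 $$E_i(u)\Psi_\Lambda(v)=\frac{\theta_{r^*}(u-v-\frac{\lambda^i}2)}{\theta_{r^*}(u-v+\frac{\lambda^i}2)}\Psi_\Lambda(v)E_i(u),$$ $$F_i(u)\Psi_\Lambda(v)=\Psi_\Lambda(v)F_i(u).$$ (These relations are the defining intertwining properties of the type I and type II vertex operators of $U_{q,p}(\widehat{sl}_N)$, $p=q^{2r}$, at level $k$.) -/

import Mathlib

open Filter Topology

namespace EllipticVO

noncomputable section

/-! ### Parameters, `q`-numbers and theta functions -/

/-- The parameters: rank `N` (for `sl_N`), a logarithm `logq` of `q` (so that `q ^ x` makes sense for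
all complex `x`), the level `k` and the elliptic parameter `r`. -/
structure Params where
  N : ℕ
  logq : ℂ
  k : ℝ
  r : ℝ

/-- `r* = r - k`. -/
def Params.rstar (P : Params) : ℝ := P.r - P.k

/-- `q ^ x = exp (x log q)`. -/
def qpow (P : Params) (x : ℂ) : ℂ := Complex.exp (x * P.logq)

/-- `[x] = (q ^ x - q ^ (-x)) / (q - q⁻¹)`. -/
def qnum (P : Params) (x : ℂ) : ℂ :=
  (qpow P x - qpow P (-x)) / (qpow P 1 - qpow P (-1))

/-- `(z; t)_∞ = ∏_{n ≥ 0} (1 - z tⁿ)`. -/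
def qPoch (z t : ℂ) : ℂ := ∏' n : ℕ, (1 - z * t ^ n)

/-- `Θ_t(z) = (z; t)_∞ (t z⁻¹; t)_∞ (t; t)_∞`. -/
def bigTheta (t z : ℂ) : ℂ := qPoch z t * qPoch (t * z⁻¹) t * qPoch t t

/-- The Jacobi theta function
`θ_ν(u) = q ^ (u² / ν - u) Θ_{q ^ (2ν)}(q ^ (2u)) / (q ^ (2ν); q ^ (2ν))_∞ ^ 3`. -/
def theta (P : Params) (ν : ℝ) (u : ℂ) : ℂ :=
  qpow P (u ^ 2 / ν - u) * bigTheta (qpow P (2 * ν)) (qpow P (2 * u)) /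
    qPoch (qpow P (2 * ν)) (qpow P (2 * ν)) ^ 3

/-- The Cartan matrix of `sl_N`. -/
def cartan (i j : ℕ) : ℂ := if i = j then 2 else if i = j + 1 ∨ j = i + 1 then -1 else 0

/-! ### The Heisenberg algebras -/

/-- Indices `1 ≤ i ≤ N - 1`. -/
abbrev AIdx (N : ℕ) : Type := ↥(Finset.Ico 1 N)

/-- Index pairs `1 ≤ i < j ≤ N`. -/
abbrev PIdx (N : ℕ) : Type :=
  ↥((Finset.Icc 1 N ×ˢ Finset.Icc 1 N).filter (fun e : ℕ × ℕ => e.1 < e.2))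

/-- The `N² - 1` free bosons `a^i`, `b^{ij}`, `c^{ij}`, in this order. -/
abbrev Boson (N : ℕ) : Type := AIdx N ⊕ (PIdx N ⊕ PIdx N)

/-- Linear combinations of the bosons. -/
abbrev BVec (N : ℕ) : Type := Boson N → ℂ

/-- Oscillator brackets: `[β_n, γ_{-n}] = oscBracket P n β γ`. All other brackets of oscillators vanish. -/
def oscBracket (P : Params) (n : ℕ+) : Boson P.N → Boson P.N → ℂ
  | Sum.inl i, Sum.inl j =>
      qnum P ((P.k + P.N) * (n : ℕ)) * qnum P (cartan i j * (n : ℕ)) / (n : ℕ)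
  | Sum.inr (Sum.inl e), Sum.inr (Sum.inl f) => if e = f then -(qnum P (n : ℕ) ^ 2 / (n : ℕ)) else 0
  | Sum.inr (Sum.inr e), Sum.inr (Sum.inr f) => if e = f then qnum P (n : ℕ) ^ 2 / (n : ℕ) else 0
  | _, _ => 0

/-- Zero mode brackets: `[p_β, q_γ] = zeroBracket P β γ`. -/
def zeroBracket (P : Params) : Boson P.N → Boson P.N → ℂ
  | Sum.inl i, Sum.inl j => cartan i j * (P.k + P.N)
  | Sum.inr (Sum.inl e), Sum.inr (Sum.inl f) => if e = f then -1 else 0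
  | Sum.inr (Sum.inr e), Sum.inr (Sum.inr f) => if e = f then 1 else 0
  | _, _ => 0

/-- Brackets of the additional Heisenberg algebra: `[p̂_i, q̂_j] = hatBracket P i j`,
i.e. `[q̂_i, p̂_j] = a_{ij} / 2`. -/
def hatBracket (P : Params) (i j : AIdx P.N) : ℂ := -(cartan i j / 2)

/-- Generators: the unit, creation modes `neg β n = β_{-n}` and annihilation modes `pos β n = β_n`
(`n > 0`), the zero modes `q_β`, `p_β`, and `q̂_i`, `p̂_i`. -/
inductive Gen (N : ℕ) : Type
  | one : Gen N
  | neg (β : Boson N) (n : ℕ+) : Gen N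
  | pos (β : Boson N) (n : ℕ+) : Gen N
  | q (β : Boson N) : Gen N
  | p (β : Boson N) : Gen N
  | qhat (i : AIdx N) : Gen N
  | phat (i : AIdx N) : Gen N

/-- Formal, possibly infinite, linear combinations of generators: these are the exponents of fields. -/
abbrev Expo (N : ℕ) : Type := Gen N → ℂ

/-! ### The Fock space and normal ordered exponentials -/

/-- The standard basis of the (sum over all momenta of the) Fock spaces: the vector
`∏ (β_{-n}) ^ (occ (β, n)) |mom, momHat⟩`, where the vacuum `|mom, momHat⟩` is killed by all `β_n`, `n > 0`,
and `p_β`, `p̂_i` act on it by the scalars `mom β`, `momHat i`. -/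
@[ext]
structure State (N : ℕ) : Type where
  mom : BVec N
  momHat : AIdx N → ℂ
  occ : (Boson N × ℕ+) →₀ ℕ

/-- Operators from the Fock space to its completion, as matrices:
`A x y` is the coefficient of the basis vector `x` in the image of the basis vector `y`. -/
abbrev FockOp (N : ℕ) : Type := State N → State N → ℂ

/-- Product of operators (operator on the right acts first). In the definitions below it is used only
where all these sums are finite. -/
def opMul {N : ℕ} (A B : FockOp N) : FockOp N := fun x y => ∑' s, A x s * B s y

infixl:70 " ⬝ₒ " => opMul

/-- `exp (∑ i, y i * X i)` as a formal power series. -/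
def expSeries {σ : Type} (y : σ → ℂ) : MvPowerSeries σ ℂ :=
  fun m => m.prod fun i e => y i ^ e / (Nat.factorial e : ℂ)

/-- The substitution `X i ↦ X i + t i`, that is, `exp (∑ i, t i * ∂/∂(X i))`. -/
def shiftVars {σ : Type} (t : σ → ℂ) (f : MvPolynomial σ ℂ) : MvPolynomial σ ℂ :=
  MvPolynomial.aeval (fun i => MvPolynomial.X i + MvPolynomial.C (t i)) f

/-- The annihilation part `∑ X(β_n) β_n` of an exponent acts on polynomials in the creation modes as the
derivation `γ_{-n} ↦ ∑_β X(β_n) [β_n, γ_{-n}]`. -/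
def annCoeff (P : Params) (X : Expo P.N) (g : Boson P.N × ℕ+) : ℂ :=
  ∑ β, X (Gen.pos β g.2) * oscBracket P g.2 β g.1

open Classical in
/-- The normal ordered exponential `:exp X:`, that is
`exp (creation part) · exp (q part) · exp (p part) · exp (annihilation part)`, with matrix elements:
the annihilation part acts by translation, the `p` part by a scalar, the `q` part shifts the momenta by
`[p, q part]`, and the creation part acts by multiplication by a power series. -/
def normExp (P : Params) (X : Expo P.N) : FockOp P.N := fun x y =>
  if (∀ β, x.mom β = y.mom β + ∑ γ, X (Gen.q γ) * zeroBracket P β γ) ∧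
      (∀ i, x.momHat i = y.momHat i + ∑ j, X (Gen.qhat j) * hatBracket P i j) then
    Complex.exp (X Gen.one + ∑ β, X (Gen.p β) * y.mom β + ∑ i, X (Gen.phat i) * y.momHat i) *
      MvPowerSeries.coeff x.occ
        (expSeries (fun g : Boson P.N × ℕ+ => X (Gen.neg g.1 g.2)) *
          (shiftVars (annCoeff P X) (MvPolynomial.monomial y.occ 1) :
            MvPowerSeries (Boson P.N × ℕ+) ℂ))
  else 0

/-! ### Building exponents

Fields are written as functions of `s = log_q z`, so `z = q ^ s`, `ln z = s log q`, and `q ^ α z`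
corresponds to `s + α`. -/

/-- The boson `a^i` (zero if `i` is out of range). -/
def va (P : Params) (i : ℕ) : BVec P.N
  | Sum.inl j => if (j : ℕ) = i then 1 else 0
  | _ => 0

/-- The boson `b^{ij}`, with the convention `b^{ii} = 0`. -/
def vb (P : Params) (i j : ℕ) : BVec P.N
  | Sum.inr (Sum.inl e) => if (e : ℕ × ℕ) = (i, j) then 1 else 0
  | _ => 0

/-- The boson `c^{ij}`, with the convention `c^{ii} = 0`. -/
def vc (P : Params) (i j : ℕ) : BVec P.N
  | Sum.inr (Sum.inr e) => if (e : ℕ × ℕ) = (i, j) then 1 else 0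
  | _ => 0

/-- The boson `(b + c)^{ij}`. -/
def vbc (P : Params) (i j : ℕ) : BVec P.N := vb P i j + vc P i j

/-- `∑_{n ≠ 0} (X n)_n`: the `n`-th modes are combined with the coefficients `X n`; `X 0` is not used. -/
def modeSum {N : ℕ} (X : ℤ → BVec N) : Expo N
  | Gen.neg β n => X (-((n : ℕ) : ℤ)) β
  | Gen.pos β n => X ((n : ℕ) : ℤ) β
  | _ => 0

/-- The combination of the zero modes `q_β` with coefficients `x`. -/
def qPart {N : ℕ} (x : BVec N) : Expo N
  | Gen.q β => x β
  | _ => 0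

/-- The combination of the zero modes `p_β` with coefficients `x`. -/
def pPart {N : ℕ} (x : BVec N) : Expo N
  | Gen.p β => x β
  | _ => 0

/-- The combination of the `q̂_i` with coefficients `x`. -/
def qhatPart {N : ℕ} (x : AIdx N → ℂ) : Expo N
  | Gen.qhat i => x i
  | _ => 0

/-- The combination of the `p̂_i` with coefficients `x`. -/
def phatPart {N : ℕ} (x : AIdx N → ℂ) : Expo N
  | Gen.phat i => x i
  | _ => 0

/-- The scalar `c`. -/
def onePart {N : ℕ} (c : ℂ) : Expo N
  | Gen.one => c
  | _ => 0

/-- The coefficient vector of `p̂_i` or of `q̂_i`. -/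
def vhat (P : Params) (i : ℕ) : AIdx P.N → ℂ := fun j => if (j : ℕ) = i then 1 else 0

/-- A sign `±` as a complex number. -/
def sgn (ε : ℤˣ) : ℂ := ((ε : ℤ) : ℂ)

/-- `x(z) = -∑_{n ≠ 0} x_n / [n] z^{-n} + q_x + p_x ln z`. -/
def bosonField (P : Params) (x : BVec P.N) (s : ℂ) : Expo P.N :=
  modeSum (fun n => -(qpow P (-(n * s)) / qnum P n) • x) + qPart x + pPart ((s * P.logq) • x)

/-- `x_±(z) = ±((q - q⁻¹) ∑_{n > 0} x_{±n} z^{∓n} + p_x ln q)`. -/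
def bosonPM (P : Params) (ε : ℤˣ) (x : BVec P.N) (s : ℂ) : Expo P.N :=
  modeSum (fun n => if 0 < (ε : ℤ) * n then
    (sgn ε * (qpow P 1 - qpow P (-1)) * qpow P (-(n * s))) • x else 0) +
  pPart ((sgn ε * P.logq) • x)

/-! ### The Wakimoto currents of `U_q(sl_N^)` at level `k` -/

/-- The current `ψ_±^i(z)`. -/
def psiCur (P : Params) (ε : ℤˣ) (i : ℕ) (s : ℂ) : FockOp P.N :=
  normExp P
    ((∑ j ∈ Finset.Icc 1 i,
        (bosonPM P ε (vb P j (i + 1)) (s + sgn ε * (P.k / 2 + j - 1)) -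
          bosonPM P ε (vb P j i) (s + sgn ε * (P.k / 2 + j)))) +
      bosonPM P ε (va P i) (s + sgn ε * (P.N / 2)) +
      ∑ j ∈ Finset.Icc (i + 1) P.N,
        (bosonPM P ε (vb P i j) (s + sgn ε * (P.k / 2 + j)) -
          bosonPM P ε (vb P (i + 1) j) (s + sgn ε * (P.k / 2 + j - 1))))

/-- The current `e^{+,i}(z)`. -/
def ePlusCur (P : Params) (i : ℕ) (s : ℂ) : FockOp P.N :=
  (-1 / ((qpow P 1 - qpow P (-1)) * qpow P s)) •
    ∑ j ∈ Finset.Icc 1 i,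
      (normExp P
          (bosonField P (vbc P j i) (s + (j - 1)) +
            (bosonPM P 1 (vb P j (i + 1)) (s + (j - 1)) - bosonField P (vbc P j (i + 1)) (s + j)) +
            ∑ l ∈ Finset.Icc 1 (j - 1),
              (bosonPM P 1 (vb P l (i + 1)) (s + (l - 1)) - bosonPM P 1 (vb P l i) (s + l))) -
        normExp P
          (bosonField P (vbc P j i) (s + (j - 1)) +
            (bosonPM P (-1) (vb P j (i + 1)) (s + (j - 1)) -
              bosonField P (vbc P j (i + 1)) (s + (j - 2))) +
            ∑ l ∈ Finset.Icc 1 (j - 1),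
              (bosonPM P 1 (vb P l (i + 1)) (s + (l - 1)) - bosonPM P 1 (vb P l i) (s + l))))

/-- `∑_{l=m}^N (b_±^{i,l}(q^{±(k+l)} z) - b_±^{i+1,l}(q^{±(k+l-1)} z)) + a_±^i(q^{±(k+N)/2} z)`. -/
def tailExpo (P : Params) (ε : ℤˣ) (i m : ℕ) (s : ℂ) : Expo P.N :=
  bosonPM P ε (va P i) (s + sgn ε * ((P.k + P.N) / 2)) +
    ∑ l ∈ Finset.Icc m P.N,
      (bosonPM P ε (vb P i l) (s + sgn ε * (P.k + l)) -
        bosonPM P ε (vb P (i + 1) l) (s + sgn ε * (P.k + l - 1)))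

/-- `∑_{l=j+1}^i (b_-^{l,i+1}(q^{-(k+l-1)} z) - b_-^{l,i}(q^{-(k+l)} z))`. -/
def midExpo (P : Params) (i j : ℕ) (s : ℂ) : Expo P.N :=
  ∑ l ∈ Finset.Icc (j + 1) i,
    (bosonPM P (-1) (vb P l (i + 1)) (s - (P.k + l - 1)) - bosonPM P (-1) (vb P l i) (s - (P.k + l)))

/-- The current `e^{-,i}(z)`. -/
def eMinusCur (P : Params) (i : ℕ) (s : ℂ) : FockOp P.N :=
  (-1 / ((qpow P 1 - qpow P (-1)) * qpow P s)) •
    ((∑ j ∈ Finset.Icc 1 (i - 1),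
        (normExp P
            (bosonField P (vbc P j (i + 1)) (s - (P.k + j)) +
              (-bosonPM P (-1) (vb P j i) (s - (P.k + j)) -
                bosonField P (vbc P j i) (s - (P.k + j - 1))) +
              (midExpo P i j s + tailExpo P (-1) i (i + 1) s)) -
          normExp P
            (bosonField P (vbc P j (i + 1)) (s - (P.k + j)) +
              (-bosonPM P 1 (vb P j i) (s - (P.k + j)) -
                bosonField P (vbc P j i) (s - (P.k + j + 1))) +
              (midExpo P i j s + tailExpo P (-1) i (i + 1) s)))) +
      normExp P (bosonField P (vbc P i (i + 1)) (s - (P.k + i)) + tailExpo P (-1) i (i + 1) s) -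
      normExp P (bosonField P (vbc P i (i + 1)) (s + (P.k + i)) + tailExpo P 1 i (i + 1) s) -
      ∑ j ∈ Finset.Icc (i + 2) P.N,
        (normExp P
            (bosonField P (vbc P i j) (s + (P.k + j - 1)) +
              (bosonPM P 1 (vb P (i + 1) j) (s + (P.k + j - 1)) -
                bosonField P (vbc P (i + 1) j) (s + (P.k + j))) +
              tailExpo P 1 i j s) -
          normExp P
            (bosonField P (vbc P i j) (s + (P.k + j - 1)) +
              (bosonPM P (-1) (vb P (i + 1) j) (s + (P.k + j - 1)) -
                bosonField P (vbc P (i + 1) j) (s + (P.k + j - 2))) +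
              tailExpo P 1 i j s)))

/-! ### The total currents of `U_{q,p}(sl_N^)` -/

/-- The combination of `n`-th (or `-n`-th) modes in the twisting currents `D_i^±`. -/
def dVec (P : Params) (i : ℕ) (n : ℂ) : BVec P.N :=
  (∑ j ∈ Finset.Icc 1 i,
      (qpow P (-((P.k + j - 1) * n)) • vb P j (i + 1) - qpow P (-((P.k + j) * n)) • vb P j i)) +
    qpow P (-((P.k + P.N) / 2 * n)) • va P i +
    ∑ j ∈ Finset.Icc (i + 1) P.N,
      (qpow P (-((P.k + j) * n)) • vb P i j - qpow P (-((P.k + j - 1) * n)) • vb P (i + 1) j)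

/-- `D_i^+(z; r, r*)`, containing creation modes only. -/
def dPlus (P : Params) (i : ℕ) (s : ℂ) : FockOp P.N :=
  normExp P (modeSum fun m : ℤ =>
    if m < 0 then
      (1 / qnum P (P.rstar * (-m)) * qpow P (P.r * (-m)) * qpow P ((-m) * s)) • dVec P i (-m)
    else 0)

/-- `D_i^-(z; r, r*)`, containing annihilation modes only. -/
def dMinus (P : Params) (i : ℕ) (s : ℂ) : FockOp P.N :=
  normExp P (modeSum fun n : ℤ =>
    if 0 < n then
      (-(1 / qnum P (P.r * n) * qpow P (P.r * n) * qpow P (-(n * s)))) • dVec P i n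
    else 0)

/-- The dressed currents
`Ψ_i^±(z) = D_i^+(q^{±k/2} z) ψ_±^i(z) D_i^-(q^{∓k/2} z)`. -/
def dressedPsi (P : Params) (ε : ℤˣ) (i : ℕ) (s : ℂ) : FockOp P.N :=
  dPlus P i (s + sgn ε * (P.k / 2)) ⬝ₒ psiCur P ε i s ⬝ₒ dMinus P i (s - sgn ε * (P.k / 2))

/-- `e_i(z) = D_i^+(z) e^{+,i}(z)`. -/
def dressedE (P : Params) (i : ℕ) (s : ℂ) : FockOp P.N := dPlus P i s ⬝ₒ ePlusCur P i s

/-- `f_i(z) = e^{-,i}(z) D_i^-(z)`. -/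
def dressedF (P : Params) (i : ℕ) (s : ℂ) : FockOp P.N := eMinusCur P i s ⬝ₒ dMinus P i s

/-- The coefficients in
`h_i = ∑_{l=1}^i (p_b^{l,i+1} - p_b^{l,i}) + p_a^i + ∑_{l=i+1}^N (p_b^{i,l} - p_b^{i+1,l})`. -/
def hVec (P : Params) (i : ℕ) : BVec P.N :=
  (∑ l ∈ Finset.Icc 1 i, (vb P l (i + 1) - vb P l i)) + va P i +
    ∑ l ∈ Finset.Icc (i + 1) P.N, (vb P i l - vb P (i + 1) l)

/-- `h_i`. -/
def hExpo (P : Params) (i : ℕ) : Expo P.N := pPart (hVec P i)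

/-- `p̂_i`. -/
def phat (P : Params) (i : ℕ) : Expo P.N := phatPart (vhat P i)

/-- `q̂_i`. -/
def qhat (P : Params) (i : ℕ) : Expo P.N := qhatPart (vhat P i)

/-- `H_i^±(u) = Ψ_i^±(z) e^{2q̂_i} q^{∓h_i} (q^{±(r-k/2)} z)^{(p̂_i+h_i-1)/r - (p̂_i-1)/r*}`, `z = q^{2u}`. -/
def curH (P : Params) (ε : ℤˣ) (i : ℕ) (u : ℂ) : FockOp P.N :=
  dressedPsi P ε i (2 * u) ⬝ₒ normExp P ((2 : ℂ) • qhat P i) ⬝ₒ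
    normExp P ((-(sgn ε) * P.logq) • hExpo P i) ⬝ₒ
    normExp P (((sgn ε * (P.r - P.k / 2) + 2 * u) * P.logq) •
      ((1 / P.r : ℂ) • (phat P i + hExpo P i - onePart 1) -
        (1 / P.rstar : ℂ) • (phat P i - onePart 1)))

/-- `E_i(u) = e_i(z) e^{2q̂_i} z^{-(p̂_i-1)/r*}`, `z = q^{2u}`. -/
def curE (P : Params) (i : ℕ) (u : ℂ) : FockOp P.N :=
  dressedE P i (2 * u) ⬝ₒ normExp P ((2 : ℂ) • qhat P i) ⬝ₒ
    normExp P ((2 * u * P.logq) • -((1 / P.rstar : ℂ) • (phat P i - onePart 1)))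

/-- `F_i(u) = f_i(z) z^{(h_i+p̂_i-1)/r}`, `z = q^{2u}`. -/
def curF (P : Params) (i : ℕ) (u : ℂ) : FockOp P.N :=
  dressedF P i (2 * u) ⬝ₒ
    normExp P ((2 * u * P.logq) • ((1 / P.r : ℂ) • (hExpo P i + phat P i - onePart 1)))

/-! ### The vertex operators

The normal ordered product of exponentials is the normal ordered exponential of the sum of the
exponents, so the components of the vertex operators are given through their exponents. A weight
`(λ^1, …, λ^{N-1})` is given as a function `wt` on `ℕ` of which only the values at `1, …, N-1` are used. -/

/-- The dual modes `ǎ_n^i = ∑_j n [min(i,j) n] [(N - max(i,j)) n] / ([(k+N) n] [N n] [n]²) a_n^j`. -/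
def aDual (P : Params) (i : ℕ) (n : ℤ) : BVec P.N :=
  ∑ j ∈ Finset.Ico 1 P.N,
    (n * (qnum P ((min i j : ℕ) * n) * qnum P ((P.N - (max i j : ℕ)) * n)) /
      (qnum P ((P.k + P.N) * n) * qnum P (P.N * n) * qnum P n ^ 2)) • va P j

/-- The coefficients of the dual zero modes `p̌_a^i`, `q̌_a^i`. -/
def aDualZero (P : Params) (i : ℕ) : BVec P.N :=
  ∑ j ∈ Finset.Ico 1 P.N,
    ((min i j : ℕ) * (P.N - (max i j : ℕ)) / ((P.k + P.N) * P.N) : ℂ) • va P j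

/-- The modes `H_n^i`. -/
def hMode (P : Params) (i : ℕ) (n : ℤ) : BVec P.N :=
  (∑ j ∈ Finset.Icc 1 i,
      (qpow P (-((P.k / 2 + j - 1) * (|n| : ℤ))) • vb P j (i + 1) -
        qpow P (-((P.k / 2 + j) * (|n| : ℤ))) • vb P j i)) +
    qpow P (-(P.N / 2 * (|n| : ℤ))) • va P i +
    ∑ j ∈ Finset.Icc (i + 1) P.N,
      (qpow P (-((P.k / 2 + j) * (|n| : ℤ))) • vb P i j -
        qpow P (-((P.k / 2 + j - 1) * (|n| : ℤ))) • vb P (i + 1) j)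

/-- The dual modes `Ȟ_n^i = ∑_j n [min(i,j) n] [(N - max(i,j)) n] / ([k n] [N n] [n]²) H_n^j`. -/
def hDual (P : Params) (i : ℕ) (n : ℤ) : BVec P.N :=
  ∑ j ∈ Finset.Ico 1 P.N,
    (n * (qnum P ((min i j : ℕ) * n) * qnum P ((P.N - (max i j : ℕ)) * n)) /
      (qnum P (P.k * n) * qnum P (P.N * n) * qnum P n ^ 2)) • hMode P j n

/-- `ȟ_i = ∑_j min(i,j) (N - max(i,j)) / N h_j`. -/
def hCheck (P : Params) (i : ℕ) : Expo P.N :=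
  ∑ j ∈ Finset.Ico 1 P.N, ((min i j : ℕ) * (P.N - (max i j : ℕ)) / P.N : ℂ) • hExpo P j

/-- `p̌_i = ∑_j min(i,j) (N - max(i,j)) / N p̂_j`. -/
def pCheck (P : Params) (i : ℕ) : Expo P.N :=
  ∑ j ∈ Finset.Ico 1 P.N, ((min i j : ℕ) * (P.N - (max i j : ℕ)) / P.N : ℂ) • phat P j

/-- `q̌_i = ∑_j min(i,j) (N - max(i,j)) / N q̂_j`. -/
def qCheck (P : Params) (i : ℕ) : Expo P.N :=
  ∑ j ∈ Finset.Ico 1 P.N, ((min i j : ℕ) * (P.N - (max i j : ℕ)) / P.N : ℂ) • qhat P j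

/-- The exponent of the component `φ_{λ^i}(z)`:
`-∑_{n ≠ 0} [λ^i |n|] / |n| q^{(k+N)|n|/2} z^{-n} ǎ_n^i + λ^i (q̌_a^i + p̌_a^i ln z)`. -/
def phiExpo (P : Params) (wt : ℕ → ℂ) (i : ℕ) (s : ℂ) : Expo P.N :=
  modeSum (fun n : ℤ =>
    (-(qnum P (wt i * (|n| : ℤ)) / (|n| : ℤ) * qpow P ((P.k + P.N) / 2 * (|n| : ℤ)) * qpow P (-(n * s)))) •
      aDual P i n) +
  wt i • (qPart (aDualZero P i) + pPart ((s * P.logq) • aDualZero P i))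

/-- The exponent of the component `ψ_{λ^i}(z)`. -/
def psiExpo (P : Params) (wt : ℕ → ℂ) (i : ℕ) (s : ℂ) : Expo P.N :=
  modeSum (fun n : ℤ =>
    (-(qnum P (wt (P.N - i) * (|n| : ℤ)) / (|n| : ℤ) * qpow P (-((P.k + P.N) / 2 * (|n| : ℤ))) * qpow P (-(n * s)))) •
      aDual P i n) +
  wt (P.N - i) • (qPart (aDualZero P i) + pPart ((s * P.logq) • aDualZero P i)) +
  modeSum (fun n : ℤ =>
    ∑ j ∈ Finset.Icc (i + 1) P.N,
      ((if n < 0 then 1 else -1) * (qnum P (wt (j - i) * (|n| : ℤ)) / qnum P (|n| : ℤ) ^ 2) *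
        qpow P (-(n * s))) • vbc P i j) +
  ∑ j ∈ Finset.Icc (i + 1) P.N,
    wt (j - i) • (qPart (vbc P i j) + pPart ((s * P.logq) • vbc P i j))

/-- The exponent of `T_+^i(z; p)`. -/
def tPlusExpo (P : Params) (wt : ℕ → ℂ) (i : ℕ) (s : ℂ) : Expo P.N :=
  modeSum (fun n : ℤ =>
    if 0 < n then
      (1 / n * (qnum P (wt i * n) * qnum P (P.k * n) / qnum P (P.r * n)) *
        qpow P ((P.r - P.k / 2) * n) * qpow P (-(n * s))) • hDual P i n
    else 0) +
  (-(wt i / P.r) * (s * P.logq)) •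
    (pCheck P i + hCheck P i - (P.k + P.N : ℂ) • pPart (aDualZero P i))

/-- The exponent of `T_-^i(z; p)`. -/
def tMinusExpo (P : Params) (wt : ℕ → ℂ) (i : ℕ) (s : ℂ) : Expo P.N :=
  modeSum (fun m : ℤ =>
    if m < 0 then
      (1 / (-m) * (qnum P (wt i * (-m)) * qnum P (P.k * (-m)) / qnum P (P.rstar * (-m))) *
        qpow P ((P.r - P.k / 2) * (-m)) * qpow P ((-m) * s)) • hDual P i m
    else 0) +
  (-(2 * wt i)) • qCheck P i + (wt i / P.rstar * (s * P.logq)) • pCheck P i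

/-- `Φ_Λ(u) = :∏_i φ_{λ^i}(z) T_+^i(z; p):`, `z = q^{2u}`. -/
def PhiVO (P : Params) (wt : ℕ → ℂ) (u : ℂ) : FockOp P.N :=
  normExp P (∑ i ∈ Finset.Ico 1 P.N, (phiExpo P wt i (2 * u) + tPlusExpo P wt i (2 * u)))

/-- `Ψ_Λ(u) = :∏_i T_-^i(z; p) ψ_{λ^i}(z):`, `z = q^{2u}`. -/
def PsiVO (P : Params) (wt : ℕ → ℂ) (u : ℂ) : FockOp P.N :=
  normExp P (∑ i ∈ Finset.Ico 1 P.N, (tMinusExpo P wt i (2 * u) + psiExpo P wt i (2 * u)))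

/-! ### Exchange relations -/

/-- The exchange relation `A(u) B(v) = c(u - v) B(v) A(u)` between fields, in the usual sense of analytic
continuation of matrix elements. With `z = q^{2u}`, `w = q^{2v}`: every matrix element of the operator
product `A(u) B(v)` converges absolutely for `|z| ≫ |w|`, every matrix element of `B(v) A(u)` converges
absolutely for `|w| ≫ |z|`, both extend to meromorphic functions of `u ∈ ℂ`, and these
are related by the factor `c(u - v)`. -/
def Exchange (P : Params) (A B : ℂ → FockOp P.N) (c : ℂ → ℂ) : Prop :=
  ∃ R : ℝ, 0 < R ∧ ∀ (v : ℂ) (x y : State P.N), ∃ f g : ℂ → ℂ,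
    Meromorphic f ∧ Meromorphic g ∧
    (∀ u : ℂ, R * ‖qpow P (2 * v)‖ < ‖qpow P (2 * u)‖ →
      HasSum (fun s : State P.N => A u x s * B v s y) (f u)) ∧
    (∀ u : ℂ, R * ‖qpow P (2 * u)‖ < ‖qpow P (2 * v)‖ →
      HasSum (fun s : State P.N => B v x s * A u s y) (g u)) ∧
    f =ᶠ[codiscrete ℂ] fun u => c (u - v) * g u

end

end EllipticVO

set_option linter.unusedSimpArgs false

namespace EllipticVO

noncomputable section

/-! ### Exponentials as sums over multi-indices -/

section MultiExp

variable {σ : Type}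

-- All currents and vertex operators are finite linear combinations, with coefficients meromorphic
-- in u, of normal ordered exponentials of free bosons. Wick's formula :e^X: :e^Y: = e^⟨X,Y⟩
-- :e^(X+Y): (`hasSum_normExp_mul`) has a scalar contraction ⟨X,Y⟩: the bracket of the annihilation
-- part and the momenta of X with the creation part and the q-part of Y. The operator :e^(X+Y): is
-- the same for both orders, and its matrix elements are entire in u. An exchange relation of two
-- exponentials is therefore an identity between the continuations of e^⟨X,Y⟩ and e^⟨Y,X⟩
-- (`exchange_normExp`). The modes grow at most geometrically, so the contraction series converge
-- for |z| > R|w| with an R that does not depend on the matrix element (`exists_hasSum_annCoeff`).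
--
-- Two kinds of oscillator series occur. The series with coefficients -([μn]/n) q^(±νn)/[νn] sum to
-- logarithms of quotients of q-Pochhammer symbols; the two orders differ by θ_ν(u+μ/2)/θ_ν(u-μ/2)
-- times a power of q with exponent affine in u (`modeExchange_theta_left`,
-- `modeExchange_theta_right`). The series with coefficients ±([μn]/n)(q-q⁻¹) sum to logarithms of
-- rational functions, and the two orders differ by the constant q^(-2μ) (`modeExchange_swap`). In
-- each case the contractions of the zero modes remove the remaining power of q.
--
-- The currents E_i and F_i are sums of many exponentials, and the point is that all of them
-- exchange with the same factor. The reason is linear algebra: with Q = q^n, the pairing with the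
-- n-th modes of a vertex operator takes on b^{lm} the value Δ_m Q^(-l) - Δ_l Q^(-m) + L(m-l) and on
-- c^{lm} the value -L(m-l) (`Shape`). On the combinations in the currents such a functional
-- telescopes (`Shape.sum_left`, `Shape.sum_right`), so that it sees only δ_i = QΔ_{i+1} - Δ_i, the
-- value A_i on a^i, and a few values of L. The dependence on the summation index j survives only in
-- terms of the second kind above, which the zero modes cancel. The zero modes obey the same
-- formulas with Q = 1.
--
-- The numbers A_i and δ_i come from inverting the q-Cartan matrix: its inverse is the Green's
-- function [min(i,j)n][(N-max(i,j))n] up to normalisation (`sum_cartanWith_min_max`), which is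
-- exactly the kernel in the dual modes ǎ and Ȟ. Hence the i-th current sees only λ^i, apart from
-- the shifts L and from a λ^{N-i} that cancels.

theorem hasSum_of_eq {ι : Type*} {f g : ι → ℂ} {a b : ℂ} (h : HasSum f a) (hf : ∀ i, g i = f i)
    (hb : b = a) : HasSum g b := by
  rw [hb, funext hf]; exact h

/-- The condition `f i 0 = 1` lets the product over the support of `m` be extended to all of `s`;
the rest is distributivity. -/
theorem sum_box_prod {R : Type*} [CommSemiring R] (f : σ → ℕ → R)
    (hf : ∀ i, f i 0 = 1) (s : Finset σ) (K : ℕ) :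
    ∑ m ∈ s.finsupp (fun _ => Finset.range K), m.prod f = ∏ i ∈ s, ∑ e ∈ Finset.range K, f i e := by
  classical
  rw [Finset.prod_sum, Finset.finsupp, Finset.sum_map]
  refine Finset.sum_congr rfl fun p _ => ?_
  rw [Finsupp.prod_of_support_subset (s := s) _ (by
    simpa using Finsupp.support_indicator_subset s p) _ (fun i _ => hf i), ← Finset.prod_attach]
  refine Finset.prod_congr rfl fun i _ => ?_
  simp [Finsupp.indicator_of_mem i.2]

/-- Closed neighbourhoods form a basis in ℂ, and a limit of points of a closed set stays in the set.
So a joint limit can be computed as an iterated one. -/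
theorem tendsto_of_tendsto_prod {α β : Type*} {l₁ : Filter α} {l₂ : Filter β} [l₂.NeBot]
    {f : α × β → ℂ} {g : α → ℂ} {T : ℂ} (h : Tendsto f (l₁ ×ˢ l₂) (𝓝 T))
    (hg : ∀ a, Tendsto (fun b => f (a, b)) l₂ (𝓝 (g a))) : Tendsto g l₁ (𝓝 T) := by
  rw [(closed_nhds_basis T).tendsto_right_iff]
  rintro V ⟨hV, hVc⟩
  filter_upwards [(h.eventually hV).curry] with a ha
  exact hVc.mem_of_tendsto (hg a) ha

/-- The boxes exhaust the multi-indices: `m` lies in the box over its support whose height is its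
largest entry. -/
theorem tendsto_box_atTop :
    Tendsto (fun a : Finset σ × ℕ => a.1.finsupp (fun _ => Finset.range (a.2 + 1))) atTop atTop := by
  classical
  refine tendsto_atTop_finset_of_monotone ?_ ?_
  · rintro ⟨s, K⟩ ⟨t, L⟩ ⟨hst, hKL⟩ m hm
    simp only [Finset.mem_finsupp_iff, Finset.mem_range] at hm ⊢
    refine ⟨hm.1.trans hst, fun i _ => ?_⟩
    by_cases hi : i ∈ s
    · exact (hm.2 i hi).trans_le (Nat.succ_le_succ hKL)
    · have h0 : m i = 0 := by
        by_contra h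
        exact hi (hm.1 (Finsupp.mem_support_iff.2 h))
      rw [h0]; exact Nat.succ_pos _
  · intro m
    refine ⟨(m.support, m.support.sup m), ?_⟩
    simp only [Finset.mem_finsupp_iff, Finset.mem_range]
    exact ⟨le_rfl, fun i hi => Nat.lt_succ_of_le (Finset.le_sup hi)⟩

/-- The term `∏ z_i ^ (m i) / (m i)!` of the exponential of `∑ z_i`. -/
def divPow (z : σ → ℂ) (m : σ →₀ ℕ) : ℂ := m.prod fun i e => z i ^ e / (Nat.factorial e : ℂ)

/-- Every finite set of multi-indices lies in a box, and over a box the norms factor into partial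
sums of real exponential series. -/
theorem summable_divPow {z : σ → ℂ} (hz : Summable z) : Summable (divPow z) := by
  classical
  refine Summable.of_norm (summable_of_sum_le (c := Real.exp (∑' i, ‖z i‖)) (fun _ => norm_nonneg _) ?_)
  intro u
  have hn : ∀ m : σ →₀ ℕ, ‖divPow z m‖ = m.prod fun i e => ‖z i‖ ^ e / (Nat.factorial e : ℝ) := by
    intro m
    simp [divPow, Finsupp.prod, norm_prod]
  obtain ⟨⟨s, K⟩, h⟩ := ((tendsto_box_atTop (σ := σ)).eventually (eventually_ge_atTop u)).exists
  calc ∑ m ∈ u, ‖divPow z m‖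
      ≤ ∑ m ∈ s.finsupp (fun _ => Finset.range (K + 1)), ‖divPow z m‖ :=
        Finset.sum_le_sum_of_subset_of_nonneg h fun _ _ _ => norm_nonneg _
    _ = ∏ i ∈ s, ∑ e ∈ Finset.range (K + 1), ‖z i‖ ^ e / (Nat.factorial e : ℝ) := by
        rw [← sum_box_prod _ (by simp)]
        exact Finset.sum_congr rfl fun m _ => hn m
    _ ≤ ∏ i ∈ s, Real.exp ‖z i‖ :=
        Finset.prod_le_prod (fun i _ => Finset.sum_nonneg fun e _ => by positivity)
          fun i _ => Real.sum_le_exp_of_nonneg (norm_nonneg _) _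
    _ = Real.exp (∑ i ∈ s, ‖z i‖) := (Real.exp_sum _ _).symm
    _ ≤ Real.exp (∑' i, ‖z i‖) :=
        Real.exp_le_exp.2 (hz.norm.sum_le_tsum s fun _ _ => norm_nonneg _)

/-- Once summability is known, the value can be found along the boxes: growing the height first
gives exponentials of finite sums, and then the set of indices grows. -/
theorem hasSum_divPow {z : σ → ℂ} {S : ℂ} (hz : HasSum z S) : HasSum (divPow z) (Complex.exp S) := by
  classical
  obtain ⟨T, hT⟩ := summable_divPow hz.summable
  have h1 : Tendsto (fun s : Finset σ => Complex.exp (∑ i ∈ s, z i)) atTop (𝓝 T) := by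
    have h2 : Tendsto (fun a : Finset σ × ℕ =>
        ∑ m ∈ a.1.finsupp (fun _ => Finset.range (a.2 + 1)), divPow z m) (atTop ×ˢ atTop) (𝓝 T) := by
      rw [prod_atTop_atTop_eq]
      have hT' : Tendsto (fun s : Finset (σ →₀ ℕ) => ∑ m ∈ s, divPow z m) atTop (𝓝 T) := hT
      exact hT'.comp tendsto_box_atTop
    refine tendsto_of_tendsto_prod h2 fun s => ?_
    have h3 : ∀ K : ℕ, ∑ m ∈ s.finsupp (fun _ => Finset.range (K + 1)), divPow z m =
        ∏ i ∈ s, ∑ e ∈ Finset.range (K + 1), z i ^ e / (Nat.factorial e : ℂ) :=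
      fun K => sum_box_prod _ (by simp) s (K + 1)
    simp only [h3, Complex.exp_sum]
    refine tendsto_finsetProd _ fun i _ => ?_
    have h4 := (NormedSpace.expSeries_div_hasSum_exp (z i)).tendsto_sum_nat
    rw [← Complex.exp_eq_exp_ℂ] at h4
    exact h4.comp (tendsto_add_atTop_nat 1)
  have h5 : Tendsto (fun s : Finset σ => Complex.exp (∑ i ∈ s, z i)) atTop (𝓝 (Complex.exp S)) :=
    (Complex.continuous_exp.tendsto S).comp hz
  rwa [tendsto_nhds_unique h1 h5] at hT

/-- Splitting a multi-index into two amounts to splitting each of its nonzero entries independently.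
-/
theorem sum_antidiagonal_prod {R : Type*} [CommSemiring R] [DecidableEq σ] (f : σ → ℕ × ℕ → R)
    (m : σ →₀ ℕ) :
    ∑ p ∈ Finset.HasAntidiagonal.antidiagonal m, ∏ i ∈ m.support, f i (p.1 i, p.2 i) =
      ∏ i ∈ m.support, ∑ e ∈ Finset.HasAntidiagonal.antidiagonal (m i), f i e := by
  classical
  rw [Finset.prod_sum]
  refine Finset.sum_bij' (fun p _ => fun i _ => (p.1 i, p.2 i))
    (fun p _ => (Finsupp.indicator m.support fun i hi => (p i hi).1,
      Finsupp.indicator m.support fun i hi => (p i hi).2)) ?_ ?_ ?_ ?_ ?_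
  · intro p hp
    simp only [Finset.mem_pi, Finset.HasAntidiagonal.mem_antidiagonal] at hp ⊢
    intro i _
    rw [← hp]; rfl
  · intro p hp
    simp only [Finset.mem_pi, Finset.HasAntidiagonal.mem_antidiagonal] at hp ⊢
    ext i
    by_cases hi : i ∈ m.support
    · simp only [Finsupp.add_apply, Finsupp.indicator_of_mem hi]
      exact hp i hi
    · simp only [Finsupp.add_apply, Finsupp.indicator_of_notMem hi]
      simpa using (Finsupp.notMem_support_iff.1 hi).symm
  · intro p hp
    simp only [Finset.HasAntidiagonal.mem_antidiagonal] at hp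
    have h0 : ∀ i, i ∉ m.support → p.1 i = 0 ∧ p.2 i = 0 := by
      intro i hi
      have := Finsupp.notMem_support_iff.1 hi
      rw [← hp, Finsupp.add_apply] at this
      omega
    ext i
    · by_cases hi : i ∈ m.support
      · simp only [Finsupp.indicator_of_mem hi]
      · simp only [Finsupp.indicator_of_notMem hi, (h0 i hi).1]
    · by_cases hi : i ∈ m.support
      · simp only [Finsupp.indicator_of_mem hi]
      · simp only [Finsupp.indicator_of_notMem hi, (h0 i hi).2]
  · intro p hp
    funext i hi
    simp only [Finsupp.indicator_of_mem hi]
  · intro p hp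
    exact (Finset.prod_attach m.support (fun i => f i (p.1 i, p.2 i))).symm

theorem antidiagonal_support_subset [DecidableEq σ] {m : σ →₀ ℕ} {p : (σ →₀ ℕ) × (σ →₀ ℕ)}
    (hp : p ∈ Finset.HasAntidiagonal.antidiagonal m) : p.1.support ⊆ m.support ∧ p.2.support ⊆ m.support :=
        by
  simp only [Finset.HasAntidiagonal.mem_antidiagonal] at hp
  constructor <;> intro i hi <;> rw [Finsupp.mem_support_iff] at hi ⊢ <;>
    rw [← hp, Finsupp.add_apply] <;> omega

theorem add_pow_div_factorial {R : Type*} [CommRing R] [Algebra ℚ R] (a b : R) (n : ℕ) :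
    ((Nat.factorial n : ℚ)⁻¹) • (a + b) ^ n = ∑ e ∈ Finset.HasAntidiagonal.antidiagonal n,
      (((Nat.factorial e.1 : ℚ)⁻¹) • a ^ e.1) * (((Nat.factorial e.2 : ℚ)⁻¹) • b ^ e.2) := by
  rw [(Commute.all a b).add_pow', Finset.smul_sum]
  refine Finset.sum_congr rfl fun e he => ?_
  rw [Finset.HasAntidiagonal.mem_antidiagonal] at he
  subst he
  rw [smul_mul_smul_comm, ← Nat.cast_smul_eq_nsmul ℚ, smul_smul]
  congr 1
  have h : (Nat.factorial (e.1 + e.2) : ℚ) = (e.1 + e.2).choose e.1 * (Nat.factorial e.1) * (Nat.factorial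
      e.2) := by
    rw [Nat.choose_symm_add]
    exact_mod_cast (Nat.add_choose_mul_factorial_mul_factorial e.1 e.2).symm
  have h1 : (Nat.factorial (e.1 + e.2) : ℚ) ≠ 0 := by positivity
  have h2 : (Nat.factorial e.1 : ℚ) ≠ 0 := by positivity
  have h3 : (Nat.factorial e.2 : ℚ) ≠ 0 := by positivity
  field_simp
  rw [h]

/-- The binomial theorem for divided powers. It is needed over two ℚ-algebras: over ℂ for the
product of exponential series, and over the polynomial ring for the translation of a monomial. -/
theorem prod_add_divPow {R : Type*} [CommRing R] [Algebra ℚ R] [DecidableEq σ] (a b : σ → R)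
    (m : σ →₀ ℕ) :
    (m.prod fun i e => ((Nat.factorial e : ℚ)⁻¹) • (a i + b i) ^ e) =
      ∑ p ∈ Finset.HasAntidiagonal.antidiagonal m,
        (p.1.prod fun i e => ((Nat.factorial e : ℚ)⁻¹) • a i ^ e) *
          (p.2.prod fun i e => ((Nat.factorial e : ℚ)⁻¹) • b i ^ e) := by
  simp only [Finsupp.prod, add_pow_div_factorial]
  rw [← sum_antidiagonal_prod (fun i e => (((Nat.factorial e.1 : ℚ)⁻¹) • a i ^ e.1) *
    (((Nat.factorial e.2 : ℚ)⁻¹) • b i ^ e.2))]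
  refine Finset.sum_congr rfl fun p hp => ?_
  have := antidiagonal_support_subset hp
  rw [Finset.prod_mul_distrib]
  congr 1
  · symm
    refine Finset.prod_subset this.1 fun i _ hi => ?_
    simp [Finsupp.notMem_support_iff.1 hi]
  · symm
    refine Finset.prod_subset this.2 fun i _ hi => ?_
    simp [Finsupp.notMem_support_iff.1 hi]

theorem expSeries_add (a b : σ → ℂ) : expSeries (a + b) = expSeries a * expSeries b := by
  classical
  ext m
  rw [MvPowerSeries.coeff_mul]
  have h := prod_add_divPow a b m
  have e : ∀ (z : σ → ℂ) (m : σ →₀ ℕ), MvPowerSeries.coeff m (expSeries z) =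
      m.prod fun i e => ((Nat.factorial e : ℚ)⁻¹) • z i ^ e := by
    intro z m
    change (m.prod fun i e => z i ^ e / (Nat.factorial e : ℂ)) = _
    refine Finsupp.prod_congr fun i _ => ?_
    rw [Algebra.smul_def]; simp [div_eq_inv_mul]
  simp only [e]
  exact h

theorem coeff_expSeries (z : σ → ℂ) (m : σ →₀ ℕ) :
    MvPowerSeries.coeff m (expSeries z) = divPow z m := rfl

/-- The product of the factorials of the entries of a multi-index. -/
def multiFactorial (m : σ →₀ ℕ) : ℂ := m.prod fun _ e => (Nat.factorial e : ℂ)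

theorem multiFactorial_ne_zero (m : σ →₀ ℕ) : multiFactorial m ≠ 0 :=
  Finset.prod_ne_zero_iff.2 fun i _ => Nat.cast_ne_zero.2 (Nat.factorial_pos (m i)).ne'

theorem divPow_eq (z : σ → ℂ) (m : σ →₀ ℕ) :
    divPow z m = (m.prod fun i e => z i ^ e) / multiFactorial m := by
  simp [divPow, multiFactorial, Finsupp.prod, Finset.prod_div_distrib]

/-- Taylor's formula for the action of an annihilation exponential on a basis vector of the Fock
space. -/
theorem shiftVars_monomial (t : σ → ℂ) (m : σ →₀ ℕ) [DecidableEq σ] :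
    shiftVars t (MvPolynomial.monomial m 1) = MvPolynomial.C (multiFactorial m) *
      ∑ p ∈ Finset.HasAntidiagonal.antidiagonal m,
        MvPolynomial.monomial p.1 ((multiFactorial p.1)⁻¹ * divPow t p.2) := by
  have h := prod_add_divPow (R := MvPolynomial σ ℂ) MvPolynomial.X (fun i => MvPolynomial.C (t i)) m
  have e : ∀ (z : σ → MvPolynomial σ ℂ) (m : σ →₀ ℕ),
      (m.prod fun i e => ((Nat.factorial e : ℚ)⁻¹) • z i ^ e) =
        MvPolynomial.C (multiFactorial m)⁻¹ * m.prod fun i e => z i ^ e := by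
    intro z m
    rw [multiFactorial, Finsupp.prod, Finsupp.prod, ← Finset.prod_inv_distrib, map_prod, Finsupp.prod,
      ← Finset.prod_mul_distrib]
    refine Finset.prod_congr rfl fun i _ => ?_
    rw [Algebra.smul_def]
    congr 1
    rw [IsScalarTower.algebraMap_apply ℚ ℂ (MvPolynomial σ ℂ), MvPolynomial.algebraMap_eq]
    simp
  simp only [e] at h
  have h' : shiftVars t (MvPolynomial.monomial m 1) =
      m.prod fun i e => (MvPolynomial.X i + MvPolynomial.C (t i)) ^ e := by
    rw [shiftVars, MvPolynomial.aeval_monomial, map_one, one_mul]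
  rw [h']
  have h2 := congrArg (fun p => MvPolynomial.C (multiFactorial m) * p) h
  simp only [← mul_assoc, ← map_mul, mul_inv_cancel₀ (multiFactorial_ne_zero m), map_one, one_mul] at h2
  rw [h2]
  congr 1
  refine Finset.sum_congr rfl fun p _ => ?_
  have h3 : (p.2.prod fun i e => (MvPolynomial.C (σ := σ) (t i)) ^ e) =
      MvPolynomial.C (p.2.prod fun i e => t i ^ e) := by
    simp [Finsupp.prod]
  have h4 : (p.1.prod fun i e => (MvPolynomial.X (R := ℂ) i) ^ e) = MvPolynomial.monomial p.1 1 := by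
    rw [MvPolynomial.monomial_eq]; simp
  rw [mul_assoc (MvPolynomial.C _ * _), h3, h4, divPow_eq, ← map_mul, MvPolynomial.C_mul_monomial,
    mul_comm, MvPolynomial.C_mul_monomial]
  congr 1
  ring

theorem coeff_shiftVars_monomial (t : σ → ℂ) (m c : σ →₀ ℕ) :
    MvPolynomial.coeff c (shiftVars t (MvPolynomial.monomial m 1)) =
      if c ≤ m then multiFactorial m * ((multiFactorial c)⁻¹ * divPow t (m - c)) else 0 := by
  classical
  rw [shiftVars_monomial, MvPolynomial.coeff_C_mul, MvPolynomial.coeff_sum]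
  simp only [MvPolynomial.coeff_monomial]
  split_ifs with h
  · rw [Finset.sum_eq_single (c, m - c)]
    · simp
    · rintro ⟨a, b⟩ hp hne
      rw [Finset.HasAntidiagonal.mem_antidiagonal] at hp
      rw [if_neg]
      rintro rfl
      apply hne
      simp only at hp
      rw [← hp, add_tsub_cancel_left]
    · intro hn
      exact absurd (Finset.HasAntidiagonal.mem_antidiagonal.2 (add_tsub_cancel_of_le h)) hn
  · rw [Finset.sum_eq_zero, mul_zero]
    rintro ⟨a, b⟩ hp
    rw [Finset.HasAntidiagonal.mem_antidiagonal] at hp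
    rw [if_neg]
    rintro rfl
    exact h (hp ▸ le_self_add)

theorem prod_pow_add (z : σ → ℂ) (c h : σ →₀ ℕ) :
    ((c + h).prod fun i e => z i ^ e) = (c.prod fun i e => z i ^ e) * h.prod fun i e => z i ^ e := by
  classical
  exact Finsupp.prod_add_index' (by simp) fun i a b => pow_add _ _ _

/-- This is e^(t∂) e^(bX) = e^(t·b) e^(bX), read off coefficientwise. Only m = c + h contributes,
and the sum over h is the exponential series of t·b. There may be infinitely many variables, hence
the summability of t·b as a hypothesis. -/
theorem hasSum_coeff_shiftVars_expSeries {t b : σ → ℂ} {S : ℂ} (hS : HasSum (fun i => t i * b i) S)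
    (c : σ →₀ ℕ) :
    HasSum (fun m => MvPolynomial.coeff c (shiftVars t (MvPolynomial.monomial m 1)) * divPow b m)
      (Complex.exp S * divPow b c) := by
  have hinj : Function.Injective fun h : σ →₀ ℕ => c + h := fun a b h => add_left_cancel h
  rw [← hinj.hasSum_iff]
  · have h := (hasSum_divPow hS).mul_right (divPow b c)
    refine hasSum_of_eq h (fun m => ?_) rfl
    rw [Function.comp_apply, coeff_shiftVars_monomial, if_pos le_self_add, add_tsub_cancel_left]
    simp only [divPow_eq, prod_pow_add]
    have h1 := multiFactorial_ne_zero c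
    have h2 := multiFactorial_ne_zero m
    have h3 := multiFactorial_ne_zero (c + m)
    have h4 : (m.prod fun i e => (t i * b i) ^ e) =
        (m.prod fun i e => t i ^ e) * m.prod fun i e => b i ^ e := by
      simp only [mul_pow]; exact Finsupp.prod_mul
    rw [h4]
    field_simp
  · intro m hm
    rw [coeff_shiftVars_monomial, if_neg, zero_mul]
    intro h
    exact hm ⟨m - c, add_tsub_cancel_of_le h⟩

/-- The oscillator part of Wick's formula: the index m runs over the intermediate occupation
numbers, `a` is the creation part of the left factor, and `p` is what the annihilation part of the
right factor makes of the initial vector. Translation is multiplicative, so it acts separately on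
e^(bX) and on `p`. -/
theorem hasSum_coeff_mul_expSeries {t b : σ → ℂ} {S : ℂ} (hS : HasSum (fun i => t i * b i) S)
    (p : MvPolynomial σ ℂ) (a : MvPowerSeries σ ℂ) (x : σ →₀ ℕ) :
    HasSum (fun m => MvPowerSeries.coeff x (a * (shiftVars t (MvPolynomial.monomial m 1) :
        MvPowerSeries σ ℂ)) * MvPowerSeries.coeff m (expSeries b * (p : MvPowerSeries σ ℂ)))
      (Complex.exp S * MvPowerSeries.coeff x (a * (expSeries b * (shiftVars t p : MvPowerSeries σ ℂ)))) :=
          by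
  classical
  have key : ∀ (p : MvPolynomial σ ℂ) (c : σ →₀ ℕ),
      HasSum (fun m => MvPolynomial.coeff c (shiftVars t (MvPolynomial.monomial m 1)) *
        MvPowerSeries.coeff m (expSeries b * (p : MvPowerSeries σ ℂ)))
      (Complex.exp S * MvPowerSeries.coeff c (expSeries b * (shiftVars t p : MvPowerSeries σ ℂ))) := by
    intro p
    induction p using MvPolynomial.induction_on' with
    | monomial d r =>
      intro c
      -- Multiplication by X^d leaves only the indices m = d + e, and the translate of X^(d+e) is
      -- the product of the translates of X^d and X^e.
      have hinj : Function.Injective fun e : σ →₀ ℕ => d + e := fun a b h => add_left_cancel h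
      have hs : ∀ e, shiftVars t (MvPolynomial.monomial (d + e) 1) =
          shiftVars t (MvPolynomial.monomial d 1) * shiftVars t (MvPolynomial.monomial e 1) := by
        intro e
        simp only [shiftVars, ← map_mul, MvPolynomial.monomial_mul, mul_one]
      rw [← hinj.hasSum_iff]
      · have hr : shiftVars t (MvPolynomial.monomial d r) =
            MvPolynomial.C r * shiftVars t (MvPolynomial.monomial d 1) := by
          have : MvPolynomial.monomial d r = MvPolynomial.C r * MvPolynomial.monomial d (1 : ℂ) := by
            rw [MvPolynomial.C_mul_monomial, mul_one]
          rw [this, shiftVars, map_mul, MvPolynomial.algHom_C]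
          rfl
        have hc : MvPowerSeries.coeff c (expSeries b * ((MvPolynomial.C r *
            shiftVars t (MvPolynomial.monomial d 1) : MvPolynomial σ ℂ) : MvPowerSeries σ ℂ)) = r *
                MvPowerSeries.coeff c
              ((shiftVars t (MvPolynomial.monomial d 1) : MvPowerSeries σ ℂ) * expSeries b) := by
          rw [MvPolynomial.coe_mul, MvPolynomial.coe_C, mul_left_comm, MvPowerSeries.coeff_C_mul,
            mul_comm (expSeries b)]
        rw [hr, hc, MvPowerSeries.coeff_mul]
        simp only [Function.comp_def, hs, MvPolynomial.coeff_mul, Finset.sum_mul, Finset.mul_sum]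
        refine hasSum_sum fun e _ => ?_
        have h := (hasSum_coeff_shiftVars_expSeries hS e.2).mul_left
          (MvPolynomial.coeff e.1 (shiftVars t (MvPolynomial.monomial d 1)) * r)
        refine hasSum_of_eq h (fun m => ?_) ?_
        · rw [MvPolynomial.coe_monomial, MvPowerSeries.coeff_mul_monomial, if_pos le_self_add,
            add_tsub_cancel_left, coeff_expSeries]
          ring
        · rw [coeff_expSeries, MvPolynomial.coeff_coe]
          ring
      · intro m hm
        rw [MvPolynomial.coe_monomial, MvPowerSeries.coeff_mul_monomial, if_neg, mul_zero]
        intro h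
        exact hm ⟨m - d, add_tsub_cancel_of_le h⟩
    | add p q hp hq =>
      intro c
      have h := (hp c).add (hq c)
      simp only [shiftVars, map_add, MvPolynomial.coe_add, mul_add] at h ⊢
      exact h
  simp only [MvPowerSeries.coeff_mul x a, Finset.sum_mul, Finset.mul_sum, MvPolynomial.coeff_coe]
  refine hasSum_sum fun e _ => ?_
  have h := (key p e.2).mul_left (MvPowerSeries.coeff e.1 a)
  rw [mul_left_comm] at h
  simpa only [mul_assoc] using h

end MultiExp

/-! ### Products of normal ordered exponentials -/

/-- The zero mode part of the contraction of two exponents. -/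
def zeroContr (P : Params) (X Y : Expo P.N) : ℂ :=
  ∑ β, X (Gen.p β) * ∑ γ, Y (Gen.q γ) * zeroBracket P β γ +
    ∑ i, X (Gen.phat i) * ∑ j, Y (Gen.qhat j) * hatBracket P i j

theorem shiftVars_shiftVars {σ : Type} (t t' : σ → ℂ) (f : MvPolynomial σ ℂ) :
    shiftVars t (shiftVars t' f) = shiftVars (t + t') f := by
  rw [shiftVars, shiftVars, shiftVars, ← AlgHom.comp_apply]
  congr 1
  ext i
  simp [add_assoc]

theorem annCoeff_add (P : Params) (X Y : Expo P.N) :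
    annCoeff P (X + Y) = annCoeff P X + annCoeff P Y := by
  funext g
  simp [annCoeff, add_mul, Finset.sum_add_distrib]

/-- Wick's formula. The intermediate momenta are determined by `y` and the q-part of `Y`, so the sum
over states is a sum over occupation numbers. The zero mode contraction appears because the p-part
of `X` acts on momenta already shifted by `Y`. -/
theorem hasSum_normExp_mul (P : Params) {X Y : Expo P.N} {S : ℂ}
    (hS : HasSum (fun g : Boson P.N × ℕ+ => annCoeff P X g * Y (Gen.neg g.1 g.2)) S)
    (x y : State P.N) :
    HasSum (fun s => normExp P X x s * normExp P Y s y)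
      (Complex.exp (S + zeroContr P X Y) * normExp P (X + Y) x y) := by
  classical
  -- The momenta after `Y` has acted on `y`; every other intermediate state contributes zero.
  let mom0 : BVec P.N := fun β => y.mom β + ∑ γ, Y (Gen.q γ) * zeroBracket P β γ
  let hat0 : AIdx P.N → ℂ := fun i => y.momHat i + ∑ j, Y (Gen.qhat j) * hatBracket P i j
  have hinj : Function.Injective fun m : (Boson P.N × ℕ+) →₀ ℕ => State.mk mom0 hat0 m := by
    intro a b h
    exact (State.mk.inj h).2.2
  rw [← hinj.hasSum_iff]
  · have h := hasSum_coeff_mul_expSeries hS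
      (shiftVars (annCoeff P Y) (MvPolynomial.monomial y.occ 1))
      (expSeries fun g : Boson P.N × ℕ+ => X (Gen.neg g.1 g.2)) x.occ
    -- If `x` does not have the momenta shifted by both q-parts, both sides vanish.
    by_cases hc : (∀ β, x.mom β = mom0 β + ∑ γ, X (Gen.q γ) * zeroBracket P β γ) ∧
      (∀ i, x.momHat i = hat0 i + ∑ j, X (Gen.qhat j) * hatBracket P i j)
    · have h2 := h.mul_left (Complex.exp (X Gen.one + ∑ β, X (Gen.p β) * mom0 β +
          ∑ i, X (Gen.phat i) * hat0 i) *
        Complex.exp (Y Gen.one + ∑ β, Y (Gen.p β) * y.mom β + ∑ i, Y (Gen.phat i) * y.momHat i))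
      refine hasSum_of_eq h2 (fun m => ?_) ?_
      · rw [Function.comp_apply, normExp, normExp, if_pos hc, if_pos ⟨fun _ => rfl, fun _ => rfl⟩]
        ring
      · have hc' : (∀ β, x.mom β = y.mom β + ∑ γ, (X + Y) (Gen.q γ) * zeroBracket P β γ) ∧
            (∀ i, x.momHat i = y.momHat i + ∑ j, (X + Y) (Gen.qhat j) * hatBracket P i j) := by
          refine ⟨fun β => ?_, fun i => ?_⟩
          · rw [hc.1 β]
            simp only [mom0, Pi.add_apply, add_mul, Finset.sum_add_distrib]
            ring
          · rw [hc.2 i]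
            simp only [hat0, Pi.add_apply, add_mul, Finset.sum_add_distrib]
            ring
        have he : (expSeries fun g : Boson P.N × ℕ+ => (X + Y) (Gen.neg g.1 g.2)) =
            (expSeries fun g : Boson P.N × ℕ+ => X (Gen.neg g.1 g.2)) *
              expSeries fun g : Boson P.N × ℕ+ => Y (Gen.neg g.1 g.2) := expSeries_add _ _
        have hE : Complex.exp (S + zeroContr P X Y) * Complex.exp ((X + Y) Gen.one +
              ∑ β, (X + Y) (Gen.p β) * y.mom β + ∑ i, (X + Y) (Gen.phat i) * y.momHat i) =
            Complex.exp (X Gen.one + ∑ β, X (Gen.p β) * mom0 β + ∑ i, X (Gen.phat i) * hat0 i) *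
              Complex.exp (Y Gen.one + ∑ β, Y (Gen.p β) * y.mom β +
                ∑ i, Y (Gen.phat i) * y.momHat i) * Complex.exp S := by
          rw [← Complex.exp_add, ← Complex.exp_add, ← Complex.exp_add]
          congr 1
          simp only [zeroContr, mom0, hat0, Pi.add_apply, mul_add, add_mul, Finset.sum_add_distrib]
          ring
        rw [normExp, if_pos hc', annCoeff_add, he, ← shiftVars_shiftVars, mul_assoc (expSeries _),
          ← mul_assoc (Complex.exp _), hE, mul_assoc (_ * _) (Complex.exp S)]
    · have hc' : ¬ ((∀ β, x.mom β = y.mom β + ∑ γ, (X + Y) (Gen.q γ) * zeroBracket P β γ) ∧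
            (∀ i, x.momHat i = y.momHat i + ∑ j, (X + Y) (Gen.qhat j) * hatBracket P i j)) := by
        rintro ⟨h1, h2⟩
        refine hc ⟨fun β => ?_, fun i => ?_⟩
        · rw [h1 β]
          simp only [mom0, Pi.add_apply, add_mul, Finset.sum_add_distrib]
          ring
        · rw [h2 i]
          simp only [hat0, Pi.add_apply, add_mul, Finset.sum_add_distrib]
          ring
      rw [normExp, if_neg hc', mul_zero]
      refine hasSum_of_eq hasSum_zero (fun m => ?_) rfl
      rw [Function.comp_apply, normExp, if_neg hc, zero_mul]
  · intro s hs
    have : normExp P Y s y = 0 := by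
      rw [normExp, if_neg]
      rintro ⟨h1, h2⟩
      exact hs ⟨s.occ, by ext <;> simp [mom0, hat0, h1, h2]⟩
    rw [this, mul_zero]

/-- `C` is the product of `A` and `B`, all matrix elements converging absolutely. -/
def HasOpMul {N : ℕ} (A B C : FockOp N) : Prop :=
  ∀ x y, HasSum (fun s => A x s * B s y) (C x y)

theorem HasOpMul.eq {N : ℕ} {A B C : FockOp N} (h : HasOpMul A B C) : A ⬝ₒ B = C := by
  funext x y
  exact (h x y).tsum_eq

theorem HasOpMul.add_right {N : ℕ} {A B C B' C' : FockOp N} (h : HasOpMul A B C)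
    (h' : HasOpMul A B' C') : HasOpMul A (B + B') (C + C') := fun x y => by
  refine hasSum_of_eq ((h x y).add (h' x y)) (fun s => ?_) rfl
  simp only [Pi.add_apply]; ring

theorem HasOpMul.add_left {N : ℕ} {A B C A' C' : FockOp N} (h : HasOpMul A B C)
    (h' : HasOpMul A' B C') : HasOpMul (A + A') B (C + C') := fun x y => by
  refine hasSum_of_eq ((h x y).add (h' x y)) (fun s => ?_) rfl
  simp only [Pi.add_apply]; ring

theorem HasOpMul.smul_right {N : ℕ} {A B C : FockOp N} (h : HasOpMul A B C) (c : ℂ) :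
    HasOpMul A (c • B) (c • C) := fun x y => by
  refine hasSum_of_eq ((h x y).mul_left c) (fun s => ?_) rfl
  simp only [Pi.smul_apply, smul_eq_mul]; ring

theorem HasOpMul.smul_left {N : ℕ} {A B C : FockOp N} (h : HasOpMul A B C) (c : ℂ) :
    HasOpMul (c • A) B (c • C) := fun x y => by
  refine hasSum_of_eq ((h x y).mul_left c) (fun s => ?_) rfl
  simp only [Pi.smul_apply, smul_eq_mul]; ring

theorem HasOpMul.sub_right {N : ℕ} {A B C B' C' : FockOp N} (h : HasOpMul A B C)
    (h' : HasOpMul A B' C') : HasOpMul A (B - B') (C - C') := by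
  have := h.add_right (h'.smul_right (-1))
  simpa [sub_eq_add_neg] using this

theorem HasOpMul.sub_left {N : ℕ} {A B C A' C' : FockOp N} (h : HasOpMul A B C)
    (h' : HasOpMul A' B C') : HasOpMul (A - A') B (C - C') := by
  have := h.add_left (h'.smul_left (-1))
  simpa [sub_eq_add_neg] using this

theorem HasOpMul.sum_right {N : ℕ} {ι : Type*} (s : Finset ι) {A : FockOp N} {B C : ι → FockOp N}
    (h : ∀ i ∈ s, HasOpMul A (B i) (C i)) : HasOpMul A (∑ i ∈ s, B i) (∑ i ∈ s, C i) := fun x y => by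
  refine hasSum_of_eq (hasSum_sum fun i hi => h i hi x y) (fun s => ?_) ?_
  · simp only [Finset.sum_apply, Finset.mul_sum]
  · simp only [Finset.sum_apply]

theorem HasOpMul.sum_left {N : ℕ} {ι : Type*} (s : Finset ι) {B : FockOp N} {A C : ι → FockOp N}
    (h : ∀ i ∈ s, HasOpMul (A i) B (C i)) : HasOpMul (∑ i ∈ s, A i) B (∑ i ∈ s, C i) := fun x y => by
  refine hasSum_of_eq (hasSum_sum fun i hi => h i hi x y) (fun s => ?_) ?_
  · simp only [Finset.sum_apply, Finset.sum_mul]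
  · simp only [Finset.sum_apply]

/-- Each alternative kills one part of the contraction, so the exponents simply add. This fuses the
products that define the currents, without any condition of convergence. -/
theorem hasOpMul_normExp (P : Params) {X Y : Expo P.N}
    (h : (∀ β n, X (Gen.pos β n) = 0) ∨ ∀ β n, Y (Gen.neg β n) = 0)
    (hp : (∀ β, X (Gen.p β) = 0) ∨ ∀ β, Y (Gen.q β) = 0)
    (hh : (∀ β, X (Gen.phat β) = 0) ∨ ∀ β, Y (Gen.qhat β) = 0) :
    HasOpMul (normExp P X) (normExp P Y) (normExp P (X + Y)) := fun x y => by
  have hS : HasSum (fun g : Boson P.N × ℕ+ => annCoeff P X g * Y (Gen.neg g.1 g.2)) 0 := by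
    refine hasSum_of_eq hasSum_zero (fun g => ?_) rfl
    rcases h with h | h
    · simp [annCoeff, h]
    · simp [h]
  have hz : zeroContr P X Y = 0 := by
    have h1 : ∑ β, X (Gen.p β) * ∑ γ, Y (Gen.q γ) * zeroBracket P β γ = 0 := by
      rcases hp with h | h <;> simp [h]
    have h2 : ∑ i, X (Gen.phat i) * ∑ j, Y (Gen.qhat j) * hatBracket P i j = 0 := by
      rcases hh with h | h <;> simp [h]
    rw [zeroContr, h1, h2, add_zero]
  have := hasSum_normExp_mul P hS x y
  rwa [hz, add_zero, Complex.exp_zero, one_mul] at this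

/-! ### Powers of `q` -/

section QPow

variable (P : Params)

theorem qpow_add (x y : ℂ) : qpow P (x + y) = qpow P x * qpow P y := by
  rw [qpow, add_mul, Complex.exp_add]; rfl

theorem qpow_zero : qpow P 0 = 1 := by simp [qpow]

theorem qpow_ne_zero (x : ℂ) : qpow P x ≠ 0 := Complex.exp_ne_zero _

theorem qpow_neg (x : ℂ) : qpow P (-x) = (qpow P x)⁻¹ := by
  rw [qpow, neg_mul, Complex.exp_neg]; rfl

theorem qpow_sub (x y : ℂ) : qpow P (x - y) = qpow P x / qpow P y := by
  rw [sub_eq_add_neg, qpow_add, qpow_neg, div_eq_mul_inv]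

theorem qpow_mul_nat (x : ℂ) (n : ℕ) : qpow P (x * n) = qpow P x ^ n := by
  rw [qpow, qpow, ← Complex.exp_nat_mul]
  congr 1; ring

theorem qpow_nat_mul (x : ℂ) (n : ℕ) : qpow P (n * x) = qpow P x ^ n := by
  rw [mul_comm, qpow_mul_nat]

theorem differentiable_qpow : Differentiable ℂ (qpow P) := by
  unfold qpow
  fun_prop

theorem norm_qpow (x : ℂ) : ‖qpow P x‖ = Real.exp (x * P.logq).re := Complex.norm_exp _

theorem logq_re_neg (hq : ‖qpow P 1‖ < 1) : P.logq.re < 0 := by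
  rw [norm_qpow, one_mul, Real.exp_lt_one_iff] at hq
  exact hq

theorem norm_qpow_real (x : ℝ) : ‖qpow P x‖ = Real.exp (x * P.logq.re) := by
  rw [norm_qpow, Complex.re_ofReal_mul]

theorem qnum_neg (x : ℂ) : qnum P (-x) = -qnum P x := by
  rw [qnum, qnum, neg_neg]; ring

/-- For real y the modulus of q^y is exp(y Re log q), so the triangle inequality bounds the
difference below by a hyperbolic sine, which increases with |y|. The uniformity in y is what bounds
1/[xn] for all n at once. -/
theorem norm_qpow_sub_qpow_neg_ge (hq : ‖qpow P 1‖ < 1) {x y : ℝ} (hxy : x ≤ |y|) :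
    Real.exp (-(x * P.logq.re)) - Real.exp (x * P.logq.re) ≤ ‖qpow P y - qpow P (-y)‖ := by
  have h0 := logq_re_neg P hq
  have h : ∀ z : ℝ, x ≤ z →
      Real.exp (-(x * P.logq.re)) - Real.exp (x * P.logq.re) ≤ ‖qpow P (-z) - qpow P z‖ := by
    intro z hz
    have h1 := norm_sub_norm_le (qpow P (-z)) (qpow P z)
    have h2 := norm_qpow_real P z
    have h3 := norm_qpow_real P (-z)
    rw [Complex.ofReal_neg] at h3
    rw [h2, h3] at h1
    refine le_trans (sub_le_sub (Real.exp_le_exp.2 ?_) (Real.exp_le_exp.2 ?_)) h1 <;> nlinarith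
  rcases abs_cases y with ⟨h1, _⟩ | ⟨h1, _⟩
  · rw [norm_sub_rev]
    exact h y (h1 ▸ hxy)
  · have := h (-y) (h1 ▸ hxy)
    rwa [Complex.ofReal_neg, neg_neg] at this

theorem qpow_sub_qpow_neg_ne_zero (hq : ‖qpow P 1‖ < 1) {x : ℝ} (hx : x ≠ 0) :
    qpow P x - qpow P (-x) ≠ 0 := by
  have h := norm_qpow_sub_qpow_neg_ge P hq (le_refl |x|)
  have h0 := logq_re_neg P hq
  have h1 : 0 < |x| := abs_pos.2 hx
  have h2 : Real.exp (|x| * P.logq.re) < Real.exp (-(|x| * P.logq.re)) :=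
    Real.exp_lt_exp.2 (by nlinarith)
  rw [← norm_pos_iff]
  linarith

theorem qpow_one_sub_ne_zero (hq : ‖qpow P 1‖ < 1) : qpow P 1 - qpow P (-1) ≠ 0 := by
  have := qpow_sub_qpow_neg_ne_zero P hq one_ne_zero
  simpa using this

theorem qnum_ne_zero (hq : ‖qpow P 1‖ < 1) {x : ℝ} (hx : x ≠ 0) : qnum P x ≠ 0 :=
  div_ne_zero (qpow_sub_qpow_neg_ne_zero P hq hx) (qpow_one_sub_ne_zero P hq)

end QPow

/-! ### Geometrically bounded sequences -/

/-- The sequence `f` grows at most geometrically. -/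
def GeomBounded (f : ℕ+ → ℂ) : Prop := ∃ C : ℝ, 1 ≤ C ∧ ∀ n : ℕ+, ‖f n‖ ≤ C ^ (n : ℕ)

namespace GeomBounded

theorem of_le {f : ℕ+ → ℂ} {C : ℝ} (h : ∀ n, ‖f n‖ ≤ C ^ (n : ℕ)) (hC : 0 ≤ C) : GeomBounded f :=
  ⟨max 1 C, le_max_left _ _, fun n => (h n).trans (pow_le_pow_left₀ hC (le_max_right _ _) _)⟩

theorem of_bounded {f : ℕ+ → ℂ} {C : ℝ} (h : ∀ n, ‖f n‖ ≤ C) : GeomBounded f :=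
  ⟨max 1 C, le_max_left _ _, fun n => (h n).trans ((le_max_right 1 C).trans
    (le_self_pow₀ (le_max_left _ _) n.pos.ne'))⟩

theorem const (c : ℂ) : GeomBounded fun _ => c := of_bounded fun _ => le_rfl

theorem add {f g : ℕ+ → ℂ} (hf : GeomBounded f) (hg : GeomBounded g) :
    GeomBounded fun n => f n + g n := by
  obtain ⟨C, hC, hf⟩ := hf
  obtain ⟨D, hD, hg⟩ := hg
  refine ⟨C + D, by linarith, fun n => (norm_add_le _ _).trans ?_⟩
  exact (add_le_add (hf n) (hg n)).trans (pow_add_pow_le (by linarith) (by linarith) n.pos.ne')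

theorem mul {f g : ℕ+ → ℂ} (hf : GeomBounded f) (hg : GeomBounded g) :
    GeomBounded fun n => f n * g n := by
  obtain ⟨C, hC, hf⟩ := hf
  obtain ⟨D, hD, hg⟩ := hg
  refine ⟨C * D, by nlinarith, fun n => ?_⟩
  rw [norm_mul, mul_pow]
  exact mul_le_mul (hf n) (hg n) (norm_nonneg _) (by positivity)

theorem neg {f : ℕ+ → ℂ} (hf : GeomBounded f) : GeomBounded fun n => -f n := by
  simpa using (const (-1)).mul hf

theorem sub {f g : ℕ+ → ℂ} (hf : GeomBounded f) (hg : GeomBounded g) :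
    GeomBounded fun n => f n - g n := by
  simpa [sub_eq_add_neg] using hf.add hg.neg

theorem pow {f : ℕ+ → ℂ} (hf : GeomBounded f) (k : ℕ) : GeomBounded fun n => f n ^ k := by
  induction k with
  | zero => simpa using const 1
  | succ k ih => simpa only [pow_succ] using ih.mul hf

theorem sum {ι : Type*} (s : Finset ι) {f : ι → ℕ+ → ℂ} (h : ∀ i ∈ s, GeomBounded (f i)) :
    GeomBounded fun n => ∑ i ∈ s, f i n := by
  classical
  induction s using Finset.induction_on with
  | empty => simpa using const 0
  | insert a s ha ih =>
    simp only [Finset.sum_insert ha]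
    exact (h a (Finset.mem_insert_self _ _)).add
      (ih fun i hi => h i (Finset.mem_insert_of_mem hi))

theorem natCast : GeomBounded fun n => ((n : ℕ) : ℂ) :=
  of_le (C := 2) (fun n => by
    rw [Complex.norm_natCast]; exact_mod_cast Nat.lt_two_pow_self.le) (by norm_num)

theorem inv_natCast : GeomBounded fun n => (((n : ℕ) : ℂ))⁻¹ :=
  of_bounded (C := 1) fun n => by
    rw [norm_inv, Complex.norm_natCast]
    exact inv_le_one_of_one_le₀ (by exact_mod_cast n.pos)

theorem qpow_mul (P : Params) (x : ℂ) : GeomBounded fun n => qpow P (x * (n : ℕ)) :=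
  of_le (C := ‖qpow P x‖) (fun n => by rw [qpow_mul_nat, norm_pow]) (norm_nonneg _)

theorem qnum_mul (P : Params) (x : ℂ) : GeomBounded fun n => qnum P (x * (n : ℕ)) := by
  simp only [qnum, div_eq_mul_inv, ← neg_mul]
  exact ((qpow_mul P x).sub (qpow_mul P (-x))).mul (const _)

/-- Since n ≥ 1, one has |xn| ≥ |x|, so [xn] is bounded away from zero uniformly in n. -/
theorem inv_qnum_mul (P : Params) (hq : ‖qpow P 1‖ < 1) {x : ℝ} (hx : x ≠ 0) :
    GeomBounded fun n => (qnum P (x * (n : ℕ)))⁻¹ := by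
  have h0 := logq_re_neg P hq
  have h1 : 0 < |x| := abs_pos.2 hx
  have h2 : Real.exp (|x| * P.logq.re) < Real.exp (-(|x| * P.logq.re)) :=
    Real.exp_lt_exp.2 (by nlinarith)
  have key : GeomBounded fun n => (qpow P (x * (n : ℕ)) - qpow P (-(x * (n : ℕ))))⁻¹ := by
    refine of_bounded (C := (Real.exp (-(|x| * P.logq.re)) - Real.exp (|x| * P.logq.re))⁻¹) fun n => ?_
    have hn : (1 : ℝ) ≤ (n : ℕ) := by exact_mod_cast n.pos
    have h := norm_qpow_sub_qpow_neg_ge P hq (x := |x|) (y := x * (n : ℕ)) (by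
      rw [abs_mul, Nat.abs_cast]; nlinarith)
    push_cast at h
    rw [norm_inv]
    exact inv_anti₀ (by linarith) h
  simp only [qnum, inv_div]
  simp only [div_eq_mul_inv]
  exact (const _).mul key

end GeomBounded

/-! ### Fields -/

/-- Exponents `X s` depending on `s = log_q z` as the exponents of free fields do: the `n`-th modes
scale as `z ^ (-n)` and are geometrically bounded, the coefficients of `q_β`, `q̂_i` are constant, and those
of `p_β`, `p̂_i` and the unit are entire. -/
structure RegularField (P : Params) (X : ℂ → Expo P.N) : Prop where
  pos : ∀ s β n, X s (.pos β n) = qpow P (-(s * (n : ℕ))) * X 0 (.pos β n)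
  neg : ∀ s β n, X s (.neg β n) = qpow P (s * (n : ℕ)) * X 0 (.neg β n)
  q : ∀ s γ, X s (.q γ) = X 0 (.q γ)
  qhat : ∀ s i, X s (.qhat i) = X 0 (.qhat i)
  p : ∀ β, Differentiable ℂ fun s => X s (.p β)
  phat : ∀ i, Differentiable ℂ fun s => X s (.phat i)
  one : Differentiable ℂ fun s => X s .one
  boundPos : ∀ β, GeomBounded fun n => X 0 (.pos β n)
  boundNeg : ∀ β, GeomBounded fun n => X 0 (.neg β n)

namespace RegularField

variable {P : Params} {X Y : ℂ → Expo P.N}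

theorem const (Z : Expo P.N) (hpos : ∀ β n, Z (.pos β n) = 0) (hneg : ∀ β n, Z (.neg β n) = 0) :
    RegularField P fun _ => Z where
  pos s β n := by simp [hpos]
  neg s β n := by simp [hneg]
  q s γ := rfl
  qhat s i := rfl
  p β := differentiable_const _
  phat i := differentiable_const _
  one := differentiable_const _
  boundPos β := by simpa [hpos] using GeomBounded.const 0
  boundNeg β := by simpa [hneg] using GeomBounded.const 0

theorem add (hX : RegularField P X) (hY : RegularField P Y) : RegularField P fun s => X s + Y s where
  pos s β n := by simp only [Pi.add_apply]; rw [hX.pos, hY.pos]; ring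
  neg s β n := by simp only [Pi.add_apply]; rw [hX.neg, hY.neg]; ring
  q s γ := by simp only [Pi.add_apply]; rw [hX.q, hY.q]
  qhat s i := by simp only [Pi.add_apply]; rw [hX.qhat, hY.qhat]
  p β := (hX.p β).add (hY.p β)
  phat i := (hX.phat i).add (hY.phat i)
  one := hX.one.add hY.one
  boundPos β := (hX.boundPos β).add (hY.boundPos β)
  boundNeg β := (hX.boundNeg β).add (hY.boundNeg β)

theorem smul (c : ℂ) (hX : RegularField P X) : RegularField P fun s => c • X s where
  pos s β n := by simp only [Pi.smul_apply, smul_eq_mul]; rw [hX.pos]; ring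
  neg s β n := by simp only [Pi.smul_apply, smul_eq_mul]; rw [hX.neg]; ring
  q s γ := by simp only [Pi.smul_apply]; rw [hX.q]
  qhat s i := by simp only [Pi.smul_apply]; rw [hX.qhat]
  p β := (hX.p β).const_smul c
  phat i := (hX.phat i).const_smul c
  one := hX.one.const_smul c
  boundPos β := (GeomBounded.const c).mul (hX.boundPos β)
  boundNeg β := (GeomBounded.const c).mul (hX.boundNeg β)

theorem neg' (hX : RegularField P X) : RegularField P fun s => -X s := by
  simpa using hX.smul (-1)

theorem sub (hX : RegularField P X) (hY : RegularField P Y) : RegularField P fun s => X s - Y s := by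
  simpa only [sub_eq_add_neg] using hX.add hY.neg'

theorem sum {ι : Type*} (s : Finset ι) {X : ι → ℂ → Expo P.N} (h : ∀ i ∈ s, RegularField P (X i)) :
    RegularField P fun z => ∑ i ∈ s, X i z := by
  classical
  induction s using Finset.induction_on with
  | empty => simpa using RegularField.const (0 : Expo P.N) (fun _ _ => rfl) fun _ _ => rfl
  | insert a s ha ih =>
    simp only [Finset.sum_insert ha]
    exact (h a (Finset.mem_insert_self _ _)).add (ih fun i hi => h i (Finset.mem_insert_of_mem hi))

/-- Passing from z to q^c z multiplies the n-th modes by q^(∓cn), which preserves geometric bounds.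
-/
theorem shift (hX : RegularField P X) (c : ℂ) : RegularField P fun s => X (s + c) where
  pos s β n := by
    rw [hX.pos (s + c), zero_add, hX.pos c, add_mul, neg_add, qpow_add, mul_assoc]
  neg s β n := by
    rw [hX.neg (s + c), zero_add, hX.neg c, add_mul, qpow_add, mul_assoc]
  q s γ := by
    rw [hX.q, hX.q (0 + c)]
  qhat s i := by
    rw [hX.qhat, hX.qhat (0 + c)]
  p β := (hX.p β).comp (differentiable_id.add_const c)
  phat i := (hX.phat i).comp (differentiable_id.add_const c)
  one := hX.one.comp (differentiable_id.add_const c)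
  boundPos β := by
    have h : (fun n : ℕ+ => X (0 + c) (.pos β n)) =
        fun n : ℕ+ => qpow P (-c * (n : ℕ)) * X 0 (.pos β n) := by
      funext n; rw [zero_add, hX.pos, neg_mul]
    rw [h]
    exact (GeomBounded.qpow_mul P _).mul (hX.boundPos β)
  boundNeg β := by
    have h : (fun n : ℕ+ => X (0 + c) (.neg β n)) =
        fun n : ℕ+ => qpow P (c * (n : ℕ)) * X 0 (.neg β n) := by
      funext n; rw [zero_add, hX.neg]
    rw [h]
    exact (GeomBounded.qpow_mul P _).mul (hX.boundNeg β)

theorem shift_sub (hX : RegularField P X) (c : ℂ) : RegularField P fun s => X (s - c) := by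
  simpa only [sub_eq_add_neg] using hX.shift (-c)

theorem modeSum {F : ℂ → ℤ → BVec P.N} (hF : ∀ s n, n ≠ 0 → F s n = qpow P (-(s * n)) • F 0 n)
    (hpos : ∀ β, GeomBounded fun n => F 0 ((n : ℕ) : ℤ) β)
    (hneg : ∀ β, GeomBounded fun n => F 0 (-((n : ℕ) : ℤ)) β) :
    RegularField P fun s => modeSum (F s) where
  pos s β n := by
    change F s _ β = _ * F 0 _ β
    rw [hF s _ (by exact_mod_cast n.pos.ne')]
    simp
  neg s β n := by
    change F s _ β = _ * F 0 _ β
    rw [hF s _ (by have := n.pos.ne'; omega)]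
    simp
  q s γ := rfl
  qhat s i := rfl
  p β := differentiable_const _
  phat i := differentiable_const _
  one := differentiable_const _
  boundPos β := hpos β
  boundNeg β := hneg β

/-- A function times a combination of `p_β`, `p̂_i` and the unit. -/
theorem zeroModes {f : ℂ → ℂ} (hf : Differentiable ℂ f) (Z : Expo P.N)
    (hpos : ∀ β n, Z (.pos β n) = 0) (hneg : ∀ β n, Z (.neg β n) = 0)
    (hq : ∀ γ, Z (.q γ) = 0) (hqh : ∀ i, Z (.qhat i) = 0) :
    RegularField P fun s => f s • Z where
  pos s β n := by simp [hpos]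
  neg s β n := by simp [hneg]
  q s γ := by simp [hq]
  qhat s i := by simp [hqh]
  p β := hf.mul_const _
  phat i := hf.mul_const _
  one := hf.mul_const _
  boundPos β := by simpa [hpos] using GeomBounded.const 0
  boundNeg β := by simpa [hneg] using GeomBounded.const 0

theorem pPart {f : ℂ → ℂ} (hf : Differentiable ℂ f) (x : BVec P.N) :
    RegularField P fun s => pPart (f s • x) := by
  have h : (fun s => EllipticVO.pPart (f s • x)) = fun s => f s • EllipticVO.pPart x := by
    funext s g
    cases g <;> simp [EllipticVO.pPart]
  rw [h]
  exact zeroModes hf _ (fun _ _ => rfl) (fun _ _ => rfl) (fun _ => rfl) fun _ => rfl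

theorem qPart (x : BVec P.N) : RegularField P fun _ => qPart x :=
  const _ (fun _ _ => rfl) fun _ _ => rfl

end RegularField

/-! ### Contractions -/

/-- The coefficients of the `n`-th annihilation modes. -/
def posVec {N : ℕ} (n : ℕ+) : Expo N →ₗ[ℂ] BVec N := LinearMap.funLeft ℂ ℂ fun β => .pos β n

/-- The coefficients of the `n`-th creation modes. -/
def negVec {N : ℕ} (n : ℕ+) : Expo N →ₗ[ℂ] BVec N := LinearMap.funLeft ℂ ℂ fun β => .neg β n

/-- The coefficients of the zero modes `p_β`. -/
def pVec {N : ℕ} : Expo N →ₗ[ℂ] BVec N := LinearMap.funLeft ℂ ℂ .p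

/-- The coefficients of the zero modes `q_β`. -/
def qVec {N : ℕ} : Expo N →ₗ[ℂ] BVec N := LinearMap.funLeft ℂ ℂ .q

/-- The coefficients of the `p̂_i`. -/
def phVec {N : ℕ} : Expo N →ₗ[ℂ] (AIdx N → ℂ) := LinearMap.funLeft ℂ ℂ .phat

/-- The coefficients of the `q̂_i`. -/
def qhVec {N : ℕ} : Expo N →ₗ[ℂ] (AIdx N → ℂ) := LinearMap.funLeft ℂ ℂ .qhat

/-- The bilinear form with matrix `M`. -/
def bilinOf {ι : Type*} [Fintype ι] (M : ι → ι → ℂ) : (ι → ℂ) →ₗ[ℂ] (ι → ℂ) →ₗ[ℂ] ℂ :=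
  LinearMap.mk₂ ℂ (fun x y => ∑ γ, (∑ β, x β * M β γ) * y γ)
    (fun x x' y => by simp [add_mul, Finset.sum_add_distrib])
    (fun c x y => by simp [Finset.mul_sum, mul_assoc, Finset.sum_mul])
    (fun x y y' => by simp [mul_add, Finset.sum_add_distrib])
    (fun c x y => by simp [Finset.mul_sum, mul_left_comm])

theorem bilinOf_apply {ι : Type*} [Fintype ι] (M : ι → ι → ℂ) (x y : ι → ℂ) :
    bilinOf M x y = ∑ γ, (∑ β, x β * M β γ) * y γ := rfl

theorem bilinOf_apply' {ι : Type*} [Fintype ι] (M : ι → ι → ℂ) (x y : ι → ℂ) :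
    bilinOf M x y = ∑ β, x β * ∑ γ, y γ * M β γ := by
  simp only [bilinOf_apply, Finset.sum_mul, Finset.mul_sum]
  rw [Finset.sum_comm]
  refine Finset.sum_congr rfl fun β _ => Finset.sum_congr rfl fun γ _ => ?_
  ring

theorem bilinOf_single {ι : Type*} [Fintype ι] [DecidableEq ι] (M : ι → ι → ℂ) (i j : ι) :
    bilinOf M (Pi.single i 1) (Pi.single j 1) = M i j := by
  simp [bilinOf_apply, Pi.single_apply]

theorem bilinOf_comm {ι : Type*} [Fintype ι] {M : ι → ι → ℂ} (hM : ∀ i j, M i j = M j i)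
    (x y : ι → ℂ) : bilinOf M x y = bilinOf M y x := by
  rw [bilinOf_apply, bilinOf_apply']
  refine Finset.sum_congr rfl fun γ _ => ?_
  rw [mul_comm]
  congr 1
  exact Finset.sum_congr rfl fun β _ => by rw [hM]

/-- The bracket `[∑ x_β β_n, ∑ y_γ γ_{-n}]`. -/
def modePairing (P : Params) (n : ℕ+) : BVec P.N →ₗ[ℂ] BVec P.N →ₗ[ℂ] ℂ :=
  bilinOf (oscBracket P n)

theorem zeroContr_eq (P : Params) (X Y : Expo P.N) :
    zeroContr P X Y = bilinOf (zeroBracket P) (pVec X) (qVec Y) +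
      bilinOf (hatBracket P) (phVec X) (qhVec Y) := by
  rw [bilinOf_apply', bilinOf_apply']
  rfl

/-- The n-th contribution of each boson is at most C^n |w/z|^n, with C built from the bounds of the
modes at s = 0 alone; hence one `R` serves all u and v. Summing over the bosons first turns the
contraction into a series in n that depends on u - v only. -/
theorem exists_hasSum_annCoeff (P : Params) {X Y : ℂ → Expo P.N} (hX : RegularField P X)
    (hY : RegularField P Y) :
    ∃ R : ℝ, 0 < R ∧ ∀ u v : ℂ, R * ‖qpow P (2 * v)‖ < ‖qpow P (2 * u)‖ →
      ∃ S, HasSum (fun g : Boson P.N × ℕ+ =>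
          annCoeff P (X (2 * u)) g * Y (2 * v) (.neg g.1 g.2)) S ∧
        HasSum (fun n : ℕ+ => modePairing P n (posVec n (X 0)) (negVec n (Y 0)) *
          qpow P (-(2 * (u - v) * (n : ℕ)))) S := by
  have hb : ∀ β γ, GeomBounded fun n => oscBracket P n β γ := by
    intro β γ
    have hi : GeomBounded fun n => qnum P ((n : ℕ)) ^ 2 / ((n : ℕ) : ℂ) := by
      simp only [div_eq_mul_inv]
      simpa using ((GeomBounded.qnum_mul P 1).pow 2).mul GeomBounded.inv_natCast
    rcases β with i | e | e <;> rcases γ with j | f | f <;> simp only [oscBracket]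
    · simp only [div_eq_mul_inv]
      exact ((GeomBounded.qnum_mul P _).mul (GeomBounded.qnum_mul P _)).mul
        GeomBounded.inv_natCast
    all_goals first
      | exact GeomBounded.const 0
      | (split_ifs
         · first | exact hi.neg | exact hi
         · exact GeomBounded.const 0)
  have hall : ∀ γ, GeomBounded fun n => (∑ β, X 0 (.pos β n) * oscBracket P n β γ) *
      Y 0 (.neg γ n) := fun γ =>
    (GeomBounded.sum _ fun β _ => (hX.boundPos β).mul (hb β γ)).mul (hY.boundNeg γ)
  choose C hC1 hC using hall
  have hsumC : ∀ γ, C γ ≤ ∑ γ, C γ + 1 := fun γ => by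
    have := Finset.single_le_sum (f := C) (fun i _ => (by linarith [hC1 i] : 0 ≤ C i))
      (Finset.mem_univ γ)
    linarith
  have hpos : 0 < ∑ γ, C γ + 1 := by
    have : 0 ≤ ∑ γ, C γ := Finset.sum_nonneg fun i _ => by linarith [hC1 i]
    linarith
  -- The sum dominates each `C γ`; the added 1 makes it positive even if there were no bosons.
  refine ⟨∑ γ, C γ + 1, hpos, fun u v huv => ?_⟩
  set R := ∑ γ, C γ + 1 with hR
  have hterm : ∀ g : Boson P.N × ℕ+, annCoeff P (X (2 * u)) g * Y (2 * v) (.neg g.1 g.2) =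
      ((∑ β, X 0 (.pos β g.2) * oscBracket P g.2 β g.1) * Y 0 (.neg g.1 g.2)) *
        qpow P (-(2 * (u - v) * (g.2 : ℕ))) := by
    intro g
    have e : qpow P (-(2 * (u - v) * (g.2 : ℕ))) =
        qpow P (-(2 * u * (g.2 : ℕ))) * qpow P (2 * v * (g.2 : ℕ)) := by
      rw [← qpow_add]; congr 1; ring
    rw [e, annCoeff, hY.neg]
    simp only [hX.pos (2 * u), mul_assoc, ← Finset.mul_sum]
    ring
  -- The ratio R|w/z| of the dominating geometric series, less than 1 in the region considered.
  set ρ := R * ‖qpow P (-(2 * (u - v)))‖ with hρ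
  have hρ1 : ρ < 1 := by
    have e : qpow P (-(2 * (u - v))) = qpow P (2 * v) / qpow P (2 * u) := by
      rw [← qpow_sub]; congr 1; ring
    have h0 : 0 < ‖qpow P (2 * u)‖ := norm_pos_iff.2 (qpow_ne_zero P _)
    rw [hρ, e, norm_div, ← mul_div_assoc, div_lt_one h0]
    exact huv
  have hρ0 : 0 ≤ ρ := mul_nonneg hpos.le (norm_nonneg _)
  have hsum : Summable fun g : Boson P.N × ℕ+ =>
      annCoeff P (X (2 * u)) g * Y (2 * v) (.neg g.1 g.2) := by
    have hgeo : Summable fun n : ℕ+ => ρ ^ (n : ℕ) :=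
      (summable_geometric_of_lt_one hρ0 hρ1).comp_injective PNat.coe_injective
    have h1 : Summable fun _ : Boson P.N => (1 : ℝ) := (hasSum_fintype _).summable
    refine Summable.of_norm_bounded (h1.mul_of_nonneg hgeo (fun _ => zero_le_one)
      fun n => pow_nonneg hρ0 _) fun g => ?_
    rw [hterm, norm_mul, one_mul, hρ, mul_pow, ← norm_pow, ← qpow_mul_nat, neg_mul]
    exact mul_le_mul_of_nonneg_right ((hC g.1 g.2).trans
      (pow_le_pow_left₀ (by linarith [hC1 g.1]) (hsumC g.1) _)) (norm_nonneg _)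
  refine ⟨_, hsum.hasSum, ?_⟩
  have hsw := (Equiv.prodComm ℕ+ (Boson P.N)).hasSum_iff.2 hsum.hasSum
  refine hasSum_of_eq (hsw.prod_fiberwise fun n => hasSum_fintype _) (fun n => ?_) rfl
  simp only [Function.comp_apply, Equiv.prodComm_apply, Prod.swap_prod_mk]
  rw [modePairing, bilinOf_apply, Finset.sum_mul]
  refine Finset.sum_congr rfl fun γ _ => ?_
  rw [hterm]
  rfl

/-! ### Exchange relations of exponentials -/

theorem differentiable_divPow {σ : Type} {z : ℂ → σ → ℂ} (hz : ∀ i, Differentiable ℂ fun s => z s i)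
    (m : σ →₀ ℕ) : Differentiable ℂ fun s => divPow (z s) m := by
  simp only [divPow, Finsupp.prod]
  refine Differentiable.fun_finsetProd fun i _ => ?_
  simp only [div_eq_mul_inv]
  exact ((hz i).pow _).mul_const _

/-- The q-parts do not depend on s, so neither does the momentum condition. When it holds, a matrix
element is the exponential of an entire function times a polynomial in finitely many coefficients of
the exponent. -/
theorem differentiable_normExp {P : Params} {Z : ℂ → Expo P.N}
    (hZ : ∀ g, Differentiable ℂ fun s => Z s g) (hq : ∀ s γ, Z s (.q γ) = Z 0 (.q γ))
    (hqh : ∀ s i, Z s (.qhat i) = Z 0 (.qhat i)) (x y : State P.N) :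
    Differentiable ℂ fun s => normExp P (Z s) x y := by
  classical
  by_cases hc : (∀ β, x.mom β = y.mom β + ∑ γ, Z 0 (Gen.q γ) * zeroBracket P β γ) ∧
      (∀ i, x.momHat i = y.momHat i + ∑ j, Z 0 (Gen.qhat j) * hatBracket P i j)
  · simp only [normExp, hq, hqh, if_pos hc]
    refine Differentiable.mul ?_ ?_
    · refine Differentiable.cexp (((hZ _).add ?_).add ?_)
      · exact Differentiable.fun_sum fun β _ => (hZ _).mul_const _
      · exact Differentiable.fun_sum fun i _ => (hZ _).mul_const _
    · simp only [MvPowerSeries.coeff_mul, coeff_expSeries, MvPolynomial.coeff_coe,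
        coeff_shiftVars_monomial]
      refine Differentiable.fun_sum fun p _ => (differentiable_divPow (fun g => hZ _) _).mul ?_
      split_ifs
      · refine ((differentiable_divPow (fun g => ?_) _).const_mul _).const_mul _
        exact Differentiable.fun_sum fun β _ => (hZ _).mul_const _
      · exact differentiable_const _
  · simp only [normExp, hq, hqh, if_neg hc]
    exact differentiable_const _

theorem RegularField.differentiable {P : Params} {X : ℂ → Expo P.N} (hX : RegularField P X)
    (g : Gen P.N) : Differentiable ℂ fun s => X s g := by
  have hd := differentiable_qpow P
  cases g with
  | one => exact hX.one
  | neg β n =>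
    rw [show (fun s => X s (.neg β n)) = _ from funext fun s => hX.neg s β n]
    exact (hd.comp (differentiable_id.mul_const _)).mul_const _
  | pos β n =>
    rw [show (fun s => X s (.pos β n)) = _ from funext fun s => hX.pos s β n]
    exact (hd.comp (differentiable_id.mul_const _).neg).mul_const _
  | q β => simp only [hX.q]; exact differentiable_const _
  | p β => exact hX.p β
  | qhat i => simp only [hX.qhat]; exact differentiable_const _
  | phat i => exact hX.phat i

theorem meromorphic_of_differentiable {f : ℂ → ℂ} (hf : Differentiable ℂ f) : Meromorphic f :=
  fun x => (hf.analyticAt x).meromorphicAt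

theorem meromorphic_comp_sub {f : ℂ → ℂ} (hf : Meromorphic f) (v : ℂ) :
    Meromorphic fun u => f (u - v) := fun x =>
  (hf (x - v)).comp_analyticAt (g := fun u => u - v) (by fun_prop)

/-- Transfers identities valid off a discrete set from the variable u to u - v. -/
theorem tendsto_sub_codiscrete (v : ℂ) :
    Tendsto (fun u : ℂ => u - v) (codiscrete ℂ) (codiscrete ℂ) := by
  intro S hS
  simp only [mem_map, mem_codiscrete, disjoint_principal_right, compl_compl] at hS ⊢
  intro x
  have h : Tendsto (fun u : ℂ => u - v) (𝓝[≠] x) (𝓝[≠] (x - v)) := by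
    refine tendsto_nhdsWithin_iff.2 ⟨?_, ?_⟩
    · exact ((continuous_id.sub continuous_const).tendsto x).mono_left nhdsWithin_le_nhds
    · filter_upwards [self_mem_nhdsWithin] with u hu
      simpa using hu
  exact h (hS (x - v))

/-- The exponentials of `∑ α_n z ^ (-n)` and `∑ β_n z ^ n` continue to meromorphic functions of `u`,
`z = q ^ (2u)`, with quotient `c`. -/
def ModeExchange (P : Params) (α β : ℕ+ → ℂ) (c : ℂ → ℂ) : Prop :=
  ∃ R : ℝ, 0 < R ∧ ∃ F G : ℂ → ℂ, Meromorphic F ∧ Meromorphic G ∧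
    (∀ u, R < ‖qpow P (2 * u)‖ → ∃ S,
      HasSum (fun n : ℕ+ => α n * qpow P (-(2 * u * (n : ℕ)))) S ∧ Complex.exp S = F u) ∧
    (∀ u, R * ‖qpow P (2 * u)‖ < 1 → ∃ S,
      HasSum (fun n : ℕ+ => β n * qpow P (2 * u * (n : ℕ))) S ∧ Complex.exp S = G u) ∧
    F =ᶠ[codiscrete ℂ] fun u => c u * G u

theorem modeExchange_zero (P : Params) : ModeExchange P (fun _ => 0) (fun _ => 0) fun _ => 1 := by
  refine ⟨1, one_pos, fun _ => 1, fun _ => 1, .const _, .const _, fun u _ => ⟨0, ?_, by simp⟩,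
    fun u _ => ⟨0, ?_, by simp⟩, ?_⟩
  · simp
  · simp
  · exact Eventually.of_forall fun u => by simp

theorem ModeExchange.add {P : Params} {α β α' β' : ℕ+ → ℂ} {c c' : ℂ → ℂ}
    (h : ModeExchange P α β c) (h' : ModeExchange P α' β' c') :
    ModeExchange P (fun n => α n + α' n) (fun n => β n + β' n) fun u => c u * c' u := by
  obtain ⟨R, hR, F, G, hF, hG, h1, h2, h3⟩ := h
  obtain ⟨R', hR', F', G', hF', hG', h1', h2', h3'⟩ := h'
  refine ⟨max R R', lt_max_of_lt_left hR, fun u => F u * F' u, fun u => G u * G' u, hF.fun_mul hF',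
    hG.fun_mul hG', fun u hu => ?_, fun u hu => ?_, ?_⟩
  · obtain ⟨S, hS, he⟩ := h1 u ((le_max_left _ _).trans_lt hu)
    obtain ⟨S', hS', he'⟩ := h1' u ((le_max_right _ _).trans_lt hu)
    exact ⟨S + S', hasSum_of_eq (hS.add hS') (fun n => by ring) rfl, by
      rw [Complex.exp_add, he, he']⟩
  · obtain ⟨S, hS, he⟩ := h2 u
      ((mul_le_mul_of_nonneg_right (le_max_left R R') (norm_nonneg _)).trans_lt hu)
    obtain ⟨S', hS', he'⟩ := h2' u
      ((mul_le_mul_of_nonneg_right (le_max_right R R') (norm_nonneg _)).trans_lt hu)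
    exact ⟨S + S', hasSum_of_eq (hS.add hS') (fun n => by ring) rfl, by
      rw [Complex.exp_add, he, he']⟩
  · filter_upwards [h3, h3'] with u hu hu'
    rw [hu, hu']; ring

/-- The extra contractions in individual terms of the currents, and those of H_i^±, have arguments
displaced by a power of q. -/
theorem ModeExchange.shift {P : Params} {α β : ℕ+ → ℂ} {c : ℂ → ℂ}
    (h : ModeExchange P α β c) (κ : ℂ) :
    ModeExchange P (fun n => α n * qpow P (2 * κ * (n : ℕ)))
      (fun n => β n * qpow P (-(2 * κ * (n : ℕ)))) fun u => c (u - κ) := by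
  obtain ⟨R, hR, F, G, hF, hG, h1, h2, h3⟩ := h
  set k := ‖qpow P (2 * κ)‖ with hk
  have hk0 : 0 < k := norm_pos_iff.2 (qpow_ne_zero P _)
  have hnorm : ∀ u, ‖qpow P (2 * (u - κ))‖ = ‖qpow P (2 * u)‖ / k := by
    intro u
    rw [mul_sub, qpow_sub, norm_div]
  -- The substitution u ↦ u - κ divides |z| by k, so the bound on large |z| is multiplied by k and
  -- the one for small |z| divided by it.
  refine ⟨max (R * k) (R / k), lt_max_of_lt_left (by positivity), fun u => F (u - κ),
    fun u => G (u - κ), meromorphic_comp_sub hF κ, meromorphic_comp_sub hG κ, fun u hu => ?_,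
    fun u hu => ?_, (tendsto_sub_codiscrete κ).eventually h3⟩
  · obtain ⟨S, hS, he⟩ := h1 (u - κ) (by
      rw [hnorm, lt_div_iff₀ hk0]; exact (le_max_left _ _).trans_lt hu)
    refine ⟨S, hasSum_of_eq hS (fun n => ?_) rfl, he⟩
    rw [mul_assoc, ← qpow_add]; congr 2; ring
  · obtain ⟨S, hS, he⟩ := h2 (u - κ) (by
      rw [hnorm, mul_div_assoc', ← div_mul_eq_mul_div]
      exact (mul_le_mul_of_nonneg_right (le_max_right (R * k) (R / k)) (norm_nonneg _)).trans_lt hu)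
    refine ⟨S, hasSum_of_eq hS (fun n => ?_) rfl, he⟩
    rw [mul_assoc, ← qpow_add]; congr 2; ring

/-- Both products are multiples of the same normal ordered exponential. The oscillators contribute
the factor `c'`, and `hz` says that the zero modes turn `c'` into the wanted `c`. -/
theorem exchange_normExp {P : Params} {X Y : ℂ → Expo P.N} (hX : RegularField P X)
    (hY : RegularField P Y) {c c' : ℂ → ℂ}
    (h : ModeExchange P (fun n => modePairing P n (posVec n (X 0)) (negVec n (Y 0)))
      (fun n => modePairing P n (posVec n (Y 0)) (negVec n (X 0))) c')
    (hz : ∀ u v, c' (u - v) * Complex.exp (zeroContr P (X (2 * u)) (Y (2 * v))) =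
      c (u - v) * Complex.exp (zeroContr P (Y (2 * v)) (X (2 * u)))) :
    Exchange P (fun u => normExp P (X (2 * u))) (fun v => normExp P (Y (2 * v))) c := by
  obtain ⟨R, hR, F, G, hF, hG, h1, h2, h3⟩ := h
  obtain ⟨R', hR', h1'⟩ := exists_hasSum_annCoeff P hX hY
  obtain ⟨R'', hR'', h2'⟩ := exists_hasSum_annCoeff P hY hX
  refine ⟨max R (max R' R''), lt_max_of_lt_left hR, fun v x y => ?_⟩
  have hv0 : 0 < ‖qpow P (2 * v)‖ := norm_pos_iff.2 (qpow_ne_zero P _)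
  have hdiff : ∀ g, Differentiable ℂ fun u => X (2 * u) g := fun g =>
    (hX.differentiable g).comp (differentiable_id.const_mul 2)
  -- The matrix element common to both orders is entire, so all poles come from the scalar
  -- contractions.
  have hN : Differentiable ℂ fun u => normExp P (X (2 * u) + Y (2 * v)) x y := by
    refine differentiable_normExp (Z := fun u => X (2 * u) + Y (2 * v)) (fun g => ?_)
      (fun s γ => ?_) (fun s i => ?_) x y
    · simp only [Pi.add_apply]
      exact (hdiff g).add_const _
    · simp only [Pi.add_apply]; rw [hX.q, mul_zero]
    · simp only [Pi.add_apply]; rw [hX.qhat, mul_zero]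
  have hz1 : Differentiable ℂ fun u => zeroContr P (X (2 * u)) (Y (2 * v)) := by
    unfold zeroContr
    refine Differentiable.fun_add ?_ ?_
    · exact Differentiable.fun_sum fun β _ => (hdiff _).mul_const _
    · exact Differentiable.fun_sum fun β _ => (hdiff _).mul_const _
  have hz2 : Differentiable ℂ fun u => zeroContr P (Y (2 * v)) (X (2 * u)) := by
    unfold zeroContr
    refine Differentiable.fun_add ?_ ?_
    · exact Differentiable.fun_sum fun β _ =>
        (Differentiable.fun_sum fun γ _ => (hdiff _).mul_const _).const_mul _
    · exact Differentiable.fun_sum fun β _ =>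
        (Differentiable.fun_sum fun γ _ => (hdiff _).mul_const _).const_mul _
  refine ⟨fun u => F (u - v) * (Complex.exp (zeroContr P (X (2 * u)) (Y (2 * v))) *
      normExp P (X (2 * u) + Y (2 * v)) x y),
    fun u => G (u - v) * (Complex.exp (zeroContr P (Y (2 * v)) (X (2 * u))) *
      normExp P (X (2 * u) + Y (2 * v)) x y),
    (meromorphic_comp_sub hF v).fun_mul (meromorphic_of_differentiable (hz1.cexp.mul hN)),
    (meromorphic_comp_sub hG v).fun_mul (meromorphic_of_differentiable (hz2.cexp.mul hN)),
    fun u hu => ?_, fun u hu => ?_, ?_⟩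
  · have hle : ∀ r, r ≤ max R (max R' R'') → r * ‖qpow P (2 * v)‖ < ‖qpow P (2 * u)‖ := fun r hr =>
      (mul_le_mul_of_nonneg_right hr (norm_nonneg _)).trans_lt hu
    obtain ⟨S, hS, hS'⟩ := h1' u v (hle _ ((le_max_left _ _).trans (le_max_right _ _)))
    obtain ⟨T, hT, he⟩ := h1 (u - v) (by
      rw [mul_sub, qpow_sub, norm_div, lt_div_iff₀ hv0]; exact hle _ (le_max_left _ _))
    have hST : S = T := hS'.unique hT
    have hm := hasSum_normExp_mul P hS x y
    rw [Complex.exp_add, hST, he, mul_assoc] at hm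
    exact hm
  · have hle : ∀ r, r ≤ max R (max R' R'') → r * ‖qpow P (2 * u)‖ < ‖qpow P (2 * v)‖ := fun r hr =>
      (mul_le_mul_of_nonneg_right hr (norm_nonneg _)).trans_lt hu
    obtain ⟨S, hS, hS'⟩ := h2' v u (hle _ ((le_max_right _ _).trans (le_max_right _ _)))
    obtain ⟨T, hT, he⟩ := h2 (u - v) (by
      rw [mul_sub, qpow_sub, norm_div, mul_div_assoc', div_lt_one hv0]; exact hle _ (le_max_left _ _))
    have hS'' : HasSum (fun n : ℕ+ => modePairing P n (posVec n (Y 0)) (negVec n (X 0)) *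
        qpow P (2 * (u - v) * (n : ℕ))) S :=
      hasSum_of_eq hS' (fun n => by congr 2; ring) rfl
    have hST : S = T := hS''.unique hT
    have hm := hasSum_normExp_mul P hS x y
    rw [Complex.exp_add, hST, he, mul_assoc, add_comm] at hm
    exact hm
  · filter_upwards [(tendsto_sub_codiscrete v).eventually h3] with u hu
    rw [hu]
    linear_combination (G (u - v) * normExp P (X (2 * u) + Y (2 * v)) x y) * hz u v

/-! ### Linear combinations of exchange relations -/

namespace Exchange

variable {P : Params} {A A' B : ℂ → FockOp P.N} {c : ℂ → ℂ}

theorem add_left (h : Exchange P A B c) (h' : Exchange P A' B c) :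
    Exchange P (fun u => A u + A' u) B c := by
  obtain ⟨R, hR, h⟩ := h
  obtain ⟨R', hR', h'⟩ := h'
  refine ⟨max R R', lt_max_of_lt_left hR, fun v x y => ?_⟩
  obtain ⟨f, g, hf, hg, h1, h2, h3⟩ := h v x y
  obtain ⟨f', g', hf', hg', h1', h2', h3'⟩ := h' v x y
  refine ⟨fun u => f u + f' u, fun u => g u + g' u, hf.fun_add hf', hg.fun_add hg',
    fun u hu => ?_, fun u hu => ?_, ?_⟩
  · refine hasSum_of_eq ((h1 u ?_).add (h1' u ?_)) (fun s => ?_) rfl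
    · exact (mul_le_mul_of_nonneg_right (le_max_left _ _) (norm_nonneg _)).trans_lt hu
    · exact (mul_le_mul_of_nonneg_right (le_max_right _ _) (norm_nonneg _)).trans_lt hu
    · simp only [Pi.add_apply]; ring
  · refine hasSum_of_eq ((h2 u ?_).add (h2' u ?_)) (fun s => ?_) rfl
    · exact (mul_le_mul_of_nonneg_right (le_max_left _ _) (norm_nonneg _)).trans_lt hu
    · exact (mul_le_mul_of_nonneg_right (le_max_right _ _) (norm_nonneg _)).trans_lt hu
    · simp only [Pi.add_apply]; ring
  · filter_upwards [h3, h3'] with u hu hu'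
    rw [hu, hu']; ring

/-- A scalar depending on u alone passes through both products; it is needed for the factor
-1/((q-q⁻¹)z) of E_i and F_i. -/
theorem smul_left (h : Exchange P A B c) {d : ℂ → ℂ} (hd : Meromorphic d) :
    Exchange P (fun u => d u • A u) B c := by
  obtain ⟨R, hR, h⟩ := h
  refine ⟨R, hR, fun v x y => ?_⟩
  obtain ⟨f, g, hf, hg, h1, h2, h3⟩ := h v x y
  refine ⟨fun u => d u * f u, fun u => d u * g u, hd.fun_mul hf, hd.fun_mul hg,
    fun u hu => ?_, fun u hu => ?_, ?_⟩
  · refine hasSum_of_eq ((h1 u hu).mul_left (d u)) (fun s => ?_) rfl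
    simp only [Pi.smul_apply, smul_eq_mul]; ring
  · refine hasSum_of_eq ((h2 u hu).mul_left (d u)) (fun s => ?_) rfl
    simp only [Pi.smul_apply, smul_eq_mul]; ring
  · filter_upwards [h3] with u hu
    rw [hu]; ring

theorem sub_left (h : Exchange P A B c) (h' : Exchange P A' B c) :
    Exchange P (fun u => A u - A' u) B c := by
  have := h.add_left (h'.smul_left (d := fun _ => -1) (.const _))
  simpa [sub_eq_add_neg] using this

theorem zero_left (P : Params) (B : ℂ → FockOp P.N) (c : ℂ → ℂ) :
    Exchange P (fun _ => 0) B c := by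
  refine ⟨1, one_pos, fun v x y => ⟨fun _ => 0, fun _ => 0, .const _, .const _, fun u _ => ?_,
    fun u _ => ?_, ?_⟩⟩
  · simp
  · simp
  · exact Eventually.of_forall fun u => by simp

theorem sum_left {ι : Type*} (s : Finset ι) {A : ι → ℂ → FockOp P.N}
    (h : ∀ i ∈ s, Exchange P (A i) B c) : Exchange P (fun u => ∑ i ∈ s, A i u) B c := by
  classical
  induction s using Finset.induction_on with
  | empty => simpa using zero_left P B c
  | insert a s ha ih =>
    simp only [Finset.sum_insert ha]
    exact (h a (Finset.mem_insert_self _ _)).add_left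
      (ih fun i hi => h i (Finset.mem_insert_of_mem hi))

end Exchange

/-! ### `q`-Pochhammer symbols and theta functions -/

theorem hasSum_log_one_sub {z : ℂ} (hz : ‖z‖ < 1) :
    HasSum (fun n : ℕ+ => -(z ^ (n : ℕ) / (n : ℕ))) (Complex.log (1 - z)) := by
  have h := (Complex.hasSum_taylorSeries_neg_log hz).neg
  rw [neg_neg] at h
  refine (PNat.coe_injective.hasSum_iff (f := fun n : ℕ => -(z ^ n / (n : ℂ))) ?_).2 h
  intro n hn
  have h0 : n = 0 := by
    by_contra h0
    exact hn ⟨⟨n, Nat.pos_of_ne_zero h0⟩, rfl⟩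
  simp [h0]

theorem one_sub_ne_zero_of_norm_lt {z : ℂ} (hz : ‖z‖ < 1) : 1 - z ≠ 0 := by
  intro h
  rw [sub_eq_zero] at h
  rw [← h, norm_one] at hz
  exact lt_irrefl _ hz

theorem tprod_exp_of_hasSum {f : ℕ → ℂ} {S : ℂ} (h : HasSum f S) :
    ∏' m, Complex.exp (f m) = Complex.exp S :=
  h.cexp.tprod_eq

/-- Expanding each log(1 - z p^m) gives an absolutely convergent double series. Summed over n first
it is the logarithm of the infinite product; summed over m first, the geometric series produces 1/(1
- p^n). -/
theorem exists_hasSum_qPoch {z p : ℂ} (hz : ‖z‖ < 1) (hp : ‖p‖ < 1) :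
    ∃ S, HasSum (fun n : ℕ+ => -(z ^ (n : ℕ) / ((n : ℕ) * (1 - p ^ (n : ℕ))))) S ∧
      Complex.exp S = qPoch z p := by
  have hsum : Summable fun a : ℕ × ℕ+ =>
      -((z * p ^ a.1) ^ (a.2 : ℕ) / ((a.2 : ℕ) : ℂ)) := by
    have hg1 := summable_geometric_of_lt_one (norm_nonneg p) hp
    have hg2 : Summable fun n : ℕ+ => ‖z‖ ^ (n : ℕ) :=
      (summable_geometric_of_lt_one (norm_nonneg z) hz).comp_injective PNat.coe_injective
    refine Summable.of_norm_bounded (hg1.mul_of_nonneg hg2 (fun _ => pow_nonneg (norm_nonneg _) _)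
      fun _ => pow_nonneg (norm_nonneg _) _) fun a => ?_
    have hn : (1 : ℝ) ≤ (a.2 : ℕ) := by exact_mod_cast a.2.pos
    rw [norm_neg, norm_div, norm_pow, norm_mul, norm_pow, Complex.norm_natCast, mul_pow,
      mul_comm (‖p‖ ^ a.1)]
    refine (div_le_self (by positivity) hn).trans
      (mul_le_mul_of_nonneg_left ?_ (pow_nonneg (norm_nonneg _) _))
    exact pow_le_of_le_one (pow_nonneg (norm_nonneg _) _)
      (pow_le_one₀ (norm_nonneg _) hp.le) a.2.pos.ne'
  have hlt : ∀ m : ℕ, ‖z * p ^ m‖ < 1 := by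
    intro m
    rw [norm_mul, norm_pow]
    exact (mul_le_of_le_one_right (norm_nonneg _) (pow_le_one₀ (norm_nonneg _) hp.le)).trans_lt hz
  obtain ⟨T, hT⟩ := hsum
  refine ⟨T, ?_, ?_⟩
  rotate_left
  · have h0 : HasSum (fun m : ℕ => Complex.log (1 - z * p ^ m)) T :=
      HasSum.prod_fiberwise hT fun m =>
        hasSum_of_eq (hasSum_log_one_sub (hlt m)) (fun n => by simp only []) rfl
    have h1 := tprod_exp_of_hasSum h0
    -- Only exponentials of the principal logarithms are used, so no choice of branch for the
    -- product matters.
    have h2 : ∀ m, Complex.exp (Complex.log (1 - z * p ^ m)) = 1 - z * p ^ m := fun m =>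
      Complex.exp_log (one_sub_ne_zero_of_norm_lt (hlt m))
    simp only [h2] at h1
    exact h1.symm
  · have hsw := (Equiv.prodComm ℕ+ ℕ).hasSum_iff.2 hT
    refine hsw.prod_fiberwise fun n => ?_
    have hpn : ‖p ^ (n : ℕ)‖ < 1 := by
      rw [norm_pow]; exact pow_lt_one₀ (norm_nonneg _) hp n.pos.ne'
    refine hasSum_of_eq ((hasSum_geometric_of_norm_lt_one hpn).mul_left
      (-(z ^ (n : ℕ) / ((n : ℕ) : ℂ)))) (fun m => ?_) ?_
    · simp only [Function.comp_apply, Equiv.prodComm_apply, Prod.swap_prod_mk, mul_pow]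
      rw [← pow_mul, ← pow_mul, mul_comm m]
      ring
    · rw [neg_mul, div_mul_eq_div_div, div_eq_mul_inv _ (1 - p ^ (n : ℕ))]

theorem qPoch_ne_zero {z p : ℂ} (hz : ‖z‖ < 1) (hp : ‖p‖ < 1) : qPoch z p ≠ 0 := by
  obtain ⟨S, -, hS⟩ := exists_hasSum_qPoch hz hp
  rw [← hS]
  exact Complex.exp_ne_zero S

/-- The product converges uniformly on the disc of radius ‖z‖ + 1 about 0, which contains z in its
interior. -/
theorem differentiable_qPoch {p : ℂ} (hp : ‖p‖ < 1) : Differentiable ℂ fun z => qPoch z p := by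
  intro z
  have hz : z ∈ Metric.ball (0 : ℂ) (‖z‖ + 1) := by simp
  have hu : Summable fun n : ℕ => (‖z‖ + 1) * ‖p‖ ^ n :=
    (summable_geometric_of_lt_one (norm_nonneg p) hp).mul_left _
  have h := Summable.hasProdLocallyUniformlyOn_nat_one_add (K := Metric.ball (0 : ℂ) (‖z‖ + 1))
    (f := fun n z => -(z * p ^ n)) Metric.isOpen_ball hu
    (Eventually.of_forall fun n w hw => by
      rw [norm_neg, norm_mul, norm_pow]
      exact mul_le_mul_of_nonneg_right (by simpa using (Metric.mem_ball.1 hw).le)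
        (pow_nonneg (norm_nonneg _) _))
    (fun n => by fun_prop)
  have h' : DifferentiableOn ℂ (fun z => ∏' n : ℕ, (1 + -(z * p ^ n))) (Metric.ball 0 (‖z‖ + 1)) :=
    h.differentiableOn (Eventually.of_forall fun s => by
      exact (Differentiable.fun_finsetProd fun i _ => by fun_prop).differentiableOn) Metric.isOpen_ball
  have h'' := h'.differentiableAt (Metric.isOpen_ball.mem_nhds hz)
  simpa only [qPoch, sub_eq_add_neg] using h''

theorem norm_qpow_real_lt_one (P : Params) (hq : ‖qpow P 1‖ < 1) {x : ℝ} (hx : 0 < x) :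
    ‖qpow P x‖ < 1 := by
  rw [norm_qpow_real, Real.exp_lt_one_iff]
  exact mul_neg_of_pos_of_neg hx (logq_re_neg P hq)

/-- An entire function with one nonzero value has discrete zeros. At u = (1-a)/2 the argument is q
itself, inside the unit disc, where the product does not vanish. -/
theorem qPoch_qpow_ne_zero_codiscrete (P : Params) (hq : ‖qpow P 1‖ < 1) {p : ℂ} (hp : ‖p‖ < 1)
    (a : ℂ) : ∀ᶠ u in codiscrete ℂ, qPoch (qpow P (2 * u + a)) p ≠ 0 := by
  have hd : Differentiable ℂ fun u => qPoch (qpow P (2 * u + a)) p :=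
    (differentiable_qPoch hp).comp ((differentiable_qpow P).comp (by fun_prop))
  refine AnalyticOnNhd.preimage_zero_mem_codiscrete (x := (1 - a) / 2) (fun x _ => hd.analyticAt x) ?_
  have e : 2 * ((1 - a) / 2) + a = 1 := by ring
  simp only [e]
  exact qPoch_ne_zero hq hp

/-- The difference `(q ^ (μ n) - q ^ (-μ n)) / n`. -/
def qDiff (P : Params) (μ : ℂ) (n : ℕ+) : ℂ :=
  (qpow P (μ * (n : ℕ)) - qpow P (-(μ * (n : ℕ)))) / (n : ℕ)

theorem qpow_add_mul_nat (P : Params) (x y : ℂ) (n : ℕ) :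
    qpow P (x * n) * qpow P (y * n) = qpow P (x + y) ^ n := by
  rw [← qpow_add, ← add_mul, qpow_mul_nat]

/-- The two series are the expansions at z = ∞ and at z = 0 of logarithms of quotients of linear
factors. Since 1 - x = -x(1 - 1/x), these quotients agree up to the constant q^(-2μ). -/
theorem modeExchange_swap (P : Params) (μ : ℂ) :
    ModeExchange P (qDiff P μ) (fun n => -qDiff P μ n) fun _ => qpow P (-(2 * μ)) := by
  have hd : ∀ a b : ℂ, Meromorphic fun u => 1 - qpow P (a + b * u) := fun a b =>
    meromorphic_of_differentiable (((differentiable_qpow P).comp (by fun_prop)).const_sub 1)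
  refine ⟨max ‖qpow P μ‖ ‖qpow P (-μ)‖, lt_max_of_lt_left (norm_pos_iff.2 (qpow_ne_zero P _)),
    fun u => (1 - qpow P (-μ + -2 * u)) / (1 - qpow P (μ + -2 * u)),
    fun u => (1 - qpow P (μ + 2 * u)) / (1 - qpow P (-μ + 2 * u)),
    (hd _ _).fun_div (hd _ _), (hd _ _).fun_div (hd _ _), fun u hu => ?_, fun u hu => ?_,
    Eventually.of_forall fun u => ?_⟩
  · have hn : ∀ a, ‖qpow P a‖ ≤ max ‖qpow P μ‖ ‖qpow P (-μ)‖ → ‖qpow P (a + -2 * u)‖ < 1 := by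
      intro a ha
      rw [neg_mul, ← sub_eq_add_neg, qpow_sub, norm_div,
        div_lt_one (norm_pos_iff.2 (qpow_ne_zero P _))]
      exact ha.trans_lt hu
    have h1 := hn _ (le_max_left _ _)
    have h2 := hn _ (le_max_right _ _)
    refine ⟨_, hasSum_of_eq ((hasSum_log_one_sub h2).sub (hasSum_log_one_sub h1)) (fun n => ?_) rfl, ?_⟩
    · rw [← qpow_add_mul_nat, ← qpow_add_mul_nat, qDiff]
      simp only [neg_mul]
      ring
    · rw [Complex.exp_sub, Complex.exp_log (one_sub_ne_zero_of_norm_lt h1),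
        Complex.exp_log (one_sub_ne_zero_of_norm_lt h2)]
  · have hn : ∀ a, ‖qpow P a‖ ≤ max ‖qpow P μ‖ ‖qpow P (-μ)‖ → ‖qpow P (a + 2 * u)‖ < 1 := by
      intro a ha
      rw [qpow_add, norm_mul]
      exact (mul_le_mul_of_nonneg_right ha (norm_nonneg _)).trans_lt hu
    have h1 := hn _ (le_max_left _ _)
    have h2 := hn _ (le_max_right _ _)
    refine ⟨_, hasSum_of_eq ((hasSum_log_one_sub h1).sub (hasSum_log_one_sub h2)) (fun n => ?_) rfl, ?_⟩
    · simp only [qDiff]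
      rw [← qpow_add_mul_nat, ← qpow_add_mul_nat]
      simp only [neg_mul]
      ring
    · rw [Complex.exp_sub, Complex.exp_log (one_sub_ne_zero_of_norm_lt h1),
        Complex.exp_log (one_sub_ne_zero_of_norm_lt h2)]
  · have e : ∀ a, 1 - qpow P (-a + -2 * u) = -qpow P (-a + -2 * u) * (1 - qpow P (a + 2 * u)) := by
      intro a
      have : qpow P (-a + -2 * u) * qpow P (a + 2 * u) = 1 := by
        rw [← qpow_add, show -a + -2 * u + (a + 2 * u) = 0 by ring, qpow_zero]
      linear_combination -this
    have e1 := e μ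
    have e2 := e (-μ)
    rw [neg_neg] at e2
    simp only []
    rw [e1, e2, mul_div_mul_comm, neg_div_neg_eq, ← qpow_sub]
    congr 2
    ring

/-- With p = q^(2ν), the first series gives (pq^(-μ)/z;p)/(pq^μ/z;p) and the second (q^(-μ)z;p)/(q^μ
z;p). Their quotient is Θ_p(q^μ z)/Θ_p(q^(-μ)z). The power of q in the statement undoes the factors
q^(u²/ν-u) in the two values of θ_ν. -/
theorem modeExchange_theta (P : Params) (hq : ‖qpow P 1‖ < 1) {ν : ℝ} (hν : 0 < ν) (μ : ℂ) :
    ModeExchange P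
      (fun n => qDiff P μ n * (qpow P (2 * ν) ^ (n : ℕ) / (1 - qpow P (2 * ν) ^ (n : ℕ))))
      (fun n => qDiff P μ n * (1 / (1 - qpow P (2 * ν) ^ (n : ℕ))))
      fun u => qpow P (μ - 2 * μ / ν * u) * (theta P ν (u + μ / 2) / theta P ν (u - μ / 2)) := by
  set p := qpow P (2 * ν) with hpdef
  have hp : ‖p‖ < 1 := by
    have := norm_qpow_real_lt_one P hq (x := 2 * ν) (by linarith)
    push_cast at this
    exact this
  have hd : ∀ a b : ℂ, Meromorphic fun u => qPoch (qpow P (b * u + a)) p := fun a b =>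
    meromorphic_of_differentiable
      ((differentiable_qPoch hp).comp ((differentiable_qpow P).comp (by fun_prop)))
  -- Large enough for all four Pochhammer arguments to lie in the unit disc in their respective
  -- regions.
  set R := ‖qpow P μ‖ + ‖qpow P (-μ)‖ + ‖qpow P (2 * ν + μ)‖ + ‖qpow P (2 * ν - μ)‖ with hR
  have hR0 : 0 < R := by
    have := norm_pos_iff.2 (qpow_ne_zero P μ)
    positivity
  refine ⟨R, hR0, fun u => qPoch (qpow P (-2 * u + (2 * ν - μ))) p / qPoch (qpow P (-2 * u + (2 * ν + μ)))
      p,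
    fun u => qPoch (qpow P (2 * u + -μ)) p / qPoch (qpow P (2 * u + μ)) p,
    (hd _ _).fun_div (hd _ _), (hd _ _).fun_div (hd _ _), fun u hu => ?_, fun u hu => ?_, ?_⟩
  · have hn : ∀ a, ‖qpow P a‖ ≤ R → ‖qpow P (-2 * u + a)‖ < 1 := by
      intro a ha
      rw [neg_mul, neg_add_eq_sub, qpow_sub, norm_div,
        div_lt_one (norm_pos_iff.2 (qpow_ne_zero P _))]
      exact ha.trans_lt hu
    obtain ⟨S, hS, hSe⟩ := exists_hasSum_qPoch (hn (2 * ν - μ) (by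
      rw [hR]
      linarith [norm_nonneg (qpow P μ), norm_nonneg (qpow P (-μ)), norm_nonneg (qpow P (2 * ν + μ))])) hp
    obtain ⟨T, hT, hTe⟩ := exists_hasSum_qPoch (hn (2 * ν + μ) (by
      rw [hR]
      linarith [norm_nonneg (qpow P μ), norm_nonneg (qpow P (-μ)), norm_nonneg (qpow P (2 * ν - μ))])) hp
    refine ⟨S - T, hasSum_of_eq (hS.sub hT) (fun n => ?_) rfl, by rw [Complex.exp_sub, hSe, hTe]⟩
    have e1 : qpow P (-2 * u + (2 * ν - μ)) ^ (n : ℕ) =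
        qpow P (-(2 * u * (n : ℕ))) * p ^ (n : ℕ) * qpow P (-(μ * (n : ℕ))) := by
      rw [hpdef, ← qpow_mul_nat, ← qpow_mul_nat, ← qpow_add, ← qpow_add]; congr 1; ring
    have e2 : qpow P (-2 * u + (2 * ν + μ)) ^ (n : ℕ) =
        qpow P (-(2 * u * (n : ℕ))) * p ^ (n : ℕ) * qpow P (μ * (n : ℕ)) := by
      rw [hpdef, ← qpow_mul_nat, ← qpow_mul_nat, ← qpow_add, ← qpow_add]; congr 1; ring
    simp only [qDiff]
    rw [e1, e2, div_mul_eq_div_div, div_mul_eq_div_div]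
    ring
  · have hn : ∀ a, ‖qpow P a‖ ≤ R → ‖qpow P (2 * u + a)‖ < 1 := by
      intro a ha
      rw [add_comm, qpow_add, norm_mul]
      exact (mul_le_mul_of_nonneg_right ha (norm_nonneg _)).trans_lt hu
    obtain ⟨S, hS, hSe⟩ := exists_hasSum_qPoch (hn (-μ) (by
      rw [hR]
      linarith [norm_nonneg (qpow P μ),
        norm_nonneg (qpow P (2 * ν - μ)), norm_nonneg (qpow P (2 * ν + μ))])) hp
    obtain ⟨T, hT, hTe⟩ := exists_hasSum_qPoch (hn μ (by
      rw [hR]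
      linarith [norm_nonneg (qpow P (-μ)),
        norm_nonneg (qpow P (2 * ν - μ)), norm_nonneg (qpow P (2 * ν + μ))])) hp
    refine ⟨S - T, hasSum_of_eq (hS.sub hT) (fun n => ?_) rfl, by rw [Complex.exp_sub, hSe, hTe]⟩
    simp only [qDiff]
    rw [← qpow_add_mul_nat, ← qpow_add_mul_nat, div_mul_eq_div_div, div_mul_eq_div_div]
    simp only [neg_mul]
    ring
  -- Only the two symbols in positive powers of z get cancelled and must not vanish. The other two
  -- form the same quotient on both sides, so their zeros do no harm.
  · filter_upwards [qPoch_qpow_ne_zero_codiscrete P hq hp μ,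
      qPoch_qpow_ne_zero_codiscrete P hq hp (-μ)] with u h1 h2
    have hpp : qPoch p p ≠ 0 := qPoch_ne_zero hp hp
    have hθ : ∀ a, theta P ν (u + a / 2) = qpow P ((u + a / 2) ^ 2 / ν - (u + a / 2)) *
        (qPoch (qpow P (2 * u + a)) p * qPoch (qpow P (-2 * u + (2 * ν - a))) p * qPoch p p) /
          qPoch p p ^ 3 := by
      intro a
      rw [theta, bigTheta, ← hpdef]
      have e1 : 2 * (u + a / 2) = 2 * u + a := by ring
      have e2 : p * (qpow P (2 * u + a))⁻¹ = qpow P (-2 * u + (2 * ν - a)) := by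
        rw [hpdef, ← qpow_neg, ← qpow_add]; congr 1; ring
      rw [e1, e2]
    have hs : u - μ / 2 = u + -μ / 2 := by ring
    -- The difference of the two Gaussian exponents is 2uμ/ν - μ.
    have e0 : qpow P (μ - 2 * μ / ν * u) * qpow P ((u + μ / 2) ^ 2 / ν - (u + μ / 2)) =
        qpow P ((u + -μ / 2) ^ 2 / ν - (u + -μ / 2)) := by
      rw [← qpow_add]
      congr 1
      have : (ν : ℂ) ≠ 0 := by exact_mod_cast hν.ne'
      field_simp
      ring
    have hE := qpow_ne_zero P ((u + -μ / 2) ^ 2 / ν - (u + -μ / 2))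
    rw [hs, hθ, hθ, sub_neg_eq_add, ← e0]
    rw [← e0] at hE
    have hE1 := left_ne_zero_of_mul hE
    have hE2 := right_ne_zero_of_mul hE
    generalize qpow P (μ - 2 * μ / ν * u) = A at *
    generalize qpow P ((u + μ / 2) ^ 2 / ν - (u + μ / 2)) = B at *
    generalize qPoch (qpow P (-2 * u + (2 * ν - μ))) p = C at *
    generalize qPoch (qpow P (-2 * u + (2 * ν + μ))) p = D at *
    field_simp

/-! ### Brackets of the bosons -/

section Basis

variable (P : Params)

theorem va_eq_single (i : AIdx P.N) : va P i = Pi.single (Sum.inl i) 1 := by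
  funext β
  rcases β with j | e | e
  · rw [Pi.single_apply]
    exact if_congr (by rw [Sum.inl.injEq, ← Subtype.coe_inj]) rfl rfl
  · simp [va]
  · simp [va]

theorem vb_eq_single (e : PIdx P.N) : vb P e.1.1 e.1.2 = Pi.single (Sum.inr (Sum.inl e)) 1 := by
  funext β
  rcases β with j | f | f
  · simp [vb]
  · rw [Pi.single_apply]
    exact if_congr (by rw [Sum.inr.injEq, Sum.inl.injEq, ← Subtype.coe_inj]) rfl rfl
  · simp [vb]

theorem vc_eq_single (e : PIdx P.N) : vc P e.1.1 e.1.2 = Pi.single (Sum.inr (Sum.inr e)) 1 := by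
  funext β
  rcases β with j | f | f
  · simp [vc]
  · simp [vc]
  · rw [Pi.single_apply]
    exact if_congr (by rw [Sum.inr.injEq, Sum.inr.injEq, ← Subtype.coe_inj]) rfl rfl

theorem vb_eq_zero {l m : ℕ} (h : ¬ (1 ≤ l ∧ l < m ∧ m ≤ P.N)) : vb P l m = 0 := by
  funext β
  rcases β with j | ⟨⟨a, b⟩, hf⟩ | f
  · rfl
  · simp only [Finset.mem_filter, Finset.mem_product, Finset.mem_Icc] at hf
    have : (a, b) ≠ (l, m) := by
      intro he
      simp only [Prod.mk.injEq] at he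
      omega
    simp [vb, this]
  · rfl

theorem vc_eq_zero {l m : ℕ} (h : ¬ (1 ≤ l ∧ l < m ∧ m ≤ P.N)) : vc P l m = 0 := by
  funext β
  rcases β with j | f | ⟨⟨a, b⟩, hf⟩
  · rfl
  · rfl
  · simp only [Finset.mem_filter, Finset.mem_product, Finset.mem_Icc] at hf
    have : (a, b) ≠ (l, m) := by
      intro he
      simp only [Prod.mk.injEq] at he
      omega
    simp [vc, this]

theorem vb_self (l : ℕ) : vb P l l = 0 := vb_eq_zero P (by omega)

theorem vc_self (l : ℕ) : vc P l l = 0 := vc_eq_zero P (by omega)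

theorem vbc_self (l : ℕ) : vbc P l l = 0 := by rw [vbc, vb_self, vc_self, add_zero]

end Basis

/-- A symmetric bilinear form on the combinations of the bosons for which the `a`, `b` and `c` bosons are
mutually orthogonal, the `b` and `c` bosons are orthogonal bases of square lengths `-w` and `w`, and the
Gram matrix of the `a` bosons is `M`. -/
structure BosonForm (P : Params) (B : BVec P.N →ₗ[ℂ] BVec P.N →ₗ[ℂ] ℂ) (M : ℕ → ℕ → ℂ) (w : ℂ) :
    Prop where
  symm : ∀ x y, B x y = B y x
  aa : ∀ i j, 1 ≤ i → i < P.N → 1 ≤ j → j < P.N → B (va P i) (va P j) = M i j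
  ab : ∀ i l m, 1 ≤ i → i < P.N → B (va P i) (vb P l m) = 0
  ac : ∀ i l m, 1 ≤ i → i < P.N → B (va P i) (vc P l m) = 0
  bb : ∀ l m l' m', 1 ≤ l → l < m → m ≤ P.N →
    B (vb P l' m') (vb P l m) = if (l', m') = (l, m) then -w else 0
  bc : ∀ l m l' m', B (vb P l' m') (vc P l m) = 0
  cc : ∀ l m l' m', 1 ≤ l → l < m → m ≤ P.N →
    B (vc P l' m') (vc P l m) = if (l', m') = (l, m) then w else 0

theorem cartan_comm (i j : ℕ) : cartan i j = cartan j i := by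
  unfold cartan
  simp only [eq_comm (a := i) (b := j), or_comm (a := i = j + 1)]

/-- Stated for an arbitrary bracket, so that it covers the oscillators for each n and the zero modes
alike. -/
theorem bosonForm_of_bracket (P : Params) {K : Boson P.N → Boson P.N → ℂ} {M : ℕ → ℕ → ℂ} {w : ℂ}
    (hM : ∀ i j, M i j = M j i)
    (aa : ∀ i j, K (Sum.inl i) (Sum.inl j) = M i j)
    (bb : ∀ e f, K (Sum.inr (Sum.inl e)) (Sum.inr (Sum.inl f)) = if e = f then -w else 0)
    (cc : ∀ e f, K (Sum.inr (Sum.inr e)) (Sum.inr (Sum.inr f)) = if e = f then w else 0)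
    (ab : ∀ i e, K (Sum.inl i) (Sum.inr e) = 0) (ba : ∀ i e, K (Sum.inr e) (Sum.inl i) = 0)
    (bc : ∀ e f, K (Sum.inr (Sum.inl e)) (Sum.inr (Sum.inr f)) = 0)
    (cb : ∀ e f, K (Sum.inr (Sum.inr e)) (Sum.inr (Sum.inl f)) = 0) :
    BosonForm P (bilinOf K) M w := by
  classical
  have hmem : ∀ l m, 1 ≤ l → l < m → m ≤ P.N → (l, m) ∈
      (Finset.Icc 1 P.N ×ˢ Finset.Icc 1 P.N).filter (fun e : ℕ × ℕ => e.1 < e.2) := by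
    intro l m h1 h2 h3
    simp only [Finset.mem_filter, Finset.mem_product, Finset.mem_Icc]
    omega
  have hb : ∀ l m, vb P l m = 0 ∨ ∃ e : PIdx P.N, e.1 = (l, m) ∧ vb P l m = Pi.single (Sum.inr (Sum.inl e))
      1 := by
    intro l m
    by_cases h : 1 ≤ l ∧ l < m ∧ m ≤ P.N
    · exact Or.inr ⟨⟨(l, m), hmem l m h.1 h.2.1 h.2.2⟩, rfl, vb_eq_single P ⟨(l, m), _⟩⟩
    · exact Or.inl (vb_eq_zero P h)
  have hc : ∀ l m, vc P l m = 0 ∨ ∃ e : PIdx P.N, e.1 = (l, m) ∧ vc P l m = Pi.single (Sum.inr (Sum.inr e))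
      1 := by
    intro l m
    by_cases h : 1 ≤ l ∧ l < m ∧ m ≤ P.N
    · exact Or.inr ⟨⟨(l, m), hmem l m h.1 h.2.1 h.2.2⟩, rfl, vc_eq_single P ⟨(l, m), _⟩⟩
    · exact Or.inl (vc_eq_zero P h)
  have ha : ∀ i, 1 ≤ i → i < P.N → ∃ e : AIdx P.N, e.1 = i ∧ va P i = Pi.single (Sum.inl e) 1 :=
    fun i h1 h2 => ⟨⟨i, Finset.mem_Ico.2 ⟨h1, h2⟩⟩, rfl, va_eq_single P ⟨i, _⟩⟩
  refine ⟨?_, ?_, ?_, ?_, ?_, ?_, ?_⟩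
  · refine bilinOf_comm ?_
    rintro (i | e | e) (j | f | f)
    · rw [aa, aa, hM]
    · rw [ab, ba]
    · rw [ab, ba]
    · rw [ab, ba]
    · rw [bb, bb]; simp only [eq_comm]
    · rw [bc, cb]
    · rw [ab, ba]
    · rw [bc, cb]
    · rw [cc, cc]; simp only [eq_comm]
  · intro i j h1 h2 h3 h4
    obtain ⟨e, rfl, he⟩ := ha i h1 h2
    obtain ⟨f, rfl, hf⟩ := ha j h3 h4
    rw [he, hf, bilinOf_single, aa]
  · intro i l m h1 h2
    obtain ⟨e, rfl, he⟩ := ha i h1 h2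
    rcases hb l m with h | ⟨f, -, hf⟩
    · rw [h, map_zero]
    · rw [he, hf, bilinOf_single, ab]
  · intro i l m h1 h2
    obtain ⟨e, rfl, he⟩ := ha i h1 h2
    rcases hc l m with h | ⟨f, -, hf⟩
    · rw [h, map_zero]
    · rw [he, hf, bilinOf_single, ab]
  · intro l m l' m' h1 h2 h3
    rw [vb_eq_single P ⟨(l, m), hmem l m h1 h2 h3⟩]
    rcases hb l' m' with h | ⟨f, hfe, hf⟩
    -- An index pair out of range gives the zero vector, and it cannot equal the pair (l, m), which
    -- is in range.
    · rw [h, map_zero, LinearMap.zero_apply, if_neg]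
      rintro he
      simp only [Prod.mk.injEq] at he
      obtain ⟨rfl, rfl⟩ := he
      rw [vb_eq_single P ⟨(l', m'), hmem l' m' h1 h2 h3⟩] at h
      simpa using congrFun h (Sum.inr (Sum.inl ⟨(l', m'), hmem l' m' h1 h2 h3⟩))
    · rw [hf, bilinOf_single, bb]
      simp only [Subtype.ext_iff, hfe]
  · intro l m l' m'
    rcases hc l m with h | ⟨e, -, he⟩
    · rw [h, map_zero]
    rcases hb l' m' with h | ⟨f, -, hf⟩
    · rw [h, map_zero, LinearMap.zero_apply]
    · rw [he, hf, bilinOf_single, bc]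
  · intro l m l' m' h1 h2 h3
    rw [vc_eq_single P ⟨(l, m), hmem l m h1 h2 h3⟩]
    rcases hc l' m' with h | ⟨f, hfe, hf⟩
    · rw [h, map_zero, LinearMap.zero_apply, if_neg]
      rintro he
      simp only [Prod.mk.injEq] at he
      obtain ⟨rfl, rfl⟩ := he
      rw [vc_eq_single P ⟨(l', m'), hmem l' m' h1 h2 h3⟩] at h
      simpa using congrFun h (Sum.inr (Sum.inr ⟨(l', m'), hmem l' m' h1 h2 h3⟩))
    · rw [hf, bilinOf_single, cc]
      simp only [Subtype.ext_iff, hfe]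

theorem bosonForm_modePairing (P : Params) (n : ℕ+) :
    BosonForm P (modePairing P n)
      (fun i j => qnum P ((P.k + P.N) * (n : ℕ)) * qnum P (cartan i j * (n : ℕ)) / (n : ℕ))
      (qnum P (n : ℕ) ^ 2 / (n : ℕ)) :=
  bosonForm_of_bracket P (fun i j => by rw [cartan_comm]) (fun _ _ => rfl) (fun _ _ => rfl)
    (fun _ _ => rfl) (fun _ e => by rcases e with e | e <;> rfl)
    (fun _ e => by rcases e with e | e <;> rfl) (fun _ _ => rfl) fun _ _ => rfl

theorem bosonForm_zeroBracket (P : Params) :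
    BosonForm P (bilinOf (zeroBracket P)) (fun i j => cartan i j * (P.k + P.N)) 1 :=
  bosonForm_of_bracket P (fun i j => by rw [cartan_comm]) (fun _ _ => rfl) (fun _ _ => rfl)
    (fun _ _ => rfl) (fun _ e => by rcases e with e | e <;> rfl)
    (fun _ e => by rcases e with e | e <;> rfl) (fun _ _ => rfl) fun _ _ => rfl

theorem hatBracket_vhat (P : Params) {i j : ℕ} (hi : 1 ≤ i) (hiN : i < P.N) (hj : 1 ≤ j)
    (hjN : j < P.N) : bilinOf (hatBracket P) (vhat P i) (vhat P j) = -(cartan i j / 2) := by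
  have h : ∀ i : AIdx P.N, vhat P i = Pi.single i 1 := by
    intro i
    funext j
    rw [Pi.single_apply]
    exact if_congr (by rw [← Subtype.coe_inj]) rfl rfl
  have h1 := h ⟨i, Finset.mem_Ico.2 ⟨hi, hiN⟩⟩
  have h2 := h ⟨j, Finset.mem_Ico.2 ⟨hj, hjN⟩⟩
  simp only at h1 h2
  rw [h1, h2, bilinOf_single]
  rfl

/-! ### Functionals on the combinations of the bosons -/

/-- The functionals `f` on the combinations of the bosons that arise as pairings with vertex operators.
Such a functional is determined by its values `A` on the `a` bosons, by `δ`, which gives its values on the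
combinations of the `b` bosons in the total currents, and by its values `-L (m - l)` on `c^{lm}`. -/
structure Shape (P : Params) (Q : ℂ) (f : BVec P.N →ₗ[ℂ] ℂ) (Δ A δ L : ℕ → ℂ) : Prop where
  zero : L 0 = 0
  step : ∀ i, 1 ≤ i → i < P.N → Q * Δ (i + 1) - Δ i = δ i
  va : ∀ i, 1 ≤ i → i < P.N → f (va P i) = A i
  -- The diagonal l = m is allowed: there the Δ-terms cancel and L 0 = 0, in accordance with b^{ll}
  -- = 0. The summand L is opposite to the value on c^{lm}, so it is invisible to b + c.
  vb : ∀ l m, 1 ≤ l → l ≤ m → m ≤ P.N → f (vb P l m) = Δ m / Q ^ l - Δ l / Q ^ m + L (m - l)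
  vc : ∀ l m, 1 ≤ l → l ≤ m → m ≤ P.N → f (vc P l m) = -L (m - l)

namespace Shape

variable {P : Params} {Q : ℂ} {f g : BVec P.N →ₗ[ℂ] ℂ} {Δ A δ L Δ' A' δ' L' : ℕ → ℂ}

theorem add (h : Shape P Q f Δ A δ L) (h' : Shape P Q g Δ' A' δ' L') :
    Shape P Q (f + g) (Δ + Δ') (A + A') (δ + δ') (L + L') where
  zero := by simp [h.zero, h'.zero]
  step i h1 h2 := by simp only [Pi.add_apply, ← h.step i h1 h2, ← h'.step i h1 h2]; ring
  va i h1 h2 := by simp only [Pi.add_apply, LinearMap.add_apply, h.va i h1 h2, h'.va i h1 h2]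
  vb l m h1 h2 h3 := by
    simp only [Pi.add_apply, LinearMap.add_apply, h.vb l m h1 h2 h3, h'.vb l m h1 h2 h3]; ring
  vc l m h1 h2 h3 := by
    simp only [Pi.add_apply, LinearMap.add_apply, h.vc l m h1 h2 h3, h'.vc l m h1 h2 h3]; ring

theorem smul (h : Shape P Q f Δ A δ L) (c : ℂ) :
    Shape P Q (c • f) (c • Δ) (c • A) (c • δ) (c • L) where
  zero := by simp [h.zero]
  step i h1 h2 := by simp only [Pi.smul_apply, smul_eq_mul, ← h.step i h1 h2]; ring
  va i h1 h2 := by simp only [Pi.smul_apply, LinearMap.smul_apply, h.va i h1 h2]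
  vb l m h1 h2 h3 := by
    simp only [Pi.smul_apply, LinearMap.smul_apply, h.vb l m h1 h2 h3, smul_eq_mul]; ring
  vc l m h1 h2 h3 := by
    simp only [Pi.smul_apply, LinearMap.smul_apply, h.vc l m h1 h2 h3, smul_eq_mul]; ring

theorem zero' : Shape P Q 0 0 0 0 0 where
  zero := rfl
  step i h1 h2 := by simp
  va i h1 h2 := by simp
  vb l m h1 h2 h3 := by simp
  vc l m h1 h2 h3 := by simp

theorem sum {ι : Type*} (s : Finset ι) {f : ι → BVec P.N →ₗ[ℂ] ℂ} {Δ A δ L : ι → ℕ → ℂ}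
    (h : ∀ i ∈ s, Shape P Q (f i) (Δ i) (A i) (δ i) (L i)) :
    Shape P Q (∑ i ∈ s, f i) (∑ i ∈ s, Δ i) (∑ i ∈ s, A i) (∑ i ∈ s, δ i) (∑ i ∈ s, L i) := by
  classical
  induction s using Finset.induction_on with
  | empty => simpa using zero'
  | insert a s ha ih =>
    simp only [Finset.sum_insert ha]
    exact (h a (Finset.mem_insert_self _ _)).add (ih fun i hi => h i (Finset.mem_insert_of_mem hi))

theorem congr (h : Shape P Q f Δ A δ L) (hf : g = f) (hA : ∀ i, 1 ≤ i → i < P.N → A i = A' i)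
    (hδ : ∀ i, 1 ≤ i → i < P.N → δ i = δ' i) (hL0 : L' 0 = 0) (hL : ∀ m, m < P.N → L m = L' m) :
    Shape P Q g Δ A' δ' L' where
  zero := hL0
  step i h1 h2 := by rw [h.step i h1 h2, hδ i h1 h2]
  va i h1 h2 := by rw [hf, h.va i h1 h2, hA i h1 h2]
  vb l m h1 h2 h3 := by rw [hf, h.vb l m h1 h2 h3, hL _ (by omega)]
  vc l m h1 h2 h3 := by rw [hf, h.vc l m h1 h2 h3, hL _ (by omega)]

/-- The fields (b+c)(z) see only Δ. The shifts L enter the currents through b_± alone. -/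
theorem vbc (h : Shape P Q f Δ A δ L) {l m : ℕ} (h1 : 1 ≤ l) (h2 : l ≤ m) (h3 : m ≤ P.N) :
    f (vbc P l m) = Δ m / Q ^ l - Δ l / Q ^ m := by
  rw [EllipticVO.vbc, map_add, h.vb l m h1 h2 h3, h.vc l m h1 h2 h3]; ring

/-- In each summand the terms with Δ_l cancel, QΔ_{i+1} - Δ_i collects to δ_i Q^(-2l), and the rest
is L(i-l+1)/Q^(l-1) - L(i-l)/Q^l, which telescopes. -/
theorem sum_left (h : Shape P Q f Δ A δ L) (hQ : Q ≠ 0) {a c i : ℕ}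
    (hac : a ≤ c) (hci : c ≤ i) (h1 : 1 ≤ i) (hi : i < P.N) :
    ∑ l ∈ Finset.Icc (a + 1) c, (Q / Q ^ l * f (EllipticVO.vb P l (i + 1)) -
        1 / Q ^ l * f (EllipticVO.vb P l i)) =
      δ i * ∑ l ∈ Finset.Icc (a + 1) c, (1 / Q ^ l) ^ 2 + (L (i - a) / Q ^ a - L (i - c) / Q ^ c) := by
  induction c, hac using Nat.le_induction with
  | base => simp
  | succ c hac ih =>
    rw [Finset.sum_Icc_succ_top (by omega), ih (by omega), Finset.sum_Icc_succ_top (by omega),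
      h.vb (c + 1) (i + 1) (by omega) (by omega) (by omega),
      h.vb (c + 1) i (by omega) (by omega) (by omega), ← h.step i h1 hi, Nat.add_sub_add_right]
    field_simp
    ring

/-- The mirror image of `sum_left`: again Δ_l cancels and the shifts telescope, now with L(l-i)/Q^l.
-/
theorem sum_right (h : Shape P Q f Δ A δ L) (hQ : Q ≠ 0) {a c i : ℕ}
    (hac : a ≤ c) (hia : i ≤ a) (h1 : 1 ≤ i) (hc : c ≤ P.N) (hi : i < P.N) :
    ∑ l ∈ Finset.Icc (a + 1) c, (1 / Q ^ l * f (EllipticVO.vb P i l) -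
        Q / Q ^ l * f (EllipticVO.vb P (i + 1) l)) =
      δ i * ∑ l ∈ Finset.Icc (a + 1) c, (1 / Q ^ l) ^ 2 + (L (c - i) / Q ^ c - L (a - i) / Q ^ a) := by
  induction c, hac using Nat.le_induction with
  | base => simp
  | succ c hac ih =>
    rw [Finset.sum_Icc_succ_top (by omega), ih (by omega), Finset.sum_Icc_succ_top (by omega),
      h.vb i (c + 1) (by omega) (by omega) (by omega),
      h.vb (i + 1) (c + 1) (by omega) (by omega) (by omega), ← h.step i h1 hi, Nat.add_sub_add_right]
    field_simp
    ring

end Shape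

/-- The geometric sums left by the telescoping become closed expressions after multiplication by the
factor q - q⁻¹ of b_±, which is a multiple of Q - Q⁻¹. -/
theorem sum_inv_pow_sq {Q : ℂ} (hQ : Q ≠ 0) {a c : ℕ} (hac : a ≤ c) :
    (Q - Q⁻¹) * ∑ l ∈ Finset.Icc (a + 1) c, (1 / Q ^ l) ^ 2 = Q⁻¹ * ((1 / Q ^ a) ^ 2 - (1 / Q ^ c) ^ 2) :=
        by
  induction c, hac using Nat.le_induction with
  | base => simp
  | succ c hac ih =>
    rw [Finset.sum_Icc_succ_top (by omega), mul_add, ih]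
    field_simp
    ring

/-! ### Modes of the elementary fields -/

section Modes

variable (P : Params) (n : ℕ+) (x : BVec P.N) (s : ℂ)

theorem posVec_modeSum {N : ℕ} (X : ℤ → BVec N) : posVec n (modeSum X) = X ((n : ℕ) : ℤ) := rfl
theorem negVec_modeSum {N : ℕ} (X : ℤ → BVec N) : negVec n (modeSum X) = X (-((n : ℕ) : ℤ)) := rfl
theorem pVec_modeSum {N : ℕ} (X : ℤ → BVec N) : pVec (modeSum X) = 0 := rfl
theorem qVec_modeSum {N : ℕ} (X : ℤ → BVec N) : qVec (modeSum X) = 0 := rfl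
theorem phVec_modeSum {N : ℕ} (X : ℤ → BVec N) : phVec (modeSum X) = 0 := rfl
theorem qhVec_modeSum {N : ℕ} (X : ℤ → BVec N) : qhVec (modeSum X) = 0 := rfl
theorem posVec_pPart {N : ℕ} (x : BVec N) : posVec n (pPart x) = 0 := rfl
theorem negVec_pPart {N : ℕ} (x : BVec N) : negVec n (pPart x) = 0 := rfl
theorem pVec_pPart {N : ℕ} (x : BVec N) : pVec (pPart x) = x := rfl
theorem qVec_pPart {N : ℕ} (x : BVec N) : qVec (pPart x) = 0 := rfl
theorem phVec_pPart {N : ℕ} (x : BVec N) : phVec (pPart x) = 0 := rfl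
theorem qhVec_pPart {N : ℕ} (x : BVec N) : qhVec (pPart x) = 0 := rfl
theorem posVec_qPart {N : ℕ} (x : BVec N) : posVec n (qPart x) = 0 := rfl
theorem negVec_qPart {N : ℕ} (x : BVec N) : negVec n (qPart x) = 0 := rfl
theorem pVec_qPart {N : ℕ} (x : BVec N) : pVec (qPart x) = 0 := rfl
theorem qVec_qPart {N : ℕ} (x : BVec N) : qVec (qPart x) = x := rfl
theorem phVec_qPart {N : ℕ} (x : BVec N) : phVec (qPart x) = 0 := rfl
theorem qhVec_qPart {N : ℕ} (x : BVec N) : qhVec (qPart x) = 0 := rfl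
theorem posVec_phatPart {N : ℕ} (x : AIdx N → ℂ) : posVec n (phatPart x) = 0 := rfl
theorem negVec_phatPart {N : ℕ} (x : AIdx N → ℂ) : negVec n (phatPart x) = 0 := rfl
theorem pVec_phatPart {N : ℕ} (x : AIdx N → ℂ) : pVec (phatPart x) = 0 := rfl
theorem qVec_phatPart {N : ℕ} (x : AIdx N → ℂ) : qVec (phatPart x) = 0 := rfl
theorem phVec_phatPart {N : ℕ} (x : AIdx N → ℂ) : phVec (phatPart x) = x := rfl
theorem qhVec_phatPart {N : ℕ} (x : AIdx N → ℂ) : qhVec (phatPart x) = 0 := rfl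
theorem posVec_qhatPart {N : ℕ} (x : AIdx N → ℂ) : posVec n (qhatPart x) = 0 := rfl
theorem negVec_qhatPart {N : ℕ} (x : AIdx N → ℂ) : negVec n (qhatPart x) = 0 := rfl
theorem pVec_qhatPart {N : ℕ} (x : AIdx N → ℂ) : pVec (qhatPart x) = 0 := rfl
theorem qVec_qhatPart {N : ℕ} (x : AIdx N → ℂ) : qVec (qhatPart x) = 0 := rfl
theorem phVec_qhatPart {N : ℕ} (x : AIdx N → ℂ) : phVec (qhatPart x) = 0 := rfl
theorem qhVec_qhatPart {N : ℕ} (x : AIdx N → ℂ) : qhVec (qhatPart x) = x := rfl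
theorem posVec_onePart {N : ℕ} (c : ℂ) : posVec n (onePart c : Expo N) = 0 := rfl
theorem negVec_onePart {N : ℕ} (c : ℂ) : negVec n (onePart c : Expo N) = 0 := rfl
theorem pVec_onePart {N : ℕ} (c : ℂ) : pVec (onePart c : Expo N) = 0 := rfl
theorem qVec_onePart {N : ℕ} (c : ℂ) : qVec (onePart c : Expo N) = 0 := rfl
theorem phVec_onePart {N : ℕ} (c : ℂ) : phVec (onePart c : Expo N) = 0 := rfl
theorem qhVec_onePart {N : ℕ} (c : ℂ) : qhVec (onePart c : Expo N) = 0 := rfl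

theorem posVec_bosonField :
    posVec n (bosonField P x s) = (-((qpow P (s * (n : ℕ)))⁻¹ / qnum P (n : ℕ))) • x := by
  rw [bosonField, map_add, map_add, posVec_modeSum, posVec_qPart, posVec_pPart, ← qpow_neg]
  simp [mul_comm s]

theorem negVec_bosonField :
    negVec n (bosonField P x s) = (qpow P (s * (n : ℕ)) / qnum P (n : ℕ)) • x := by
  rw [bosonField, map_add, map_add, negVec_modeSum, negVec_qPart, negVec_pPart]
  simp [mul_comm s, qnum_neg, div_neg]

theorem pVec_bosonField : pVec (bosonField P x s) = (s * P.logq) • x := by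
  rw [bosonField, map_add, map_add, pVec_modeSum, pVec_qPart, pVec_pPart, zero_add, zero_add]

theorem qVec_bosonField : qVec (bosonField P x s) = x := by
  rw [bosonField, map_add, map_add, qVec_modeSum, qVec_qPart, qVec_pPart, zero_add, add_zero]

theorem phVec_bosonField : phVec (bosonField P x s) = 0 := by
  rw [bosonField, map_add, map_add, phVec_modeSum, phVec_qPart, phVec_pPart, zero_add, add_zero]

theorem qhVec_bosonField : qhVec (bosonField P x s) = 0 := by
  rw [bosonField, map_add, map_add, qhVec_modeSum, qhVec_qPart, qhVec_pPart, zero_add, add_zero]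

theorem posVec_bosonPM_one :
    posVec n (bosonPM P 1 x s) = ((qpow P 1 - qpow P (-1)) * (qpow P (s * (n : ℕ)))⁻¹) • x := by
  rw [bosonPM, map_add, posVec_modeSum, posVec_pPart, ← qpow_neg]
  simp [mul_comm s, sgn, n.pos]

theorem posVec_bosonPM_neg_one : posVec n (bosonPM P (-1) x s) = 0 := by
  rw [bosonPM, map_add, posVec_modeSum, posVec_pPart]
  simp

theorem negVec_bosonPM_one : negVec n (bosonPM P 1 x s) = 0 := by
  rw [bosonPM, map_add, negVec_modeSum, negVec_pPart]
  simp

theorem negVec_bosonPM_neg_one :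
    negVec n (bosonPM P (-1) x s) = (-((qpow P 1 - qpow P (-1)) * qpow P (s * (n : ℕ)))) • x := by
  rw [bosonPM, map_add, negVec_modeSum, negVec_pPart, add_zero]
  simp only [Units.val_neg, Units.val_one, neg_mul_neg, one_mul, Nat.cast_pos, n.pos, if_true, sgn]
  simp only [mul_comm s, Int.cast_neg, Int.cast_one, Int.cast_natCast, neg_mul, neg_neg, one_mul]

theorem pVec_bosonPM (ε : ℤˣ) : pVec (bosonPM P ε x s) = (sgn ε * P.logq) • x := by
  rw [bosonPM, map_add, pVec_modeSum, pVec_pPart, zero_add]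

theorem qVec_bosonPM (ε : ℤˣ) : qVec (bosonPM P ε x s) = 0 := by
  rw [bosonPM, map_add, qVec_modeSum, qVec_pPart, zero_add]

theorem phVec_bosonPM (ε : ℤˣ) : phVec (bosonPM P ε x s) = 0 := by
  rw [bosonPM, map_add, phVec_modeSum, phVec_pPart, zero_add]

theorem qhVec_bosonPM (ε : ℤˣ) : qhVec (bosonPM P ε x s) = 0 := by
  rw [bosonPM, map_add, qhVec_modeSum, qhVec_pPart, zero_add]

theorem bosonField_zero : bosonField P 0 s = 0 := by
  funext g
  cases g <;> simp [bosonField, modeSum, pPart, qPart]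

theorem bosonPM_zero (ε : ℤˣ) : bosonPM P ε 0 s = 0 := by
  funext g
  cases g <;> simp [bosonPM, modeSum, pPart]

end Modes

/-! ### The exponents of the terms of the currents -/

/-- The exponents of the terms of `e^{+,i}`. -/
def ePlusExpo (P : Params) (ε : ℤˣ) (t : ℂ) (i j : ℕ) (s : ℂ) : Expo P.N :=
  bosonField P (vbc P j i) (s + (j - 1)) +
    (bosonPM P ε (vb P j (i + 1)) (s + (j - 1)) - bosonField P (vbc P j (i + 1)) (s + t)) +
    ∑ l ∈ Finset.Icc 1 (j - 1),
      (bosonPM P 1 (vb P l (i + 1)) (s + (l - 1)) - bosonPM P 1 (vb P l i) (s + l))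

/-- The exponents of the terms with `j ≤ i` of `e^{-,i}`. -/
def eMinusLeftExpo (P : Params) (ε : ℤˣ) (t : ℂ) (i j : ℕ) (s : ℂ) : Expo P.N :=
  bosonField P (vbc P j (i + 1)) (s - (P.k + j)) +
    (-bosonPM P ε (vb P j i) (s - (P.k + j)) - bosonField P (vbc P j i) (s - t)) +
    (midExpo P i j s + tailExpo P (-1) i (i + 1) s)

/-- The exponents of the terms with `j > i` of `e^{-,i}`. -/
def eMinusRightExpo (P : Params) (ε : ℤˣ) (t : ℂ) (i j : ℕ) (s : ℂ) : Expo P.N :=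
  bosonField P (vbc P i j) (s + (P.k + j - 1)) +
    (bosonPM P ε (vb P (i + 1) j) (s + (P.k + j - 1)) - bosonField P (vbc P (i + 1) j) (s + t)) +
    tailExpo P 1 i j s

-- Values of a functional of the given shape on the modes of e^{±,i}.

section Evaluation

theorem qpow_add_mul (P : Params) (x y z : ℂ) : qpow P ((x + y) * z) = qpow P (x * z) * qpow P (y * z) := by
  rw [add_mul, qpow_add]

theorem qpow_sub_mul (P : Params) (x y z : ℂ) : qpow P ((x - y) * z) = qpow P (x * z) / qpow P (y * z) := by
  rw [sub_mul, qpow_sub]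

theorem qpow_neg_mul (P : Params) (x z : ℂ) : qpow P (-x * z) = (qpow P (x * z))⁻¹ := by
  rw [neg_mul, qpow_neg]

theorem qpow_one_mul (P : Params) (z : ℂ) : qpow P (1 * z) = qpow P z := by rw [one_mul]

theorem qpow_two_mul (P : Params) (z : ℂ) : qpow P (2 * z) = qpow P z ^ 2 := by
  rw [two_mul, qpow_add, sq]

theorem qpow_zero_mul (P : Params) (z : ℂ) : qpow P (0 * z) = 1 := by rw [zero_mul, qpow_zero]

theorem sgn_one : sgn 1 = 1 := by simp [sgn]

theorem sgn_neg_one : sgn (-1) = -1 := by simp [sgn]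

variable {P : Params} {n : ℕ+} {f : BVec P.N →ₗ[ℂ] ℂ} {Δ A δ L : ℕ → ℂ}

theorem qnum_natCast_ne_zero (hq : ‖qpow P 1‖ < 1) (n : ℕ+) : qnum P (n : ℕ) ≠ 0 := by
  have := qnum_ne_zero P hq (x := (n : ℕ)) (by exact_mod_cast n.pos.ne')
  simpa using this

/-- Puts the factor q - q⁻¹ of b_±(z) and the factor 1/[n] of (b+c)(z) on a common footing. -/
theorem qDiff_one_eq (hq : ‖qpow P 1‖ < 1) (n : ℕ+) :
    qpow P 1 - qpow P (-1) = (qpow P (n : ℕ) - (qpow P (n : ℕ))⁻¹) / qnum P (n : ℕ) := by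
  have h1 := qpow_one_sub_ne_zero P hq
  have h2 := qnum_natCast_ne_zero hq n
  rw [eq_div_iff h2, qnum, ← qpow_neg]
  field_simp

theorem Shape.smul_sum_left (h : Shape P (qpow P (n : ℕ)) f Δ A δ L) (hq : ‖qpow P 1‖ < 1) {a c i : ℕ}
    (hac : a ≤ c) (hci : c ≤ i) (h1 : 1 ≤ i) (hi : i < P.N) :
    (qpow P 1 - qpow P (-1)) * ∑ l ∈ Finset.Icc (a + 1) c,
        (qpow P (n : ℕ) / qpow P (n : ℕ) ^ l * f (EllipticVO.vb P l (i + 1)) -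
          1 / qpow P (n : ℕ) ^ l * f (EllipticVO.vb P l i)) =
      δ i / (qpow P (n : ℕ) * qnum P (n : ℕ)) * ((1 / qpow P (n : ℕ) ^ a) ^ 2 - (1 / qpow P (n : ℕ) ^ c) ^
          2) +
        (qpow P 1 - qpow P (-1)) *
          (L (i - a) / qpow P (n : ℕ) ^ a - L (i - c) / qpow P (n : ℕ) ^ c) := by
  have hQ := qpow_ne_zero P (n : ℕ)
  have hn := qnum_natCast_ne_zero hq n
  rw [h.sum_left hQ hac hci h1 hi, mul_add, mul_left_comm]
  congr 1
  rw [qDiff_one_eq hq n, div_mul_eq_mul_div, sum_inv_pow_sq hQ hac]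
  field_simp

theorem Shape.smul_sum_right (h : Shape P (qpow P (n : ℕ)) f Δ A δ L) (hq : ‖qpow P 1‖ < 1) {a c i : ℕ}
    (hac : a ≤ c) (hia : i ≤ a) (h1 : 1 ≤ i) (hc : c ≤ P.N) (hi : i < P.N) :
    (qpow P 1 - qpow P (-1)) * ∑ l ∈ Finset.Icc (a + 1) c,
        (1 / qpow P (n : ℕ) ^ l * f (EllipticVO.vb P i l) -
          qpow P (n : ℕ) / qpow P (n : ℕ) ^ l * f (EllipticVO.vb P (i + 1) l)) =
      δ i / (qpow P (n : ℕ) * qnum P (n : ℕ)) * ((1 / qpow P (n : ℕ) ^ a) ^ 2 - (1 / qpow P (n : ℕ) ^ c) ^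
          2) +
        (qpow P 1 - qpow P (-1)) *
          (L (c - i) / qpow P (n : ℕ) ^ c - L (a - i) / qpow P (n : ℕ) ^ a) := by
  have hQ := qpow_ne_zero P (n : ℕ)
  have hn := qnum_natCast_ne_zero hq n
  rw [h.sum_right hQ hac hia h1 hc hi, mul_add, mul_left_comm]
  congr 1
  rw [qDiff_one_eq hq n, div_mul_eq_mul_div, sum_inv_pow_sq hQ hac]
  field_simp

/-- The summation starts at a + 1: terms with j ≤ i use a = i, terms with j > i use a = j - 1. -/
theorem tailExpo_pos_one (h : Shape P (qpow P (n : ℕ)) f Δ A δ L) (hq : ‖qpow P 1‖ < 1) {i a : ℕ}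
    (h1 : 1 ≤ i) (hia : i ≤ a) (ha : a ≤ P.N) (hi : i < P.N) :
    f (posVec n (tailExpo P 1 i (a + 1) 0)) =
      (qpow P 1 - qpow P (-1)) * (A i / qpow P ((P.k + P.N) / 2 * (n : ℕ))) +
      (δ i / (qpow P (n : ℕ) * qnum P (n : ℕ)) * ((1 / qpow P (n : ℕ) ^ a) ^ 2 - (1 / qpow P (n : ℕ) ^ P.N)
          ^ 2) +
        (qpow P 1 - qpow P (-1)) *
          (L (P.N - i) / qpow P (n : ℕ) ^ P.N - L (a - i) / qpow P (n : ℕ) ^ a)) /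
        qpow P (P.k * (n : ℕ)) := by
  rw [← h.smul_sum_right hq ha hia h1 le_rfl hi, tailExpo, map_add, map_add, posVec_bosonPM_one, map_smul,
    h.va i h1 hi, smul_eq_mul, zero_add, sgn_one, one_mul, map_sum, map_sum, Finset.mul_sum,
    Finset.sum_div]
  congr 1
  · ring
  · refine Finset.sum_congr rfl fun l _ => ?_
    simp only [map_sub, posVec_bosonPM_one, map_smul, smul_eq_mul, zero_add, one_mul, qpow_add_mul,
      qpow_sub_mul, qpow_nat_mul]
    have hQ := qpow_ne_zero P (n : ℕ)
    have hK := qpow_ne_zero P (P.k * (n : ℕ))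
    field_simp

theorem tailExpo_neg_neg_one (h : Shape P (qpow P (n : ℕ)) f Δ A δ L) (hq : ‖qpow P 1‖ < 1) {i a : ℕ}
    (h1 : 1 ≤ i) (hia : i ≤ a) (ha : a ≤ P.N) (hi : i < P.N) :
    f (negVec n (tailExpo P (-1) i (a + 1) 0)) = -(
      (qpow P 1 - qpow P (-1)) * (A i / qpow P ((P.k + P.N) / 2 * (n : ℕ))) +
      (δ i / (qpow P (n : ℕ) * qnum P (n : ℕ)) * ((1 / qpow P (n : ℕ) ^ a) ^ 2 - (1 / qpow P (n : ℕ) ^ P.N)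
          ^ 2) +
        (qpow P 1 - qpow P (-1)) *
          (L (P.N - i) / qpow P (n : ℕ) ^ P.N - L (a - i) / qpow P (n : ℕ) ^ a)) /
        qpow P (P.k * (n : ℕ))) := by
  rw [← h.smul_sum_right hq ha hia h1 le_rfl hi, tailExpo, map_add, map_add, negVec_bosonPM_neg_one,
      map_smul,
    h.va i h1 hi, smul_eq_mul, zero_add, sgn_neg_one, neg_one_mul, qpow_neg_mul, map_sum, map_sum,
    Finset.mul_sum, Finset.sum_div, neg_add, ← Finset.sum_neg_distrib]
  congr 1
  · ring
  · refine Finset.sum_congr rfl fun l _ => ?_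
    simp only [map_sub, negVec_bosonPM_neg_one, map_smul, smul_eq_mul, zero_add, neg_one_mul, qpow_add_mul,
      qpow_sub_mul, qpow_nat_mul, qpow_neg_mul, qpow_one_mul]
    have hQ := qpow_ne_zero P (n : ℕ)
    have hK := qpow_ne_zero P (P.k * (n : ℕ))
    field_simp
    ring

theorem tailExpo_pos_neg_one (i m : ℕ) : posVec n (tailExpo P (-1) i m 0) = 0 := by
  simp only [tailExpo, map_add, map_sum, map_sub, posVec_bosonPM_neg_one, sub_zero, Finset.sum_const_zero,
    add_zero]

theorem tailExpo_neg_one (i m : ℕ) : negVec n (tailExpo P 1 i m 0) = 0 := by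
  simp only [tailExpo, map_add, map_sum, map_sub, negVec_bosonPM_one, sub_zero, Finset.sum_const_zero,
    add_zero]

theorem midExpo_pos (i j : ℕ) : posVec n (midExpo P i j 0) = 0 := by
  simp only [midExpo, map_sum, map_sub, posVec_bosonPM_neg_one, sub_zero, Finset.sum_const_zero]

theorem midExpo_neg (h : Shape P (qpow P (n : ℕ)) f Δ A δ L) (hq : ‖qpow P 1‖ < 1) {i j : ℕ}
    (h1 : 1 ≤ j) (hji : j ≤ i) (hi : i < P.N) :
    f (negVec n (midExpo P i j 0)) = -(
      (δ i / (qpow P (n : ℕ) * qnum P (n : ℕ)) * ((1 / qpow P (n : ℕ) ^ j) ^ 2 - (1 / qpow P (n : ℕ) ^ i) ^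
          2) +
        (qpow P 1 - qpow P (-1)) * (L (i - j) / qpow P (n : ℕ) ^ j)) / qpow P (P.k * (n : ℕ))) := by
  -- The sum runs up to l = i, where the boundary value of the telescope is L 0 = 0.
  have h0 : L (i - j) / qpow P (n : ℕ) ^ j =
      L (i - j) / qpow P (n : ℕ) ^ j - L (i - i) / qpow P (n : ℕ) ^ i := by
    rw [Nat.sub_self, h.zero, zero_div, sub_zero]
  rw [h0, ← h.smul_sum_left hq hji le_rfl (h1.trans hji) hi, midExpo, map_sum, map_sum,
    Finset.mul_sum, Finset.sum_div, ← Finset.sum_neg_distrib]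
  refine Finset.sum_congr rfl fun l _ => ?_
  simp only [map_sub, negVec_bosonPM_neg_one, map_smul, smul_eq_mul, zero_sub, qpow_add_mul,
      qpow_sub_mul, qpow_nat_mul, qpow_neg_mul, qpow_one_mul]
  have hQ := qpow_ne_zero P (n : ℕ)
  have hK := qpow_ne_zero P (P.k * (n : ℕ))
  field_simp
  ring

theorem ePlusExpo_pos_sum (h : Shape P (qpow P (n : ℕ)) f Δ A δ L) (hq : ‖qpow P 1‖ < 1) {i j : ℕ}
    (hji : j ≤ i) (h1 : 1 ≤ i) (hi : i < P.N) :
    f (posVec n (∑ l ∈ Finset.Icc 1 j,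
      (bosonPM P 1 (vb P l (i + 1)) (0 + (l - 1)) - bosonPM P 1 (vb P l i) (0 + l)))) =
      δ i / (qpow P (n : ℕ) * qnum P (n : ℕ)) * (1 - (1 / qpow P (n : ℕ) ^ j) ^ 2) +
        (qpow P 1 - qpow P (-1)) * (L i - L (i - j) / qpow P (n : ℕ) ^ j) := by
  have h0 := h.smul_sum_left hq (Nat.zero_le j) hji h1 hi
  rw [pow_zero, div_one, one_pow, div_one, Nat.sub_zero] at h0
  rw [← h0, map_sum, map_sum, Finset.mul_sum]
  refine Finset.sum_congr rfl fun l _ => ?_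
  simp only [map_sub, posVec_bosonPM_one, map_smul, smul_eq_mul, zero_add,
      qpow_sub_mul, qpow_nat_mul, qpow_one_mul]
  have hQ := qpow_ne_zero P (n : ℕ)
  field_simp

theorem ePlusExpo_neg_sum (i j : ℕ) :
    negVec n (∑ l ∈ Finset.Icc 1 j,
      (bosonPM P 1 (vb P l (i + 1)) (0 + (l - 1)) - bosonPM P 1 (vb P l i) (0 + l))) = 0 := by
  simp only [map_sum, map_sub, negVec_bosonPM_one, sub_zero, Finset.sum_const_zero]

/-- The result does not depend on j: the contribution of the j-th factor cancels the lower part of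
the sum over l < j, in δ_i and in L alike. -/
theorem ePlusExpo_pos_one (h : Shape P (qpow P (n : ℕ)) f Δ A δ L) (hq : ‖qpow P 1‖ < 1) {i j : ℕ}
    (hj : 1 ≤ j) (hji : j ≤ i) (hi : i < P.N) :
    f (posVec n (ePlusExpo P 1 j i j 0)) =
      δ i / (qpow P (n : ℕ) * qnum P (n : ℕ)) + (qpow P 1 - qpow P (-1)) * L i := by
  obtain ⟨j, rfl⟩ : ∃ j', j = j' + 1 := ⟨j - 1, by omega⟩
  have hQ := qpow_ne_zero P (n : ℕ)
  have hn := qnum_natCast_ne_zero hq n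
  rw [ePlusExpo, map_add, map_add, map_add, map_add, Nat.add_sub_cancel,
    ePlusExpo_pos_sum h hq (by omega) (by omega) hi]
  simp only [map_sub, map_smul, posVec_bosonPM_one, posVec_bosonField, smul_eq_mul, zero_add,
    qpow_sub_mul, qpow_nat_mul, qpow_one_mul]
  rw [h.vbc (by omega) hji (by omega), h.vbc (by omega) (by omega) (by omega),
    h.vb (j + 1) (i + 1) (by omega) (by omega) (by omega), Nat.add_sub_add_right,
    qDiff_one_eq hq n, ← h.step i (by omega) hi]
  -- With the powers of q replaced by independent variables, the claim is an identity of rational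
  -- functions.
  generalize qpow P (n : ℕ) = Q at *
  generalize qnum P (n : ℕ) = w at *
  field_simp
  ring

theorem ePlusExpo_neg_one (h : Shape P (qpow P (n : ℕ)) f Δ A δ L) (hq : ‖qpow P 1‖ < 1) {i j : ℕ}
    (hj : 1 ≤ j) (hji : j ≤ i) (hi : i < P.N) :
    f (negVec n (ePlusExpo P 1 j i j 0)) = -(δ i / (qpow P (n : ℕ) * qnum P (n : ℕ))) := by
  obtain ⟨j, rfl⟩ : ∃ j', j = j' + 1 := ⟨j - 1, by omega⟩
  have hQ := qpow_ne_zero P (n : ℕ)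
  have hn := qnum_natCast_ne_zero hq n
  rw [ePlusExpo, map_add, map_add, map_add, map_add, Nat.add_sub_cancel, ePlusExpo_neg_sum, map_zero]
  simp only [map_sub, map_smul, map_zero, negVec_bosonPM_one, negVec_bosonField, smul_eq_mul, zero_add,
    qpow_sub_mul, qpow_nat_mul, qpow_one_mul]
  rw [h.vbc (by omega) hji (by omega), h.vbc (by omega) (by omega) (by omega), ← h.step i (by omega) hi]
  generalize qpow P (n : ℕ) = Q at *
  generalize qnum P (n : ℕ) = w at *
  field_simp
  ring

/-- Replacing b_+ by b_- moves one boson from the annihilation to the creation modes. Relative to ε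
= 1 this leaves a multiple of L(i+1-j) in both; with opposite signs of L for the two orders, this is
the pattern of `modeExchange_swap`, displaced by Q^(1-j). -/
theorem ePlusExpo_pos_neg_one (h : Shape P (qpow P (n : ℕ)) f Δ A δ L) (hq : ‖qpow P 1‖ < 1) {i j : ℕ}
    (hj : 1 ≤ j) (hji : j ≤ i) (hi : i < P.N) :
    f (posVec n (ePlusExpo P (-1) (j - 2) i j 0)) =
      δ i / (qpow P (n : ℕ) * qnum P (n : ℕ)) + (qpow P 1 - qpow P (-1)) * L i -
        (qpow P 1 - qpow P (-1)) * L (i + 1 - j) * (qpow P (n : ℕ) / qpow P (n : ℕ) ^ j) := by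
  obtain ⟨j, rfl⟩ : ∃ j', j = j' + 1 := ⟨j - 1, by omega⟩
  have hQ := qpow_ne_zero P (n : ℕ)
  have hn := qnum_natCast_ne_zero hq n
  rw [ePlusExpo, map_add, map_add, map_add, map_add, Nat.add_sub_cancel,
    ePlusExpo_pos_sum h hq (by omega) (by omega) hi]
  simp only [map_sub, map_smul, map_zero, posVec_bosonPM_neg_one, posVec_bosonField, smul_eq_mul, zero_add,
    qpow_sub_mul, qpow_nat_mul, qpow_one_mul, qpow_two_mul]
  rw [h.vbc (by omega) hji (by omega), h.vbc (by omega) (by omega) (by omega),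
    Nat.add_sub_add_right, qDiff_one_eq hq n, ← h.step i (by omega) hi]
  generalize qpow P (n : ℕ) = Q at *
  generalize qnum P (n : ℕ) = w at *
  field_simp
  ring

theorem ePlusExpo_neg_neg_one (h : Shape P (qpow P (n : ℕ)) f Δ A δ L) (hq : ‖qpow P 1‖ < 1) {i j : ℕ}
    (hj : 1 ≤ j) (hji : j ≤ i) (hi : i < P.N) :
    f (negVec n (ePlusExpo P (-1) (j - 2) i j 0)) = -(δ i / (qpow P (n : ℕ) * qnum P (n : ℕ))) -
        (qpow P 1 - qpow P (-1)) * L (i + 1 - j) * (qpow P (n : ℕ) ^ j / qpow P (n : ℕ)) := by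
  obtain ⟨j, rfl⟩ : ∃ j', j = j' + 1 := ⟨j - 1, by omega⟩
  have hQ := qpow_ne_zero P (n : ℕ)
  have hn := qnum_natCast_ne_zero hq n
  rw [ePlusExpo, map_add, map_add, map_add, map_add, Nat.add_sub_cancel, ePlusExpo_neg_sum, map_zero]
  simp only [map_sub, map_smul, negVec_bosonPM_neg_one, negVec_bosonField, smul_eq_mul, zero_add,
    qpow_sub_mul, qpow_nat_mul, qpow_one_mul, qpow_two_mul]
  rw [h.vbc (by omega) hji (by omega), h.vbc (by omega) (by omega) (by omega),
    h.vb (j + 1) (i + 1) (by omega) (by omega) (by omega), Nat.add_sub_add_right,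
    qDiff_one_eq hq n, ← h.step i (by omega) hi]
  generalize qpow P (n : ℕ) = Q at *
  generalize qnum P (n : ℕ) = w at *
  field_simp
  ring

/-- The exponents μ and τ_- contain no annihilation modes, so only the j-th factor counts. The
defect L(i-j) is special to ε = 1. -/
theorem eMinusLeftExpo_pos_one (h : Shape P (qpow P (n : ℕ)) f Δ A δ L) (hq : ‖qpow P 1‖ < 1)
    {i j : ℕ} (hj : 1 ≤ j) (hji : j ≤ i) (hi : i < P.N) :
    f (posVec n (eMinusLeftExpo P 1 (P.k + j + 1) i j 0)) =
      -(qpow P (P.k * (n : ℕ)) * δ i / (qpow P (n : ℕ) * qnum P (n : ℕ))) -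
        (qpow P 1 - qpow P (-1)) * L (i - j) * (qpow P (P.k * (n : ℕ)) * qpow P (n : ℕ) ^ j) := by
  have hQ := qpow_ne_zero P (n : ℕ)
  have hK := qpow_ne_zero P (P.k * (n : ℕ))
  have hT := qpow_ne_zero P ((P.k + P.N) / 2 * (n : ℕ))
  have hn := qnum_natCast_ne_zero hq n
  rw [eMinusLeftExpo, map_add, map_add, map_add, map_add, map_add, midExpo_pos, tailExpo_pos_neg_one]
  simp only [map_sub, map_neg, map_add, map_smul, map_zero, zero_sub, zero_add, posVec_bosonPM_one,
      posVec_bosonField,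
    smul_eq_mul, qpow_add_mul, qpow_neg_mul, qpow_sub_mul, qpow_nat_mul, qpow_one_mul, qpow_two_mul]
  rw [h.vbc hj hji hi.le, h.vbc hj (by omega) (by omega), h.vb j i hj hji hi.le, qDiff_one_eq hq n,
    ← h.step i (by omega) hi]
  generalize qpow P (n : ℕ) = Q at *
  generalize qpow P (P.k * (n : ℕ)) = K at *
  generalize qpow P ((P.k + P.N) / 2 * (n : ℕ)) = T at *
  generalize qnum P (n : ℕ) = w at *
  field_simp
  ring

/-- Here τ_+ carries the annihilation modes, and its lower boundary terms at j cancel against the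
j-th factor. What remains is the upper boundary at N and the boson a^i, both independent of j. -/
theorem eMinusRightExpo_pos_one (h : Shape P (qpow P (n : ℕ)) f Δ A δ L) (hq : ‖qpow P 1‖ < 1)
    {i j : ℕ} (h1 : 1 ≤ i) (hij : i < j) (hj : j ≤ P.N) :
    f (posVec n (eMinusRightExpo P 1 (P.k + j) i j 0)) =
      -(δ i / (qpow P (P.k * (n : ℕ)) * qpow P (n : ℕ) * (qpow P (n : ℕ) ^ P.N) ^ 2 * qnum P (n : ℕ))) +
        (qpow P 1 - qpow P (-1)) * (A i / qpow P ((P.k + P.N) / 2 * (n : ℕ))) +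
        (qpow P 1 - qpow P (-1)) * (L (P.N - i) / (qpow P (P.k * (n : ℕ)) * qpow P (n : ℕ) ^ P.N)) := by
  obtain ⟨j, rfl⟩ : ∃ j', j = j' + 1 := ⟨j - 1, by omega⟩
  have hQ := qpow_ne_zero P (n : ℕ)
  have hK := qpow_ne_zero P (P.k * (n : ℕ))
  have hT := qpow_ne_zero P ((P.k + P.N) / 2 * (n : ℕ))
  have hn := qnum_natCast_ne_zero hq n
  rw [eMinusRightExpo, map_add, map_add, map_add, map_add, tailExpo_pos_one h hq h1 (by omega) (by omega)
      (by omega)]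
  simp only [map_sub, map_neg, map_add, map_smul, map_zero, zero_sub, zero_add, posVec_bosonPM_one,
      posVec_bosonField,
    smul_eq_mul, Nat.cast_add, Nat.cast_one, qpow_add_mul, qpow_neg_mul, qpow_sub_mul, qpow_nat_mul,
        qpow_one_mul, qpow_two_mul]
  rw [h.vbc h1 (by omega) hj, h.vbc (by omega) (by omega) hj, h.vb (i + 1) (j + 1) (by omega) (by omega)
      hj, Nat.add_sub_add_right,
    qDiff_one_eq hq n, ← h.step i h1 (by omega)]
  generalize qpow P (n : ℕ) = Q at *
  generalize qpow P (P.k * (n : ℕ)) = K at *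
  generalize qpow P ((P.k + P.N) / 2 * (n : ℕ)) = T at *
  generalize qnum P (n : ℕ) = w at *
  field_simp
  ring

/-- The sums in μ and τ_- join at l = i, where L 0 = 0, so the geometric sums run from j to N; the
end at j is absorbed by the j-th factor except for L(i-j). -/
theorem eMinusLeftExpo_neg_one (h : Shape P (qpow P (n : ℕ)) f Δ A δ L) (hq : ‖qpow P 1‖ < 1)
    {i j : ℕ} (hj : 1 ≤ j) (hji : j ≤ i) (hi : i < P.N) :
    f (negVec n (eMinusLeftExpo P 1 (P.k + j + 1) i j 0)) =
      δ i / (qpow P (P.k * (n : ℕ)) * qpow P (n : ℕ) * (qpow P (n : ℕ) ^ P.N) ^ 2 * qnum P (n : ℕ)) -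
        (qpow P 1 - qpow P (-1)) * (A i / qpow P ((P.k + P.N) / 2 * (n : ℕ))) -
        (qpow P 1 - qpow P (-1)) * (L (P.N - i) / (qpow P (P.k * (n : ℕ)) * qpow P (n : ℕ) ^ P.N)) -
        (qpow P 1 - qpow P (-1)) * L (i - j) / (qpow P (P.k * (n : ℕ)) * qpow P (n : ℕ) ^ j) := by
  have hQ := qpow_ne_zero P (n : ℕ)
  have hK := qpow_ne_zero P (P.k * (n : ℕ))
  have hT := qpow_ne_zero P ((P.k + P.N) / 2 * (n : ℕ))
  have hn := qnum_natCast_ne_zero hq n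
  rw [eMinusLeftExpo, map_add, map_add, map_add, map_add, map_add, map_add, midExpo_neg h hq hj hji hi,
    tailExpo_neg_neg_one h hq (hj.trans hji) le_rfl hi.le hi, Nat.sub_self, h.zero]
  simp only [map_sub, map_neg, map_add, map_smul, map_zero, zero_sub, zero_add, negVec_bosonPM_one,
      negVec_bosonField,
    smul_eq_mul, qpow_add_mul, qpow_neg_mul, qpow_sub_mul, qpow_nat_mul, qpow_one_mul, qpow_two_mul]
  rw [h.vbc hj hji hi.le, h.vbc hj (by omega) (by omega), qDiff_one_eq hq n,
    ← h.step i (by omega) hi]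
  generalize qpow P (n : ℕ) = Q at *
  generalize qpow P (P.k * (n : ℕ)) = K at *
  generalize qpow P ((P.k + P.N) / 2 * (n : ℕ)) = T at *
  generalize qnum P (n : ℕ) = w at *
  field_simp
  ring

theorem eMinusRightExpo_neg_one (h : Shape P (qpow P (n : ℕ)) f Δ A δ L) (hq : ‖qpow P 1‖ < 1)
    {i j : ℕ} (h1 : 1 ≤ i) (hij : i < j) (hj : j ≤ P.N) :
    f (negVec n (eMinusRightExpo P 1 (P.k + j) i j 0)) =
      qpow P (P.k * (n : ℕ)) * δ i / (qpow P (n : ℕ) * qnum P (n : ℕ)) := by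
  obtain ⟨j, rfl⟩ : ∃ j', j = j' + 1 := ⟨j - 1, by omega⟩
  have hQ := qpow_ne_zero P (n : ℕ)
  have hK := qpow_ne_zero P (P.k * (n : ℕ))
  have hT := qpow_ne_zero P ((P.k + P.N) / 2 * (n : ℕ))
  have hn := qnum_natCast_ne_zero hq n
  rw [eMinusRightExpo, map_add, map_add, map_add, map_add, tailExpo_neg_one]
  simp only [map_sub, map_neg, map_add, map_smul, map_zero, zero_sub, zero_add, negVec_bosonPM_one,
      negVec_bosonField,
    smul_eq_mul, Nat.cast_add, Nat.cast_one, qpow_add_mul, qpow_neg_mul, qpow_sub_mul, qpow_nat_mul,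
        qpow_one_mul, qpow_two_mul]
  rw [h.vbc h1 (by omega) hj, h.vbc (by omega) (by omega) hj,
    ← h.step i h1 (by omega)]
  generalize qpow P (n : ℕ) = Q at *
  generalize qpow P (P.k * (n : ℕ)) = K at *
  generalize qpow P ((P.k + P.N) / 2 * (n : ℕ)) = T at *
  generalize qnum P (n : ℕ) = w at *
  field_simp
  ring

theorem eMinusLeftExpo_pos_neg_one (h : Shape P (qpow P (n : ℕ)) f Δ A δ L) (hq : ‖qpow P 1‖ < 1)
    {i j : ℕ} (hj : 1 ≤ j) (hji : j ≤ i) (hi : i < P.N) :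
    f (posVec n (eMinusLeftExpo P (-1) (P.k + j - 1) i j 0)) =
      -(qpow P (P.k * (n : ℕ)) * δ i / (qpow P (n : ℕ) * qnum P (n : ℕ))) := by
  have hQ := qpow_ne_zero P (n : ℕ)
  have hK := qpow_ne_zero P (P.k * (n : ℕ))
  have hT := qpow_ne_zero P ((P.k + P.N) / 2 * (n : ℕ))
  have hn := qnum_natCast_ne_zero hq n
  rw [eMinusLeftExpo, map_add, map_add, map_add, map_add, map_add, midExpo_pos, tailExpo_pos_neg_one]
  simp only [map_sub, map_neg, map_add, map_smul, map_zero, zero_sub, zero_add, posVec_bosonPM_neg_one,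
      posVec_bosonField,
    smul_eq_mul, qpow_add_mul, qpow_neg_mul, qpow_sub_mul, qpow_nat_mul, qpow_one_mul, qpow_two_mul]
  rw [h.vbc hj hji hi.le, h.vbc hj (by omega) (by omega),
    ← h.step i (by omega) hi]
  generalize qpow P (n : ℕ) = Q at *
  generalize qpow P (P.k * (n : ℕ)) = K at *
  generalize qpow P ((P.k + P.N) / 2 * (n : ℕ)) = T at *
  generalize qnum P (n : ℕ) = w at *
  field_simp
  ring

/-- For j > i it is the terms with ε = -1 that have a defect, a multiple of L(j-i-1). -/
theorem eMinusRightExpo_pos_neg_one (h : Shape P (qpow P (n : ℕ)) f Δ A δ L) (hq : ‖qpow P 1‖ < 1)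
    {i j : ℕ} (h1 : 1 ≤ i) (hij : i < j) (hj : j ≤ P.N) :
    f (posVec n (eMinusRightExpo P (-1) (P.k + j - 2) i j 0)) =
      -(δ i / (qpow P (P.k * (n : ℕ)) * qpow P (n : ℕ) * (qpow P (n : ℕ) ^ P.N) ^ 2 * qnum P (n : ℕ))) +
        (qpow P 1 - qpow P (-1)) * (A i / qpow P ((P.k + P.N) / 2 * (n : ℕ))) +
        (qpow P 1 - qpow P (-1)) * (L (P.N - i) / (qpow P (P.k * (n : ℕ)) * qpow P (n : ℕ) ^ P.N)) -
        (qpow P 1 - qpow P (-1)) * L (j - (i + 1)) * (qpow P (n : ℕ) / (qpow P (P.k * (n : ℕ)) * qpow P (n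
            : ℕ) ^ j)) := by
  obtain ⟨j, rfl⟩ : ∃ j', j = j' + 1 := ⟨j - 1, by omega⟩
  have hQ := qpow_ne_zero P (n : ℕ)
  have hK := qpow_ne_zero P (P.k * (n : ℕ))
  have hT := qpow_ne_zero P ((P.k + P.N) / 2 * (n : ℕ))
  have hn := qnum_natCast_ne_zero hq n
  rw [eMinusRightExpo, map_add, map_add, map_add, map_add, tailExpo_pos_one h hq h1 (by omega) (by omega)
      (by omega)]
  simp only [map_sub, map_neg, map_add, map_smul, map_zero, zero_sub, zero_add, posVec_bosonPM_neg_one,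
      posVec_bosonField,
    smul_eq_mul, Nat.cast_add, Nat.cast_one, qpow_add_mul, qpow_neg_mul, qpow_sub_mul, qpow_nat_mul,
        qpow_one_mul, qpow_two_mul]
  rw [h.vbc h1 (by omega) hj, h.vbc (by omega) (by omega) hj, Nat.add_sub_add_right,
    qDiff_one_eq hq n, ← h.step i h1 (by omega)]
  generalize qpow P (n : ℕ) = Q at *
  generalize qpow P (P.k * (n : ℕ)) = K at *
  generalize qpow P ((P.k + P.N) / 2 * (n : ℕ)) = T at *
  generalize qnum P (n : ℕ) = w at *
  field_simp
  ring

/-- The boson b_-^{j,i} now sits among the creation modes and cancels exactly the defect L(i-j) of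
the case ε = 1. -/
theorem eMinusLeftExpo_neg_neg_one (h : Shape P (qpow P (n : ℕ)) f Δ A δ L) (hq : ‖qpow P 1‖ < 1)
    {i j : ℕ} (hj : 1 ≤ j) (hji : j ≤ i) (hi : i < P.N) :
    f (negVec n (eMinusLeftExpo P (-1) (P.k + j - 1) i j 0)) =
      δ i / (qpow P (P.k * (n : ℕ)) * qpow P (n : ℕ) * (qpow P (n : ℕ) ^ P.N) ^ 2 * qnum P (n : ℕ)) -
        (qpow P 1 - qpow P (-1)) * (A i / qpow P ((P.k + P.N) / 2 * (n : ℕ))) -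
        (qpow P 1 - qpow P (-1)) * (L (P.N - i) / (qpow P (P.k * (n : ℕ)) * qpow P (n : ℕ) ^ P.N)) := by
  have hQ := qpow_ne_zero P (n : ℕ)
  have hK := qpow_ne_zero P (P.k * (n : ℕ))
  have hT := qpow_ne_zero P ((P.k + P.N) / 2 * (n : ℕ))
  have hn := qnum_natCast_ne_zero hq n
  rw [eMinusLeftExpo, map_add, map_add, map_add, map_add, map_add, map_add, midExpo_neg h hq hj hji hi,
    tailExpo_neg_neg_one h hq (hj.trans hji) le_rfl hi.le hi, Nat.sub_self, h.zero]
  simp only [map_sub, map_neg, map_add, map_smul, map_zero, zero_sub, zero_add, negVec_bosonPM_neg_one,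
      negVec_bosonField,
    smul_eq_mul, qpow_add_mul, qpow_neg_mul, qpow_sub_mul, qpow_nat_mul, qpow_one_mul, qpow_two_mul]
  rw [h.vbc hj hji hi.le, h.vbc hj (by omega) (by omega), h.vb j i hj hji hi.le, qDiff_one_eq hq n,
    ← h.step i (by omega) hi]
  generalize qpow P (n : ℕ) = Q at *
  generalize qpow P (P.k * (n : ℕ)) = K at *
  generalize qpow P ((P.k + P.N) / 2 * (n : ℕ)) = T at *
  generalize qnum P (n : ℕ) = w at *
  field_simp
  ring

theorem eMinusRightExpo_neg_neg_one (h : Shape P (qpow P (n : ℕ)) f Δ A δ L) (hq : ‖qpow P 1‖ < 1)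
    {i j : ℕ} (h1 : 1 ≤ i) (hij : i < j) (hj : j ≤ P.N) :
    f (negVec n (eMinusRightExpo P (-1) (P.k + j - 2) i j 0)) =
      qpow P (P.k * (n : ℕ)) * δ i / (qpow P (n : ℕ) * qnum P (n : ℕ)) -
        (qpow P 1 - qpow P (-1)) * L (j - (i + 1)) * (qpow P (P.k * (n : ℕ)) * qpow P (n : ℕ) ^ j / qpow P
            (n : ℕ)) := by
  obtain ⟨j, rfl⟩ : ∃ j', j = j' + 1 := ⟨j - 1, by omega⟩
  have hQ := qpow_ne_zero P (n : ℕ)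
  have hK := qpow_ne_zero P (P.k * (n : ℕ))
  have hT := qpow_ne_zero P ((P.k + P.N) / 2 * (n : ℕ))
  have hn := qnum_natCast_ne_zero hq n
  rw [eMinusRightExpo, map_add, map_add, map_add, map_add, tailExpo_neg_one]
  simp only [map_sub, map_neg, map_add, map_smul, map_zero, zero_sub, zero_add, negVec_bosonPM_neg_one,
      negVec_bosonField,
    smul_eq_mul, Nat.cast_add, Nat.cast_one, qpow_add_mul, qpow_neg_mul, qpow_sub_mul, qpow_nat_mul,
        qpow_one_mul, qpow_two_mul]
  rw [h.vbc h1 (by omega) hj, h.vbc (by omega) (by omega) hj, h.vb (i + 1) (j + 1) (by omega) (by omega)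
      hj, Nat.add_sub_add_right,
    qDiff_one_eq hq n, ← h.step i h1 (by omega)]
  generalize qpow P (n : ℕ) = Q at *
  generalize qpow P (P.k * (n : ℕ)) = K at *
  generalize qpow P ((P.k + P.N) / 2 * (n : ℕ)) = T at *
  generalize qnum P (n : ℕ) = w at *
  field_simp
  ring

end Evaluation

/-! ### The inverse of the Cartan matrix -/

/-- The Cartan matrix of `sl_N` with its diagonal entries replaced by `c`. -/
def cartanWith (c : ℂ) (i j : ℕ) : ℂ := if i = j then c else if i = j + 1 ∨ j = i + 1 then -1 else 0

theorem cartan_eq (i j : ℕ) : cartan i j = cartanWith 2 i j := rfl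

/-- The identity [2n] = [n](Q + Q⁻¹) makes the bracket matrix [n] times a tridiagonal matrix with
constant diagonal. -/
theorem qnum_cartan (P : Params) (n : ℕ+) (i j : ℕ) :
    qnum P (cartan i j * (n : ℕ)) =
      qnum P (n : ℕ) * cartanWith (qpow P (n : ℕ) + (qpow P (n : ℕ))⁻¹) i j := by
  have hQ := qpow_ne_zero P (n : ℕ)
  unfold cartan cartanWith
  split_ifs
  · rw [qnum, qnum, ← neg_mul, qpow_neg_mul, qpow_two_mul, qpow_neg, qpow_neg]
    field_simp
    ring
  · rw [neg_one_mul, qnum_neg, mul_neg_one]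
  · rw [zero_mul, mul_zero, qnum]
    simp

/-- The boundary conditions F 0 = F N = 0 make the rows i = 1 and i = N - 1 look like all others. -/
theorem sum_cartanWith_mul {N i : ℕ} (c : ℂ) (F : ℕ → ℂ) (h0 : F 0 = 0) (hN : F N = 0) (hi : 1 ≤ i)
    (hiN : i < N) :
    ∑ j ∈ Finset.Ico 1 N, cartanWith c i j * F j = c * F i - F (i - 1) - F (i + 1) := by
  obtain ⟨i, rfl⟩ : ∃ i', i = i' + 1 := ⟨i - 1, by omega⟩
  have h1 : ∑ j ∈ Finset.Ico 1 N, cartanWith c (i + 1) j * F j =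
      ∑ j ∈ Finset.range (N + 1), cartanWith c (i + 1) j * F j := by
    rw [Finset.sum_range_succ, hN, mul_zero, add_zero, Finset.range_eq_Ico]
    exact (by rw [Finset.sum_eq_sum_Ico_succ_bot (by omega), h0, mul_zero, zero_add] :
      ∑ j ∈ Finset.Ico 0 N, cartanWith c (i + 1) j * F j = _).symm
  have h2 : ∀ j, cartanWith c (i + 1) j * F j = (if i + 1 = j then c * F j else 0) -
      (if i = j then F j else 0) - (if i + 2 = j then F j else 0) := by
    intro j
    unfold cartanWith
    split_ifs <;> first | omega | ring
  rw [h1, Finset.sum_congr rfl fun j _ => h2 j, Finset.sum_sub_distrib, Finset.sum_sub_distrib,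
    Finset.sum_ite_eq, Finset.sum_ite_eq, Finset.sum_ite_eq, if_pos (Finset.mem_range.2 (by omega)),
    if_pos (Finset.mem_range.2 (by omega)), if_pos (Finset.mem_range.2 (by omega)), Nat.add_sub_cancel]

/-- The Casoratian of two solutions of the recurrence is constant; shifting indices along it gives
this addition formula. -/
theorem casoratian {a : ℕ → ℂ} {c : ℂ} (h0 : a 0 = 0) (ha : ∀ m, a (m + 2) = c * a (m + 1) - a m)
    (l M : ℕ) : a (l + 1) * a (M + 1) - a l * a M = a 1 * a (l + M + 1) := by
  induction l generalizing M with
  | zero => simp only [h0, zero_add]; ring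
  | succ l ih =>
    rw [show l + 1 + M + 1 = l + (M + 1) + 1 by ring, ← ih, ha, ha]
    ring

/-- The kernel is the Green's function of the second order difference operator: off the diagonal it
is a solution vanishing at 0 or at N, hence annihilated, and on the diagonal the Casoratian appears.
It is used for a_m = [mn] with c = Q + Q⁻¹, and for a_m = m with c = 2. -/
theorem sum_cartanWith_min_max {a : ℕ → ℂ} {c : ℂ} (h0 : a 0 = 0)
    (ha : ∀ m, a (m + 2) = c * a (m + 1) - a m) {N l i : ℕ} (hl : 1 ≤ l) (hlN : l < N) (hi : 1 ≤ i)
    (hiN : i < N) :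
    ∑ j ∈ Finset.Ico 1 N, cartanWith c i j * (a (min l j) * a (N - max l j)) =
      if l = i then a 1 * a N else 0 := by
  rw [sum_cartanWith_mul c (fun j => a (min l j) * a (N - max l j)) (by simp [h0])
    (by simp [h0, max_eq_right hlN.le]) hi hiN]
  obtain ⟨i, rfl⟩ : ∃ i', i = i' + 1 := ⟨i - 1, by omega⟩
  obtain ⟨M, rfl⟩ : ∃ M, N = i + 2 + M := ⟨N - (i + 2), by omega⟩
  simp only [Nat.add_sub_cancel]
  rcases lt_trichotomy l (i + 1) with h | h | h
  · rw [if_neg h.ne, min_eq_left h.le, min_eq_left (by omega), min_eq_left (by omega), max_eq_right h.le,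
      max_eq_right (by omega), max_eq_right (by omega), show i + 2 + M - (i + 1) = M + 1 by omega,
      show i + 2 + M - i = M + 2 by omega, show i + 2 + M - (i + 1 + 1) = M by omega, ha]
    ring
  · subst h
    rw [if_pos rfl, min_self, max_self, min_eq_right (by omega), max_eq_left (by omega),
      min_eq_left (by omega), max_eq_right (by omega), show i + 2 + M - (i + 1) = M + 1 by omega,
      show i + 2 + M - (i + 1 + 1) = M by omega, show i + 2 + M = (i + 1) + M + 1 by ring,
      ← casoratian h0 ha, ha]
    ring
  · rw [if_neg h.ne', min_eq_right h.le, min_eq_right (by omega), min_eq_right (by omega), max_eq_left h.le,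
      max_eq_left (by omega), max_eq_left (by omega), ha]
    ring

theorem sum_qnum_cartan (P : Params) (n : ℕ+) {l i : ℕ} (hl : 1 ≤ l)
    (hlN : l < P.N) (hi : 1 ≤ i) (hiN : i < P.N) :
    ∑ j ∈ Finset.Ico 1 P.N, cartanWith (qpow P (n : ℕ) + (qpow P (n : ℕ))⁻¹) i j *
      (qnum P ((min l j : ℕ) * (n : ℕ)) * qnum P ((P.N - (max l j : ℕ)) * (n : ℕ))) =
      if l = i then qnum P (n : ℕ) * qnum P (P.N * (n : ℕ)) else 0 := by
  have hQ := qpow_ne_zero P (n : ℕ)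
  have h := sum_cartanWith_min_max (a := fun m => qnum P ((m : ℕ) * (n : ℕ)))
    (c := qpow P (n : ℕ) + (qpow P (n : ℕ))⁻¹) (by simp [qnum]) (fun m => by
      simp only [qnum, ← neg_mul, qpow_neg_mul, qpow_nat_mul]
      field_simp
      ring) hl hlN hi hiN
  simp only [Nat.cast_one, one_mul] at h
  rw [← h]
  refine Finset.sum_congr rfl fun j hj => ?_
  rw [Finset.mem_Ico] at hj
  rw [Nat.cast_sub (max_le hlN.le hj.2.le)]

theorem sum_cartan_min_max {N l i : ℕ} (hl : 1 ≤ l) (hlN : l < N) (hi : 1 ≤ i) (hiN : i < N) :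
    ∑ j ∈ Finset.Ico 1 N, cartan i j * ((min l j : ℕ) * (N - (max l j : ℕ))) =
      if l = i then (N : ℂ) else 0 := by
  have h := sum_cartanWith_min_max (a := fun m => (m : ℂ)) (c := 2) (by simp)
    (fun m => by push_cast; ring) hl hlN hi hiN
  simp only [Nat.cast_one, one_mul] at h
  rw [← h]
  refine Finset.sum_congr rfl fun j hj => ?_
  rw [Finset.mem_Ico] at hj
  rw [Nat.cast_sub (max_le hlN.le hj.2.le), cartan_eq]

/-! ### Shapes of the functionals defined by the bosonic combinations -/

/-- The combinations of the bosons in the total currents. -/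
def hGen (P : Params) (Q h c : ℂ) (j : ℕ) : BVec P.N :=
  (∑ l ∈ Finset.Icc 1 j, ((Q / (h * Q ^ l)) • vb P l (j + 1) - (1 / (h * Q ^ l)) • vb P l j)) +
    c • va P j +
    ∑ l ∈ Finset.Icc (j + 1) P.N, ((1 / (h * Q ^ l)) • vb P j l - (Q / (h * Q ^ l)) • vb P (j + 1) l)

/-- The membership is required only under `p`, since otherwise both sides vanish; this permits index
pairs out of the summation range. -/
theorem sum_mul_ite_and {s : Finset ℕ} (x : ℕ → ℂ) {w : ℂ} {l : ℕ} {p : Prop} [Decidable p]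
    (hl : p → l ∈ s) :
    ∑ m ∈ s, x m * (if m = l ∧ p then w else 0) = if p then x l * w else 0 := by
  by_cases hp : p
  · simp [hp, hl hp]
  · simp [hp]

namespace BosonForm

variable {P : Params} {B : BVec P.N →ₗ[ℂ] BVec P.N →ₗ[ℂ] ℂ} {M : ℕ → ℕ → ℂ} {w : ℂ}

theorem shape_va (hB : BosonForm P B M w) (Q : ℂ) {j : ℕ} (hj : 1 ≤ j) (hjN : j < P.N) :
    Shape P Q (B (va P j)) 0 (M j) 0 0 where
  zero := rfl
  step i h1 h2 := by simp
  va i h1 h2 := hB.aa j i hj hjN h1 h2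
  vb l m h1 h2 h3 := by simp [hB.ab j l m hj hjN]
  vc l m h1 h2 h3 := by simp [hB.ac j l m hj hjN]

/-- The vector pairs nontrivially only with the b^{lm} that have j or j + 1 among their indices, so
Δ is supported at j and j + 1. Then QΔ_{i+1} - Δ_i is a multiple of a column of the q-Cartan matrix.
-/
theorem shape_hGen (hB : BosonForm P B M w) {Q : ℂ} (hQ : Q ≠ 0) {h : ℂ} (hh : h ≠ 0) (c : ℂ) {j : ℕ} (hj :
    1 ≤ j)
    (hjN : j < P.N) :
    Shape P Q (B (hGen P Q h c j))
      (fun m => -(w / h) * ((if m = j + 1 then Q else 0) - if m = j then 1 else 0))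
      (fun i => c * M j i) (fun i => -(w / h) * (Q * cartanWith (Q + Q⁻¹) i j)) 0 where
  zero := rfl
  step i h1 h2 := by
    unfold cartanWith
    split_ifs <;> first | omega | (field_simp; try ring)
  va i h1 h2 := by
    have hb : ∀ l m, B (EllipticVO.vb P l m) (EllipticVO.va P i) = 0 := fun l m => by
      rw [hB.symm, hB.ab i l m h1 h2]
    simp only [hGen, map_add, map_sum, map_sub, map_smul, LinearMap.add_apply, LinearMap.sum_apply,
      LinearMap.sub_apply, LinearMap.smul_apply, hb, smul_eq_mul, mul_zero, sub_zero, Finset.sum_const_zero,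
      hB.aa j i hj hjN h1 h2, zero_add, add_zero]
  vc l m h1 h2 h3 := by
    simp only [hGen, map_add, map_sum, map_sub, map_smul, LinearMap.add_apply, LinearMap.sum_apply,
      LinearMap.sub_apply, LinearMap.smul_apply, hB.bc, smul_zero, sub_zero, Finset.sum_const_zero,
      hB.ac j l m hj hjN, zero_add, Pi.zero_apply, neg_zero]
  vb l m h1 h2 h3 := by
    rcases h2.eq_or_lt with rfl | h2
    · rw [vb_self, map_zero, Nat.sub_self, Pi.zero_apply]; ring
    simp only [hGen, map_add, map_sum, map_sub, map_smul, LinearMap.add_apply, LinearMap.sum_apply,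
      LinearMap.sub_apply, LinearMap.smul_apply, hB.ab j l m hj hjN, smul_eq_mul, mul_zero, add_zero,
      hB.bb l m _ _ h1 h2 h3, Prod.mk.injEq, Finset.sum_sub_distrib]
    -- By orthogonality at most one summand of each sum survives.
    rw [sum_mul_ite_and _ fun hm => Finset.mem_Icc.2 ⟨h1, by omega⟩,
      sum_mul_ite_and _ fun hm => Finset.mem_Icc.2 ⟨h1, by omega⟩]
    simp only [and_comm (a := j = l), and_comm (a := j + 1 = l)]
    rw [sum_mul_ite_and _ fun hm => Finset.mem_Icc.2 ⟨by omega, h3⟩,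
      sum_mul_ite_and _ fun hm => Finset.mem_Icc.2 ⟨by omega, h3⟩]
    simp only [eq_comm (a := j), eq_comm (a := j + 1), Pi.zero_apply]
    split_ifs <;> first | omega | (field_simp; try ring)

/-- The b and c bosons have opposite square lengths, so pairing with b + c gives opposite values on
b^{lm} and c^{lm}: a pure shift L. The value at m = 0 is set to zero because b^{ll} = c^{ll} = 0
whatever `c 0` is. -/
theorem shape_vbc (hB : BosonForm P B M w) (Q : ℂ) (c : ℕ → ℂ) :
    Shape P Q (∑ l ∈ Finset.Ico 1 P.N, ∑ m ∈ Finset.Icc (l + 1) P.N, c (m - l) • B (EllipticVO.vbc P l m))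
        0 0 0
      (fun m => if m = 0 then 0 else -(w * c m)) where
  zero := by simp
  step i h1 h2 := by simp
  va i h1 h2 := by
    simp only [EllipticVO.vbc, map_add, LinearMap.sum_apply, LinearMap.smul_apply, LinearMap.add_apply]
    simp only [hB.symm _ (EllipticVO.va P i), hB.ab i _ _ h1 h2, hB.ac i _ _ h1 h2, add_zero, smul_zero,
      Finset.sum_const_zero, Pi.zero_apply]
  vb l m h1 h2 h3 := by
    rcases h2.eq_or_lt with rfl | h2
    · simp [vb_self]
    simp only [EllipticVO.vbc, map_add, LinearMap.sum_apply, LinearMap.smul_apply, LinearMap.add_apply,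
      hB.bb l m _ _ h1 h2 h3, hB.symm (vc P _ _) (EllipticVO.vb P l m), hB.bc, add_zero, smul_eq_mul,
          Prod.mk.injEq,
      Pi.zero_apply, zero_div, sub_self, zero_add]
    rw [if_neg (by omega), Finset.sum_eq_single l]
    · simp only [true_and, mul_ite, mul_zero, Finset.sum_ite_eq']
      rw [if_pos (Finset.mem_Icc.2 ⟨h2, h3⟩)]
      ring
    · intro b _ hb
      exact Finset.sum_eq_zero fun x _ => by rw [if_neg (by simp [hb]), mul_zero]
    · intro hl
      exact absurd (Finset.mem_Ico.2 ⟨h1, by omega⟩) hl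
  vc l m h1 h2 h3 := by
    rcases h2.eq_or_lt with rfl | h2
    · simp [vc_self]
    simp only [EllipticVO.vbc, map_add, LinearMap.sum_apply, LinearMap.smul_apply, LinearMap.add_apply,
      hB.cc l m _ _ h1 h2 h3, hB.bc, zero_add, smul_eq_mul, Prod.mk.injEq]
    rw [if_neg (by omega), Finset.sum_eq_single l]
    · simp only [true_and, mul_ite, mul_zero, Finset.sum_ite_eq']
      rw [if_pos (Finset.mem_Icc.2 ⟨h2, h3⟩)]
      ring
    · intro b _ hb
      exact Finset.sum_eq_zero fun x _ => by rw [if_neg (by simp [hb]), mul_zero]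
    · intro hl
      exact absurd (Finset.mem_Ico.2 ⟨h1, by omega⟩) hl

end BosonForm

/-! ### The functionals defined by the vertex operators -/

/-- The left sum over l ≤ i and the right sum over l > i join to one geometric sum over 1, ..., N;
of the telescoping shifts only the outer boundary terms remain. -/
theorem Shape.hGen_eq {P : Params} {Q : ℂ} {f : BVec P.N →ₗ[ℂ] ℂ} {Δ A δ L : ℕ → ℂ}
    (hf : Shape P Q f Δ A δ L) (hQ : Q ≠ 0) {h : ℂ} (hh : h ≠ 0) (c : ℂ) {i : ℕ} (h1 : 1 ≤ i)
    (hi : i < P.N) :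
    f (hGen P Q h c i) = (δ i * (∑ l ∈ Finset.Icc 1 P.N, (1 / Q ^ l) ^ 2) +
      (L i + L (P.N - i) / Q ^ P.N)) / h + c * A i := by
  have e1 := hf.sum_left hQ (Nat.zero_le i) le_rfl h1 hi
  have e2 := hf.sum_right hQ hi.le le_rfl h1 le_rfl hi
  rw [Nat.sub_self, hf.zero, zero_div, sub_zero, zero_add, Nat.sub_zero, pow_zero, div_one] at e1
  rw [Nat.sub_self, hf.zero, zero_div, sub_zero] at e2
  have e3 : ∑ l ∈ Finset.Icc 1 P.N, (1 / Q ^ l) ^ 2 =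
      ∑ l ∈ Finset.Icc 1 i, (1 / Q ^ l) ^ 2 + ∑ l ∈ Finset.Icc (i + 1) P.N, (1 / Q ^ l) ^ 2 := by
    have h0 : ∀ a b : ℕ, Finset.Icc (a + 1) b = Finset.Ioc a b := fun a b => by
      ext x
      simp only [Finset.mem_Icc, Finset.mem_Ioc]
      omega
    rw [← zero_add 1, h0, h0, zero_add, h0, Finset.sum_Ioc_consecutive _ (Nat.zero_le i) hi.le]
  rw [e3, mul_add, add_add_add_comm, ← e1, ← e2, hGen, map_add, map_add, map_sum, map_sum, map_smul,
    hf.va i h1 hi, add_div, Finset.sum_div, Finset.sum_div, add_right_comm, smul_eq_mul]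
  congr 1
  congr 1 <;>
  · refine Finset.sum_congr rfl fun l _ => ?_
    simp only [map_sub, map_smul, smul_eq_mul]
    field_simp

-- The modes of the total currents as instances of one family of vectors; parity of the dual modes.

section Vec

variable (P : Params)

theorem aDual_neg (i : ℕ) (n : ℤ) : aDual P i (-n) = -aDual P i n := by
  rw [aDual, aDual, ← Finset.sum_neg_distrib]
  refine Finset.sum_congr rfl fun j _ => ?_
  rw [← neg_smul]
  congr 1
  push_cast
  simp only [mul_neg, qnum_neg]
  ring

theorem hMode_neg (i : ℕ) (n : ℤ) : hMode P i (-n) = hMode P i n := by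
  simp only [hMode, abs_neg]

theorem hDual_neg (i : ℕ) (n : ℤ) : hDual P i (-n) = -hDual P i n := by
  rw [hDual, hDual, ← Finset.sum_neg_distrib]
  refine Finset.sum_congr rfl fun j _ => ?_
  rw [← neg_smul, hMode_neg]
  congr 1
  push_cast
  simp only [mul_neg, qnum_neg]
  ring

theorem hMode_eq (i : ℕ) (n : ℕ+) : hMode P i ((n : ℕ) : ℤ) =
    hGen P (qpow P (n : ℕ)) (qpow P (P.k / 2 * (n : ℕ))) (qpow P (P.N / 2 * (n : ℕ)))⁻¹ i := by
  have hh := qpow_ne_zero P (P.k / 2 * (n : ℕ))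
  have hQ := qpow_ne_zero P (n : ℕ)
  rw [hMode, hGen]
  simp only [Nat.abs_cast, Int.cast_natCast, qpow_neg, qpow_add_mul, qpow_sub_mul, qpow_one_mul,
      qpow_nat_mul,
    one_div, inv_div]

theorem dVec_eq (i : ℕ) (n : ℕ+) : dVec P i (n : ℕ) =
    hGen P (qpow P (n : ℕ)) (qpow P (P.k * (n : ℕ))) (qpow P ((P.k + P.N) / 2 * (n : ℕ)))⁻¹ i := by
  rw [dVec, hGen]
  simp only [qpow_neg, qpow_add_mul, qpow_sub_mul, qpow_one_mul, qpow_nat_mul, one_div, inv_div]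

/-- The zero mode combination h_i is the member of the family with all powers of q equal to 1, so
the zero modes need no separate computation. -/
theorem hVec_eq (i : ℕ) : hVec P i = hGen P 1 1 1 i := by
  rw [hVec, hGen]
  simp

end Vec

-- Shapes of the pairings with the dual modes ǎ and Ȟ.

section Data

variable {P : Params}

theorem qnum_mul_ne_zero (hq : ‖qpow P 1‖ < 1) {x : ℝ} (hx : x ≠ 0) (n : ℕ+) :
    qnum P (x * (n : ℕ)) ≠ 0 := by
  have := qnum_ne_zero P hq (x := x * (n : ℕ)) (mul_ne_zero hx (by exact_mod_cast n.pos.ne'))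
  push_cast at this
  exact this

/-- The coefficients of ǎ^l form the l-th row of the inverse of the bracket matrix of the a bosons.
-/
theorem shape_aDual (hq : ‖qpow P 1‖ < 1) (hkh : P.k + P.N ≠ 0) (n : ℕ+) {l : ℕ} (hl : 1 ≤ l)
    (hlN : l < P.N) :
    Shape P (qpow P (n : ℕ)) (modePairing P n (aDual P l ((n : ℕ) : ℤ))) 0
      (fun i => if l = i then 1 else 0) 0 0 := by
  have hn := qnum_natCast_ne_zero hq n
  have hN := qnum_mul_ne_zero hq (x := P.N) (by simp; omega) n
  have hkN := qnum_mul_ne_zero hq hkh n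
  have hn0 : ((n : ℕ) : ℂ) ≠ 0 := by exact_mod_cast n.pos.ne'
  push_cast at hN hkN
  have h := Shape.sum (Finset.Ico 1 P.N) (fun j hj =>
    ((bosonForm_modePairing P n).shape_va (qpow P (n : ℕ)) (Finset.mem_Ico.1 hj).1
      (Finset.mem_Ico.1 hj).2).smul ((((n : ℕ) : ℤ) : ℂ) * (qnum P ((min l j : ℕ) * (((n : ℕ) : ℤ) : ℂ)) *
          qnum P ((P.N - (max l j : ℕ)) * (((n : ℕ) : ℤ) : ℂ))) /
      (qnum P ((P.k + P.N) * (((n : ℕ) : ℤ) : ℂ)) * qnum P (P.N * (((n : ℕ) : ℤ) : ℂ)) * qnum P (((n : ℕ) :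
          ℤ) : ℂ) ^ 2)))
  simp only [smul_zero, Finset.sum_const_zero] at h
  refine h.congr ?_ ?_ (fun _ _ _ => rfl) rfl fun _ _ => rfl
  · simp only [aDual, map_sum, map_smul]
  · intro i h1 h2
    rw [← one_mul (if l = i then (1 : ℂ) else 0), Finset.sum_apply]
    have hs := sum_qnum_cartan P n hl hlN h1 h2
    -- Normalised by [n][Nn], the Kronecker delta can be replaced by the inverse matrix identity and
    -- compared term by term.
    rw [show (1 : ℂ) * (if l = i then (1 : ℂ) else 0) = (if l = i then qnum P (n : ℕ) * qnum P (P.N * (n :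
        ℕ)) else 0) /
      (qnum P (n : ℕ) * qnum P (P.N * (n : ℕ))) by
        generalize qnum P (P.N * (n : ℕ)) = y at hN ⊢
        split_ifs
        · field_simp
        · ring, ← hs, Finset.sum_div]
    refine Finset.sum_congr rfl fun j _ => ?_
    simp only [Pi.smul_apply, smul_eq_mul, Int.cast_natCast]
    rw [cartan_comm, qnum_cartan]
    generalize qnum P (P.N * (n : ℕ)) = y at hN ⊢
    generalize qnum P ((P.k + P.N) * (n : ℕ)) = x at hkN ⊢
    field_simp

/-- Both the a-part and the b-part of H_j contribute a column of the q-Cartan matrix, to A and to δ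
respectively; the same inverse diagonalises both. The function Δ itself never enters the values on
the currents, so it stays existential. -/
theorem shape_hDual (hq : ‖qpow P 1‖ < 1) (hk : P.k ≠ 0) (n : ℕ+) {l : ℕ} (hl : 1 ≤ l)
    (hlN : l < P.N) : ∃ Δ,
    Shape P (qpow P (n : ℕ)) (modePairing P n (hDual P l ((n : ℕ) : ℤ))) Δ
      (fun i => if l = i then qnum P ((P.k + P.N) * (n : ℕ)) / qnum P (P.k * (n : ℕ)) / qpow P (P.N / 2 *
          (n : ℕ)) else 0)
      (fun i => if l = i then -(qnum P (n : ℕ) / qnum P (P.k * (n : ℕ)) * (qpow P (n : ℕ) / qpow P (P.k / 2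
          * (n : ℕ)))) else 0) 0 := by
  have hn := qnum_natCast_ne_zero hq n
  have hN := qnum_mul_ne_zero hq (x := P.N) (by simp; omega) n
  have hk := qnum_mul_ne_zero hq hk n
  have hn0 : ((n : ℕ) : ℂ) ≠ 0 := by exact_mod_cast n.pos.ne'
  have hQ := qpow_ne_zero P (n : ℕ)
  have hh := qpow_ne_zero P (P.k / 2 * (n : ℕ))
  have hS := qpow_ne_zero P (P.N / 2 * (n : ℕ))
  push_cast at hN
  have h := Shape.sum (Finset.Ico 1 P.N) (fun j hj =>
    ((bosonForm_modePairing P n).shape_hGen hQ hh (qpow P (P.N / 2 * (n : ℕ)))⁻¹ (Finset.mem_Ico.1 hj).1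
      (Finset.mem_Ico.1 hj).2).smul ((((n : ℕ) : ℤ) : ℂ) * (qnum P ((min l j : ℕ) * (((n : ℕ) : ℤ) : ℂ)) *
          qnum P ((P.N - (max l j : ℕ)) * (((n : ℕ) : ℤ) : ℂ))) /
      (qnum P (P.k * (((n : ℕ) : ℤ) : ℂ)) * qnum P (P.N * (((n : ℕ) : ℤ) : ℂ)) * qnum P (((n : ℕ) : ℤ) : ℂ)
          ^ 2)))
  simp only [smul_zero, Finset.sum_const_zero] at h
  refine ⟨_, h.congr ?_ ?_ ?_ rfl fun _ _ => rfl⟩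
  · simp only [hDual, map_sum, map_smul, hMode_eq]
  · intro i h1 h2
    rw [Finset.sum_apply]
    have hs := sum_qnum_cartan P n hl hlN h1 h2
    rw [show (if l = i then qnum P ((P.k + P.N) * (n : ℕ)) / qnum P (P.k * (n : ℕ)) / qpow P (P.N / 2 * (n
        : ℕ)) else 0) = (if l = i then qnum P (n : ℕ) * qnum P (P.N * (n : ℕ)) else 0) *
      (qnum P ((P.k + P.N) * (n : ℕ)) / qnum P (P.k * (n : ℕ)) / qpow P (P.N / 2 * (n : ℕ)) / (qnum P (n :
          ℕ) * qnum P (P.N * (n : ℕ)))) by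
        generalize qnum P (P.N * (n : ℕ)) = y at hN ⊢
        split_ifs
        · field_simp
        · ring, ← hs, Finset.sum_mul]
    refine Finset.sum_congr rfl fun j _ => ?_
    simp only [Pi.smul_apply, smul_eq_mul, Int.cast_natCast]
    rw [cartan_comm, qnum_cartan]
    generalize qnum P (P.N * (n : ℕ)) = y at hN ⊢
    generalize qnum P (P.k * (n : ℕ)) = z at hk ⊢
    generalize qpow P (P.k / 2 * (n : ℕ)) = h at hh ⊢
    generalize qpow P (P.N / 2 * (n : ℕ)) = S at hS ⊢
    field_simp
  · intro i h1 h2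
    rw [Finset.sum_apply]
    have hs := sum_qnum_cartan P n hl hlN h1 h2
    rw [show (if l = i then -(qnum P (n : ℕ) / qnum P (P.k * (n : ℕ)) * (qpow P (n : ℕ) / qpow P (P.k / 2 *
        (n : ℕ)))) else 0) = (if l = i then qnum P (n : ℕ) * qnum P (P.N * (n : ℕ)) else 0) *
      (-(qnum P (n : ℕ) / qnum P (P.k * (n : ℕ)) * (qpow P (n : ℕ) / qpow P (P.k / 2 * (n : ℕ)))) / (qnum P
          (n : ℕ) * qnum P (P.N * (n : ℕ)))) by
        generalize qnum P (P.N * (n : ℕ)) = y at hN ⊢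
        split_ifs
        · field_simp
        · ring, ← hs, Finset.sum_mul]
    refine Finset.sum_congr rfl fun j _ => ?_
    simp only [Pi.smul_apply, smul_eq_mul, Int.cast_natCast]
    generalize qnum P (P.N * (n : ℕ)) = y at hN ⊢
    generalize qnum P (P.k * (n : ℕ)) = z at hk ⊢
    generalize qpow P (P.k / 2 * (n : ℕ)) = h at hh ⊢
    generalize qpow P (P.N / 2 * (n : ℕ)) = S at hS ⊢
    field_simp

end Data

/-- The exponent of `Φ_Λ`. -/
def phiTotal (P : Params) (wt : ℕ → ℂ) (s : ℂ) : Expo P.N :=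
  ∑ i ∈ Finset.Ico 1 P.N, (phiExpo P wt i s + tPlusExpo P wt i s)

/-- The exponent of `Ψ_Λ`. -/
def psiTotal (P : Params) (wt : ℕ → ℂ) (s : ℂ) : Expo P.N :=
  ∑ i ∈ Finset.Ico 1 P.N, (tMinusExpo P wt i s + psiExpo P wt i s)

theorem div_mul_div_mul_eq (n a b c d : ℂ) : 1 / n * (a * b / c) * d = a / n * (b / c * d) := by
  ring

-- Oscillator modes of Φ_Λ and Ψ_Λ.

section Modes

variable (P : Params) (wt : ℕ → ℂ) (n : ℕ+)

theorem negVec_phiTotal : negVec n (phiTotal P wt 0) = ∑ i ∈ Finset.Ico 1 P.N,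
    (qnum P (wt i * (n : ℕ)) / (n : ℕ) * qpow P ((P.k + P.N) / 2 * (n : ℕ))) •
      aDual P i ((n : ℕ) : ℤ) := by
  have hp : ¬ (0 : ℤ) < -((n : ℕ) : ℤ) := by simp
  rw [phiTotal, map_sum]
  refine Finset.sum_congr rfl fun i _ => ?_
  simp only [phiExpo, tPlusExpo, pCheck, hCheck, phat, hExpo, map_add, map_sub, map_smul, map_sum,
    negVec_modeSum, negVec_qPart, negVec_pPart, negVec_phatPart, smul_zero, Finset.sum_const_zero, add_zero,
    sub_zero, if_neg hp, aDual_neg, abs_neg, Nat.abs_cast, Int.cast_natCast, mul_zero, neg_zero, qpow_zero,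
    mul_one, neg_smul, smul_neg, neg_neg]

theorem posVec_phiTotal : posVec n (phiTotal P wt 0) = ∑ i ∈ Finset.Ico 1 P.N,
    (-(qnum P (wt i * (n : ℕ)) / (n : ℕ) * qpow P ((P.k + P.N) / 2 * (n : ℕ))) •
      aDual P i ((n : ℕ) : ℤ) +
    (qnum P (wt i * (n : ℕ)) / (n : ℕ) * (qnum P (P.k * (n : ℕ)) / qnum P (P.r * (n : ℕ)) *
      qpow P ((P.r - P.k / 2) * (n : ℕ)))) • hDual P i ((n : ℕ) : ℤ)) := by
  have hp : (0 : ℤ) < ((n : ℕ) : ℤ) := by exact_mod_cast n.pos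
  rw [phiTotal, map_sum]
  refine Finset.sum_congr rfl fun i _ => ?_
  simp only [phiExpo, tPlusExpo, pCheck, hCheck, phat, hExpo, map_add, map_sub, map_smul, map_sum,
    posVec_modeSum, posVec_qPart, posVec_pPart, posVec_phatPart, smul_zero, Finset.sum_const_zero, add_zero,
    sub_zero, if_pos hp, Nat.abs_cast, Int.cast_natCast, mul_zero, neg_zero, qpow_zero, mul_one]
  rw [div_mul_div_mul_eq]

theorem negVec_psiTotal : negVec n (psiTotal P wt 0) = ∑ i ∈ Finset.Ico 1 P.N,
    ((qnum P (wt (P.N - i) * (n : ℕ)) / (n : ℕ) * (qpow P ((P.k + P.N) / 2 * (n : ℕ)))⁻¹) •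
      aDual P i ((n : ℕ) : ℤ) +
    (-(qnum P (wt i * (n : ℕ)) / (n : ℕ) * (qnum P (P.k * (n : ℕ)) / qnum P (P.rstar * (n : ℕ)) *
      qpow P ((P.r - P.k / 2) * (n : ℕ)))) • hDual P i ((n : ℕ) : ℤ) +
    ∑ j ∈ Finset.Icc (i + 1) P.N,
      (qnum P (wt (j - i) * (n : ℕ)) / qnum P (n : ℕ) ^ 2) • vbc P i j)) := by
  have hp : -((n : ℕ) : ℤ) < 0 := by simp
  rw [psiTotal, map_sum]
  refine Finset.sum_congr rfl fun i _ => ?_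
  simp only [psiExpo, tMinusExpo, pCheck, qCheck, phat, qhat, map_add, map_sub, map_neg, map_smul, map_sum,
    negVec_modeSum, negVec_qPart, negVec_pPart, negVec_phatPart, negVec_qhatPart, smul_zero,
    Finset.sum_const_zero, add_zero, sub_zero, if_pos hp, aDual_neg, hDual_neg, abs_neg, Nat.abs_cast,
    Int.cast_neg, Int.cast_natCast, mul_zero, neg_zero, qpow_zero, mul_one, neg_smul, smul_neg, neg_neg,
    qpow_neg, one_mul]
  rw [div_mul_div_mul_eq]
  abel

theorem posVec_psiTotal : posVec n (psiTotal P wt 0) = ∑ i ∈ Finset.Ico 1 P.N,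
    (-(qnum P (wt (P.N - i) * (n : ℕ)) / (n : ℕ) * (qpow P ((P.k + P.N) / 2 * (n : ℕ)))⁻¹) •
      aDual P i ((n : ℕ) : ℤ) +
    -∑ j ∈ Finset.Icc (i + 1) P.N,
      (qnum P (wt (j - i) * (n : ℕ)) / qnum P (n : ℕ) ^ 2) • vbc P i j) := by
  have hp : ¬ ((n : ℕ) : ℤ) < 0 := by simp
  rw [psiTotal, map_sum]
  refine Finset.sum_congr rfl fun i _ => ?_
  simp only [psiExpo, tMinusExpo, pCheck, qCheck, phat, qhat, map_add, map_sub, map_neg, map_smul, map_sum,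
    posVec_modeSum, posVec_qPart, posVec_pPart, posVec_phatPart, posVec_qhatPart, smul_zero,
    Finset.sum_const_zero, add_zero, sub_zero, zero_add, if_neg hp, Nat.abs_cast,
    Int.cast_natCast, mul_zero, neg_zero, qpow_zero, mul_one, zero_add,
    qpow_neg, neg_one_mul, neg_smul, Finset.sum_neg_distrib]

end Modes

-- Shapes of the pairings with the modes of Φ_Λ and Ψ_Λ.

section Shapes

variable {P : Params} (wt : ℕ → ℂ)

theorem sum_ite_mul_apply {N i : ℕ} (h1 : 1 ≤ i) (h2 : i < N) (x y : ℕ → ℂ) :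
    (∑ l ∈ Finset.Ico 1 N, x l • fun i => if l = i then y i else (0 : ℂ)) i = x i * y i := by
  rw [Finset.sum_apply, Finset.sum_eq_single i]
  · simp
  · intro b _ hb; simp [hb]
  · intro h; exact absurd (Finset.mem_Ico.2 ⟨h1, h2⟩) h

/-- By duality the coefficient of ǎ^l is the value on a^l. -/
theorem shape_sum_aDual (hq : ‖qpow P 1‖ < 1) (hkh : P.k + P.N ≠ 0) (n : ℕ+) (x : ℕ → ℂ) :
    Shape P (qpow P (n : ℕ)) (∑ l ∈ Finset.Ico 1 P.N, x l • modePairing P n (aDual P l ((n : ℕ) : ℤ)))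
      0 x 0 0 := by
  have h := Shape.sum (Finset.Ico 1 P.N) fun l hl =>
    (shape_aDual hq hkh n (Finset.mem_Ico.1 hl).1 (Finset.mem_Ico.1 hl).2).smul (x l)
  simp only [smul_zero, Finset.sum_const_zero] at h
  refine h.congr rfl (fun i h1 h2 => ?_) (fun _ _ _ => rfl) rfl fun _ _ => rfl
  rw [sum_ite_mul_apply h1 h2, mul_one]

theorem shape_sum_hDual (hq : ‖qpow P 1‖ < 1) (hk : P.k ≠ 0) (n : ℕ+) (x : ℕ → ℂ) : ∃ Δ,
    Shape P (qpow P (n : ℕ)) (∑ l ∈ Finset.Ico 1 P.N, x l • modePairing P n (hDual P l ((n : ℕ) : ℤ))) Δ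
      (fun i => x i * (qnum P ((P.k + P.N) * (n : ℕ)) / qnum P (P.k * (n : ℕ)) / qpow P (P.N / 2 * (n :
          ℕ))))
      (fun i => x i * -(qnum P (n : ℕ) / qnum P (P.k * (n : ℕ)) * (qpow P (n : ℕ) / qpow P (P.k / 2 * (n :
          ℕ))))) 0 := by
  have h0 : ∀ l ∈ Finset.Ico 1 P.N, _ := fun l hl =>
    shape_hDual hq hk n (Finset.mem_Ico.1 hl).1 (Finset.mem_Ico.1 hl).2
  choose! Δ hΔ using h0
  have h := Shape.sum (Finset.Ico 1 P.N) fun l hl => (hΔ l hl).smul (x l)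
  simp only [smul_zero, Finset.sum_const_zero] at h
  refine ⟨_, h.congr rfl (fun i h1 h2 => ?_) (fun i h1 h2 => ?_) rfl fun _ _ => rfl⟩
  · rw [sum_ite_mul_apply h1 h2]
  · rw [sum_ite_mul_apply h1 h2]

/-- The dressing T_+ has annihilation modes only, so the creation modes of Φ_Λ involve just the a
bosons. -/
theorem shape_phi_neg (hq : ‖qpow P 1‖ < 1) (hkh : P.k + P.N ≠ 0) (n : ℕ+) :
    Shape P (qpow P (n : ℕ)) (modePairing P n (negVec n (phiTotal P wt 0))) 0
      (fun i => qnum P (wt i * (n : ℕ)) / (n : ℕ) * qpow P ((P.k + P.N) / 2 * (n : ℕ))) 0 0 := by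
  have h := shape_sum_aDual hq hkh n fun i =>
    qnum P (wt i * (n : ℕ)) / (n : ℕ) * qpow P ((P.k + P.N) / 2 * (n : ℕ))
  refine h.congr ?_ (fun _ _ _ => rfl) (fun _ _ _ => rfl) rfl fun _ _ => rfl
  rw [negVec_phiTotal, map_sum]
  simp only [map_smul]

/-- The component φ contributes to A only; all of δ comes from T_+. -/
theorem shape_phi_pos (hq : ‖qpow P 1‖ < 1) (hk : P.k ≠ 0) (hkh : P.k + P.N ≠ 0) (n : ℕ+) : ∃ Δ,
    Shape P (qpow P (n : ℕ)) (modePairing P n (posVec n (phiTotal P wt 0))) Δ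
      (fun i => qnum P (wt i * (n : ℕ)) / (n : ℕ) * (-qpow P ((P.k + P.N) / 2 * (n : ℕ)) +
        qnum P ((P.k + P.N) * (n : ℕ)) / qnum P (P.r * (n : ℕ)) * (qpow P ((P.r - P.k / 2) * (n : ℕ)) /
          qpow P (P.N / 2 * (n : ℕ)))))
      (fun i => qnum P (wt i * (n : ℕ)) / (n : ℕ) * -(qnum P (n : ℕ) / qnum P (P.r * (n : ℕ)) *
        (qpow P ((P.r - P.k / 2) * (n : ℕ)) * qpow P (n : ℕ) / qpow P (P.k / 2 * (n : ℕ))))) 0 := by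
  have h1 := shape_sum_aDual hq hkh n fun i =>
    -(qnum P (wt i * (n : ℕ)) / (n : ℕ) * qpow P ((P.k + P.N) / 2 * (n : ℕ)))
  obtain ⟨Δ, h2⟩ := shape_sum_hDual hq hk n fun i =>
    qnum P (wt i * (n : ℕ)) / (n : ℕ) * (qnum P (P.k * (n : ℕ)) / qnum P (P.r * (n : ℕ)) *
      qpow P ((P.r - P.k / 2) * (n : ℕ)))
  have hk := qnum_mul_ne_zero hq hk n
  refine ⟨_, (h1.add h2).congr ?_ (fun i _ _ => ?_) (fun i _ _ => ?_) rfl fun _ _ => by simp⟩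
  · rw [posVec_phiTotal, map_sum, ← Finset.sum_add_distrib]
    simp only [map_add, map_smul]
  · simp only [Pi.add_apply]
    generalize qnum P (P.k * (n : ℕ)) = z at hk ⊢
    field_simp
  · simp only [Pi.add_apply, Pi.zero_apply]
    generalize qnum P (P.k * (n : ℕ)) = z at hk ⊢
    field_simp
    ring

/-- The values on the `c` bosons of the functionals defined by `Ψ_Λ`. -/
def psiShift (P : Params) (wt : ℕ → ℂ) (n : ℕ+) (m : ℕ) : ℂ :=
  if m = 0 then 0 else qnum P (wt m * (n : ℕ)) / (n : ℕ)

theorem shape_sum_vbc (hq : ‖qpow P 1‖ < 1) (n : ℕ+) :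
    Shape P (qpow P (n : ℕ)) (∑ i ∈ Finset.Ico 1 P.N, ∑ j ∈ Finset.Icc (i + 1) P.N,
      (qnum P (wt (j - i) * (n : ℕ)) / qnum P (n : ℕ) ^ 2) • modePairing P n (vbc P i j)) 0 0 0
      (-psiShift P wt n) := by
  have h := (bosonForm_modePairing P n).shape_vbc (qpow P (n : ℕ))
    fun m => qnum P (wt m * (n : ℕ)) / qnum P (n : ℕ) ^ 2
  have hn := qnum_natCast_ne_zero hq n
  refine h.congr rfl (fun _ _ _ => rfl) (fun _ _ _ => rfl) (by simp [psiShift]) fun m _ => ?_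
  simp only [Pi.neg_apply, psiShift]
  split_ifs
  · rw [neg_zero]
  · generalize qnum P (n : ℕ) = w at hn ⊢
    field_simp

/-- The (b+c)-part of ψ supplies the shift. Its creation and annihilation modes have opposite signs,
so L is opposite in the two orders. -/
theorem shape_psi_neg (hq : ‖qpow P 1‖ < 1) (hk : P.k ≠ 0) (hkh : P.k + P.N ≠ 0) (n : ℕ+) : ∃ Δ,
    Shape P (qpow P (n : ℕ)) (modePairing P n (negVec n (psiTotal P wt 0))) Δ
      (fun i => qnum P (wt (P.N - i) * (n : ℕ)) / (n : ℕ) * (qpow P ((P.k + P.N) / 2 * (n : ℕ)))⁻¹ -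
        qnum P (wt i * (n : ℕ)) / (n : ℕ) * (
        qnum P ((P.k + P.N) * (n : ℕ)) / qnum P (P.rstar * (n : ℕ)) * (qpow P ((P.r - P.k / 2) * (n : ℕ)) /
          qpow P (P.N / 2 * (n : ℕ)))))
      (fun i => qnum P (wt i * (n : ℕ)) / (n : ℕ) * (qnum P (n : ℕ) / qnum P (P.rstar * (n : ℕ)) *
        (qpow P ((P.r - P.k / 2) * (n : ℕ)) * qpow P (n : ℕ) / qpow P (P.k / 2 * (n : ℕ)))))
      (-psiShift P wt n) := by
  have h1 := shape_sum_aDual hq hkh n fun i =>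
    qnum P (wt (P.N - i) * (n : ℕ)) / (n : ℕ) * (qpow P ((P.k + P.N) / 2 * (n : ℕ)))⁻¹
  obtain ⟨Δ, h2⟩ := shape_sum_hDual hq hk n fun i =>
    -(qnum P (wt i * (n : ℕ)) / (n : ℕ) * (qnum P (P.k * (n : ℕ)) / qnum P (P.rstar * (n : ℕ)) *
      qpow P ((P.r - P.k / 2) * (n : ℕ))))
  have hk := qnum_mul_ne_zero hq hk n
  refine ⟨_, (h1.add (h2.add (shape_sum_vbc wt hq n))).congr ?_ (fun i _ _ => ?_) (fun i _ _ => ?_)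
    (by simp [psiShift]) fun _ _ => by simp⟩
  · rw [negVec_psiTotal, map_sum, ← Finset.sum_add_distrib, ← Finset.sum_add_distrib]
    simp only [map_add, map_smul, map_sum]
  · simp only [Pi.add_apply, Pi.zero_apply]
    generalize qnum P (P.k * (n : ℕ)) = z at hk ⊢
    field_simp
    ring
  · simp only [Pi.add_apply, Pi.zero_apply]
    generalize qnum P (P.k * (n : ℕ)) = z at hk ⊢
    field_simp
    ring

/-- The dressing T_- has no annihilation modes, so δ vanishes and the shift L is the negative of the
one for the creation modes. -/
theorem shape_psi_pos (hq : ‖qpow P 1‖ < 1) (hkh : P.k + P.N ≠ 0) (n : ℕ+) :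
    Shape P (qpow P (n : ℕ)) (modePairing P n (posVec n (psiTotal P wt 0))) 0
      (fun i => -(qnum P (wt (P.N - i) * (n : ℕ)) / (n : ℕ) * (qpow P ((P.k + P.N) / 2 * (n : ℕ)))⁻¹))
      0 (psiShift P wt n) := by
  have h1 := shape_sum_aDual hq hkh n fun i =>
    -(qnum P (wt (P.N - i) * (n : ℕ)) / (n : ℕ) * (qpow P ((P.k + P.N) / 2 * (n : ℕ)))⁻¹)
  have h2 := (shape_sum_vbc wt hq n).smul (-1)
  have h3 := h1.add h2
  rw [smul_zero, add_zero] at h3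
  refine h3.congr ?_ (fun i _ _ => ?_) (fun i _ _ => ?_) (by simp [psiShift]) fun _ _ => by simp
  · rw [posVec_psiTotal, map_sum, Finset.smul_sum, ← Finset.sum_add_distrib]
    simp only [map_add, map_smul, map_sum, map_neg, neg_one_smul]
  · simp
  · simp

end Shapes

/-! ### Pairings of the modes of the currents and of the vertex operators -/

theorem qDiff_eq {P : Params} (hq : ‖qpow P 1‖ < 1) (μ : ℂ) (n : ℕ+) :
    qDiff P μ n = qnum P (μ * (n : ℕ)) / (n : ℕ) * (qpow P 1 - qpow P (-1)) := by
  have h1 := qpow_one_sub_ne_zero P hq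
  rw [qDiff, qnum]
  field_simp

theorem qnum_mul_eq (P : Params) (x : ℂ) (n : ℕ+) : qnum P (x * (n : ℕ)) =
    (qpow P (x * (n : ℕ)) - (qpow P (x * (n : ℕ)))⁻¹) / (qpow P 1 - qpow P (-1)) := by
  rw [qnum, qpow_neg]

theorem modeExchange_swap' {P : Params} (hq : ‖qpow P 1‖ < 1) (μ : ℂ) :
    ModeExchange P (fun n => qnum P (μ * (n : ℕ)) / (n : ℕ) * (qpow P 1 - qpow P (-1)))
      (fun n => -(qnum P (μ * (n : ℕ)) / (n : ℕ) * (qpow P 1 - qpow P (-1)))) fun _ => qpow P (-(2 * μ)) :=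
          by
  simp only [← qDiff_eq hq]
  exact modeExchange_swap P μ

/-- With R = q^(νn), one has p^n = R² and (q-q⁻¹)/(1-R²) = -R⁻¹/[νn]; this gives the coefficients
the form in which they arise from the pairings. -/
theorem modeExchange_theta_left {P : Params} (hq : ‖qpow P 1‖ < 1) {ν : ℝ} (hν : 0 < ν) (μ : ℂ) :
    ModeExchange P
      (fun n => -(qnum P (μ * (n : ℕ)) / (n : ℕ) * (qpow P (ν * (n : ℕ)) / qnum P (ν * (n : ℕ)))))
      (fun n => -(qnum P (μ * (n : ℕ)) / (n : ℕ) * ((qpow P (ν * (n : ℕ)))⁻¹ / qnum P (ν * (n : ℕ)))))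
      fun u => qpow P (μ - 2 * μ / ν * u) * (theta P ν (u + μ / 2) / theta P ν (u - μ / 2)) := by
  have h := modeExchange_theta P hq hν μ
  have hd := qpow_one_sub_ne_zero P hq
  have e : ∀ n : ℕ+, qpow P (2 * ν) ^ (n : ℕ) = qpow P (ν * (n : ℕ)) ^ 2 := fun n => by
    rw [← qpow_mul_nat, mul_assoc, qpow_two_mul]
  -- The nonvanishing of [νn], stated in terms of R = q^(νn).
  have e' : ∀ n : ℕ+, qpow P (ν * (n : ℕ)) ^ 2 - 1 ≠ 0 := fun n => by
    have h1 := qnum_mul_ne_zero hq hν.ne' n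
    have h2 := qpow_ne_zero P (ν * (n : ℕ))
    contrapose! h1
    rw [qnum_mul_eq, div_eq_zero_iff]
    left
    field_simp
    rw [h1, mul_zero]
  convert h using 2 with n n
  · rw [e, qDiff_eq hq, qnum_mul_eq P ν]
    have h1 := e' n
    have h2 := qpow_ne_zero P (ν * (n : ℕ))
    have h3 : 1 - qpow P (ν * (n : ℕ)) ^ 2 ≠ 0 := by rw [← neg_ne_zero, neg_sub]; exact h1
    generalize qpow P (ν * (n : ℕ)) = R at *
    generalize qpow P 1 - qpow P (-1) = d at *
    field_simp
    ring
  · rw [e, qDiff_eq hq, qnum_mul_eq P ν]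
    have h1 := e' n
    have h2 := qpow_ne_zero P (ν * (n : ℕ))
    have h3 : 1 - qpow P (ν * (n : ℕ)) ^ 2 ≠ 0 := by rw [← neg_ne_zero, neg_sub]; exact h1
    generalize qpow P (ν * (n : ℕ)) = R at *
    generalize qpow P 1 - qpow P (-1) = d at *
    field_simp
    ring

/-- Exchanging R and R⁻¹ adds ±([μn]/n)(q-q⁻¹) to the coefficients, that is, one rational factor
with constant exchange q^(-2μ). -/
theorem modeExchange_theta_right {P : Params} (hq : ‖qpow P 1‖ < 1) {ν : ℝ} (hν : 0 < ν) (μ : ℂ) :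
    ModeExchange P
      (fun n => -(qnum P (μ * (n : ℕ)) / (n : ℕ) * ((qpow P (ν * (n : ℕ)))⁻¹ / qnum P (ν * (n : ℕ)))))
      (fun n => -(qnum P (μ * (n : ℕ)) / (n : ℕ) * (qpow P (ν * (n : ℕ)) / qnum P (ν * (n : ℕ)))))
      fun u => qpow P (-μ - 2 * μ / ν * u) * (theta P ν (u + μ / 2) / theta P ν (u - μ / 2)) := by
  have h := (modeExchange_theta_left hq hν μ).add (modeExchange_swap' hq μ)
  have hd := qpow_one_sub_ne_zero P hq
  have e : ∀ n : ℕ+, qpow P 1 - qpow P (-1) =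
      (qpow P (ν * (n : ℕ)) - (qpow P (ν * (n : ℕ)))⁻¹) / qnum P (ν * (n : ℕ)) := fun n => by
    have h1 := qnum_mul_ne_zero hq hν.ne' n
    rw [eq_div_iff h1, qnum_mul_eq]
    field_simp
  convert h using 2 with n n u
  · rw [e n]; ring
  · rw [e n]; ring
  · rw [mul_right_comm, ← qpow_add]
    congr 2
    ring

/-! ### The exponents of the currents of `U_{q,p}(sl_N^)` -/

/-- The exponent of `D_i^+(z)`. -/
def dPlusExpo (P : Params) (i : ℕ) (s : ℂ) : Expo P.N :=
  modeSum fun m : ℤ =>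
    if m < 0 then
      (1 / qnum P (P.rstar * (-m)) * qpow P (P.r * (-m)) * qpow P ((-m) * s)) • dVec P i (-m)
    else 0

/-- The exponent of `D_i^-(z)`. -/
def dMinusExpo (P : Params) (i : ℕ) (s : ℂ) : Expo P.N :=
  modeSum fun n : ℤ =>
    if 0 < n then
      (-(1 / qnum P (P.r * n) * qpow P (P.r * n) * qpow P (-(n * s)))) • dVec P i n
    else 0

/-- The exponent of `ψ_±^i(z)`. -/
def psiCurExpo (P : Params) (ε : ℤˣ) (i : ℕ) (s : ℂ) : Expo P.N :=
  (∑ j ∈ Finset.Icc 1 i,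
      (bosonPM P ε (vb P j (i + 1)) (s + sgn ε * (P.k / 2 + j - 1)) -
        bosonPM P ε (vb P j i) (s + sgn ε * (P.k / 2 + j)))) +
    bosonPM P ε (va P i) (s + sgn ε * (P.N / 2)) +
    ∑ j ∈ Finset.Icc (i + 1) P.N,
      (bosonPM P ε (vb P i j) (s + sgn ε * (P.k / 2 + j)) -
        bosonPM P ε (vb P (i + 1) j) (s + sgn ε * (P.k / 2 + j - 1)))

/-- The exponents of the terms of `E_i`. -/
def curEExpo (P : Params) (ε : ℤˣ) (t : ℂ) (i j : ℕ) (s : ℂ) : Expo P.N :=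
  dPlusExpo P i s + ePlusExpo P ε t i j s + (2 : ℂ) • qhat P i +
    (s * P.logq) • -((1 / P.rstar : ℂ) • (phat P i - onePart 1))

/-- The exponents of the terms with `j ≤ i` of `F_i`. -/
def curFLeftExpo (P : Params) (ε : ℤˣ) (t : ℂ) (i j : ℕ) (s : ℂ) : Expo P.N :=
  eMinusLeftExpo P ε t i j s + dMinusExpo P i s +
    (s * P.logq) • ((1 / P.r : ℂ) • (hExpo P i + phat P i - onePart 1))

/-- The exponents of the terms with `j > i` of `F_i`. -/
def curFRightExpo (P : Params) (ε : ℤˣ) (t : ℂ) (i j : ℕ) (s : ℂ) : Expo P.N :=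
  eMinusRightExpo P ε t i j s + dMinusExpo P i s +
    (s * P.logq) • ((1 / P.r : ℂ) • (hExpo P i + phat P i - onePart 1))

/-- The exponent of `H_i^±`. -/
def curHExpo (P : Params) (ε : ℤˣ) (i : ℕ) (s : ℂ) : Expo P.N :=
  dPlusExpo P i (s + sgn ε * (P.k / 2)) + psiCurExpo P ε i s + dMinusExpo P i (s - sgn ε * (P.k / 2)) +
    (2 : ℂ) • qhat P i + (-(sgn ε) * P.logq) • hExpo P i +
    ((sgn ε * (P.r - P.k / 2) + s) * P.logq) •
      ((1 / P.r : ℂ) • (phat P i + hExpo P i - onePart 1) -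
        (1 / P.rstar : ℂ) • (phat P i - onePart 1))

-- Oscillator modes of the total currents.

section Modes

variable (P : Params) (n : ℕ+) (i j : ℕ) (ε : ℤˣ) (t s : ℂ)

theorem posVec_dPlusExpo : posVec n (dPlusExpo P i s) = 0 := by
  rw [dPlusExpo, posVec_modeSum, if_neg (by simp)]

theorem negVec_dPlusExpo : negVec n (dPlusExpo P i s) =
    (qpow P (P.r * (n : ℕ)) / qnum P (P.rstar * (n : ℕ)) * qpow P (s * (n : ℕ))) • dVec P i (n : ℕ) := by
  rw [dPlusExpo, negVec_modeSum, if_pos (by simp)]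
  push_cast
  rw [neg_neg, mul_comm s, one_div_mul_eq_div]

theorem negVec_dMinusExpo : negVec n (dMinusExpo P i s) = 0 := by
  rw [dMinusExpo, negVec_modeSum, if_neg (by simp)]

theorem posVec_dMinusExpo : posVec n (dMinusExpo P i s) =
    (-(qpow P (P.r * (n : ℕ)) / qnum P (P.r * (n : ℕ)) * (qpow P (s * (n : ℕ)))⁻¹)) • dVec P i (n : ℕ) := by
  rw [dMinusExpo, posVec_modeSum, if_pos (by simp)]
  push_cast
  rw [mul_comm s, one_div_mul_eq_div, qpow_neg]

/-- The modes of ψ_± are proportional to those of the twists D_i^±, so one pairing determines the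
oscillator exchange of H_i^± completely. -/
theorem posVec_psiCurExpo_one : posVec n (psiCurExpo P 1 i 0) =
    ((qpow P 1 - qpow P (-1)) * qpow P (P.k / 2 * (n : ℕ))) • dVec P i (n : ℕ) := by
  have hK := qpow_ne_zero P (P.k / 2 * (n : ℕ))
  have hS := qpow_ne_zero P (P.N / 2 * (n : ℕ))
  have hQ := qpow_ne_zero P (n : ℕ)
  have hKK : qpow P (P.k * (n : ℕ)) = qpow P (P.k / 2 * (n : ℕ)) ^ 2 := by
    rw [← qpow_two_mul]; congr 1; ring
  rw [psiCurExpo, dVec, smul_add, smul_add, Finset.smul_sum, Finset.smul_sum, map_add, map_add, map_sum,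
    map_sum]
  simp only [map_sub, posVec_bosonPM_one, zero_add, sgn_one, one_mul, smul_sub, smul_smul, qpow_neg,
    qpow_add_mul, qpow_sub_mul, qpow_one_mul, qpow_nat_mul, add_div, hKK]
  congr 1
  · congr 1
    · refine Finset.sum_congr rfl fun l _ => ?_
      congr 2 <;> field_simp
    · congr 1
      generalize qpow P (P.k / 2 * (n : ℕ)) = h at hK ⊢
      field_simp
  · refine Finset.sum_congr rfl fun l _ => ?_
    congr 2 <;> field_simp

theorem negVec_psiCurExpo_neg_one : negVec n (psiCurExpo P (-1) i 0) =
    (-((qpow P 1 - qpow P (-1)) * qpow P (P.k / 2 * (n : ℕ)))) • dVec P i (n : ℕ) := by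
  have hK := qpow_ne_zero P (P.k / 2 * (n : ℕ))
  have hS := qpow_ne_zero P (P.N / 2 * (n : ℕ))
  have hQ := qpow_ne_zero P (n : ℕ)
  have hKK : qpow P (P.k * (n : ℕ)) = qpow P (P.k / 2 * (n : ℕ)) ^ 2 := by
    rw [← qpow_two_mul]; congr 1; ring
  rw [psiCurExpo, dVec, smul_add, smul_add, Finset.smul_sum, Finset.smul_sum, map_add, map_add, map_sum,
    map_sum]
  simp only [map_sub, negVec_bosonPM_neg_one, zero_add, sgn_neg_one, neg_one_mul, smul_sub, smul_smul,
      qpow_neg,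
    qpow_neg_mul, qpow_add_mul, qpow_sub_mul, qpow_one_mul, qpow_nat_mul, add_div, hKK]
  congr 1
  · congr 1
    · refine Finset.sum_congr rfl fun l _ => ?_
      congr 2 <;> field_simp
    · congr 1
      generalize qpow P (P.k / 2 * (n : ℕ)) = h at hK ⊢
      field_simp
  · refine Finset.sum_congr rfl fun l _ => ?_
    congr 2 <;> field_simp

theorem negVec_psiCurExpo_one : negVec n (psiCurExpo P 1 i s) = 0 := by
  simp only [psiCurExpo, map_add, map_sum, map_sub, negVec_bosonPM_one, sub_zero, Finset.sum_const_zero,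
    add_zero]

theorem posVec_psiCurExpo_neg_one : posVec n (psiCurExpo P (-1) i s) = 0 := by
  simp only [psiCurExpo, map_add, map_sum, map_sub, posVec_bosonPM_neg_one, sub_zero, Finset.sum_const_zero,
    add_zero]

theorem posVec_curEExpo : posVec n (curEExpo P ε t i j 0) = posVec n (ePlusExpo P ε t i j 0) := by
  simp only [curEExpo, phat, qhat, map_add, map_neg, map_sub, map_smul, posVec_dPlusExpo, posVec_qhatPart,
    posVec_phatPart, posVec_onePart, smul_zero, sub_zero, neg_zero, add_zero, zero_add]

theorem negVec_curEExpo : negVec n (curEExpo P ε t i j 0) =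
    (qpow P (P.r * (n : ℕ)) / qnum P (P.rstar * (n : ℕ))) • dVec P i (n : ℕ) +
      negVec n (ePlusExpo P ε t i j 0) := by
  simp only [curEExpo, phat, qhat, map_add, map_neg, map_sub, map_smul, negVec_dPlusExpo, negVec_qhatPart,
    negVec_phatPart, negVec_onePart, smul_zero, sub_zero, neg_zero, add_zero, qpow_zero_mul, mul_one]

theorem posVec_curFLeftExpo : posVec n (curFLeftExpo P ε t i j 0) =
    posVec n (eMinusLeftExpo P ε t i j 0) +
      (-(qpow P (P.r * (n : ℕ)) / qnum P (P.r * (n : ℕ)))) • dVec P i (n : ℕ) := by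
  simp only [curFLeftExpo, phat, hExpo, map_add, map_neg, map_sub, map_smul, posVec_dMinusExpo,
      posVec_pPart,
    posVec_phatPart, posVec_onePart, smul_zero, sub_zero, neg_zero, add_zero, qpow_zero_mul, mul_one,
        inv_one]

theorem negVec_curFLeftExpo : negVec n (curFLeftExpo P ε t i j 0) =
    negVec n (eMinusLeftExpo P ε t i j 0) := by
  simp only [curFLeftExpo, phat, hExpo, map_add, map_neg, map_sub, map_smul, negVec_dMinusExpo,
      negVec_pPart,
    negVec_phatPart, negVec_onePart, smul_zero, sub_zero, neg_zero, add_zero]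

theorem posVec_curFRightExpo : posVec n (curFRightExpo P ε t i j 0) =
    posVec n (eMinusRightExpo P ε t i j 0) +
      (-(qpow P (P.r * (n : ℕ)) / qnum P (P.r * (n : ℕ)))) • dVec P i (n : ℕ) := by
  simp only [curFRightExpo, phat, hExpo, map_add, map_neg, map_sub, map_smul, posVec_dMinusExpo,
      posVec_pPart,
    posVec_phatPart, posVec_onePart, smul_zero, sub_zero, neg_zero, add_zero, qpow_zero_mul, mul_one,
        inv_one]

theorem negVec_curFRightExpo : negVec n (curFRightExpo P ε t i j 0) =
    negVec n (eMinusRightExpo P ε t i j 0) := by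
  simp only [curFRightExpo, phat, hExpo, map_add, map_neg, map_sub, map_smul, negVec_dMinusExpo,
      negVec_pPart,
    negVec_phatPart, negVec_onePart, smul_zero, sub_zero, neg_zero, add_zero]

theorem posVec_curHExpo : posVec n (curHExpo P ε i 0) = posVec n (psiCurExpo P ε i 0) +
    (-(qpow P (P.r * (n : ℕ)) / qnum P (P.r * (n : ℕ)) * qpow P (sgn ε * (P.k / 2) * (n : ℕ)))) •
      dVec P i (n : ℕ) := by
  simp only [curHExpo, phat, qhat, hExpo, map_add, map_neg, map_sub, map_smul, posVec_dPlusExpo,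
    posVec_dMinusExpo, posVec_pPart, posVec_qhatPart, posVec_phatPart, posVec_onePart, smul_zero, sub_zero,
    neg_zero, add_zero, zero_add, zero_sub, qpow_neg_mul, inv_inv]

theorem negVec_curHExpo : negVec n (curHExpo P ε i 0) =
    (qpow P (P.r * (n : ℕ)) / qnum P (P.rstar * (n : ℕ)) * qpow P (sgn ε * (P.k / 2) * (n : ℕ))) •
      dVec P i (n : ℕ) + negVec n (psiCurExpo P ε i 0) := by
  simp only [curHExpo, phat, qhat, hExpo, map_add, map_neg, map_sub, map_smul, negVec_dPlusExpo,
    negVec_dMinusExpo, negVec_pPart, negVec_qhatPart, negVec_phatPart, negVec_onePart, smul_zero, sub_zero,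
    neg_zero, add_zero, zero_add]

end Modes

-- Reduction of all powers of q to q^n, q^(kn/2), q^(Nn/2) and q^(rn).

section Atoms

variable (P : Params) (n : ℕ+)

theorem qpow_k_eq : qpow P (P.k * (n : ℕ)) = qpow P (P.k / 2 * (n : ℕ)) ^ 2 := by
  rw [← qpow_two_mul]; congr 1; ring

theorem qpow_kN_half_eq : qpow P ((P.k + P.N) / 2 * (n : ℕ)) =
    qpow P (P.k / 2 * (n : ℕ)) * qpow P (P.N / 2 * (n : ℕ)) := by
  rw [← qpow_add]; congr 1; ring

theorem qpow_pow_N_eq : qpow P (n : ℕ) ^ P.N = qpow P (P.N / 2 * (n : ℕ)) ^ 2 := by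
  rw [← qpow_two_mul, ← qpow_nat_mul]; congr 1; ring

theorem qpow_kN_eq : qpow P ((P.k + P.N) * (n : ℕ)) =
    qpow P (P.k / 2 * (n : ℕ)) ^ 2 * qpow P (P.N / 2 * (n : ℕ)) ^ 2 := by
  rw [← qpow_two_mul, ← qpow_two_mul, ← qpow_add]; congr 1; ring

theorem qpow_r_sub_eq : qpow P ((P.r - P.k / 2) * (n : ℕ)) =
    qpow P (P.r * (n : ℕ)) / qpow P (P.k / 2 * (n : ℕ)) := qpow_sub_mul _ _ _ _

theorem qpow_rstar_eq : qpow P (P.rstar * (n : ℕ)) =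
    qpow P (P.r * (n : ℕ)) / qpow P (P.k / 2 * (n : ℕ)) ^ 2 := by
  rw [← qpow_k_eq, Params.rstar, Complex.ofReal_sub, qpow_sub_mul]

variable {P}

theorem qpow_sq_sub_one_ne_zero (hq : ‖qpow P 1‖ < 1) {x : ℝ} (hx : x ≠ 0) :
    qpow P (x * (n : ℕ)) ^ 2 - 1 ≠ 0 := by
  have h1 := qnum_mul_ne_zero hq hx n
  have h2 := qpow_ne_zero P (x * (n : ℕ))
  contrapose! h1
  rw [qnum_mul_eq, div_eq_zero_iff]
  left
  field_simp
  rw [h1, mul_zero]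

/-- This is q^(2r*n) ≠ 1 after clearing denominators, using r* = r - k. -/
theorem qpow_r_sq_sub_ne_zero (hq : ‖qpow P 1‖ < 1) (hrs : P.rstar ≠ 0) :
    qpow P (P.r * (n : ℕ)) ^ 2 - qpow P (P.k / 2 * (n : ℕ)) ^ 4 ≠ 0 := by
  have h1 := qpow_sq_sub_one_ne_zero n hq hrs
  have h2 := qpow_ne_zero P (P.k / 2 * (n : ℕ))
  rw [qpow_rstar_eq] at h1
  contrapose! h1
  rw [div_pow, sub_eq_zero, div_eq_one_iff_eq (pow_ne_zero 2 (pow_ne_zero 2 h2))]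
  linear_combination h1

end Atoms

-- Pairings of the vertex operators with the modes of the twists.

section Pairings

variable {P : Params} {n : ℕ+} {f : BVec P.N →ₗ[ℂ] ℂ} {Δ A δ L : ℕ → ℂ} (wt : ℕ → ℂ) {i j : ℕ}

theorem Shape.dVec_eq (h : Shape P (qpow P (n : ℕ)) f Δ A δ L) (hq : ‖qpow P 1‖ < 1) (h1 : 1 ≤ i)
    (hi : i < P.N) :
    f (dVec P i (n : ℕ)) = (δ i / (qpow P (n : ℕ) * qnum P (n : ℕ)) * (1 - (1 / qpow P (n : ℕ) ^ P.N) ^ 2) /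
        (qpow P 1 - qpow P (-1)) + (L i + L (P.N - i) / qpow P (n : ℕ) ^ P.N)) / qpow P (P.k * (n : ℕ)) +
      A i / qpow P ((P.k + P.N) / 2 * (n : ℕ)) := by
  have hQ := qpow_ne_zero P (n : ℕ)
  have hd := qpow_one_sub_ne_zero P hq
  have hn := qnum_natCast_ne_zero hq n
  have hG := sum_inv_pow_sq hQ (Nat.zero_le P.N)
  have hdn : (qpow P 1 - qpow P (-1)) * qnum P (n : ℕ) = qpow P (n : ℕ) - (qpow P (n : ℕ))⁻¹ := by
    rw [qDiff_one_eq hq n, div_mul_cancel₀ _ hn]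
  rw [EllipticVO.dVec_eq, h.hGen_eq hQ (qpow_ne_zero P _) _ h1 hi, inv_mul_eq_div]
  congr 3
  rw [← hdn, zero_add, pow_zero, div_one, one_pow] at hG
  rw [mul_comm, ← eq_div_iff (mul_ne_zero hd hn)] at hG
  rw [hG]
  field_simp

theorem phi_neg_dVec (hq : ‖qpow P 1‖ < 1) (hkh : P.k + P.N ≠ 0) (h1 : 1 ≤ i) (hi : i < P.N) :
    modePairing P n (negVec n (phiTotal P wt 0)) (dVec P i (n : ℕ)) = qnum P (wt i * (n : ℕ)) / (n : ℕ) :=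
        by
  rw [(shape_phi_neg wt hq hkh n).dVec_eq hq h1 hi]
  have hT := qpow_ne_zero P ((P.k + P.N) / 2 * (n : ℕ))
  simp only [Pi.zero_apply, zero_div, zero_mul, add_zero, zero_add]
  rw [mul_div_cancel_right₀ _ hT]

/-- The contributions of φ and T_+ to A combine with the δ-term of T_+, and every power of q^N
cancels. -/
theorem phi_pos_dVec (hq : ‖qpow P 1‖ < 1) (hk : P.k ≠ 0) (hkh : P.k + P.N ≠ 0) (hr : P.r ≠ 0)
    (h1 : 1 ≤ i) (hi : i < P.N) :
    modePairing P n (posVec n (phiTotal P wt 0)) (dVec P i (n : ℕ)) = -(qnum P (wt i * (n : ℕ)) / (n : ℕ) *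
      (qnum P (P.rstar * (n : ℕ)) / qnum P (P.r * (n : ℕ)) / qpow P (P.k * (n : ℕ)))) := by
  obtain ⟨Δ, h⟩ := shape_phi_pos wt hq hk hkh n
  rw [h.dVec_eq hq h1 hi]
  simp only [Pi.zero_apply, qnum_mul_eq P P.r, qnum_mul_eq P P.rstar, qnum_mul_eq P (P.k + P.N), qpow_k_eq,
    qpow_kN_half_eq, qpow_pow_N_eq, qpow_kN_eq, qpow_r_sub_eq, qpow_rstar_eq]
  have hd := qpow_one_sub_ne_zero P hq
  have hn := qnum_natCast_ne_zero hq n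
  have hQ := qpow_ne_zero P (n : ℕ)
  have hh := qpow_ne_zero P (P.k / 2 * (n : ℕ))
  have hS := qpow_ne_zero P (P.N / 2 * (n : ℕ))
  have hR := qpow_ne_zero P (P.r * (n : ℕ))
  have hR1 := qpow_sq_sub_one_ne_zero n hq hr
  generalize qnum P (wt i * (n : ℕ)) / (n : ℕ) = l
  generalize qpow P 1 - qpow P (-1) = d at *
  generalize qnum P (n : ℕ) = w at *
  generalize qpow P (n : ℕ) = Q at *
  generalize qpow P (P.k / 2 * (n : ℕ)) = h at *
  generalize qpow P (P.N / 2 * (n : ℕ)) = S at *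
  generalize qpow P (P.r * (n : ℕ)) = R at *
  field_simp
  ring

/-- The shift L(N-i) of the (b+c)-part cancels the a-part with weight λ^{N-i}. This is why ψ_{λ^i}
carries λ^{N-i}: only λ^i is left. -/
theorem psi_neg_dVec (hq : ‖qpow P 1‖ < 1) (hk : P.k ≠ 0) (hkh : P.k + P.N ≠ 0) (hrs : P.rstar ≠ 0)
    (h1 : 1 ≤ i) (hi : i < P.N) :
    modePairing P n (negVec n (psiTotal P wt 0)) (dVec P i (n : ℕ)) = -(qnum P (wt i * (n : ℕ)) / (n : ℕ) *
      (qnum P (P.r * (n : ℕ)) / qnum P (P.rstar * (n : ℕ)))) := by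
  obtain ⟨Δ, h⟩ := shape_psi_neg wt hq hk hkh n
  rw [h.dVec_eq hq h1 hi]
  simp only [Pi.neg_apply, psiShift, if_neg (show ¬ i = 0 by omega), if_neg (show ¬ P.N - i = 0 by omega),
    qnum_mul_eq P P.r, qnum_mul_eq P P.rstar, qnum_mul_eq P (P.k + P.N), qpow_k_eq,
    qpow_kN_half_eq, qpow_pow_N_eq, qpow_kN_eq, qpow_r_sub_eq, qpow_rstar_eq]
  have hd := qpow_one_sub_ne_zero P hq
  have hn := qnum_natCast_ne_zero hq n
  have hQ := qpow_ne_zero P (n : ℕ)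
  have hh := qpow_ne_zero P (P.k / 2 * (n : ℕ))
  have hS := qpow_ne_zero P (P.N / 2 * (n : ℕ))
  have hR := qpow_ne_zero P (P.r * (n : ℕ))
  have hR1 := qpow_r_sq_sub_ne_zero n hq hrs
  generalize qnum P (wt i * (n : ℕ)) / (n : ℕ) = l
  generalize qnum P (wt (P.N - i) * (n : ℕ)) / (n : ℕ) = l'
  generalize qpow P 1 - qpow P (-1) = d at *
  generalize qnum P (n : ℕ) = w at *
  generalize qpow P (n : ℕ) = Q at *
  generalize qpow P (P.k / 2 * (n : ℕ)) = h at *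
  generalize qpow P (P.N / 2 * (n : ℕ)) = S at *
  generalize qpow P (P.r * (n : ℕ)) = R at *
  field_simp
  ring

theorem psi_pos_dVec (hq : ‖qpow P 1‖ < 1) (hkh : P.k + P.N ≠ 0) (h1 : 1 ≤ i) (hi : i < P.N) :
    modePairing P n (posVec n (psiTotal P wt 0)) (dVec P i (n : ℕ)) =
      qnum P (wt i * (n : ℕ)) / (n : ℕ) / qpow P (P.k * (n : ℕ)) := by
  rw [(shape_psi_pos wt hq hkh n).dVec_eq hq h1 hi]
  simp only [Pi.zero_apply, psiShift, if_neg (show ¬ i = 0 by omega), if_neg (show ¬ P.N - i = 0 by omega),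
    qpow_k_eq, qpow_kN_half_eq, qpow_pow_N_eq]
  have hh := qpow_ne_zero P (P.k / 2 * (n : ℕ))
  have hS := qpow_ne_zero P (P.N / 2 * (n : ℕ))
  generalize qnum P (wt i * (n : ℕ)) / (n : ℕ) = l
  generalize qnum P (wt (P.N - i) * (n : ℕ)) / (n : ℕ) = l'
  generalize qpow P (P.k / 2 * (n : ℕ)) = h at *
  generalize qpow P (P.N / 2 * (n : ℕ)) = S at *
  field_simp
  ring

/-! ### Exchange of the oscillators -/

theorem modeExchange_of_eq {α β α' β' : ℕ+ → ℂ} {c : ℂ → ℂ} (h : ModeExchange P α β c)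
    (hα : ∀ n, α' n = α n) (hβ : ∀ n, β' n = β n) : ModeExchange P α' β' c := by
  rwa [funext hα, funext hβ]

theorem modePairing_comm (P : Params) (n : ℕ+) (x y : BVec P.N) :
    modePairing P n x y = modePairing P n y x := (bosonForm_modePairing P n).symm x y

/-- In one order both δ and L vanish, since the creation modes of Φ_Λ contain only a bosons. In the
other order the twist D_i^+ cancels the δ-term of e^{+,i}. The two contractions vanish separately,
term by term in j. -/
theorem curE_phi_modes (hq : ‖qpow P 1‖ < 1) (hk : P.k ≠ 0) (hkh : P.k + P.N ≠ 0) (hr : P.r ≠ 0)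
    (hrs : P.rstar ≠ 0) (hj : 1 ≤ j) (hji : j ≤ i) (hi : i < P.N) {ε : ℤˣ} {t : ℂ}
    (h : (ε = 1 ∧ t = j) ∨ (ε = -1 ∧ t = j - 2)) :
    ModeExchange P
      (fun n => modePairing P n (posVec n (curEExpo P ε t i j 0)) (negVec n (phiTotal P wt 0)))
      (fun n => modePairing P n (posVec n (phiTotal P wt 0)) (negVec n (curEExpo P ε t i j 0)))
      fun _ => 1 := by
  refine modeExchange_of_eq (modeExchange_zero P) (fun n => ?_) fun n => ?_
  · have hs := shape_phi_neg wt hq hkh n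
    rw [modePairing_comm, posVec_curEExpo]
    rcases h with ⟨rfl, rfl⟩ | ⟨rfl, rfl⟩
    · rw [ePlusExpo_pos_one hs hq hj hji hi]; simp
    · rw [ePlusExpo_pos_neg_one hs hq hj hji hi]; simp
  · obtain ⟨Δ, hs⟩ := shape_phi_pos wt hq hk hkh n
    have e : modePairing P n (posVec n (phiTotal P wt 0)) (negVec n (ePlusExpo P ε t i j 0)) =
        -(qnum P (wt i * (n : ℕ)) / (n : ℕ) * -(qnum P (n : ℕ) / qnum P (P.r * (n : ℕ)) *
        (qpow P ((P.r - P.k / 2) * (n : ℕ)) * qpow P (n : ℕ) / qpow P (P.k / 2 * (n : ℕ)))) /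
        (qpow P (n : ℕ) * qnum P (n : ℕ))) := by
      rcases h with ⟨rfl, rfl⟩ | ⟨rfl, rfl⟩
      · rw [ePlusExpo_neg_one hs hq hj hji hi]
      · rw [ePlusExpo_neg_neg_one hs hq hj hji hi]; simp
    rw [negVec_curEExpo, map_add, map_smul, e, phi_pos_dVec wt hq hk hkh hr (by omega) hi, qpow_k_eq,
      qpow_r_sub_eq, smul_eq_mul]
    have hn := qnum_natCast_ne_zero hq n
    have hQ := qpow_ne_zero P (n : ℕ)
    have hh := qpow_ne_zero P (P.k / 2 * (n : ℕ))
    have hy := qnum_mul_ne_zero hq hr n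
    have hz := qnum_mul_ne_zero hq hrs n
    generalize qnum P (wt i * (n : ℕ)) / (n : ℕ) = l
    generalize qnum P (n : ℕ) = w at *
    generalize qpow P (n : ℕ) = Q at *
    generalize qpow P (P.k / 2 * (n : ℕ)) = h at *
    generalize qnum P (P.r * (n : ℕ)) = y at *
    generalize qnum P (P.rstar * (n : ℕ)) = z at *
    generalize qpow P (P.r * (n : ℕ)) = R at *
    field_simp
    ring

end Pairings

-- Oscillator exchange of each term of the currents with the vertex operators.

section Pairings

variable {P : Params} (wt : ℕ → ℂ) {i j : ℕ}

theorem psiShift_of_pos (P : Params) (wt : ℕ → ℂ) (n : ℕ+) {m : ℕ} (hm : 0 < m) :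
    psiShift P wt n m = qnum P (wt m * (n : ℕ)) / (n : ℕ) := if_neg hm.ne'

theorem shift_one_sub (P : Params) (j : ℕ) (n : ℕ+) :
    qpow P (2 * ((1 - j) / 2) * (n : ℕ)) = qpow P (n : ℕ) / qpow P (n : ℕ) ^ j := by
  rw [mul_div_cancel₀ _ two_ne_zero, qpow_sub_mul, qpow_one_mul, qpow_nat_mul]

theorem shift_k_add (P : Params) (j : ℕ) (n : ℕ+) :
    qpow P (2 * ((P.k + j) / 2) * (n : ℕ)) = qpow P (P.k / 2 * (n : ℕ)) ^ 2 * qpow P (n : ℕ) ^ j := by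
  rw [mul_div_cancel₀ _ two_ne_zero, qpow_add_mul, qpow_nat_mul, qpow_k_eq]

theorem shift_one_sub_k_sub (P : Params) (j : ℕ) (n : ℕ+) :
    qpow P (2 * ((1 - P.k - j) / 2) * (n : ℕ)) =
      qpow P (n : ℕ) / qpow P (P.k / 2 * (n : ℕ)) ^ 2 / qpow P (n : ℕ) ^ j := by
  rw [mul_div_cancel₀ _ two_ne_zero, qpow_sub_mul, qpow_sub_mul, qpow_nat_mul, qpow_k_eq, qpow_one_mul]

theorem shift_k_four (P : Params) (n : ℕ+) :
    qpow P (2 * (P.k / 4) * (n : ℕ)) = qpow P (P.k / 2 * (n : ℕ)) := by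
  congr 1; ring

theorem shift_neg_k_four (P : Params) (n : ℕ+) :
    qpow P (2 * -(P.k / 4) * (n : ℕ)) = (qpow P (P.k / 2 * (n : ℕ)))⁻¹ := by
  rw [← qpow_neg]; congr 1; ring

/-- The denominators that occur in the rational identities for the n-th modes. -/
theorem mode_factors_ne_zero (hq : ‖qpow P 1‖ < 1) (hr : 0 < P.r) (hrs : 0 < P.rstar) (n : ℕ+) :
    qpow P 1 - qpow P (-1) ≠ 0 ∧ qnum P (n : ℕ) ≠ 0 ∧ qpow P (n : ℕ) ≠ 0 ∧
      qpow P (P.k / 2 * (n : ℕ)) ≠ 0 ∧ qpow P (P.N / 2 * (n : ℕ)) ≠ 0 ∧ qpow P (P.r * (n : ℕ)) ≠ 0 ∧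
      qpow P (P.r * (n : ℕ)) ^ 2 - 1 ≠ 0 ∧
      qpow P (P.r * (n : ℕ)) ^ 2 - qpow P (P.k / 2 * (n : ℕ)) ^ 4 ≠ 0 :=
  ⟨qpow_one_sub_ne_zero P hq, qnum_natCast_ne_zero hq n, qpow_ne_zero P _, qpow_ne_zero P _,
    qpow_ne_zero P _, qpow_ne_zero P _, qpow_sq_sub_one_ne_zero n hq hr.ne',
        qpow_r_sq_sub_ne_zero n hq hrs.ne'⟩

/-- The parameter is -λ^i with modulus r*. In one order the δ-term and the shift L(i) combine to
change q^(r*n) into its inverse, whence `modeExchange_theta_right`. -/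
theorem curE_psi_modes_one (hq : ‖qpow P 1‖ < 1) (hk : P.k ≠ 0) (hkh : P.k + P.N ≠ 0) (hr : 0 < P.r)
    (hrs : 0 < P.rstar) (hj : 1 ≤ j) (hji : j ≤ i) (hi : i < P.N) :
    ModeExchange P
      (fun n => modePairing P n (posVec n (curEExpo P 1 j i j 0)) (negVec n (psiTotal P wt 0)))
      (fun n => modePairing P n (posVec n (psiTotal P wt 0)) (negVec n (curEExpo P 1 j i j 0)))
      fun u => qpow P (-(-wt i) - 2 * -wt i / P.rstar * u) *
        (theta P P.rstar (u + -wt i / 2) / theta P P.rstar (u - -wt i / 2)) := by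
  refine modeExchange_of_eq (modeExchange_theta_right hq hrs (-wt i)) (fun n => ?_) fun n => ?_
  · obtain ⟨Δ, hs⟩ := shape_psi_neg wt hq hk hkh n
    rw [modePairing_comm, posVec_curEExpo, ePlusExpo_pos_one hs hq hj hji hi]
    simp only [smul_eq_mul, Pi.zero_apply, Pi.neg_apply, psiShift_of_pos P wt n (by omega : 0 < i),
        qnum_mul_eq P P.r, qnum_mul_eq P P.rstar, qnum_mul_eq P (P.k + P.N), qpow_k_eq,
      qpow_kN_half_eq, qpow_pow_N_eq, qpow_kN_eq, qpow_r_sub_eq, qpow_rstar_eq, neg_mul, qnum_neg, neg_div,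
          neg_neg, qpow_neg P (2 * _ * _)]
    obtain ⟨hd, hn, hQ, hh, hS, hR, hR1, hR2⟩ := mode_factors_ne_zero hq hr hrs n
    generalize qnum P (wt i * (n : ℕ)) / (n : ℕ) = l0
    generalize qpow P 1 - qpow P (-1) = d, qnum P (n : ℕ) = w, qpow P (n : ℕ) = Q,
      qpow P (P.k / 2 * (n : ℕ)) = h, qpow P (P.N / 2 * (n : ℕ)) = S, qpow P (P.r * (n : ℕ)) = R at *
    field_simp
    ring
  · have hs := shape_psi_pos wt hq hkh n
    rw [negVec_curEExpo, map_add, map_smul, ePlusExpo_neg_one hs hq hj hji hi,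
        psi_pos_dVec wt hq hkh (by omega) hi]
    simp only [smul_eq_mul, Pi.zero_apply, Pi.neg_apply, psiShift_of_pos P wt n (by omega : 0 < i),
        qnum_mul_eq P P.r, qnum_mul_eq P P.rstar, qnum_mul_eq P (P.k + P.N), qpow_k_eq,
      qpow_kN_half_eq, qpow_pow_N_eq, qpow_kN_eq, qpow_r_sub_eq, qpow_rstar_eq, neg_mul, qnum_neg, neg_div,
          neg_neg, qpow_neg P (2 * _ * _)]
    obtain ⟨hd, hn, hQ, hh, hS, hR, hR1, hR2⟩ := mode_factors_ne_zero hq hr hrs n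
    generalize qnum P (wt i * (n : ℕ)) / (n : ℕ) = l0
    generalize qpow P 1 - qpow P (-1) = d, qnum P (n : ℕ) = w, qpow P (n : ℕ) = Q,
      qpow P (P.k / 2 * (n : ℕ)) = h, qpow P (P.N / 2 * (n : ℕ)) = S, qpow P (P.r * (n : ℕ)) = R at *
    field_simp
    ring

/-- The defect L(i+1-j), at the displacement Q^(1-j) = q^(2κn) with κ = (1-j)/2, adds one rational
factor; its constant exchange is left to the zero modes. -/
theorem curE_psi_modes_neg_one (hq : ‖qpow P 1‖ < 1) (hk : P.k ≠ 0) (hkh : P.k + P.N ≠ 0) (hr : 0 < P.r)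
    (hrs : 0 < P.rstar) (hj : 1 ≤ j) (hji : j ≤ i) (hi : i < P.N) :
    ModeExchange P
      (fun n => modePairing P n (posVec n (curEExpo P (-1) (j - 2) i j 0)) (negVec n (psiTotal P wt 0)))
      (fun n => modePairing P n (posVec n (psiTotal P wt 0)) (negVec n (curEExpo P (-1) (j - 2) i j 0)))
      fun u => qpow P (-(-wt i) - 2 * -wt i / P.rstar * u) *
        (theta P P.rstar (u + -wt i / 2) / theta P P.rstar (u - -wt i / 2)) *
        qpow P (-(2 * wt (i + 1 - j))) := by
  refine modeExchange_of_eq ((modeExchange_theta_right hq hrs (-wt i)).add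
    ((modeExchange_swap' hq (wt (i + 1 - j))).shift ((1 - j) / 2))) (fun n => ?_) fun n => ?_
  · obtain ⟨Δ, hs⟩ := shape_psi_neg wt hq hk hkh n
    rw [modePairing_comm, posVec_curEExpo, ePlusExpo_pos_neg_one hs hq hj hji hi]
    simp only [smul_eq_mul, Pi.zero_apply, Pi.neg_apply, psiShift_of_pos P wt n (by omega : 0 < i),
        psiShift_of_pos P wt n (by omega : 0 < i + 1 - j), shift_one_sub, qnum_mul_eq P P.r,
        qnum_mul_eq P P.rstar, qnum_mul_eq P (P.k + P.N), qpow_k_eq,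
      qpow_kN_half_eq, qpow_pow_N_eq, qpow_kN_eq, qpow_r_sub_eq, qpow_rstar_eq, neg_mul, qnum_neg, neg_div,
          neg_neg, qpow_neg P (2 * _ * _)]
    obtain ⟨hd, hn, hQ, hh, hS, hR, hR1, hR2⟩ := mode_factors_ne_zero hq hr hrs n
    generalize qnum P (wt i * (n : ℕ)) / (n : ℕ) = l0
    generalize qnum P (wt (i + 1 - j) * (n : ℕ)) / (n : ℕ) = l1
    generalize qpow P 1 - qpow P (-1) = d, qnum P (n : ℕ) = w, qpow P (n : ℕ) = Q,
      qpow P (P.k / 2 * (n : ℕ)) = h, qpow P (P.N / 2 * (n : ℕ)) = S, qpow P (P.r * (n : ℕ)) = R at *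
    field_simp
    ring
  · have hs := shape_psi_pos wt hq hkh n
    rw [negVec_curEExpo, map_add, map_smul, ePlusExpo_neg_neg_one hs hq hj hji hi,
        psi_pos_dVec wt hq hkh (by omega) hi]
    simp only [smul_eq_mul, Pi.zero_apply, Pi.neg_apply, psiShift_of_pos P wt n (by omega : 0 < i),
        psiShift_of_pos P wt n (by omega : 0 < i + 1 - j), shift_one_sub, qnum_mul_eq P P.r,
        qnum_mul_eq P P.rstar, qnum_mul_eq P (P.k + P.N), qpow_k_eq,
      qpow_kN_half_eq, qpow_pow_N_eq, qpow_kN_eq, qpow_r_sub_eq, qpow_rstar_eq, neg_mul, qnum_neg, neg_div,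
          neg_neg, qpow_neg P (2 * _ * _)]
    obtain ⟨hd, hn, hQ, hh, hS, hR, hR1, hR2⟩ := mode_factors_ne_zero hq hr hrs n
    generalize qnum P (wt i * (n : ℕ)) / (n : ℕ) = l0
    generalize qnum P (wt (i + 1 - j) * (n : ℕ)) / (n : ℕ) = l1
    generalize qpow P 1 - qpow P (-1) = d, qnum P (n : ℕ) = w, qpow P (n : ℕ) = Q,
      qpow P (P.k / 2 * (n : ℕ)) = h, qpow P (P.N / 2 * (n : ℕ)) = S, qpow P (P.r * (n : ℕ)) = R at *
    field_simp
    ring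

/-- For j ≤ i the boson a^i enters through τ_-, hence through creation modes. The annihilation side
is the twist D_i^- alone, which selects `modeExchange_theta_left`. -/
theorem curFLeft_phi_modes_one (hq : ‖qpow P 1‖ < 1) (hk : P.k ≠ 0) (hkh : P.k + P.N ≠ 0) (hr : 0 < P.r)
    (hrs : 0 < P.rstar) (hj : 1 ≤ j) (hji : j ≤ i) (hi : i < P.N) :
    ModeExchange P
      (fun n => modePairing P n (posVec n (curFLeftExpo P 1 (P.k + j + 1) i j 0)) (negVec n (phiTotal P wt
          0)))
      (fun n => modePairing P n (posVec n (phiTotal P wt 0)) (negVec n (curFLeftExpo P 1 (P.k + j + 1) i j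
          0)))
      fun u => qpow P (wt i - 2 * wt i / P.r * u) * (theta P P.r (u + wt i / 2) / theta P P.r (u - wt i /
          2)) := by
  refine modeExchange_of_eq (modeExchange_theta_left hq hr (wt i)) (fun n => ?_) fun n => ?_
  · have hs := shape_phi_neg wt hq hkh n
    rw [modePairing_comm, posVec_curFLeftExpo, map_add, map_smul, eMinusLeftExpo_pos_one hs hq hj hji hi,
        phi_neg_dVec wt hq hkh (by omega) hi]
    simp only [smul_eq_mul, Pi.zero_apply, Pi.neg_apply, qnum_mul_eq P P.r, qnum_mul_eq P P.rstar,
        qnum_mul_eq P (P.k + P.N), qpow_k_eq,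
      qpow_kN_half_eq, qpow_pow_N_eq, qpow_kN_eq, qpow_r_sub_eq, qpow_rstar_eq, neg_mul, qnum_neg, neg_div,
          neg_neg, qpow_neg P (2 * _ * _)]
    obtain ⟨hd, hn, hQ, hh, hS, hR, hR1, hR2⟩ := mode_factors_ne_zero hq hr hrs n
    generalize qnum P (wt i * (n : ℕ)) / (n : ℕ) = l0
    generalize qpow P 1 - qpow P (-1) = d, qnum P (n : ℕ) = w, qpow P (n : ℕ) = Q,
      qpow P (P.k / 2 * (n : ℕ)) = h, qpow P (P.N / 2 * (n : ℕ)) = S, qpow P (P.r * (n : ℕ)) = R at *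
    field_simp
    ring
  · obtain ⟨Δ, hs⟩ := shape_phi_pos wt hq hk hkh n
    rw [negVec_curFLeftExpo, eMinusLeftExpo_neg_one hs hq hj hji hi]
    simp only [smul_eq_mul, Pi.zero_apply, Pi.neg_apply, qnum_mul_eq P P.r, qnum_mul_eq P P.rstar,
        qnum_mul_eq P (P.k + P.N), qpow_k_eq,
      qpow_kN_half_eq, qpow_pow_N_eq, qpow_kN_eq, qpow_r_sub_eq, qpow_rstar_eq, neg_mul, qnum_neg, neg_div,
          neg_neg, qpow_neg P (2 * _ * _)]
    obtain ⟨hd, hn, hQ, hh, hS, hR, hR1, hR2⟩ := mode_factors_ne_zero hq hr hrs n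
    generalize qnum P (wt i * (n : ℕ)) / (n : ℕ) = l0
    generalize qpow P 1 - qpow P (-1) = d, qnum P (n : ℕ) = w, qpow P (n : ℕ) = Q,
      qpow P (P.k / 2 * (n : ℕ)) = h, qpow P (P.N / 2 * (n : ℕ)) = S, qpow P (P.r * (n : ℕ)) = R at *
    field_simp
    ring

/-- For j > i the boson a^i enters through τ_+, hence through annihilation modes, and turns q^(rn)
into its inverse there. The prefactor differs from the case j ≤ i by q^(-2λ^i), which the momenta
compensate. -/
theorem curFRight_phi_modes_one (hq : ‖qpow P 1‖ < 1) (hk : P.k ≠ 0) (hkh : P.k + P.N ≠ 0) (hr : 0 < P.r)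
    (hrs : 0 < P.rstar) (h1 : 1 ≤ i) (hij : i < j) (hj : j ≤ P.N) :
    ModeExchange P
      (fun n => modePairing P n (posVec n (curFRightExpo P 1 (P.k + j) i j 0)) (negVec n (phiTotal P wt 0)))
      (fun n => modePairing P n (posVec n (phiTotal P wt 0)) (negVec n (curFRightExpo P 1 (P.k + j) i j 0)))
      fun u => qpow P (-wt i - 2 * wt i / P.r * u) * (theta P P.r (u + wt i / 2) / theta P P.r (u - wt i /
          2)) := by
  refine modeExchange_of_eq (modeExchange_theta_right hq hr (wt i)) (fun n => ?_) fun n => ?_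
  · have hs := shape_phi_neg wt hq hkh n
    rw [modePairing_comm, posVec_curFRightExpo, map_add, map_smul, eMinusRightExpo_pos_one hs hq h1 hij hj,
        phi_neg_dVec wt hq hkh h1 (by omega)]
    simp only [smul_eq_mul, Pi.zero_apply, Pi.neg_apply, qnum_mul_eq P P.r, qnum_mul_eq P P.rstar,
        qnum_mul_eq P (P.k + P.N), qpow_k_eq,
      qpow_kN_half_eq, qpow_pow_N_eq, qpow_kN_eq, qpow_r_sub_eq, qpow_rstar_eq, neg_mul, qnum_neg, neg_div,
          neg_neg, qpow_neg P (2 * _ * _)]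
    obtain ⟨hd, hn, hQ, hh, hS, hR, hR1, hR2⟩ := mode_factors_ne_zero hq hr hrs n
    generalize qnum P (wt i * (n : ℕ)) / (n : ℕ) = l0
    generalize qpow P 1 - qpow P (-1) = d, qnum P (n : ℕ) = w, qpow P (n : ℕ) = Q,
      qpow P (P.k / 2 * (n : ℕ)) = h, qpow P (P.N / 2 * (n : ℕ)) = S, qpow P (P.r * (n : ℕ)) = R at *
    field_simp
    ring
  · obtain ⟨Δ, hs⟩ := shape_phi_pos wt hq hk hkh n
    rw [negVec_curFRightExpo, eMinusRightExpo_neg_one hs hq h1 hij hj]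
    simp only [smul_eq_mul, Pi.zero_apply, Pi.neg_apply, qnum_mul_eq P P.r, qnum_mul_eq P P.rstar,
        qnum_mul_eq P (P.k + P.N), qpow_k_eq,
      qpow_kN_half_eq, qpow_pow_N_eq, qpow_kN_eq, qpow_r_sub_eq, qpow_rstar_eq, neg_mul, qnum_neg, neg_div,
          neg_neg, qpow_neg P (2 * _ * _)]
    obtain ⟨hd, hn, hQ, hh, hS, hR, hR1, hR2⟩ := mode_factors_ne_zero hq hr hrs n
    generalize qnum P (wt i * (n : ℕ)) / (n : ℕ) = l0
    generalize qpow P 1 - qpow P (-1) = d, qnum P (n : ℕ) = w, qpow P (n : ℕ) = Q,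
      qpow P (P.k / 2 * (n : ℕ)) = h, qpow P (P.N / 2 * (n : ℕ)) = S, qpow P (P.r * (n : ℕ)) = R at *
    field_simp

/-- The twist cancels δ, and only the defect L(i-j) at displacement q^(k+j) remains. The inequality
j < i is strict because the formula for the exchange factor would involve `wt 0` at j = i, whereas
the defect is zero there. -/
theorem curFLeft_psi_modes_one (hq : ‖qpow P 1‖ < 1) (hk : P.k ≠ 0) (hkh : P.k + P.N ≠ 0) (hr : 0 < P.r)
    (hrs : 0 < P.rstar) (hj : 1 ≤ j) (hji : j < i) (hi : i < P.N) :
    ModeExchange P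
      (fun n => modePairing P n (posVec n (curFLeftExpo P 1 (P.k + j + 1) i j 0)) (negVec n (psiTotal P wt
          0)))
      (fun n => modePairing P n (posVec n (psiTotal P wt 0)) (negVec n (curFLeftExpo P 1 (P.k + j + 1) i j
          0)))
      fun _ => qpow P (-(2 * wt (i - j))) := by
  refine modeExchange_of_eq ((modeExchange_swap' hq (wt (i - j))).shift ((P.k + j) / 2)) (fun n => ?_) fun
      n => ?_
  · obtain ⟨Δ, hs⟩ := shape_psi_neg wt hq hk hkh n
    rw [modePairing_comm, posVec_curFLeftExpo, map_add, map_smul, eMinusLeftExpo_pos_one hs hq hj hji.le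
        hi, psi_neg_dVec wt hq hk hkh hrs.ne' (by omega) hi]
    simp only [smul_eq_mul, Pi.zero_apply, Pi.neg_apply, psiShift_of_pos P wt n (by omega : 0 < i - j),
        shift_k_add, qnum_mul_eq P P.r, qnum_mul_eq P P.rstar, qnum_mul_eq P (P.k + P.N), qpow_k_eq,
      qpow_kN_half_eq, qpow_pow_N_eq, qpow_kN_eq, qpow_r_sub_eq, qpow_rstar_eq, neg_mul, qnum_neg, neg_div,
          neg_neg, qpow_neg P (2 * _ * _)]
    obtain ⟨hd, hn, hQ, hh, hS, hR, hR1, hR2⟩ := mode_factors_ne_zero hq hr hrs n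
    generalize qnum P (wt i * (n : ℕ)) / (n : ℕ) = l0
    generalize qnum P (wt (i - j) * (n : ℕ)) / (n : ℕ) = l1
    generalize qpow P 1 - qpow P (-1) = d, qnum P (n : ℕ) = w, qpow P (n : ℕ) = Q,
      qpow P (P.k / 2 * (n : ℕ)) = h, qpow P (P.N / 2 * (n : ℕ)) = S, qpow P (P.r * (n : ℕ)) = R at *
    field_simp
    ring
  · have hs := shape_psi_pos wt hq hkh n
    rw [negVec_curFLeftExpo, eMinusLeftExpo_neg_one hs hq hj hji.le hi]
    simp only [smul_eq_mul, Pi.zero_apply, Pi.neg_apply, psiShift_of_pos P wt n (by omega : 0 < P.N - i),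
        psiShift_of_pos P wt n (by omega : 0 < i - j), shift_k_add, qnum_mul_eq P P.r,
        qnum_mul_eq P P.rstar, qnum_mul_eq P (P.k + P.N), qpow_k_eq,
      qpow_kN_half_eq, qpow_pow_N_eq, qpow_kN_eq, qpow_r_sub_eq, qpow_rstar_eq, neg_mul, qnum_neg, neg_div,
          neg_neg, qpow_neg P (2 * _ * _)]
    obtain ⟨hd, hn, hQ, hh, hS, hR, hR1, hR2⟩ := mode_factors_ne_zero hq hr hrs n
    generalize qnum P (wt (P.N - i) * (n : ℕ)) / (n : ℕ) = l0
    generalize qnum P (wt (i - j) * (n : ℕ)) / (n : ℕ) = l1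
    generalize qpow P 1 - qpow P (-1) = d, qnum P (n : ℕ) = w, qpow P (n : ℕ) = Q,
      qpow P (P.k / 2 * (n : ℕ)) = h, qpow P (P.N / 2 * (n : ℕ)) = S, qpow P (P.r * (n : ℕ)) = R at *
    field_simp
    ring

/-- There is no defect here: the twist and the currents cancel in δ, and λ^{N-i} cancels between the
a-part and the shift. -/
theorem curFRight_psi_modes_one (hq : ‖qpow P 1‖ < 1) (hk : P.k ≠ 0) (hkh : P.k + P.N ≠ 0) (hr : 0 < P.r)
    (hrs : 0 < P.rstar) (h1 : 1 ≤ i) (hij : i < j) (hj : j ≤ P.N) :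
    ModeExchange P
      (fun n => modePairing P n (posVec n (curFRightExpo P 1 (P.k + j) i j 0)) (negVec n (psiTotal P wt 0)))
      (fun n => modePairing P n (posVec n (psiTotal P wt 0)) (negVec n (curFRightExpo P 1 (P.k + j) i j 0)))
      fun _ => 1 := by
  refine modeExchange_of_eq (modeExchange_zero P) (fun n => ?_) fun n => ?_
  · obtain ⟨Δ, hs⟩ := shape_psi_neg wt hq hk hkh n
    rw [modePairing_comm, posVec_curFRightExpo, map_add, map_smul, eMinusRightExpo_pos_one hs hq h1 hij hj,
        psi_neg_dVec wt hq hk hkh hrs.ne' h1 (by omega)]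
    simp only [smul_eq_mul, Pi.zero_apply, Pi.neg_apply, psiShift_of_pos P wt n (by omega : 0 < P.N - i),
        qnum_mul_eq P P.r, qnum_mul_eq P P.rstar, qnum_mul_eq P (P.k + P.N), qpow_k_eq,
      qpow_kN_half_eq, qpow_pow_N_eq, qpow_kN_eq, qpow_r_sub_eq, qpow_rstar_eq, neg_mul, qnum_neg, neg_div,
          neg_neg, qpow_neg P (2 * _ * _)]
    obtain ⟨hd, hn, hQ, hh, hS, hR, hR1, hR2⟩ := mode_factors_ne_zero hq hr hrs n
    generalize qnum P (wt i * (n : ℕ)) / (n : ℕ) = l0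
    generalize qnum P (wt (P.N - i) * (n : ℕ)) / (n : ℕ) = l1
    generalize qpow P 1 - qpow P (-1) = d, qnum P (n : ℕ) = w, qpow P (n : ℕ) = Q,
      qpow P (P.k / 2 * (n : ℕ)) = h, qpow P (P.N / 2 * (n : ℕ)) = S, qpow P (P.r * (n : ℕ)) = R at *
    field_simp
    ring
  · have hs := shape_psi_pos wt hq hkh n
    rw [negVec_curFRightExpo, eMinusRightExpo_neg_one hs hq h1 hij hj]
    simp only [smul_eq_mul, Pi.zero_apply, Pi.neg_apply, qnum_mul_eq P P.r, qnum_mul_eq P P.rstar,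
        qnum_mul_eq P (P.k + P.N), qpow_k_eq,
      qpow_kN_half_eq, qpow_pow_N_eq, qpow_kN_eq, qpow_r_sub_eq, qpow_rstar_eq, neg_mul, qnum_neg, neg_div,
          neg_neg, qpow_neg P (2 * _ * _)]
    obtain ⟨hd, hn, hQ, hh, hS, hR, hR1, hR2⟩ := mode_factors_ne_zero hq hr hrs n
    generalize qnum P (wt i * (n : ℕ)) / (n : ℕ) = l0
    generalize qpow P 1 - qpow P (-1) = d, qnum P (n : ℕ) = w, qpow P (n : ℕ) = Q,
      qpow P (P.k / 2 * (n : ℕ)) = h, qpow P (P.N / 2 * (n : ℕ)) = S, qpow P (P.r * (n : ℕ)) = R at *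
    field_simp
    ring

/-- The modes of ψ_+ change q^(rn) into its inverse in the annihilation part, so H_i^+ uses
`modeExchange_theta_right`. The argument q^(-k/2)z of D_i^- accounts for the displacement by k/4. -/
theorem curH_phi_modes_one (hq : ‖qpow P 1‖ < 1) (hk : P.k ≠ 0) (hkh : P.k + P.N ≠ 0) (hr : 0 < P.r)
    (hrs : 0 < P.rstar) (h1 : 1 ≤ i) (hi : i < P.N) :
    ModeExchange P
      (fun n => modePairing P n (posVec n (curHExpo P 1 i 0)) (negVec n (phiTotal P wt 0)))
      (fun n => modePairing P n (posVec n (phiTotal P wt 0)) (negVec n (curHExpo P 1 i 0)))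
      fun u => qpow P (-wt i - 2 * wt i / P.r * (u - P.k / 4)) *
        (theta P P.r (u - P.k / 4 + wt i / 2) / theta P P.r (u - P.k / 4 - wt i / 2)) := by
  refine modeExchange_of_eq ((modeExchange_theta_right hq hr (wt i)).shift (P.k / 4)) (fun n => ?_) fun n
      => ?_
  · have hs := shape_phi_neg wt hq hkh n
    rw [modePairing_comm, posVec_curHExpo, posVec_psiCurExpo_one, map_add, map_smul, map_smul,
        phi_neg_dVec wt hq hkh h1 hi]
    simp only [smul_eq_mul, Pi.zero_apply, Pi.neg_apply, shift_k_four, sgn_one, one_mul, qnum_mul_eq P P.r,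
        qnum_mul_eq P P.rstar, qnum_mul_eq P (P.k + P.N), qpow_k_eq,
      qpow_kN_half_eq, qpow_pow_N_eq, qpow_kN_eq, qpow_r_sub_eq, qpow_rstar_eq, neg_mul, qnum_neg, neg_div,
          neg_neg, qpow_neg P (2 * _ * _)]
    obtain ⟨hd, hn, hQ, hh, hS, hR, hR1, hR2⟩ := mode_factors_ne_zero hq hr hrs n
    generalize qnum P (wt i * (n : ℕ)) / (n : ℕ) = l0
    generalize qpow P 1 - qpow P (-1) = d, qnum P (n : ℕ) = w, qpow P (n : ℕ) = Q,
      qpow P (P.k / 2 * (n : ℕ)) = h, qpow P (P.N / 2 * (n : ℕ)) = S, qpow P (P.r * (n : ℕ)) = R at *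
    field_simp
    ring
  · obtain ⟨Δ, hs⟩ := shape_phi_pos wt hq hk hkh n
    rw [negVec_curHExpo, negVec_psiCurExpo_one, map_add, map_zero, map_smul,
        phi_pos_dVec wt hq hk hkh hr.ne' h1 hi]
    simp only [smul_eq_mul, Pi.zero_apply, Pi.neg_apply, shift_k_four, sgn_one, one_mul, qnum_mul_eq P P.r,
        qnum_mul_eq P P.rstar, qnum_mul_eq P (P.k + P.N), qpow_k_eq,
      qpow_kN_half_eq, qpow_pow_N_eq, qpow_kN_eq, qpow_r_sub_eq, qpow_rstar_eq, neg_mul, qnum_neg, neg_div,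
          neg_neg, qpow_neg P (2 * _ * _)]
    obtain ⟨hd, hn, hQ, hh, hS, hR, hR1, hR2⟩ := mode_factors_ne_zero hq hr hrs n
    generalize qnum P (wt i * (n : ℕ)) / (n : ℕ) = l0
    generalize qpow P 1 - qpow P (-1) = d, qnum P (n : ℕ) = w, qpow P (n : ℕ) = Q,
      qpow P (P.k / 2 * (n : ℕ)) = h, qpow P (P.N / 2 * (n : ℕ)) = S, qpow P (P.r * (n : ℕ)) = R at *
    field_simp
    ring

/-- Rewriting q^(rn) as q^(r*n) q^(kn) turns the displacement k/4 into -k/4. -/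
theorem curH_psi_modes_one (hq : ‖qpow P 1‖ < 1) (hk : P.k ≠ 0) (hkh : P.k + P.N ≠ 0) (hr : 0 < P.r)
    (hrs : 0 < P.rstar) (h1 : 1 ≤ i) (hi : i < P.N) :
    ModeExchange P
      (fun n => modePairing P n (posVec n (curHExpo P 1 i 0)) (negVec n (psiTotal P wt 0)))
      (fun n => modePairing P n (posVec n (psiTotal P wt 0)) (negVec n (curHExpo P 1 i 0)))
      fun u => qpow P (-(-wt i) - 2 * -wt i / P.rstar * (u - -(P.k / 4))) *
        (theta P P.rstar (u - -(P.k / 4) + -wt i / 2) / theta P P.rstar (u - -(P.k / 4) - -wt i / 2)) := by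
  refine modeExchange_of_eq ((modeExchange_theta_right hq hrs (-wt i)).shift (-(P.k / 4))) (fun n => ?_)
      fun n => ?_
  · obtain ⟨Δ, hs⟩ := shape_psi_neg wt hq hk hkh n
    rw [modePairing_comm, posVec_curHExpo, posVec_psiCurExpo_one, map_add, map_smul, map_smul,
        psi_neg_dVec wt hq hk hkh hrs.ne' h1 hi]
    simp only [smul_eq_mul, Pi.zero_apply, Pi.neg_apply, shift_neg_k_four, sgn_one, one_mul,
        qnum_mul_eq P P.r, qnum_mul_eq P P.rstar, qnum_mul_eq P (P.k + P.N), qpow_k_eq,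
      qpow_kN_half_eq, qpow_pow_N_eq, qpow_kN_eq, qpow_r_sub_eq, qpow_rstar_eq, neg_mul, qnum_neg, neg_div,
          neg_neg, qpow_neg P (2 * _ * _)]
    obtain ⟨hd, hn, hQ, hh, hS, hR, hR1, hR2⟩ := mode_factors_ne_zero hq hr hrs n
    generalize qnum P (wt i * (n : ℕ)) / (n : ℕ) = l0
    generalize qpow P 1 - qpow P (-1) = d, qnum P (n : ℕ) = w, qpow P (n : ℕ) = Q,
      qpow P (P.k / 2 * (n : ℕ)) = h, qpow P (P.N / 2 * (n : ℕ)) = S, qpow P (P.r * (n : ℕ)) = R at *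
    field_simp
    ring
  · have hs := shape_psi_pos wt hq hkh n
    rw [negVec_curHExpo, negVec_psiCurExpo_one, map_add, map_zero, map_smul, psi_pos_dVec wt hq hkh h1 hi]
    simp only [smul_eq_mul, Pi.zero_apply, Pi.neg_apply, shift_neg_k_four, sgn_one, one_mul,
        qnum_mul_eq P P.r, qnum_mul_eq P P.rstar, qnum_mul_eq P (P.k + P.N), qpow_k_eq,
      qpow_kN_half_eq, qpow_pow_N_eq, qpow_kN_eq, qpow_r_sub_eq, qpow_rstar_eq, neg_mul, qnum_neg, neg_div,
          neg_neg, qpow_neg P (2 * _ * _)]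
    obtain ⟨hd, hn, hQ, hh, hS, hR, hR1, hR2⟩ := mode_factors_ne_zero hq hr hrs n
    generalize qnum P (wt i * (n : ℕ)) / (n : ℕ) = l0
    generalize qpow P 1 - qpow P (-1) = d, qnum P (n : ℕ) = w, qpow P (n : ℕ) = Q,
      qpow P (P.k / 2 * (n : ℕ)) = h, qpow P (P.N / 2 * (n : ℕ)) = S, qpow P (P.r * (n : ℕ)) = R at *
    field_simp
    ring

theorem curFLeft_phi_modes_neg_one (hq : ‖qpow P 1‖ < 1) (hk : P.k ≠ 0) (hkh : P.k + P.N ≠ 0) (hr : 0 < P.r)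
    (hrs : 0 < P.rstar) (hj : 1 ≤ j) (hji : j ≤ i) (hi : i < P.N) :
    ModeExchange P
      (fun n => modePairing P n (posVec n (curFLeftExpo P (-1) (P.k + j - 1) i j 0)) (negVec n (phiTotal P
          wt 0)))
      (fun n => modePairing P n (posVec n (phiTotal P wt 0)) (negVec n (curFLeftExpo P (-1) (P.k + j - 1) i
          j 0)))
      fun u => qpow P (wt i - 2 * wt i / P.r * u) * (theta P P.r (u + wt i / 2) / theta P P.r (u - wt i /
          2)) := by
  refine modeExchange_of_eq (modeExchange_theta_left hq hr (wt i)) (fun n => ?_) fun n => ?_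
  · have hs := shape_phi_neg wt hq hkh n
    rw [modePairing_comm, posVec_curFLeftExpo, map_add, map_smul, eMinusLeftExpo_pos_neg_one hs hq hj hji
        hi, phi_neg_dVec wt hq hkh (by omega) hi]
    simp only [smul_eq_mul, Pi.zero_apply, Pi.neg_apply, qnum_mul_eq P P.r, qnum_mul_eq P P.rstar,
        qnum_mul_eq P (P.k + P.N), qpow_k_eq,
      qpow_kN_half_eq, qpow_pow_N_eq, qpow_kN_eq, qpow_r_sub_eq, qpow_rstar_eq, neg_mul, qnum_neg, neg_div,
          neg_neg, qpow_neg P (2 * _ * _)]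
    obtain ⟨hd, hn, hQ, hh, hS, hR, hR1, hR2⟩ := mode_factors_ne_zero hq hr hrs n
    generalize qnum P (wt i * (n : ℕ)) / (n : ℕ) = l0
    generalize qpow P 1 - qpow P (-1) = d, qnum P (n : ℕ) = w, qpow P (n : ℕ) = Q,
      qpow P (P.k / 2 * (n : ℕ)) = h, qpow P (P.N / 2 * (n : ℕ)) = S, qpow P (P.r * (n : ℕ)) = R at *
    field_simp
    ring
  · obtain ⟨Δ, hs⟩ := shape_phi_pos wt hq hk hkh n
    rw [negVec_curFLeftExpo, eMinusLeftExpo_neg_neg_one hs hq hj hji hi]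
    simp only [smul_eq_mul, Pi.zero_apply, Pi.neg_apply, qnum_mul_eq P P.r, qnum_mul_eq P P.rstar,
        qnum_mul_eq P (P.k + P.N), qpow_k_eq,
      qpow_kN_half_eq, qpow_pow_N_eq, qpow_kN_eq, qpow_r_sub_eq, qpow_rstar_eq, neg_mul, qnum_neg, neg_div,
          neg_neg, qpow_neg P (2 * _ * _)]
    obtain ⟨hd, hn, hQ, hh, hS, hR, hR1, hR2⟩ := mode_factors_ne_zero hq hr hrs n
    generalize qnum P (wt i * (n : ℕ)) / (n : ℕ) = l0
    generalize qpow P 1 - qpow P (-1) = d, qnum P (n : ℕ) = w, qpow P (n : ℕ) = Q,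
      qpow P (P.k / 2 * (n : ℕ)) = h, qpow P (P.N / 2 * (n : ℕ)) = S, qpow P (P.r * (n : ℕ)) = R at *
    field_simp
    ring

theorem curFRight_phi_modes_neg_one (hq : ‖qpow P 1‖ < 1) (hk : P.k ≠ 0) (hkh : P.k + P.N ≠ 0) (hr : 0 <
    P.r)
    (hrs : 0 < P.rstar) (h1 : 1 ≤ i) (hij : i < j) (hj : j ≤ P.N) :
    ModeExchange P
      (fun n => modePairing P n (posVec n (curFRightExpo P (-1) (P.k + j - 2) i j 0)) (negVec n (phiTotal P
          wt 0)))
      (fun n => modePairing P n (posVec n (phiTotal P wt 0)) (negVec n (curFRightExpo P (-1) (P.k + j - 2)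
          i j 0)))
      fun u => qpow P (-wt i - 2 * wt i / P.r * u) * (theta P P.r (u + wt i / 2) / theta P P.r (u - wt i /
          2)) := by
  refine modeExchange_of_eq (modeExchange_theta_right hq hr (wt i)) (fun n => ?_) fun n => ?_
  · have hs := shape_phi_neg wt hq hkh n
    rw [modePairing_comm, posVec_curFRightExpo, map_add, map_smul, eMinusRightExpo_pos_neg_one hs hq h1 hij
        hj, phi_neg_dVec wt hq hkh h1 (by omega)]
    simp only [smul_eq_mul, Pi.zero_apply, Pi.neg_apply, qnum_mul_eq P P.r, qnum_mul_eq P P.rstar,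
        qnum_mul_eq P (P.k + P.N), qpow_k_eq,
      qpow_kN_half_eq, qpow_pow_N_eq, qpow_kN_eq, qpow_r_sub_eq, qpow_rstar_eq, neg_mul, qnum_neg, neg_div,
          neg_neg, qpow_neg P (2 * _ * _)]
    obtain ⟨hd, hn, hQ, hh, hS, hR, hR1, hR2⟩ := mode_factors_ne_zero hq hr hrs n
    generalize qnum P (wt i * (n : ℕ)) / (n : ℕ) = l0
    generalize qpow P 1 - qpow P (-1) = d, qnum P (n : ℕ) = w, qpow P (n : ℕ) = Q,
      qpow P (P.k / 2 * (n : ℕ)) = h, qpow P (P.N / 2 * (n : ℕ)) = S, qpow P (P.r * (n : ℕ)) = R at *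
    field_simp
    ring
  · obtain ⟨Δ, hs⟩ := shape_phi_pos wt hq hk hkh n
    rw [negVec_curFRightExpo, eMinusRightExpo_neg_neg_one hs hq h1 hij hj]
    simp only [smul_eq_mul, Pi.zero_apply, Pi.neg_apply, qnum_mul_eq P P.r, qnum_mul_eq P P.rstar,
        qnum_mul_eq P (P.k + P.N), qpow_k_eq,
      qpow_kN_half_eq, qpow_pow_N_eq, qpow_kN_eq, qpow_r_sub_eq, qpow_rstar_eq, neg_mul, qnum_neg, neg_div,
          neg_neg, qpow_neg P (2 * _ * _)]
    obtain ⟨hd, hn, hQ, hh, hS, hR, hR1, hR2⟩ := mode_factors_ne_zero hq hr hrs n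
    generalize qnum P (wt i * (n : ℕ)) / (n : ℕ) = l0
    generalize qpow P 1 - qpow P (-1) = d, qnum P (n : ℕ) = w, qpow P (n : ℕ) = Q,
      qpow P (P.k / 2 * (n : ℕ)) = h, qpow P (P.N / 2 * (n : ℕ)) = S, qpow P (P.r * (n : ℕ)) = R at *
    field_simp
    ring

/-- Without a defect the contractions vanish, so here j = i is allowed; this covers the single term
of e^{-,i} at j = i. -/
theorem curFLeft_psi_modes_neg_one (hq : ‖qpow P 1‖ < 1) (hk : P.k ≠ 0) (hkh : P.k + P.N ≠ 0) (hr : 0 < P.r)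
    (hrs : 0 < P.rstar) (hj : 1 ≤ j) (hji : j ≤ i) (hi : i < P.N) :
    ModeExchange P
      (fun n => modePairing P n (posVec n (curFLeftExpo P (-1) (P.k + j - 1) i j 0)) (negVec n (psiTotal P
          wt 0)))
      (fun n => modePairing P n (posVec n (psiTotal P wt 0)) (negVec n (curFLeftExpo P (-1) (P.k + j - 1) i
          j 0)))
      fun _ => 1 := by
  refine modeExchange_of_eq (modeExchange_zero P) (fun n => ?_) fun n => ?_
  · obtain ⟨Δ, hs⟩ := shape_psi_neg wt hq hk hkh n
    rw [modePairing_comm, posVec_curFLeftExpo, map_add, map_smul, eMinusLeftExpo_pos_neg_one hs hq hj hji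
        hi, psi_neg_dVec wt hq hk hkh hrs.ne' (by omega) hi]
    simp only [smul_eq_mul, Pi.zero_apply, Pi.neg_apply, qnum_mul_eq P P.r, qnum_mul_eq P P.rstar,
        qnum_mul_eq P (P.k + P.N), qpow_k_eq,
      qpow_kN_half_eq, qpow_pow_N_eq, qpow_kN_eq, qpow_r_sub_eq, qpow_rstar_eq, neg_mul, qnum_neg, neg_div,
          neg_neg, qpow_neg P (2 * _ * _)]
    obtain ⟨hd, hn, hQ, hh, hS, hR, hR1, hR2⟩ := mode_factors_ne_zero hq hr hrs n
    generalize qnum P (wt i * (n : ℕ)) / (n : ℕ) = l0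
    generalize qpow P 1 - qpow P (-1) = d, qnum P (n : ℕ) = w, qpow P (n : ℕ) = Q,
      qpow P (P.k / 2 * (n : ℕ)) = h, qpow P (P.N / 2 * (n : ℕ)) = S, qpow P (P.r * (n : ℕ)) = R at *
    field_simp
    ring
  · have hs := shape_psi_pos wt hq hkh n
    rw [negVec_curFLeftExpo, eMinusLeftExpo_neg_neg_one hs hq hj hji hi]
    simp only [smul_eq_mul, Pi.zero_apply, Pi.neg_apply, psiShift_of_pos P wt n (by omega : 0 < P.N - i),
        qnum_mul_eq P P.r, qnum_mul_eq P P.rstar, qnum_mul_eq P (P.k + P.N), qpow_k_eq,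
      qpow_kN_half_eq, qpow_pow_N_eq, qpow_kN_eq, qpow_r_sub_eq, qpow_rstar_eq, neg_mul, qnum_neg, neg_div,
          neg_neg, qpow_neg P (2 * _ * _)]
    obtain ⟨hd, hn, hQ, hh, hS, hR, hR1, hR2⟩ := mode_factors_ne_zero hq hr hrs n
    generalize qnum P (wt (P.N - i) * (n : ℕ)) / (n : ℕ) = l0
    generalize qpow P 1 - qpow P (-1) = d, qnum P (n : ℕ) = w, qpow P (n : ℕ) = Q,
      qpow P (P.k / 2 * (n : ℕ)) = h, qpow P (P.N / 2 * (n : ℕ)) = S, qpow P (P.r * (n : ℕ)) = R at *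
    field_simp
    ring

/-- The defect L(j-i-1) is present only for j > i + 1, which is also the range in which these terms
occur. -/
theorem curFRight_psi_modes_neg_one (hq : ‖qpow P 1‖ < 1) (hk : P.k ≠ 0) (hkh : P.k + P.N ≠ 0) (hr : 0 <
    P.r)
    (hrs : 0 < P.rstar) (h1 : 1 ≤ i) (hij : i + 1 < j) (hj : j ≤ P.N) :
    ModeExchange P
      (fun n => modePairing P n (posVec n (curFRightExpo P (-1) (P.k + j - 2) i j 0)) (negVec n (psiTotal P
          wt 0)))
      (fun n => modePairing P n (posVec n (psiTotal P wt 0)) (negVec n (curFRightExpo P (-1) (P.k + j - 2)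
          i j 0)))
      fun _ => qpow P (-(2 * wt (j - (i + 1)))) := by
  refine modeExchange_of_eq ((modeExchange_swap' hq (wt (j - (i + 1)))).shift ((1 - P.k - j) / 2)) (fun n
      => ?_) fun n => ?_
  · obtain ⟨Δ, hs⟩ := shape_psi_neg wt hq hk hkh n
    rw [modePairing_comm, posVec_curFRightExpo, map_add, map_smul, eMinusRightExpo_pos_neg_one hs hq h1 (by
        omega) hj, psi_neg_dVec wt hq hk hkh hrs.ne' h1 (by omega)]
    simp only [smul_eq_mul, Pi.zero_apply, Pi.neg_apply, psiShift_of_pos P wt n (by omega : 0 < P.N - i),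
        psiShift_of_pos P wt n (by omega : 0 < j - (i + 1)), shift_one_sub_k_sub, qnum_mul_eq P P.r,
        qnum_mul_eq P P.rstar, qnum_mul_eq P (P.k + P.N), qpow_k_eq,
      qpow_kN_half_eq, qpow_pow_N_eq, qpow_kN_eq, qpow_r_sub_eq, qpow_rstar_eq, neg_mul, qnum_neg, neg_div,
          neg_neg, qpow_neg P (2 * _ * _)]
    obtain ⟨hd, hn, hQ, hh, hS, hR, hR1, hR2⟩ := mode_factors_ne_zero hq hr hrs n
    generalize qnum P (wt i * (n : ℕ)) / (n : ℕ) = l0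
    generalize qnum P (wt (P.N - i) * (n : ℕ)) / (n : ℕ) = l1
    generalize qnum P (wt (j - (i + 1)) * (n : ℕ)) / (n : ℕ) = l2
    generalize qpow P 1 - qpow P (-1) = d, qnum P (n : ℕ) = w, qpow P (n : ℕ) = Q,
      qpow P (P.k / 2 * (n : ℕ)) = h, qpow P (P.N / 2 * (n : ℕ)) = S, qpow P (P.r * (n : ℕ)) = R at *
    field_simp
    ring
  · have hs := shape_psi_pos wt hq hkh n
    rw [negVec_curFRightExpo, eMinusRightExpo_neg_neg_one hs hq h1 (by omega) hj]
    simp only [smul_eq_mul, Pi.zero_apply, Pi.neg_apply, psiShift_of_pos P wt n (by omega : 0 < j - (i +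
        1)), shift_one_sub_k_sub, qnum_mul_eq P P.r, qnum_mul_eq P P.rstar, qnum_mul_eq P (P.k + P.N),
        qpow_k_eq,
      qpow_kN_half_eq, qpow_pow_N_eq, qpow_kN_eq, qpow_r_sub_eq, qpow_rstar_eq, neg_mul, qnum_neg, neg_div,
          neg_neg, qpow_neg P (2 * _ * _)]
    obtain ⟨hd, hn, hQ, hh, hS, hR, hR1, hR2⟩ := mode_factors_ne_zero hq hr hrs n
    generalize qnum P (wt i * (n : ℕ)) / (n : ℕ) = l0
    generalize qnum P (wt (j - (i + 1)) * (n : ℕ)) / (n : ℕ) = l1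
    generalize qpow P 1 - qpow P (-1) = d, qnum P (n : ℕ) = w, qpow P (n : ℕ) = Q,
      qpow P (P.k / 2 * (n : ℕ)) = h, qpow P (P.N / 2 * (n : ℕ)) = S, qpow P (P.r * (n : ℕ)) = R at *
    field_simp
    ring

/-- For H_i^- the current ψ_- has no annihilation modes, so the twist alone remains there, and
`modeExchange_theta_left` applies with displacement -k/4. -/
theorem curH_phi_modes_neg_one (hq : ‖qpow P 1‖ < 1) (hk : P.k ≠ 0) (hkh : P.k + P.N ≠ 0) (hr : 0 < P.r)
    (hrs : 0 < P.rstar) (h1 : 1 ≤ i) (hi : i < P.N) :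
    ModeExchange P
      (fun n => modePairing P n (posVec n (curHExpo P (-1) i 0)) (negVec n (phiTotal P wt 0)))
      (fun n => modePairing P n (posVec n (phiTotal P wt 0)) (negVec n (curHExpo P (-1) i 0)))
      fun u => qpow P (wt i - 2 * wt i / P.r * (u - -(P.k / 4))) *
        (theta P P.r (u - -(P.k / 4) + wt i / 2) / theta P P.r (u - -(P.k / 4) - wt i / 2)) := by
  refine modeExchange_of_eq ((modeExchange_theta_left hq hr (wt i)).shift (-(P.k / 4))) (fun n => ?_) fun n
      => ?_
  · have hs := shape_phi_neg wt hq hkh n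
    rw [modePairing_comm, posVec_curHExpo, posVec_psiCurExpo_neg_one, map_add, map_zero, map_smul,
        phi_neg_dVec wt hq hkh h1 hi]
    simp only [smul_eq_mul, Pi.zero_apply, Pi.neg_apply, shift_neg_k_four, sgn_neg_one, one_mul,
        qpow_neg P (P.k / 2 * _), qnum_mul_eq P P.r, qnum_mul_eq P P.rstar, qnum_mul_eq P (P.k + P.N),
        qpow_k_eq,
      qpow_kN_half_eq, qpow_pow_N_eq, qpow_kN_eq, qpow_r_sub_eq, qpow_rstar_eq, neg_mul, qnum_neg, neg_div,
          neg_neg, qpow_neg P (2 * _ * _)]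
    obtain ⟨hd, hn, hQ, hh, hS, hR, hR1, hR2⟩ := mode_factors_ne_zero hq hr hrs n
    generalize qnum P (wt i * (n : ℕ)) / (n : ℕ) = l0
    generalize qpow P 1 - qpow P (-1) = d, qnum P (n : ℕ) = w, qpow P (n : ℕ) = Q,
      qpow P (P.k / 2 * (n : ℕ)) = h, qpow P (P.N / 2 * (n : ℕ)) = S, qpow P (P.r * (n : ℕ)) = R at *
    field_simp
    ring
  · obtain ⟨Δ, hs⟩ := shape_phi_pos wt hq hk hkh n
    rw [negVec_curHExpo, negVec_psiCurExpo_neg_one, map_add, map_smul, map_smul,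
        phi_pos_dVec wt hq hk hkh hr.ne' h1 hi]
    simp only [smul_eq_mul, Pi.zero_apply, Pi.neg_apply, shift_neg_k_four, sgn_neg_one, one_mul,
        qpow_neg P (P.k / 2 * _), qnum_mul_eq P P.r, qnum_mul_eq P P.rstar, qnum_mul_eq P (P.k + P.N),
        qpow_k_eq,
      qpow_kN_half_eq, qpow_pow_N_eq, qpow_kN_eq, qpow_r_sub_eq, qpow_rstar_eq, neg_mul, qnum_neg, neg_div,
          neg_neg, qpow_neg P (2 * _ * _)]
    obtain ⟨hd, hn, hQ, hh, hS, hR, hR1, hR2⟩ := mode_factors_ne_zero hq hr hrs n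
    generalize qnum P (wt i * (n : ℕ)) / (n : ℕ) = l0
    generalize qpow P 1 - qpow P (-1) = d, qnum P (n : ℕ) = w, qpow P (n : ℕ) = Q,
      qpow P (P.k / 2 * (n : ℕ)) = h, qpow P (P.N / 2 * (n : ℕ)) = S, qpow P (P.r * (n : ℕ)) = R at *
    field_simp
    ring

theorem curH_psi_modes_neg_one (hq : ‖qpow P 1‖ < 1) (hk : P.k ≠ 0) (hkh : P.k + P.N ≠ 0) (hr : 0 < P.r)
    (hrs : 0 < P.rstar) (h1 : 1 ≤ i) (hi : i < P.N) :
    ModeExchange P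
      (fun n => modePairing P n (posVec n (curHExpo P (-1) i 0)) (negVec n (psiTotal P wt 0)))
      (fun n => modePairing P n (posVec n (psiTotal P wt 0)) (negVec n (curHExpo P (-1) i 0)))
      fun u => qpow P (-wt i - 2 * -wt i / P.rstar * (u - P.k / 4)) *
        (theta P P.rstar (u - P.k / 4 + -wt i / 2) / theta P P.rstar (u - P.k / 4 - -wt i / 2)) := by
  refine modeExchange_of_eq ((modeExchange_theta_left hq hrs (-wt i)).shift (P.k / 4)) (fun n => ?_) fun n
      => ?_
  · obtain ⟨Δ, hs⟩ := shape_psi_neg wt hq hk hkh n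
    rw [modePairing_comm, posVec_curHExpo, posVec_psiCurExpo_neg_one, map_add, map_zero, map_smul,
        psi_neg_dVec wt hq hk hkh hrs.ne' h1 hi]
    simp only [smul_eq_mul, Pi.zero_apply, Pi.neg_apply, shift_k_four, sgn_neg_one, one_mul,
        qpow_neg P (P.k / 2 * _), qnum_mul_eq P P.r, qnum_mul_eq P P.rstar, qnum_mul_eq P (P.k + P.N),
        qpow_k_eq,
      qpow_kN_half_eq, qpow_pow_N_eq, qpow_kN_eq, qpow_r_sub_eq, qpow_rstar_eq, neg_mul, qnum_neg, neg_div,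
          neg_neg, qpow_neg P (2 * _ * _)]
    obtain ⟨hd, hn, hQ, hh, hS, hR, hR1, hR2⟩ := mode_factors_ne_zero hq hr hrs n
    generalize qnum P (wt i * (n : ℕ)) / (n : ℕ) = l0
    generalize qpow P 1 - qpow P (-1) = d, qnum P (n : ℕ) = w, qpow P (n : ℕ) = Q,
      qpow P (P.k / 2 * (n : ℕ)) = h, qpow P (P.N / 2 * (n : ℕ)) = S, qpow P (P.r * (n : ℕ)) = R at *
    field_simp
    ring
  · have hs := shape_psi_pos wt hq hkh n
    rw [negVec_curHExpo, negVec_psiCurExpo_neg_one, map_add, map_smul, map_smul,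
        psi_pos_dVec wt hq hkh h1 hi]
    simp only [smul_eq_mul, Pi.zero_apply, Pi.neg_apply, shift_k_four, sgn_neg_one, one_mul,
        qpow_neg P (P.k / 2 * _), qnum_mul_eq P P.r, qnum_mul_eq P P.rstar, qnum_mul_eq P (P.k + P.N),
        qpow_k_eq,
      qpow_kN_half_eq, qpow_pow_N_eq, qpow_kN_eq, qpow_r_sub_eq, qpow_rstar_eq, neg_mul, qnum_neg, neg_div,
          neg_neg, qpow_neg P (2 * _ * _)]
    obtain ⟨hd, hn, hQ, hh, hS, hR, hR1, hR2⟩ := mode_factors_ne_zero hq hr hrs n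
    generalize qnum P (wt i * (n : ℕ)) / (n : ℕ) = l0
    generalize qpow P 1 - qpow P (-1) = d, qnum P (n : ℕ) = w, qpow P (n : ℕ) = Q,
      qpow P (P.k / 2 * (n : ℕ)) = h, qpow P (P.N / 2 * (n : ℕ)) = S, qpow P (P.r * (n : ℕ)) = R at *
    field_simp
    ring

end Pairings

/-! ### Zero modes of the vertex operators -/

/-- The coefficients of the dual zero modes `p̌_i`, `q̌_i`. -/
def vhatCheck (P : Params) (i : ℕ) : AIdx P.N → ℂ :=
  ∑ j ∈ Finset.Ico 1 P.N, ((min i j : ℕ) * (P.N - (max i j : ℕ)) / P.N : ℂ) • vhat P j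

/-- The coefficients of `ȟ_i`. -/
def hVecCheck (P : Params) (i : ℕ) : BVec P.N :=
  ∑ j ∈ Finset.Ico 1 P.N, ((min i j : ℕ) * (P.N - (max i j : ℕ)) / P.N : ℂ) • hVec P j

section ZeroModes

variable (P : Params) (wt : ℕ → ℂ) (s : ℂ)

theorem pVec_phiTotal : pVec (phiTotal P wt s) = ∑ i ∈ Finset.Ico 1 P.N,
    ((wt i * (s * P.logq)) • aDualZero P i + (-(wt i / P.r) * (s * P.logq)) •
      (hVecCheck P i - (P.k + P.N : ℂ) • aDualZero P i)) := by
  simp only [phiTotal, phiExpo, tPlusExpo, pCheck, hCheck, phat, hExpo, map_add, map_sub, map_smul, map_sum,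
    pVec_modeSum, pVec_qPart, pVec_pPart, pVec_phatPart, smul_zero, Finset.sum_const_zero, add_zero,
        zero_add,
    hVecCheck, smul_smul]

theorem qVec_phiTotal : qVec (phiTotal P wt s) = ∑ i ∈ Finset.Ico 1 P.N, wt i • aDualZero P i := by
  simp only [phiTotal, phiExpo, tPlusExpo, pCheck, hCheck, phat, hExpo, map_add, map_sub, map_smul, map_sum,
    qVec_modeSum, qVec_qPart, qVec_pPart, qVec_phatPart, smul_zero, Finset.sum_const_zero, add_zero,
        zero_add,
    sub_zero]

theorem phVec_phiTotal : phVec (phiTotal P wt s) =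
    ∑ i ∈ Finset.Ico 1 P.N, (-(wt i / P.r) * (s * P.logq)) • vhatCheck P i := by
  simp only [phiTotal, phiExpo, tPlusExpo, pCheck, hCheck, phat, hExpo, map_add, map_sub, map_smul, map_sum,
    phVec_modeSum, phVec_qPart, phVec_pPart, phVec_phatPart, smul_zero, Finset.sum_const_zero, add_zero,
        zero_add,
    sub_zero, vhatCheck]

theorem qhVec_phiTotal : qhVec (phiTotal P wt s) = 0 := by
  simp only [phiTotal, phiExpo, tPlusExpo, pCheck, hCheck, phat, hExpo, map_add, map_sub, map_smul, map_sum,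
    qhVec_modeSum, qhVec_qPart, qhVec_pPart, qhVec_phatPart, smul_zero, Finset.sum_const_zero, add_zero,
    zero_add, sub_zero]

theorem pVec_psiTotal : pVec (psiTotal P wt s) = ∑ i ∈ Finset.Ico 1 P.N,
    ((wt (P.N - i) * (s * P.logq)) • aDualZero P i +
      ∑ j ∈ Finset.Icc (i + 1) P.N, ((s * P.logq) * wt (j - i)) • vbc P i j) := by
  simp only [psiTotal, psiExpo, tMinusExpo, pCheck, qCheck, phat, qhat, map_add, map_neg, map_sub, map_smul,
    map_sum, pVec_modeSum, pVec_qPart, pVec_pPart, pVec_phatPart, pVec_qhatPart, smul_zero, neg_zero,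
    Finset.sum_const_zero, add_zero, zero_add, sub_zero, smul_smul, mul_comm (s * P.logq)]

theorem qVec_psiTotal : qVec (psiTotal P wt s) = ∑ i ∈ Finset.Ico 1 P.N,
    (wt (P.N - i) • aDualZero P i + ∑ j ∈ Finset.Icc (i + 1) P.N, wt (j - i) • vbc P i j) := by
  simp only [psiTotal, psiExpo, tMinusExpo, pCheck, qCheck, phat, qhat, map_add, map_neg, map_sub, map_smul,
    map_sum, qVec_modeSum, qVec_qPart, qVec_pPart, qVec_phatPart, qVec_qhatPart, smul_zero, neg_zero,
    Finset.sum_const_zero, add_zero, zero_add, sub_zero]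

theorem phVec_psiTotal : phVec (psiTotal P wt s) =
    ∑ i ∈ Finset.Ico 1 P.N, (wt i / P.rstar * (s * P.logq)) • vhatCheck P i := by
  simp only [psiTotal, psiExpo, tMinusExpo, pCheck, qCheck, phat, qhat, map_add, map_neg, map_sub, map_smul,
    map_sum, phVec_modeSum, phVec_qPart, phVec_pPart, phVec_phatPart, phVec_qhatPart, smul_zero, neg_zero,
    Finset.sum_const_zero, add_zero, zero_add, sub_zero, vhatCheck]

theorem qhVec_psiTotal : qhVec (psiTotal P wt s) =
    ∑ i ∈ Finset.Ico 1 P.N, (-(2 * wt i)) • vhatCheck P i := by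
  simp only [psiTotal, psiExpo, tMinusExpo, pCheck, qCheck, phat, qhat, map_add, map_neg, map_sub, map_smul,
    map_sum, qhVec_modeSum, qhVec_qPart, qhVec_pPart, qhVec_phatPart, qhVec_qhatPart, smul_zero, neg_zero,
    Finset.sum_const_zero, add_zero, zero_add, sub_zero, vhatCheck]

variable {P} {i : ℕ}

/-- The kernel of p̌ and q̌ is the inverse Cartan matrix, and the bracket of the hatted modes is
-1/2 times the Cartan matrix. -/
theorem hatBracket_vhatCheck (x : ℕ → ℂ) (h1 : 1 ≤ i) (hi : i < P.N) :
    bilinOf (hatBracket P) (∑ l ∈ Finset.Ico 1 P.N, x l • vhatCheck P l) (vhat P i) = -(x i / 2) := by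
  have hN : (P.N : ℂ) ≠ 0 := by exact_mod_cast (by omega : P.N ≠ 0)
  have e : ∀ l ∈ Finset.Ico 1 P.N, bilinOf (hatBracket P) (x l • vhatCheck P l) (vhat P i) =
      if l = i then -(x i / 2) else 0 := by
    intro l hl
    rw [Finset.mem_Ico] at hl
    have hs := sum_cartan_min_max hl.1 hl.2 h1 hi
    rw [show (if l = i then -(x i / 2) else 0) = (if l = i then (P.N : ℂ) else 0) * (-(x l / 2) / P.N) by
      split_ifs with h
      · rw [h]; field_simp
      · ring, ← hs, Finset.sum_mul, vhatCheck, map_smul, map_sum, LinearMap.smul_apply, LinearMap.sum_apply,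
      smul_eq_mul, Finset.mul_sum]
    refine Finset.sum_congr rfl fun j hj => ?_
    rw [Finset.mem_Ico] at hj
    rw [map_smul, LinearMap.smul_apply, hatBracket_vhat P hj.1 hj.2 h1 hi, smul_eq_mul, cartan_comm]
    field_simp
  rw [map_sum, LinearMap.sum_apply, Finset.sum_congr rfl e, Finset.sum_ite_eq',
    if_pos (Finset.mem_Ico.2 ⟨h1, hi⟩)]

theorem hatBracket_comm (x y : AIdx P.N → ℂ) :
    bilinOf (hatBracket P) x y = bilinOf (hatBracket P) y x :=
  bilinOf_comm (fun i j => by rw [hatBracket, hatBracket, cartan_comm]) x y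

theorem sum_check_mul_cartan {N l : ℕ} (hl : 1 ≤ l) (hlN : l < N) (h1 : 1 ≤ i) (hi : i < N) :
    ∑ j ∈ Finset.Ico 1 N, ((min l j : ℕ) * (N - (max l j : ℕ)) / N : ℂ) * cartan j i =
      if l = i then 1 else 0 := by
  have hN : (N : ℂ) ≠ 0 := by exact_mod_cast (by omega : N ≠ 0)
  have hs := sum_cartan_min_max hl hlN h1 hi
  rw [show (if l = i then (1 : ℂ) else 0) = (if l = i then (N : ℂ) else 0) / N by
    split_ifs
    · rw [div_self hN]
    · rw [zero_div], ← hs, Finset.sum_div]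
  refine Finset.sum_congr rfl fun j _ => ?_
  rw [cartan_comm]
  ring

/-- The case Q = 1 of the duality of the a bosons, with the ordinary Cartan matrix. -/
theorem shape_sum_aDualZero (hkh : P.k + P.N ≠ 0) (x : ℕ → ℂ) :
    Shape P 1 (∑ l ∈ Finset.Ico 1 P.N, x l • bilinOf (zeroBracket P) (aDualZero P l)) 0 x 0 0 := by
  have hkN : (P.k + P.N : ℂ) ≠ 0 := by exact_mod_cast hkh
  have h0 : ∀ l ∈ Finset.Ico 1 P.N, Shape P 1 (bilinOf (zeroBracket P) (aDualZero P l)) 0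
      (fun i => if l = i then 1 else 0) 0 0 := by
    intro l hl
    rw [Finset.mem_Ico] at hl
    have h := Shape.sum (Finset.Ico 1 P.N) fun j hj =>
      ((bosonForm_zeroBracket P).shape_va 1 (Finset.mem_Ico.1 hj).1 (Finset.mem_Ico.1 hj).2).smul
        ((min l j : ℕ) * (P.N - (max l j : ℕ)) / ((P.k + P.N) * P.N) : ℂ)
    simp only [smul_zero, Finset.sum_const_zero] at h
    refine h.congr ?_ (fun i h1 h2 => ?_) (fun _ _ _ => rfl) rfl fun _ _ => rfl
    · simp only [aDualZero, map_sum, map_smul]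
    · rw [← sum_check_mul_cartan hl.1 hl.2 h1 h2, Finset.sum_apply]
      refine Finset.sum_congr rfl fun j _ => ?_
      simp only [Pi.smul_apply, smul_eq_mul]
      field_simp
  have h := Shape.sum (Finset.Ico 1 P.N) fun l hl => (h0 l hl).smul (x l)
  simp only [smul_zero, Finset.sum_const_zero] at h
  refine h.congr rfl (fun i h1 h2 => ?_) (fun _ _ _ => rfl) rfl fun _ _ => rfl
  rw [sum_ite_mul_apply h1 h2, mul_one]

/-- The h_j pair to Cartan columns in both A and δ, so the inverse matrix makes ȟ_i dual, up to
constants, in both. -/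
theorem shape_sum_hVecCheck (P : Params) (x : ℕ → ℂ) : ∃ Δ,
    Shape P 1 (∑ l ∈ Finset.Ico 1 P.N, x l • bilinOf (zeroBracket P) (hVecCheck P l)) Δ
      (fun i => x i * (P.k + P.N)) (-x) 0 := by
  have h0 : ∀ l ∈ Finset.Ico 1 P.N, ∃ Δ, Shape P 1 (bilinOf (zeroBracket P) (hVecCheck P l)) Δ
      (fun i => if l = i then (P.k + P.N : ℂ) else 0) (fun i => if l = i then -1 else 0) 0 := by
    intro l hl
    rw [Finset.mem_Ico] at hl
    have h := Shape.sum (Finset.Ico 1 P.N) fun j hj =>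
      ((bosonForm_zeroBracket P).shape_hGen one_ne_zero one_ne_zero 1 (Finset.mem_Ico.1 hj).1
        (Finset.mem_Ico.1 hj).2).smul ((min l j : ℕ) * (P.N - (max l j : ℕ)) / P.N : ℂ)
    simp only [smul_zero, Finset.sum_const_zero] at h
    refine ⟨_, h.congr ?_ (fun i h1 h2 => ?_) (fun i h1 h2 => ?_) rfl fun _ _ => rfl⟩
    · simp only [hVecCheck, map_sum, map_smul, hVec_eq]
    · rw [show (if l = i then (P.k + P.N : ℂ) else 0) = (if l = i then 1 else 0) * (P.k + P.N) by
        split_ifs <;> ring, ← sum_check_mul_cartan hl.1 hl.2 h1 h2, Finset.sum_apply, Finset.sum_mul]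
      refine Finset.sum_congr rfl fun j _ => ?_
      simp only [Pi.smul_apply, smul_eq_mul]
      ring
    · rw [show (if l = i then (-1 : ℂ) else 0) = -(if l = i then 1 else 0) by
        split_ifs <;> ring, ← sum_check_mul_cartan hl.1 hl.2 h1 h2, Finset.sum_apply,
        ← Finset.sum_neg_distrib]
      refine Finset.sum_congr rfl fun j _ => ?_
      simp only [Pi.smul_apply, smul_eq_mul]
      rw [cartan_comm, cartan_eq, inv_one, one_add_one_eq_two]
      ring
  choose! Δ hΔ using h0
  have h := Shape.sum (Finset.Ico 1 P.N) fun l hl => (hΔ l hl).smul (x l)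
  simp only [smul_zero, Finset.sum_const_zero] at h
  refine ⟨_, h.congr rfl (fun i h1 h2 => ?_) (fun i h1 h2 => ?_) rfl fun _ _ => rfl⟩
  · rw [sum_ite_mul_apply h1 h2]
  · rw [sum_ite_mul_apply h1 h2, Pi.neg_apply, mul_neg_one]

theorem shape_phi_q (hkh : P.k + P.N ≠ 0) :
    Shape P 1 (bilinOf (zeroBracket P) (qVec (phiTotal P wt s))) 0 wt 0 0 := by
  rw [qVec_phiTotal, map_sum]
  simpa only [map_smul] using shape_sum_aDualZero hkh wt

/-- Only δ matters here, since the q-parts of the currents contain just b + c; the values A are left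
unspecified. -/
theorem shape_phi_p (hkh : P.k + P.N ≠ 0) : ∃ Δ A,
    Shape P 1 (bilinOf (zeroBracket P) (pVec (phiTotal P wt s))) Δ A
      (fun i => wt i / P.r * (s * P.logq)) 0 := by
  have h1 := shape_sum_aDualZero hkh fun l => wt l * (s * P.logq) + wt l / P.r * (s * P.logq) * (P.k + P.N)
  obtain ⟨Δ, h2⟩ := shape_sum_hVecCheck P fun l => -(wt l / P.r) * (s * P.logq)
  refine ⟨_, _, (h1.add h2).congr ?_ (fun _ _ _ => rfl) (fun i _ _ => ?_) rfl fun _ _ => by simp⟩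
  · rw [pVec_phiTotal, map_sum, ← Finset.sum_add_distrib]
    refine Finset.sum_congr rfl fun l _ => ?_
    simp only [map_add, map_sub, map_smul]
    module
  · simp

/-- The values on the zero modes of the `c` bosons of the functional defined by `Ψ_Λ`. -/
def psiShiftZero (wt : ℕ → ℂ) (m : ℕ) : ℂ := if m = 0 then 0 else wt m

theorem shape_sum_vbc_zero (P : Params) (wt : ℕ → ℂ) :
    Shape P 1 (∑ i ∈ Finset.Ico 1 P.N, ∑ j ∈ Finset.Icc (i + 1) P.N,
      wt (j - i) • bilinOf (zeroBracket P) (vbc P i j)) 0 0 0 (-psiShiftZero wt) := by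
  refine ((bosonForm_zeroBracket P).shape_vbc 1 wt).congr rfl (fun _ _ _ => rfl) (fun _ _ _ => rfl)
    (by simp [psiShiftZero]) fun m _ => ?_
  simp only [Pi.neg_apply, psiShiftZero]
  split_ifs <;> simp

/-- The weights λ^{N-i} on a^i and the opposite shifts reproduce, for the zero modes, the
cancellation found for the oscillators. -/
theorem shape_psi_q (hkh : P.k + P.N ≠ 0) :
    Shape P 1 (bilinOf (zeroBracket P) (qVec (psiTotal P wt s))) 0 (fun i => wt (P.N - i)) 0
      (-psiShiftZero wt) := by
  have h := (shape_sum_aDualZero hkh fun i => wt (P.N - i)).add (shape_sum_vbc_zero P wt)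
  simp only [add_zero, zero_add] at h
  refine h.congr ?_ (fun _ _ _ => rfl) (fun _ _ _ => rfl) (by simp [psiShiftZero]) fun _ _ => rfl
  rw [qVec_psiTotal, map_sum, ← Finset.sum_add_distrib]
  simp only [map_add, map_sum, map_smul]

theorem shape_psi_p (hkh : P.k + P.N ≠ 0) : ∃ A L,
    Shape P 1 (bilinOf (zeroBracket P) (pVec (psiTotal P wt s))) 0 A 0 L := by
  have h := (shape_sum_aDualZero hkh fun i => wt (P.N - i) * (s * P.logq)).add
    ((shape_sum_vbc_zero P wt).smul (s * P.logq))
  simp only [add_zero, smul_zero] at h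
  refine ⟨_, _, h.congr ?_ (fun _ _ _ => rfl) (fun _ _ _ => rfl) (by simp [psiShiftZero]) fun _ _ => rfl⟩
  rw [pVec_psiTotal, map_sum, Finset.smul_sum, ← Finset.sum_add_distrib]
  simp only [map_add, map_sum, map_smul, Finset.smul_sum, smul_smul]

end ZeroModes

/-! ### Zero modes of the currents -/

section CurrentZeroModes

variable {P : Params} {f : BVec P.N →ₗ[ℂ] ℂ} {Δ A δ L : ℕ → ℂ} {i j : ℕ} (ε : ℤˣ) (t s : ℂ)

theorem qVec_ePlusExpo : qVec (ePlusExpo P ε t i j s) = vbc P j i - vbc P j (i + 1) := by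
  simp only [ePlusExpo, map_add, map_sub, map_sum, qVec_bosonField, qVec_bosonPM, sub_zero,
    Finset.sum_const_zero, add_zero, zero_sub]
  rw [← sub_eq_add_neg]

theorem qVec_eMinusLeftExpo :
    qVec (eMinusLeftExpo P ε t i j s) = vbc P j (i + 1) - vbc P j i := by
  simp only [eMinusLeftExpo, midExpo, tailExpo, map_add, map_sub, map_neg, map_sum, qVec_bosonField,
    qVec_bosonPM, sub_zero, Finset.sum_const_zero, add_zero, zero_sub, neg_zero]
  rw [← sub_eq_add_neg]

theorem qVec_eMinusRightExpo :
    qVec (eMinusRightExpo P ε t i j s) = vbc P i j - vbc P (i + 1) j := by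
  simp only [eMinusRightExpo, tailExpo, map_add, map_sub, map_neg, map_sum, qVec_bosonField,
    qVec_bosonPM, sub_zero, Finset.sum_const_zero, add_zero, zero_sub, neg_zero]
  rw [← sub_eq_add_neg]

/-- The q-part is a difference of b + c bosons, so the shifts drop out; for Q = 1 the terms with Δ_j
cancel, and the result is independent of j. -/
theorem Shape.qVec_ePlusExpo (h : Shape P 1 f Δ A δ L) (hj : 1 ≤ j) (hji : j ≤ i) (hi : i < P.N) :
    f (qVec (ePlusExpo P ε t i j s)) = -δ i := by
  rw [EllipticVO.qVec_ePlusExpo, map_sub, h.vbc hj hji hi.le, h.vbc hj (by omega) hi,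
    ← h.step i (hj.trans hji) hi]
  simp only [one_pow, div_one, one_mul]
  ring

theorem Shape.qVec_eMinusLeftExpo (h : Shape P 1 f Δ A δ L) (hj : 1 ≤ j) (hji : j ≤ i) (hi : i < P.N) :
    f (qVec (eMinusLeftExpo P ε t i j s)) = δ i := by
  rw [EllipticVO.qVec_eMinusLeftExpo, map_sub, h.vbc hj hji hi.le, h.vbc hj (by omega) hi,
    ← h.step i (hj.trans hji) hi]
  simp only [one_pow, div_one, one_mul]
  ring

theorem Shape.qVec_eMinusRightExpo (h : Shape P 1 f Δ A δ L) (h1 : 1 ≤ i) (hij : i < j) (hj : j ≤ P.N) :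
    f (qVec (eMinusRightExpo P ε t i j s)) = δ i := by
  rw [EllipticVO.qVec_eMinusRightExpo, map_sub, h.vbc h1 hij.le hj, h.vbc (by omega) hij hj,
    ← h.step i h1 (by omega)]
  simp only [one_pow, div_one, one_mul]
  ring

/-- With Q = 1 and Δ = 0 only the telescoping shifts are left. -/
theorem Shape.sum_left_one (h : Shape P 1 f 0 A 0 L) {a c : ℕ} (hac : a ≤ c) (hci : c ≤ i) (h1 : 1 ≤ i)
    (hi : i < P.N) :
    ∑ l ∈ Finset.Icc (a + 1) c, (f (EllipticVO.vb P l (i + 1)) - f (EllipticVO.vb P l i)) =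
      L (i - a) - L (i - c) := by
  simpa using h.sum_left one_ne_zero hac hci h1 hi

theorem Shape.sum_right_one (h : Shape P 1 f 0 A 0 L) {a c : ℕ} (hac : a ≤ c) (hia : i ≤ a) (h1 : 1 ≤ i)
    (hc : c ≤ P.N) (hi : i < P.N) :
    ∑ l ∈ Finset.Icc (a + 1) c, (f (EllipticVO.vb P i l) - f (EllipticVO.vb P (i + 1) l)) =
      L (c - i) - L (a - i) := by
  simpa using h.sum_right one_ne_zero hac hia h1 hc hi

theorem Shape.hVec_eq (h : Shape P 1 f 0 A 0 L) (h1 : 1 ≤ i) (hi : i < P.N) :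
    f (hVec P i) = A i + L i + L (P.N - i) := by
  rw [EllipticVO.hVec_eq, h.hGen_eq one_ne_zero one_ne_zero 1 h1 hi]
  simp only [Pi.zero_apply, one_pow, div_one, one_mul]
  ring

/-- For ε = -1 the momenta acquire -2L(i+1-j), the zero mode companion of the defect of the
oscillators. -/
theorem Shape.pVec_ePlusExpo (h : Shape P 1 f 0 A 0 L) (hj : 1 ≤ j) (hji : j ≤ i) (hi : i < P.N) :
    f (pVec (ePlusExpo P ε t i j s)) = P.logq * (L i + (sgn ε - 1) * L (i + 1 - j)) := by
  obtain ⟨j, rfl⟩ : ∃ j', j = j' + 1 := ⟨j - 1, by omega⟩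
  simp only [ePlusExpo, map_add, map_sub, map_sum, pVec_bosonField, pVec_bosonPM, map_smul, smul_eq_mul,
    ← mul_sub, ← Finset.mul_sum, Nat.add_sub_cancel]
  rw [h.sum_left_one (Nat.zero_le j) (by omega) (by omega) hi, h.vbc hj hji hi.le,
    h.vbc hj (by omega) hi, h.vb (j + 1) (i + 1) hj (by omega) hi]
  simp only [Pi.zero_apply, zero_div, sub_zero, sgn_one, Nat.add_sub_add_right, Nat.sub_zero]
  ring

theorem pVec_midExpo : pVec (midExpo P i j s) =
    -P.logq • ∑ l ∈ Finset.Icc (j + 1) i, (vb P l (i + 1) - vb P l i) := by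
  simp only [midExpo, map_sub, map_sum, pVec_bosonPM, sgn_neg_one, neg_one_mul, ← smul_sub, Finset.smul_sum]

theorem pVec_tailExpo (m : ℕ) : pVec (tailExpo P ε i m s) =
    (sgn ε * P.logq) • (va P i + ∑ l ∈ Finset.Icc m P.N, (vb P i l - vb P (i + 1) l)) := by
  simp only [tailExpo, map_add, map_sub, map_sum, pVec_bosonPM, ← smul_sub, ← Finset.smul_sum, ← smul_add]

/-- The overall sign is negative since τ_- carries the momenta with a minus sign; for j > i it is
positive. This accounts for the relative factor q^(2λ^i) between the two families. -/
theorem Shape.pVec_eMinusLeftExpo (h : Shape P 1 f 0 A 0 L) (hj : 1 ≤ j) (hji : j ≤ i) (hi : i < P.N) :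
    f (pVec (eMinusLeftExpo P ε t i j s)) =
      -(P.logq * (A i + L (P.N - i) + (sgn ε + 1) * L (i - j))) := by
  simp only [eMinusLeftExpo, pVec_midExpo, pVec_tailExpo, map_add, map_sub, map_neg, map_sum,
    pVec_bosonField, pVec_bosonPM, map_smul, smul_eq_mul]
  rw [h.sum_left_one hji le_rfl (hj.trans hji) hi, h.sum_right_one hi.le le_rfl (hj.trans hji) le_rfl hi,
    h.vbc hj hji hi.le, h.vbc hj (by omega) hi, h.vb _ _ hj hji hi.le, h.va i (hj.trans hji) hi]
  simp only [Pi.zero_apply, zero_div, sub_zero, sgn_neg_one, Nat.sub_self, h.zero]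
  ring

theorem Shape.pVec_eMinusRightExpo (h : Shape P 1 f 0 A 0 L) (h1 : 1 ≤ i) (hij : i < j) (hj : j ≤ P.N) :
    f (pVec (eMinusRightExpo P ε t i j s)) =
      P.logq * (A i + L (P.N - i) + (sgn ε - 1) * L (j - (i + 1))) := by
  obtain ⟨j, rfl⟩ : ∃ j', j = j' + 1 := ⟨j - 1, by omega⟩
  simp only [eMinusRightExpo, pVec_tailExpo, map_add, map_sub, map_neg, map_sum,
    pVec_bosonField, pVec_bosonPM, map_smul, smul_eq_mul]
  rw [h.sum_right_one (by omega : j ≤ P.N) (by omega) h1 le_rfl (by omega),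
    h.vbc h1 hij.le hj, h.vbc (by omega) hij hj, h.vb (i + 1) (j + 1) (by omega) hij hj,
        h.va i h1 (by omega)]
  simp only [Pi.zero_apply, zero_div, sub_zero, sgn_one, Nat.add_sub_add_right]
  ring

theorem pVec_psiCurExpo : pVec (psiCurExpo P ε i s) = (sgn ε * P.logq) • hVec P i := by
  simp only [psiCurExpo, hVec, map_add, map_sub, map_sum, pVec_bosonPM, ← smul_sub, ← Finset.smul_sum,
    ← smul_add]

theorem qVec_psiCurExpo : qVec (psiCurExpo P ε i s) = 0 := by
  simp only [psiCurExpo, map_add, map_sub, map_sum, qVec_bosonPM, sub_zero, Finset.sum_const_zero, add_zero]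

theorem phVec_psiCurExpo : phVec (psiCurExpo P ε i s) = 0 := by
  simp only [psiCurExpo, map_add, map_sub, map_sum, phVec_bosonPM, sub_zero, Finset.sum_const_zero,
      add_zero]

theorem qhVec_psiCurExpo : qhVec (psiCurExpo P ε i s) = 0 := by
  simp only [psiCurExpo, map_add, map_sub, map_sum, qhVec_bosonPM, sub_zero, Finset.sum_const_zero,
      add_zero]

theorem phVec_ePlusExpo : phVec (ePlusExpo P ε t i j s) = 0 := by
  simp only [ePlusExpo, map_add, map_sub, map_sum, phVec_bosonField, phVec_bosonPM, sub_zero,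
    Finset.sum_const_zero, add_zero]

theorem qhVec_ePlusExpo : qhVec (ePlusExpo P ε t i j s) = 0 := by
  simp only [ePlusExpo, map_add, map_sub, map_sum, qhVec_bosonField, qhVec_bosonPM, sub_zero,
    Finset.sum_const_zero, add_zero]

theorem phVec_eMinusLeftExpo : phVec (eMinusLeftExpo P ε t i j s) = 0 := by
  simp only [eMinusLeftExpo, midExpo, tailExpo, map_add, map_sub, map_neg, map_sum, phVec_bosonField,
    phVec_bosonPM, sub_zero, Finset.sum_const_zero, add_zero, neg_zero]

theorem qhVec_eMinusLeftExpo : qhVec (eMinusLeftExpo P ε t i j s) = 0 := by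
  simp only [eMinusLeftExpo, midExpo, tailExpo, map_add, map_sub, map_neg, map_sum, qhVec_bosonField,
    qhVec_bosonPM, sub_zero, Finset.sum_const_zero, add_zero, neg_zero]

theorem phVec_eMinusRightExpo : phVec (eMinusRightExpo P ε t i j s) = 0 := by
  simp only [eMinusRightExpo, tailExpo, map_add, map_sub, map_neg, map_sum, phVec_bosonField,
    phVec_bosonPM, sub_zero, Finset.sum_const_zero, add_zero, neg_zero]

theorem qhVec_eMinusRightExpo : qhVec (eMinusRightExpo P ε t i j s) = 0 := by
  simp only [eMinusRightExpo, tailExpo, map_add, map_sub, map_neg, map_sum, qhVec_bosonField,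
    qhVec_bosonPM, sub_zero, Finset.sum_const_zero, add_zero, neg_zero]

theorem pVec_curEExpo : pVec (curEExpo P ε t i j s) = pVec (ePlusExpo P ε t i j s) := by
  simp only [curEExpo, dPlusExpo, phat, qhat, map_add, map_neg, map_sub, map_smul, pVec_modeSum,
      pVec_qhatPart,
    pVec_phatPart, pVec_onePart, smul_zero, sub_zero, neg_zero, add_zero, zero_add]

theorem qVec_curEExpo : qVec (curEExpo P ε t i j s) = qVec (ePlusExpo P ε t i j s) := by
  simp only [curEExpo, dPlusExpo, phat, qhat, map_add, map_neg, map_sub, map_smul, qVec_modeSum,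
      qVec_qhatPart,
    qVec_phatPart, qVec_onePart, smul_zero, sub_zero, neg_zero, add_zero, zero_add]

theorem phVec_curEExpo : phVec (curEExpo P ε t i j s) = (-(s * P.logq / P.rstar)) • vhat P i := by
  simp only [curEExpo, dPlusExpo, phat, qhat, map_add, map_neg, map_sub, map_smul, phVec_modeSum,
      phVec_qhatPart,
    phVec_phatPart, phVec_onePart, smul_zero, sub_zero, neg_zero, add_zero, zero_add, phVec_ePlusExpo]
  module

theorem qhVec_curEExpo : qhVec (curEExpo P ε t i j s) = (2 : ℂ) • vhat P i := by
  simp only [curEExpo, dPlusExpo, phat, qhat, map_add, map_neg, map_sub, map_smul, qhVec_modeSum,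
      qhVec_qhatPart,
    qhVec_phatPart, qhVec_onePart, smul_zero, sub_zero, neg_zero, add_zero, zero_add, qhVec_ePlusExpo]

theorem pVec_curFLeftExpo : pVec (curFLeftExpo P ε t i j s) =
    pVec (eMinusLeftExpo P ε t i j s) + (s * P.logq / P.r) • hVec P i := by
  simp only [curFLeftExpo, dMinusExpo, phat, hExpo, map_add, map_neg, map_sub, map_smul, pVec_modeSum,
    pVec_pPart, pVec_phatPart, pVec_onePart, smul_zero, sub_zero, neg_zero, add_zero, zero_add]
  module

theorem qVec_curFLeftExpo : qVec (curFLeftExpo P ε t i j s) = qVec (eMinusLeftExpo P ε t i j s) := by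
  simp only [curFLeftExpo, dMinusExpo, phat, hExpo, map_add, map_neg, map_sub, map_smul, qVec_modeSum,
    qVec_pPart, qVec_phatPart, qVec_onePart, smul_zero, sub_zero, neg_zero, add_zero, zero_add]

theorem phVec_curFLeftExpo : phVec (curFLeftExpo P ε t i j s) = (s * P.logq / P.r) • vhat P i := by
  simp only [curFLeftExpo, dMinusExpo, phat, hExpo, map_add, map_neg, map_sub, map_smul, phVec_modeSum,
    phVec_pPart, phVec_phatPart, phVec_onePart, smul_zero, sub_zero, neg_zero, add_zero, zero_add,
    phVec_eMinusLeftExpo]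
  module

theorem qhVec_curFLeftExpo : qhVec (curFLeftExpo P ε t i j s) = 0 := by
  simp only [curFLeftExpo, dMinusExpo, phat, hExpo, map_add, map_neg, map_sub, map_smul, qhVec_modeSum,
    qhVec_pPart, qhVec_phatPart, qhVec_onePart, smul_zero, sub_zero, neg_zero, add_zero, zero_add,
    qhVec_eMinusLeftExpo]

theorem pVec_curFRightExpo : pVec (curFRightExpo P ε t i j s) =
    pVec (eMinusRightExpo P ε t i j s) + (s * P.logq / P.r) • hVec P i := by
  simp only [curFRightExpo, dMinusExpo, phat, hExpo, map_add, map_neg, map_sub, map_smul, pVec_modeSum,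
    pVec_pPart, pVec_phatPart, pVec_onePart, smul_zero, sub_zero, neg_zero, add_zero, zero_add]
  module

theorem qVec_curFRightExpo : qVec (curFRightExpo P ε t i j s) = qVec (eMinusRightExpo P ε t i j s) := by
  simp only [curFRightExpo, dMinusExpo, phat, hExpo, map_add, map_neg, map_sub, map_smul, qVec_modeSum,
    qVec_pPart, qVec_phatPart, qVec_onePart, smul_zero, sub_zero, neg_zero, add_zero, zero_add]

theorem phVec_curFRightExpo : phVec (curFRightExpo P ε t i j s) = (s * P.logq / P.r) • vhat P i := by
  simp only [curFRightExpo, dMinusExpo, phat, hExpo, map_add, map_neg, map_sub, map_smul, phVec_modeSum,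
    phVec_pPart, phVec_phatPart, phVec_onePart, smul_zero, sub_zero, neg_zero, add_zero, zero_add,
    phVec_eMinusRightExpo]
  module

theorem qhVec_curFRightExpo : qhVec (curFRightExpo P ε t i j s) = 0 := by
  simp only [curFRightExpo, dMinusExpo, phat, hExpo, map_add, map_neg, map_sub, map_smul, qhVec_modeSum,
    qhVec_pPart, qhVec_phatPart, qhVec_onePart, smul_zero, sub_zero, neg_zero, add_zero, zero_add,
    qhVec_eMinusRightExpo]

/-- The factor q^(∓h_i) in H_i^± removes the momentum part of ψ_±, so only the power of z
contributes. -/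
theorem pVec_curHExpo : pVec (curHExpo P ε i s) =
    ((sgn ε * (P.r - P.k / 2) + s) * P.logq / P.r) • hVec P i := by
  simp only [curHExpo, dPlusExpo, dMinusExpo, phat, qhat, hExpo, map_add, map_neg, map_sub, map_smul,
    pVec_modeSum, pVec_pPart, pVec_phatPart, pVec_qhatPart, pVec_onePart, smul_zero, sub_zero, neg_zero,
    add_zero, zero_add, pVec_psiCurExpo]
  module

theorem qVec_curHExpo : qVec (curHExpo P ε i s) = 0 := by
  simp only [curHExpo, dPlusExpo, dMinusExpo, phat, qhat, hExpo, map_add, map_neg, map_sub, map_smul,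
    qVec_modeSum, qVec_pPart, qVec_phatPart, qVec_qhatPart, qVec_onePart, smul_zero, sub_zero, neg_zero,
    add_zero, zero_add, qVec_psiCurExpo]

theorem phVec_curHExpo : phVec (curHExpo P ε i s) =
    ((sgn ε * (P.r - P.k / 2) + s) * P.logq * (1 / P.r - 1 / P.rstar)) • vhat P i := by
  simp only [curHExpo, dPlusExpo, dMinusExpo, phat, qhat, hExpo, map_add, map_neg, map_sub, map_smul,
    phVec_modeSum, phVec_pPart, phVec_phatPart, phVec_qhatPart, phVec_onePart, smul_zero, sub_zero,
        neg_zero,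
    add_zero, zero_add, phVec_psiCurExpo]
  module

theorem qhVec_curHExpo : qhVec (curHExpo P ε i s) = (2 : ℂ) • vhat P i := by
  simp only [curHExpo, dPlusExpo, dMinusExpo, phat, qhat, hExpo, map_add, map_neg, map_sub, map_smul,
    qhVec_modeSum, qhVec_pPart, qhVec_phatPart, qhVec_qhatPart, qhVec_onePart, smul_zero, sub_zero,
        neg_zero,
    add_zero, zero_add, qhVec_psiCurExpo]

end CurrentZeroModes

/-! ### Contractions of the zero modes -/

section ZeroContr

variable {P : Params} (wt : ℕ → ℂ) {i j : ℕ} (ε : ℤˣ) (τ s t : ℂ)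

theorem psiShiftZero_of_pos {m : ℕ} (hm : 0 < m) : psiShiftZero wt m = wt m := if_neg hm.ne'

theorem zeroBracket_comm (x y : BVec P.N) :
    bilinOf (zeroBracket P) x y = bilinOf (zeroBracket P) y x := (bosonForm_zeroBracket P).symm x y

/-- The contraction of an exponent with `Φ_Λ`, whose `q̂`-part vanishes. -/
theorem zeroContr_phiTotal (X : Expo P.N) :
    zeroContr P X (phiTotal P wt t) = bilinOf (zeroBracket P) (qVec (phiTotal P wt t)) (pVec X) := by
  rw [zeroContr_eq, qhVec_phiTotal, map_zero, add_zero, zeroBracket_comm]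

theorem zeroContr_phiTotal_left {X : Expo P.N} {c : ℂ} (hX : qhVec X = c • vhat P i) (h1 : 1 ≤ i)
    (hi : i < P.N) : zeroContr P (phiTotal P wt t) X =
      bilinOf (zeroBracket P) (pVec (phiTotal P wt t)) (qVec X) + c * (wt i / P.r * (t * P.logq) / 2) := by
  rw [zeroContr_eq, phVec_phiTotal, hX, map_smul, hatBracket_vhatCheck _ h1 hi, smul_eq_mul]
  ring

theorem zeroContr_psiTotal {X : Expo P.N} {c : ℂ} (hX : phVec X = c • vhat P i) (h1 : 1 ≤ i)
    (hi : i < P.N) : zeroContr P X (psiTotal P wt t) =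
      bilinOf (zeroBracket P) (qVec (psiTotal P wt t)) (pVec X) + c * wt i := by
  rw [zeroContr_eq, qhVec_psiTotal, hX, hatBracket_comm, map_smul, hatBracket_vhatCheck _ h1 hi,
    smul_eq_mul, zeroBracket_comm]
  ring

theorem zeroContr_psiTotal_left {X : Expo P.N} {c : ℂ} (hX : qhVec X = c • vhat P i) (h1 : 1 ≤ i)
    (hi : i < P.N) : zeroContr P (psiTotal P wt t) X =
      bilinOf (zeroBracket P) (pVec (psiTotal P wt t)) (qVec X) -
        c * (wt i / P.rstar * (t * P.logq) / 2) := by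
  rw [zeroContr_eq, phVec_psiTotal, hX, map_smul, hatBracket_vhatCheck _ h1 hi, smul_eq_mul]
  ring

theorem zeroContr_curE_phi (hkh : P.k + P.N ≠ 0) (hj : 1 ≤ j) (hji : j ≤ i) (hi : i < P.N) :
    zeroContr P (curEExpo P ε τ i j s) (phiTotal P wt t) = 0 := by
  rw [zeroContr_phiTotal, pVec_curEExpo, (shape_phi_q wt t hkh).pVec_ePlusExpo ε τ s hj hji hi]
  simp

/-- The (b+c)-momenta of Φ_Λ are compensated by the hatted momenta acting on e^(2q̂_i). -/
theorem zeroContr_phi_curE (hkh : P.k + P.N ≠ 0) (hj : 1 ≤ j) (hji : j ≤ i) (hi : i < P.N) :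
    zeroContr P (phiTotal P wt t) (curEExpo P ε τ i j s) = 0 := by
  obtain ⟨Δ, A, h⟩ := shape_phi_p wt t hkh
  rw [zeroContr_phiTotal_left wt t (qhVec_curEExpo ε τ s) (hj.trans hji) hi, qVec_curEExpo,
    h.qVec_ePlusExpo ε τ s hj hji hi]
  ring

/-- For ε = -1 the term 2λ^{i+1-j} cancels the constant q^(-2λ^{i+1-j}) of the oscillators; the part
linear in s cancels the exponent linear in u that accompanies the theta quotient. -/
theorem zeroContr_curE_psi (hkh : P.k + P.N ≠ 0) (hj : 1 ≤ j) (hji : j ≤ i) (hi : i < P.N) :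
    zeroContr P (curEExpo P ε τ i j s) (psiTotal P wt t) =
      P.logq * (-wt i - (sgn ε - 1) * wt (i + 1 - j) - s / P.rstar * wt i) := by
  rw [zeroContr_psiTotal wt t (phVec_curEExpo ε τ s) (hj.trans hji) hi, pVec_curEExpo,
    (shape_psi_q wt t hkh).pVec_ePlusExpo ε τ s hj hji hi, Pi.neg_apply, Pi.neg_apply,
    psiShiftZero_of_pos wt (by omega), psiShiftZero_of_pos wt (by omega)]
  ring

theorem zeroContr_psi_curE (hkh : P.k + P.N ≠ 0) (hj : 1 ≤ j) (hji : j ≤ i) (hi : i < P.N) :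
    zeroContr P (psiTotal P wt t) (curEExpo P ε τ i j s) = -(P.logq * (t / P.rstar * wt i)) := by
  obtain ⟨A, L, h⟩ := shape_psi_p wt t hkh
  rw [zeroContr_psiTotal_left wt t (qhVec_curEExpo ε τ s) (hj.trans hji) hi, qVec_curEExpo,
    h.qVec_ePlusExpo ε τ s hj hji hi, Pi.zero_apply]
  ring

theorem zeroContr_curFLeft_phi (hkh : P.k + P.N ≠ 0) (hj : 1 ≤ j) (hji : j ≤ i) (hi : i < P.N) :
    zeroContr P (curFLeftExpo P ε τ i j s) (phiTotal P wt t) = P.logq * (-wt i + s / P.r * wt i) := by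
  have h := shape_phi_q wt t hkh
  rw [zeroContr_phiTotal, pVec_curFLeftExpo, map_add, map_smul,
    h.pVec_eMinusLeftExpo ε τ s hj hji hi, h.hVec_eq (hj.trans hji) hi, smul_eq_mul]
  simp only [Pi.zero_apply]
  ring

theorem zeroContr_curFRight_phi (hkh : P.k + P.N ≠ 0) (h1 : 1 ≤ i) (hij : i < j) (hj : j ≤ P.N) :
    zeroContr P (curFRightExpo P ε τ i j s) (phiTotal P wt t) = P.logq * (wt i + s / P.r * wt i) := by
  have h := shape_phi_q wt t hkh
  rw [zeroContr_phiTotal, pVec_curFRightExpo, map_add, map_smul,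
    h.pVec_eMinusRightExpo ε τ s h1 hij hj, h.hVec_eq h1 (by omega), smul_eq_mul]
  simp only [Pi.zero_apply]
  ring

theorem zeroContr_phi_curFLeft (hkh : P.k + P.N ≠ 0) (hj : 1 ≤ j) (hji : j ≤ i) (hi : i < P.N) :
    zeroContr P (phiTotal P wt t) (curFLeftExpo P ε τ i j s) = P.logq * (t / P.r * wt i) := by
  obtain ⟨Δ, A, h⟩ := shape_phi_p wt t hkh
  rw [zeroContr_phiTotal_left (i := i) (c := 0) wt t (by rw [qhVec_curFLeftExpo, zero_smul])
    (hj.trans hji) hi, qVec_curFLeftExpo, h.qVec_eMinusLeftExpo ε τ s hj hji hi]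
  ring

theorem zeroContr_phi_curFRight (hkh : P.k + P.N ≠ 0) (h1 : 1 ≤ i) (hij : i < j) (hj : j ≤ P.N) :
    zeroContr P (phiTotal P wt t) (curFRightExpo P ε τ i j s) = P.logq * (t / P.r * wt i) := by
  obtain ⟨Δ, A, h⟩ := shape_phi_p wt t hkh
  rw [zeroContr_phiTotal_left (i := i) (c := 0) wt t (by rw [qhVec_curFRightExpo, zero_smul])
    h1 (by omega), qVec_curFRightExpo, h.qVec_eMinusRightExpo ε τ s h1 hij hj]
  ring

/-- The parts linear in s cancel between h_i and p̂_i, and λ^{N-i} cancels between a^i and the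
shift. Only the companion of the defect L(i-j) is left. -/
theorem zeroContr_curFLeft_psi (hkh : P.k + P.N ≠ 0) (hj : 1 ≤ j) (hji : j ≤ i) (hi : i < P.N) :
    zeroContr P (curFLeftExpo P ε τ i j s) (psiTotal P wt t) =
      P.logq * ((sgn ε + 1) * psiShiftZero wt (i - j)) := by
  have h := shape_psi_q wt t hkh
  rw [zeroContr_psiTotal wt t (phVec_curFLeftExpo ε τ s) (hj.trans hji) hi, pVec_curFLeftExpo, map_add,
    map_smul, h.pVec_eMinusLeftExpo ε τ s hj hji hi, h.hVec_eq (hj.trans hji) hi, smul_eq_mul]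
  simp only [Pi.neg_apply, psiShiftZero_of_pos wt (by omega : 0 < P.N - i),
    psiShiftZero_of_pos wt (by omega : 0 < i)]
  ring

theorem zeroContr_curFRight_psi (hkh : P.k + P.N ≠ 0) (h1 : 1 ≤ i) (hij : i < j) (hj : j ≤ P.N) :
    zeroContr P (curFRightExpo P ε τ i j s) (psiTotal P wt t) =
      P.logq * ((1 - sgn ε) * psiShiftZero wt (j - (i + 1))) := by
  have h := shape_psi_q wt t hkh
  rw [zeroContr_psiTotal wt t (phVec_curFRightExpo ε τ s) h1 (by omega), pVec_curFRightExpo, map_add,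
    map_smul, h.pVec_eMinusRightExpo ε τ s h1 hij hj, h.hVec_eq h1 (by omega), smul_eq_mul]
  simp only [Pi.neg_apply, psiShiftZero_of_pos wt (by omega : 0 < P.N - i),
    psiShiftZero_of_pos wt (by omega : 0 < i)]
  ring

theorem zeroContr_psi_curFLeft (hkh : P.k + P.N ≠ 0) (hj : 1 ≤ j) (hji : j ≤ i) (hi : i < P.N) :
    zeroContr P (psiTotal P wt t) (curFLeftExpo P ε τ i j s) = 0 := by
  obtain ⟨A, L, h⟩ := shape_psi_p wt t hkh
  rw [zeroContr_psiTotal_left (i := i) (c := 0) wt t (by rw [qhVec_curFLeftExpo, zero_smul])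
    (hj.trans hji) hi, qVec_curFLeftExpo, h.qVec_eMinusLeftExpo ε τ s hj hji hi]
  simp

theorem zeroContr_psi_curFRight (hkh : P.k + P.N ≠ 0) (h1 : 1 ≤ i) (hij : i < j) (hj : j ≤ P.N) :
    zeroContr P (psiTotal P wt t) (curFRightExpo P ε τ i j s) = 0 := by
  obtain ⟨A, L, h⟩ := shape_psi_p wt t hkh
  rw [zeroContr_psiTotal_left (i := i) (c := 0) wt t (by rw [qhVec_curFRightExpo, zero_smul])
    h1 (by omega), qVec_curFRightExpo, h.qVec_eMinusRightExpo ε τ s h1 hij hj]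
  simp

theorem zeroContr_curH_phi (hkh : P.k + P.N ≠ 0) (h1 : 1 ≤ i) (hi : i < P.N) :
    zeroContr P (curHExpo P ε i s) (phiTotal P wt t) =
      P.logq * ((sgn ε * (P.r - P.k / 2) + s) / P.r * wt i) := by
  rw [zeroContr_phiTotal, pVec_curHExpo, map_smul, (shape_phi_q wt t hkh).hVec_eq h1 hi, smul_eq_mul]
  simp only [Pi.zero_apply]
  ring

theorem zeroContr_curH_psi (hkh : P.k + P.N ≠ 0) (h1 : 1 ≤ i) (hi : i < P.N) :
    zeroContr P (curHExpo P ε i s) (psiTotal P wt t) =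
      -(P.logq * ((sgn ε * (P.r - P.k / 2) + s) / P.rstar * wt i)) := by
  rw [zeroContr_psiTotal wt t (phVec_curHExpo ε s) h1 hi, pVec_curHExpo, map_smul,
    (shape_psi_q wt t hkh).hVec_eq h1 hi, smul_eq_mul]
  simp only [Pi.neg_apply, psiShiftZero_of_pos wt (by omega : 0 < P.N - i),
    psiShiftZero_of_pos wt (by omega : 0 < i)]
  ring

theorem zeroContr_phi_curH (h1 : 1 ≤ i) (hi : i < P.N) :
    zeroContr P (phiTotal P wt t) (curHExpo P ε i s) = P.logq * (t / P.r * wt i) := by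
  rw [zeroContr_phiTotal_left wt t (qhVec_curHExpo ε s) h1 hi, qVec_curHExpo, map_zero]
  ring

theorem zeroContr_psi_curH (h1 : 1 ≤ i) (hi : i < P.N) :
    zeroContr P (psiTotal P wt t) (curHExpo P ε i s) = -(P.logq * (t / P.rstar * wt i)) := by
  rw [zeroContr_psiTotal_left wt t (qhVec_curHExpo ε s) h1 hi, qVec_curHExpo, map_zero]
  ring

end ZeroContr

/-! ### Regularity of the exponents -/

theorem GeomBounded.inv_qnum_natCast (P : Params) (hq : ‖qpow P 1‖ < 1) :
    GeomBounded fun n => (qnum P (n : ℕ))⁻¹ := by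
  simpa using GeomBounded.inv_qnum_mul P hq one_ne_zero

theorem not_natCast_neg (n : ℕ) : ¬((n : ℤ) < 0) := (Int.natCast_nonneg n).not_gt

section Vectors

variable {P : Params} (i : ℕ) (β : Boson P.N)

theorem geomBounded_dVec : GeomBounded fun n => dVec P i (n : ℕ) β := by
  simp only [dVec, Pi.add_apply, Finset.sum_apply, Pi.sub_apply, Pi.smul_apply, smul_eq_mul, ← neg_mul]
  refine ((GeomBounded.sum _ fun l _ => ?_).add ((GeomBounded.qpow_mul P _).mul (.const _))).add
    (GeomBounded.sum _ fun l _ => ?_)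
  all_goals
    exact ((GeomBounded.qpow_mul P _).mul (.const _)).sub ((GeomBounded.qpow_mul P _).mul (.const _))

theorem geomBounded_hMode : GeomBounded fun n => hMode P i ((n : ℕ) : ℤ) β := by
  simp only [hMode, Pi.add_apply, Finset.sum_apply, Pi.sub_apply, Pi.smul_apply, smul_eq_mul, ← neg_mul,
    Nat.abs_cast, Int.cast_natCast]
  refine ((GeomBounded.sum _ fun l _ => ?_).add ((GeomBounded.qpow_mul P _).mul (.const _))).add
    (GeomBounded.sum _ fun l _ => ?_)
  all_goals
    exact ((GeomBounded.qpow_mul P _).mul (.const _)).sub ((GeomBounded.qpow_mul P _).mul (.const _))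

/-- The only point is division by [xn], [Nn] and [n]: these have real nonzero arguments and stay
away from zero. -/
theorem geomBounded_dual (hq : ‖qpow P 1‖ < 1) {x : ℝ} (hx : x ≠ 0) (hN : P.N ≠ 0) (a b : ℂ) :
    GeomBounded fun n => ((n : ℕ) * (qnum P (a * (n : ℕ)) * qnum P (b * (n : ℕ))) /
      (qnum P (x * (n : ℕ)) * qnum P (P.N * (n : ℕ)) * qnum P (n : ℕ) ^ 2) : ℂ) := by
  have hN' := GeomBounded.inv_qnum_mul P hq (x := P.N) (Nat.cast_ne_zero.2 hN)
  rw [Complex.ofReal_natCast] at hN'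
  simp only [div_eq_mul_inv, mul_inv, ← inv_pow]
  exact (GeomBounded.natCast.mul ((GeomBounded.qnum_mul P _).mul (GeomBounded.qnum_mul P _))).mul
    (((GeomBounded.inv_qnum_mul P hq hx).mul hN').mul ((GeomBounded.inv_qnum_natCast P hq).pow 2))

theorem geomBounded_aDual (hq : ‖qpow P 1‖ < 1) (hkh : P.k + P.N ≠ 0) (hN : P.N ≠ 0) :
    GeomBounded fun n => aDual P i ((n : ℕ) : ℤ) β := by
  simp only [aDual, Finset.sum_apply, Pi.smul_apply, smul_eq_mul, Int.cast_natCast]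
  refine GeomBounded.sum _ fun j _ => GeomBounded.mul ?_ (.const _)
  simpa only [Complex.ofReal_add, Complex.ofReal_natCast] using
    geomBounded_dual hq hkh hN (min i j : ℕ) (P.N - (max i j : ℕ))

theorem geomBounded_hDual (hq : ‖qpow P 1‖ < 1) (hk : P.k ≠ 0) (hN : P.N ≠ 0) :
    GeomBounded fun n => hDual P i ((n : ℕ) : ℤ) β := by
  simp only [hDual, Finset.sum_apply, Pi.smul_apply, smul_eq_mul, Int.cast_natCast]
  exact GeomBounded.sum _ fun j _ => (geomBounded_dual hq hk hN _ _).mul (geomBounded_hMode j β)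

end Vectors

namespace RegularField

variable {P : Params}

/-- Separates the dependence on z from the mode coefficients, so that regularity becomes a growth
estimate at s = 0. -/
theorem modeSum_smul {f : ℤ → ℂ} {V : ℤ → BVec P.N}
    (hpos : ∀ β, GeomBounded fun n => f ((n : ℕ) : ℤ) * V ((n : ℕ) : ℤ) β)
    (hneg : ∀ β, GeomBounded fun n => f (-((n : ℕ) : ℤ)) * V (-((n : ℕ) : ℤ)) β) :
    RegularField P fun s => EllipticVO.modeSum fun n => (f n * qpow P (-(n * s))) • V n := by
  refine modeSum (fun s n _ => ?_) (fun β => ?_) fun β => ?_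
  · rw [smul_smul, mul_zero, neg_zero, qpow_zero, mul_one, mul_comm (f n), mul_comm s]
  · simpa only [mul_zero, neg_zero, qpow_zero, mul_one, Pi.smul_apply, smul_eq_mul] using hpos β
  · simpa only [mul_zero, neg_zero, qpow_zero, mul_one, Pi.smul_apply, smul_eq_mul] using hneg β

theorem bosonField (hq : ‖qpow P 1‖ < 1) (x : BVec P.N) : RegularField P (bosonField P x) := by
  refine ((?_ : RegularField P _).add (qPart x)).add (pPart (by fun_prop) x)
  have h := modeSum_smul (P := P) (f := fun n => -(qnum P n)⁻¹) (V := fun _ => x) (fun β => ?_) fun β => ?_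
  · simpa only [neg_mul, ← div_eq_inv_mul] using h
  · simpa only [Int.cast_natCast] using (GeomBounded.inv_qnum_natCast P hq).neg.mul (.const _)
  · simpa only [Int.cast_neg, Int.cast_natCast, qnum_neg, inv_neg, neg_neg] using
      (GeomBounded.inv_qnum_natCast P hq).mul (.const _)

theorem bosonPM (ε : ℤˣ) (x : BVec P.N) : RegularField P (bosonPM P ε x) := by
  refine (?_ : RegularField P _).add (.const _ (fun _ _ => rfl) fun _ _ => rfl)
  have h := modeSum_smul (P := P)
    (f := fun n => if 0 < (ε : ℤ) * n then sgn ε * (qpow P 1 - qpow P (-1)) else 0) (V := fun _ => x)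
    (fun β => ?_) fun β => ?_
  · simpa only [ite_mul, zero_mul, ite_smul, zero_smul] using h
  all_goals
    refine GeomBounded.mul ?_ (.const _)
    rcases Int.units_eq_one_or ε with rfl | rfl <;>
      simp [GeomBounded.const, not_natCast_neg]

theorem dPlusExpo (hq : ‖qpow P 1‖ < 1) (hrs : P.rstar ≠ 0) (i : ℕ) : RegularField P (dPlusExpo P i) := by
  have h := modeSum_smul (P := P)
    (f := fun m => if m < 0 then 1 / qnum P (P.rstar * (-m)) * qpow P (P.r * (-m)) else 0)
    (V := fun m => dVec P i (-m)) (fun β => ?_) fun β => ?_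
  · unfold EllipticVO.dPlusExpo
    simpa only [ite_mul, zero_mul, ite_smul, zero_smul, neg_mul] using h
  · simpa [not_natCast_neg] using GeomBounded.const 0
  · simpa using ((GeomBounded.inv_qnum_mul P hq hrs).mul (GeomBounded.qpow_mul P P.r)).mul
      (geomBounded_dVec i β)

theorem dMinusExpo (hq : ‖qpow P 1‖ < 1) (hr : P.r ≠ 0) (i : ℕ) : RegularField P (dMinusExpo P i) := by
  have h := modeSum_smul (P := P)
    (f := fun m => if 0 < m then -(1 / qnum P (P.r * m) * qpow P (P.r * m)) else 0)
    (V := fun m => dVec P i m) (fun β => ?_) fun β => ?_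
  · unfold EllipticVO.dMinusExpo
    simpa only [ite_mul, zero_mul, ite_smul, zero_smul, neg_mul] using h
  · simpa using (((GeomBounded.inv_qnum_mul P hq hr).mul (GeomBounded.qpow_mul P P.r)).mul
      (geomBounded_dVec i β)).neg
  · simpa [not_natCast_neg] using GeomBounded.const 0

theorem psiCurExpo (ε : ℤˣ) (i : ℕ) : RegularField P (psiCurExpo P ε i) :=
  ((RegularField.sum _ fun _ _ => ((bosonPM _ _).shift _).sub ((bosonPM _ _).shift _)).add
    ((bosonPM _ _).shift _)).add
    (RegularField.sum _ fun _ _ => ((bosonPM _ _).shift _).sub ((bosonPM _ _).shift _))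

theorem ePlusExpo (hq : ‖qpow P 1‖ < 1) (ε : ℤˣ) (t : ℂ) (i j : ℕ) :
    RegularField P (ePlusExpo P ε t i j) :=
  (((bosonField hq _).shift _).add (((bosonPM _ _).shift _).sub ((bosonField hq _).shift _))).add
    (RegularField.sum _ fun _ _ => ((bosonPM _ _).shift _).sub ((bosonPM _ _).shift _))

theorem midExpo (i j : ℕ) : RegularField P (midExpo P i j) :=
  RegularField.sum _ fun _ _ => ((bosonPM _ _).shift_sub _).sub ((bosonPM _ _).shift_sub _)

theorem tailExpo (ε : ℤˣ) (i m : ℕ) : RegularField P (tailExpo P ε i m) :=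
  ((bosonPM _ _).shift _).add
    (RegularField.sum _ fun _ _ => ((bosonPM _ _).shift _).sub ((bosonPM _ _).shift _))

theorem eMinusLeftExpo (hq : ‖qpow P 1‖ < 1) (ε : ℤˣ) (t : ℂ) (i j : ℕ) :
    RegularField P (eMinusLeftExpo P ε t i j) :=
  (((bosonField hq _).shift_sub _).add
    (((bosonPM _ _).shift_sub _).neg'.sub ((bosonField hq _).shift_sub _))).add
    ((midExpo i j).add (tailExpo _ _ _))

theorem eMinusRightExpo (hq : ‖qpow P 1‖ < 1) (ε : ℤˣ) (t : ℂ) (i j : ℕ) :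
    RegularField P (eMinusRightExpo P ε t i j) :=
  (((bosonField hq _).shift _).add (((bosonPM _ _).shift _).sub ((bosonField hq _).shift _))).add
    (tailExpo _ _ _)

theorem curEExpo (hq : ‖qpow P 1‖ < 1) (hrs : P.rstar ≠ 0) (ε : ℤˣ) (t : ℂ) (i j : ℕ) :
    RegularField P (curEExpo P ε t i j) :=
  (((dPlusExpo hq hrs i).add (ePlusExpo hq ε t i j)).add (.const _ (fun _ _ => by simp [EllipticVO.qhat,
      qhatPart])
    fun _ _ => by simp [EllipticVO.qhat, qhatPart])).add
    (zeroModes (by fun_prop) _ (fun _ _ => by simp [EllipticVO.phat, phatPart, onePart])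
      (fun _ _ => by simp [EllipticVO.phat, phatPart, onePart]) (fun _ => by simp [EllipticVO.phat,
          phatPart, onePart])
      fun _ => by simp [EllipticVO.phat, phatPart, onePart])

theorem curFLeftExpo (hq : ‖qpow P 1‖ < 1) (hr : P.r ≠ 0) (ε : ℤˣ) (t : ℂ) (i j : ℕ) :
    RegularField P (curFLeftExpo P ε t i j) :=
  ((eMinusLeftExpo hq ε t i j).add (dMinusExpo hq hr i)).add
    (zeroModes (by fun_prop) _ (fun _ _ => by simp [EllipticVO.phat, hExpo, phatPart, EllipticVO.pPart,
        onePart])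
      (fun _ _ => by simp [EllipticVO.phat, hExpo, phatPart, EllipticVO.pPart, onePart])
      (fun _ => by simp [EllipticVO.phat, hExpo, phatPart, EllipticVO.pPart, onePart])
      fun _ => by simp [EllipticVO.phat, hExpo, phatPart, EllipticVO.pPart, onePart])

theorem curFRightExpo (hq : ‖qpow P 1‖ < 1) (hr : P.r ≠ 0) (ε : ℤˣ) (t : ℂ) (i j : ℕ) :
    RegularField P (curFRightExpo P ε t i j) :=
  ((eMinusRightExpo hq ε t i j).add (dMinusExpo hq hr i)).add
    (zeroModes (by fun_prop) _ (fun _ _ => by simp [EllipticVO.phat, hExpo, phatPart, EllipticVO.pPart,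
        onePart])
      (fun _ _ => by simp [EllipticVO.phat, hExpo, phatPart, EllipticVO.pPart, onePart])
      (fun _ => by simp [EllipticVO.phat, hExpo, phatPart, EllipticVO.pPart, onePart])
      fun _ => by simp [EllipticVO.phat, hExpo, phatPart, EllipticVO.pPart, onePart])

theorem curHExpo (hq : ‖qpow P 1‖ < 1) (hr : P.r ≠ 0) (hrs : P.rstar ≠ 0) (ε : ℤˣ) (i : ℕ) :
    RegularField P (curHExpo P ε i) :=
  ((((((dPlusExpo hq hrs i).shift _).add (psiCurExpo ε i)).add ((dMinusExpo hq hr i).shift_sub _)).add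
    (.const _ (fun _ _ => by simp [EllipticVO.qhat, qhatPart]) fun _ _ => by simp [EllipticVO.qhat,
        qhatPart])).add
    (.const _ (fun _ _ => by simp [hExpo, EllipticVO.pPart])
      fun _ _ => by simp [hExpo, EllipticVO.pPart])).add
    (zeroModes (by fun_prop) _ (fun _ _ => by simp [EllipticVO.phat, hExpo, phatPart, EllipticVO.pPart,
        onePart])
      (fun _ _ => by simp [EllipticVO.phat, hExpo, phatPart, EllipticVO.pPart, onePart])
      (fun _ => by simp [EllipticVO.phat, hExpo, phatPart, EllipticVO.pPart, onePart])
      fun _ => by simp [EllipticVO.phat, hExpo, phatPart, EllipticVO.pPart, onePart])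

variable (wt : ℕ → ℂ)

theorem phiExpo (hq : ‖qpow P 1‖ < 1) (hkh : P.k + P.N ≠ 0) (hN : P.N ≠ 0) (i : ℕ) :
    RegularField P (phiExpo P wt i) := by
  refine (?_ : RegularField P _).add (((qPart _).add (pPart (by fun_prop) _)).smul _)
  have hb : ∀ β, GeomBounded fun n => -(qnum P (wt i * (n : ℕ)) * ((n : ℕ) : ℂ)⁻¹ *
      qpow P ((P.k + P.N) / 2 * (n : ℕ))) * aDual P i ((n : ℕ) : ℤ) β := fun β =>
    (((GeomBounded.qnum_mul P _).mul .inv_natCast).mul (GeomBounded.qpow_mul P _)).neg.mul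
      (geomBounded_aDual i β hq hkh hN)
  have h := modeSum_smul (P := P) (f := fun n => -(qnum P (wt i * (|n| : ℤ)) / (|n| : ℤ) *
    qpow P ((P.k + P.N) / 2 * (|n| : ℤ)))) (V := aDual P i) (fun β => ?_) fun β => ?_
  · simpa only [neg_mul] using h
  · simpa only [Nat.abs_cast, Int.cast_natCast, div_eq_mul_inv] using hb β
  · simpa only [abs_neg, aDual_neg, Pi.neg_apply, mul_neg, Nat.abs_cast, Int.cast_natCast,
      div_eq_mul_inv] using (hb β).neg

theorem tPlusExpo (hq : ‖qpow P 1‖ < 1) (hr : P.r ≠ 0) (hk : P.k ≠ 0) (hN : P.N ≠ 0) (i : ℕ) :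
    RegularField P (tPlusExpo P wt i) := by
  refine (?_ : RegularField P _).add (zeroModes (by fun_prop) _ (fun _ _ => ?_) (fun _ _ => ?_) (fun _ =>
      ?_)
    fun _ => ?_)
  · have h := modeSum_smul (P := P) (f := fun n => if 0 < n then 1 / n * (qnum P (wt i * n) *
      qnum P (P.k * n) / qnum P (P.r * n)) * qpow P ((P.r - P.k / 2) * n) else 0) (V := hDual P i)
      (fun β => ?_) fun β => ?_
    · simpa only [ite_mul, zero_mul, ite_smul, zero_smul] using h
    · simpa [div_eq_mul_inv] using ((GeomBounded.inv_natCast.mul (((GeomBounded.qnum_mul P (wt i)).mul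
        (GeomBounded.qnum_mul P P.k)).mul (GeomBounded.inv_qnum_mul P hq hr))).mul
        (GeomBounded.qpow_mul P (P.r - P.k / 2))).mul (geomBounded_hDual i β hq hk hN)
    · simpa [not_natCast_neg] using GeomBounded.const 0
  all_goals
    simp [pCheck, hCheck, EllipticVO.phat, hExpo, phatPart, EllipticVO.pPart]

theorem tMinusExpo (hq : ‖qpow P 1‖ < 1) (hrs : P.rstar ≠ 0) (hk : P.k ≠ 0) (hN : P.N ≠ 0) (i : ℕ) :
    RegularField P (tMinusExpo P wt i) := by
  refine ((?_ : RegularField P _).add (.const _ (fun _ _ => by simp [qCheck, EllipticVO.qhat, qhatPart])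
    fun _ _ => by simp [qCheck, EllipticVO.qhat, qhatPart])).add
    (zeroModes (by fun_prop) _ (fun _ _ => ?_) (fun _ _ => ?_) (fun _ => ?_) fun _ => ?_)
  · have h := modeSum_smul (P := P) (f := fun m => if m < 0 then 1 / (-m) * (qnum P (wt i * (-m)) *
      qnum P (P.k * (-m)) / qnum P (P.rstar * (-m))) * qpow P ((P.r - P.k / 2) * (-m)) else 0)
      (V := hDual P i) (fun β => ?_) fun β => ?_
    · simpa only [ite_mul, zero_mul, ite_smul, zero_smul, neg_mul] using h
    · simpa [not_natCast_neg] using GeomBounded.const 0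
    · simpa [div_eq_mul_inv, hDual_neg] using (((GeomBounded.inv_natCast.mul
        (((GeomBounded.qnum_mul P (wt i)).mul
        (GeomBounded.qnum_mul P P.k)).mul (GeomBounded.inv_qnum_mul P hq hrs))).mul
        (GeomBounded.qpow_mul P (P.r - P.k / 2))).mul (geomBounded_hDual i β hq hk hN)).neg
  all_goals
    simp [pCheck, EllipticVO.phat, phatPart]

theorem psiExpo (hq : ‖qpow P 1‖ < 1) (hkh : P.k + P.N ≠ 0) (hN : P.N ≠ 0) (i : ℕ) :
    RegularField P (psiExpo P wt i) := by
  refine ((RegularField.add ?_ (((qPart _).add (pPart (by fun_prop) _)).smul _)).add ?_).add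
    (RegularField.sum _ fun j _ => ((qPart _).add (pPart (by fun_prop) _)).smul _)
  · have hb : ∀ β, GeomBounded fun n => -(qnum P (wt (P.N - i) * (n : ℕ)) * ((n : ℕ) : ℂ)⁻¹ *
        qpow P (-((P.k + P.N) / 2) * (n : ℕ))) * aDual P i ((n : ℕ) : ℤ) β := fun β =>
      (((GeomBounded.qnum_mul P _).mul .inv_natCast).mul (GeomBounded.qpow_mul P _)).neg.mul
        (geomBounded_aDual i β hq hkh hN)
    have h := modeSum_smul (P := P) (f := fun n => -(qnum P (wt (P.N - i) * (|n| : ℤ)) / (|n| : ℤ) *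
      qpow P (-((P.k + P.N) / 2) * (|n| : ℤ)))) (V := aDual P i) (fun β => ?_) fun β => ?_
    · simpa only [neg_mul] using h
    · simpa only [Nat.abs_cast, Int.cast_natCast, div_eq_mul_inv] using hb β
    · simpa only [abs_neg, aDual_neg, Pi.neg_apply, mul_neg, Nat.abs_cast, Int.cast_natCast,
        div_eq_mul_inv] using (hb β).neg
  · refine modeSum (fun s n _ => ?_) (fun β => ?_) fun β => ?_
    · rw [Finset.smul_sum]
      refine Finset.sum_congr rfl fun j _ => ?_
      rw [smul_smul, mul_zero, neg_zero, qpow_zero, mul_one, mul_comm (n : ℂ), mul_comm (qpow P _)]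
    all_goals
      simp only [Finset.sum_apply, Pi.smul_apply, smul_eq_mul, abs_neg, Nat.abs_cast, Int.cast_natCast,
        mul_zero, neg_zero, qpow_zero, mul_one, div_eq_mul_inv, ← inv_pow]
      exact GeomBounded.sum _ fun j _ => (GeomBounded.mul (by simp [GeomBounded.const, not_natCast_neg])
        ((GeomBounded.qnum_mul P _).mul ((GeomBounded.inv_qnum_natCast P hq).pow 2))).mul (.const _)

theorem phiTotal (hq : ‖qpow P 1‖ < 1) (hr : P.r ≠ 0) (hk : P.k ≠ 0) (hkh : P.k + P.N ≠ 0)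
    (hN : P.N ≠ 0) : RegularField P (phiTotal P wt) :=
  RegularField.sum _ fun i _ => (phiExpo wt hq hkh hN i).add (tPlusExpo wt hq hr hk hN i)

theorem psiTotal (hq : ‖qpow P 1‖ < 1) (hrs : P.rstar ≠ 0) (hk : P.k ≠ 0) (hkh : P.k + P.N ≠ 0)
    (hN : P.N ≠ 0) : RegularField P (psiTotal P wt) :=
  RegularField.sum _ fun i _ => (tMinusExpo wt hq hrs hk hN i).add (psiExpo wt hq hkh hN i)

end RegularField

/-! ### The currents as sums of normal ordered exponentials -/

theorem hasOpMul_normExp_vec (P : Params) {X Y : Expo P.N} (h : (∀ n, posVec n X = 0) ∨ ∀ n, negVec n Y = 0)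
    (hp : pVec X = 0 ∨ qVec Y = 0) (hh : phVec X = 0 ∨ qhVec Y = 0) :
    HasOpMul (normExp P X) (normExp P Y) (normExp P (X + Y)) :=
  hasOpMul_normExp P (h.imp (fun h β n => congrFun (h n) β) fun h β n => congrFun (h n) β)
    (hp.imp congrFun congrFun) (hh.imp congrFun congrFun)

section Products

variable {P : Params} (X : Expo P.N) (i : ℕ) (s : ℂ)

/-- A factor on the left without annihilation modes and momenta contracts with nothing; dually,
D_i^- on the right has no creation modes and no q-part. -/
theorem hasOpMul_dPlus : HasOpMul (dPlus P i s) (normExp P X) (normExp P (dPlusExpo P i s + X)) :=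
  hasOpMul_normExp_vec P (.inl fun n => posVec_dPlusExpo P n i s) (.inl rfl) (.inl rfl)

theorem hasOpMul_dMinus : HasOpMul (normExp P X) (dMinus P i s) (normExp P (X + dMinusExpo P i s)) :=
  hasOpMul_normExp_vec P (.inr fun n => negVec_dMinusExpo P n i s) (.inr rfl) (.inr rfl)

theorem hasOpMul_qhat (hX : phVec X = 0) (c : ℂ) :
    HasOpMul (normExp P X) (normExp P (c • qhat P i)) (normExp P (X + c • qhat P i)) :=
  hasOpMul_normExp_vec P (.inr fun n => by rw [map_smul, qhat, negVec_qhatPart, smul_zero])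
    (.inr <| by rw [map_smul, qhat, qVec_qhatPart, smul_zero]) (.inl hX)

/-- Factors built from momenta and scalars may stand on the right without a contraction. -/
theorem hasOpMul_of_zeroModes {Y : Expo P.N} (h : ∀ n, negVec n Y = 0) (hq : qVec Y = 0) (hh : qhVec Y = 0)
    :
    HasOpMul (normExp P X) (normExp P Y) (normExp P (X + Y)) :=
  hasOpMul_normExp_vec P (.inr h) (.inr hq) (.inr hh)

theorem hasOpMul_smul_phat (c d : ℂ) : HasOpMul (normExp P X) (normExp P (c • -(d • (phat P i - onePart
    1))))
    (normExp P (X + c • -(d • (phat P i - onePart 1)))) := by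
  refine hasOpMul_of_zeroModes X (fun n => ?_) ?_ ?_
  · simp only [phat, map_smul, map_neg, map_sub, negVec_phatPart, negVec_onePart, sub_zero, smul_zero,
      neg_zero]
  · simp only [phat, map_smul, map_neg, map_sub, qVec_phatPart, qVec_onePart, sub_zero, smul_zero, neg_zero]
  · simp only [phat, map_smul, map_neg, map_sub, qhVec_phatPart, qhVec_onePart, sub_zero, smul_zero,
      neg_zero]

theorem hasOpMul_smul_hExpo (c : ℂ) : HasOpMul (normExp P X) (normExp P (c • hExpo P i))
    (normExp P (X + c • hExpo P i)) := by
  refine hasOpMul_of_zeroModes X (fun n => ?_) ?_ ?_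
  · rw [hExpo, map_smul, negVec_pPart, smul_zero]
  · rw [hExpo, map_smul, qVec_pPart, smul_zero]
  · rw [hExpo, map_smul, qhVec_pPart, smul_zero]

theorem hasOpMul_smul_hExpo_phat (c d : ℂ) :
    HasOpMul (normExp P X) (normExp P (c • (d • (hExpo P i + phat P i - onePart 1))))
      (normExp P (X + c • (d • (hExpo P i + phat P i - onePart 1)))) := by
  refine hasOpMul_of_zeroModes X (fun n => ?_) ?_ ?_
  · simp only [phat, hExpo, map_smul, map_add, map_sub, negVec_pPart, negVec_phatPart, negVec_onePart,
      sub_zero, add_zero, smul_zero]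
  · simp only [phat, hExpo, map_smul, map_add, map_sub, qVec_pPart, qVec_phatPart, qVec_onePart,
      sub_zero, add_zero, smul_zero]
  · simp only [phat, hExpo, map_smul, map_add, map_sub, qhVec_pPart, qhVec_phatPart, qhVec_onePart,
      sub_zero, add_zero, smul_zero]

theorem hasOpMul_smul_hat (c d e : ℂ) :
    HasOpMul (normExp P X)
      (normExp P (c • (d • (phat P i + hExpo P i - onePart 1) - e • (phat P i - onePart 1))))
      (normExp P (X + c • (d • (phat P i + hExpo P i - onePart 1) - e • (phat P i - onePart 1)))) := by
  refine hasOpMul_of_zeroModes X (fun n => ?_) ?_ ?_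
  · simp only [phat, hExpo, map_smul, map_add, map_sub, negVec_pPart, negVec_phatPart, negVec_onePart,
      sub_zero, add_zero, smul_zero]
  · simp only [phat, hExpo, map_smul, map_add, map_sub, qVec_pPart, qVec_phatPart, qVec_onePart,
      sub_zero, add_zero, smul_zero]
  · simp only [phat, hExpo, map_smul, map_add, map_sub, qhVec_pPart, qhVec_phatPart, qhVec_onePart,
      sub_zero, add_zero, smul_zero]

end Products

variable (P : Params)

/-- The factors of H_i^± are already in normal order, with D_i^+ on the left, D_i^- to the right of
ψ_±, and e^(2q̂_i) before any p̂_i. Hence the product is a single exponential. -/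
theorem curH_eq (ε : ℤˣ) (i : ℕ) (u : ℂ) : curH P ε i u = normExp P (curHExpo P ε i (2 * u)) := by
  rw [curH, dressedPsi, show psiCur P ε i (2 * u) = normExp P (psiCurExpo P ε i (2 * u)) from rfl,
    (hasOpMul_dPlus _ _ _).eq, (hasOpMul_dMinus _ _ _).eq, (hasOpMul_qhat _ _ ?_ _).eq,
    (hasOpMul_smul_hExpo _ _ _).eq, (hasOpMul_smul_hat _ _ _ _ _).eq]
  · rfl
  · rw [map_add, map_add, phVec_psiCurExpo]
    simp only [dPlusExpo, dMinusExpo, phVec_modeSum, add_zero]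

/-- The scalar factor `-1 / ((q - q⁻¹) z)` of the currents. -/
def curCoeff (s : ℂ) : ℂ := -1 / ((qpow P 1 - qpow P (-1)) * qpow P s)

theorem hasOpMul_sum_sub {N : ℕ} {s : Finset ℕ} {A : ℕ → FockOp N} {B : FockOp N} {A' C C' : ℕ → FockOp N}
    (h : ∀ j ∈ s, HasOpMul (A j) B (C j)) (h' : ∀ j ∈ s, HasOpMul (A' j) B (C' j)) :
    HasOpMul (∑ j ∈ s, (A j - A' j)) B (∑ j ∈ s, (C j - C' j)) :=
  .sum_left s fun j hj => (h j hj).sub_left (h' j hj)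

theorem curE_eq (i : ℕ) (u : ℂ) : curE P i u = curCoeff P (2 * u) • ∑ j ∈ Finset.Icc 1 i,
    (normExp P (curEExpo P 1 j i j (2 * u)) - normExp P (curEExpo P (-1) (j - 2) i j (2 * u))) := by
  have he : ePlusCur P i (2 * u) = curCoeff P (2 * u) • ∑ j ∈ Finset.Icc 1 i,
      (normExp P (ePlusExpo P 1 j i j (2 * u)) - normExp P (ePlusExpo P (-1) (j - 2) i j (2 * u))) := rfl
  have h2 : ∀ ε t j, phVec (dPlusExpo P i (2 * u) + ePlusExpo P ε t i j (2 * u)) = 0 := fun ε t j => by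
    rw [map_add, phVec_ePlusExpo, dPlusExpo, phVec_modeSum, add_zero]
  rw [curE, dressedE, he, ((HasOpMul.sum_right _ fun j _ => (hasOpMul_dPlus _ i _).sub_right
    (hasOpMul_dPlus _ i _)).smul_right _).eq, ((hasOpMul_sum_sub (fun j _ => hasOpMul_qhat _ i (h2 _ _ _) 2)
    fun j _ => hasOpMul_qhat _ i (h2 _ _ _) 2).smul_left _).eq,
    ((hasOpMul_sum_sub (fun j _ => hasOpMul_smul_phat _ i _ _)
    fun j _ => hasOpMul_smul_phat _ i _ _).smul_left _).eq]
  rfl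

/-- The two single terms of e^{-,i} are members of the two families, at j = i with ε = -1 and at j =
i + 1 with ε = 1. -/
theorem eMinusCur_eq (i : ℕ) (s : ℂ) : eMinusCur P i s = curCoeff P s •
    ((∑ j ∈ Finset.Icc 1 (i - 1), (normExp P (eMinusLeftExpo P (-1) (P.k + j - 1) i j s) -
        normExp P (eMinusLeftExpo P 1 (P.k + j + 1) i j s))) +
      normExp P (eMinusLeftExpo P (-1) (P.k + i - 1) i i s) -
      normExp P (eMinusRightExpo P 1 (P.k + (i + 1 : ℕ)) i (i + 1) s) -
      ∑ j ∈ Finset.Icc (i + 2) P.N, (normExp P (eMinusRightExpo P 1 (P.k + j) i j s) -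
        normExp P (eMinusRightExpo P (-1) (P.k + j - 2) i j s))) := by
  -- The convention b^{ii} = c^{ii} = 0 removes the extra factors, and the sum in μ is empty; the
  -- value of `t` is immaterial here.
  have hl : eMinusLeftExpo P (-1) (P.k + i - 1) i i s =
      bosonField P (vbc P i (i + 1)) (s - (P.k + i)) + tailExpo P (-1) i (i + 1) s := by
    rw [eMinusLeftExpo, midExpo, vb_self, vbc_self, bosonPM_zero, bosonField_zero,
        Finset.Icc_eq_empty (by omega),
      Finset.sum_empty, neg_zero, sub_zero, add_zero, zero_add]
  have hr : eMinusRightExpo P 1 (P.k + (i + 1 : ℕ)) i (i + 1) s =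
      bosonField P (vbc P i (i + 1)) (s + (P.k + i)) + tailExpo P 1 i (i + 1) s := by
    rw [eMinusRightExpo, vb_self, vbc_self, bosonPM_zero, bosonField_zero, sub_zero, add_zero]
    push_cast
    rw [← add_assoc (P.k : ℂ), add_sub_cancel_right]
  rw [hl, hr]
  rfl

theorem curF_eq (i : ℕ) (u : ℂ) : curF P i u = curCoeff P (2 * u) •
    ((∑ j ∈ Finset.Icc 1 (i - 1), (normExp P (curFLeftExpo P (-1) (P.k + j - 1) i j (2 * u)) -
        normExp P (curFLeftExpo P 1 (P.k + j + 1) i j (2 * u)))) +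
      normExp P (curFLeftExpo P (-1) (P.k + i - 1) i i (2 * u)) -
      normExp P (curFRightExpo P 1 (P.k + (i + 1 : ℕ)) i (i + 1) (2 * u)) -
      ∑ j ∈ Finset.Icc (i + 2) P.N, (normExp P (curFRightExpo P 1 (P.k + j) i j (2 * u)) -
        normExp P (curFRightExpo P (-1) (P.k + j - 2) i j (2 * u)))) := by
  rw [curF, dressedF, eMinusCur_eq,
    (((((hasOpMul_sum_sub (fun j _ => hasOpMul_dMinus _ i _) fun j _ => hasOpMul_dMinus _ i _).add_left
      (hasOpMul_dMinus _ i _)).sub_left (hasOpMul_dMinus _ i _)).sub_left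
      (hasOpMul_sum_sub (fun j _ => hasOpMul_dMinus _ i _) fun j _ => hasOpMul_dMinus _ i _)).smul_left
          _).eq,
    (((((hasOpMul_sum_sub (fun j _ => hasOpMul_smul_hExpo_phat _ i _ _)
      fun j _ => hasOpMul_smul_hExpo_phat _ i _ _).add_left
      (hasOpMul_smul_hExpo_phat _ i _ _)).sub_left (hasOpMul_smul_hExpo_phat _ i _ _)).sub_left
      (hasOpMul_sum_sub (fun j _ => hasOpMul_smul_hExpo_phat _ i _ _)
        fun j _ => hasOpMul_smul_hExpo_phat _ i _ _)).smul_left _).eq]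
  rfl

theorem meromorphic_curCoeff : Meromorphic fun u => curCoeff P (2 * u) := by
  have h : Meromorphic fun u => qpow P (2 * u) :=
    meromorphic_of_differentiable ((differentiable_qpow P).comp (differentiable_id.const_mul 2))
  exact (Meromorphic.const (-1)).fun_div ((Meromorphic.const _).fun_mul h)

/-! ### Exchange relations of the terms of the currents -/

/-- Compares a power of q from the oscillators with the zero mode exponents, leaving an affine
identity in u and v to be checked. -/
theorem qpow_mul_exp {P : Params} {a T T' z z' : ℂ} (h : a * P.logq + z = z') (hT : T = T') :
    qpow P a * T * Complex.exp z = T' * Complex.exp z' := by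
  rw [← h, Complex.exp_add, hT, qpow]
  ring

section Terms

variable {P : Params} (wt : ℕ → ℂ) {i j : ℕ}

theorem exchange_curEExpo_phi (hq : ‖qpow P 1‖ < 1) (hr : 0 < P.r) (hrs : 0 < P.rstar)
    (hk : P.k ≠ 0) (hkh : P.k + P.N ≠ 0) (hj : 1 ≤ j) (hji : j ≤ i) (hi : i < P.N) {ε : ℤˣ} {t : ℂ}
    (h : (ε = 1 ∧ t = j) ∨ (ε = -1 ∧ t = j - 2)) :
    Exchange P (fun u => normExp P (curEExpo P ε t i j (2 * u))) (PhiVO P wt) fun _ => 1 :=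
  exchange_normExp (.curEExpo hq hrs.ne' _ _ i j) (.phiTotal wt hq hr.ne' hk hkh (by omega))
    (curE_phi_modes wt hq hk hkh hr.ne' hrs.ne' hj hji hi h) fun u v => by
      rw [zeroContr_curE_phi wt _ _ _ _ hkh hj hji hi, zeroContr_phi_curE wt _ _ _ _ hkh hj hji hi]

/-- The constant produced by the defect for ε = -1 is absorbed by the zero modes, so both signs and
all j give the same factor. -/
theorem exchange_curEExpo_psi (hq : ‖qpow P 1‖ < 1) (hr : 0 < P.r) (hrs : 0 < P.rstar)
    (hk : P.k ≠ 0) (hkh : P.k + P.N ≠ 0) (hj : 1 ≤ j) (hji : j ≤ i) (hi : i < P.N) {ε : ℤˣ} {t : ℂ}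
    (h : (ε = 1 ∧ t = j) ∨ (ε = -1 ∧ t = j - 2)) :
    Exchange P (fun u => normExp P (curEExpo P ε t i j (2 * u))) (PsiVO P wt) fun u =>
      theta P P.rstar (u - wt i / 2) / theta P P.rstar (u + wt i / 2) := by
  have hT : ∀ u, theta P P.rstar (u + -wt i / 2) / theta P P.rstar (u - -wt i / 2) =
      theta P P.rstar (u - wt i / 2) / theta P P.rstar (u + wt i / 2) := fun u => by
    rw [neg_div, sub_neg_eq_add, ← sub_eq_add_neg]
  have hX := RegularField.curEExpo hq hrs.ne' ε t i j
  have hY := RegularField.psiTotal wt hq hrs.ne' hk hkh (by omega)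
  rcases h with ⟨rfl, rfl⟩ | ⟨rfl, rfl⟩
  · refine exchange_normExp hX hY (curE_psi_modes_one wt hq hk hkh hr hrs hj hji hi) fun u v => ?_
    rw [zeroContr_curE_psi wt _ _ _ _ hkh hj hji hi, zeroContr_psi_curE wt _ _ _ _ hkh hj hji hi, sgn_one]
    exact qpow_mul_exp (by ring) (hT _)
  · refine exchange_normExp hX hY (curE_psi_modes_neg_one wt hq hk hkh hr hrs hj hji hi) fun u v => ?_
    rw [zeroContr_curE_psi wt _ _ _ _ hkh hj hji hi, zeroContr_psi_curE wt _ _ _ _ hkh hj hji hi,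
      sgn_neg_one, mul_right_comm (qpow P _), ← qpow_add]
    exact qpow_mul_exp (by ring) (hT _)

theorem exchange_curFLeftExpo_phi (hq : ‖qpow P 1‖ < 1) (hr : 0 < P.r) (hrs : 0 < P.rstar)
    (hk : P.k ≠ 0) (hkh : P.k + P.N ≠ 0) (hj : 1 ≤ j) (hji : j ≤ i) (hi : i < P.N) {ε : ℤˣ} {t : ℂ}
    (h : (ε = 1 ∧ t = P.k + j + 1) ∨ (ε = -1 ∧ t = P.k + j - 1)) :
    Exchange P (fun u => normExp P (curFLeftExpo P ε t i j (2 * u))) (PhiVO P wt) fun u =>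
      theta P P.r (u + wt i / 2) / theta P P.r (u - wt i / 2) := by
  have hX := RegularField.curFLeftExpo hq hr.ne' ε t i j
  have hY := RegularField.phiTotal wt hq hr.ne' hk hkh (by omega)
  have hm : ModeExchange P
      (fun n => modePairing P n (posVec n (curFLeftExpo P ε t i j 0)) (negVec n (phiTotal P wt 0)))
      (fun n => modePairing P n (posVec n (phiTotal P wt 0)) (negVec n (curFLeftExpo P ε t i j 0)))
      fun u => qpow P (wt i - 2 * wt i / P.r * u) *
        (theta P P.r (u + wt i / 2) / theta P P.r (u - wt i / 2)) := by
    rcases h with ⟨rfl, rfl⟩ | ⟨rfl, rfl⟩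
    · exact curFLeft_phi_modes_one wt hq hk hkh hr hrs hj hji hi
    · exact curFLeft_phi_modes_neg_one wt hq hk hkh hr hrs hj hji hi
  refine exchange_normExp hX hY hm fun u v => ?_
  rw [zeroContr_curFLeft_phi wt _ _ _ _ hkh hj hji hi, zeroContr_phi_curFLeft wt _ _ _ _ hkh hj hji hi]
  exact qpow_mul_exp (by ring) rfl

/-- The prefactor q^(-λ^i) of the oscillators meets +λ^i from the zero modes; for j ≤ i both signs
are reversed. The resulting exchange factor is the same. -/
theorem exchange_curFRightExpo_phi (hq : ‖qpow P 1‖ < 1) (hr : 0 < P.r) (hrs : 0 < P.rstar)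
    (hk : P.k ≠ 0) (hkh : P.k + P.N ≠ 0) (h1 : 1 ≤ i) (hij : i < j) (hj : j ≤ P.N) {ε : ℤˣ} {t : ℂ}
    (h : (ε = 1 ∧ t = P.k + j) ∨ (ε = -1 ∧ t = P.k + j - 2)) :
    Exchange P (fun u => normExp P (curFRightExpo P ε t i j (2 * u))) (PhiVO P wt) fun u =>
      theta P P.r (u + wt i / 2) / theta P P.r (u - wt i / 2) := by
  have hX := RegularField.curFRightExpo hq hr.ne' ε t i j
  have hY := RegularField.phiTotal wt hq hr.ne' hk hkh (by omega)
  have hm : ModeExchange P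
      (fun n => modePairing P n (posVec n (curFRightExpo P ε t i j 0)) (negVec n (phiTotal P wt 0)))
      (fun n => modePairing P n (posVec n (phiTotal P wt 0)) (negVec n (curFRightExpo P ε t i j 0)))
      fun u => qpow P (-wt i - 2 * wt i / P.r * u) *
        (theta P P.r (u + wt i / 2) / theta P P.r (u - wt i / 2)) := by
    rcases h with ⟨rfl, rfl⟩ | ⟨rfl, rfl⟩
    · exact curFRight_phi_modes_one wt hq hk hkh hr hrs h1 hij hj
    · exact curFRight_phi_modes_neg_one wt hq hk hkh hr hrs h1 hij hj
  refine exchange_normExp hX hY hm fun u v => ?_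
  rw [zeroContr_curFRight_phi wt _ _ _ _ hkh h1 hij hj, zeroContr_phi_curFRight wt _ _ _ _ hkh h1 hij hj]
  exact qpow_mul_exp (by ring) rfl

theorem exchange_curFLeftExpo_psi_one (hq : ‖qpow P 1‖ < 1) (hr : 0 < P.r) (hrs : 0 < P.rstar)
    (hk : P.k ≠ 0) (hkh : P.k + P.N ≠ 0) (hj : 1 ≤ j) (hji : j < i) (hi : i < P.N) :
    Exchange P (fun u => normExp P (curFLeftExpo P 1 (P.k + j + 1) i j (2 * u))) (PsiVO P wt)
      fun _ => 1 := by
  refine exchange_normExp (.curFLeftExpo hq hr.ne' _ _ i j) (.psiTotal wt hq hrs.ne' hk hkh (by omega))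
    (curFLeft_psi_modes_one wt hq hk hkh hr hrs hj hji hi) fun u v => ?_
  rw [zeroContr_curFLeft_psi wt _ _ _ _ hkh hj hji.le hi, zeroContr_psi_curFLeft wt _ _ _ _ hkh hj hji.le
      hi,
    sgn_one, psiShiftZero_of_pos wt (by omega), ← mul_one (qpow P _)]
  exact qpow_mul_exp (by ring) rfl

theorem exchange_curFLeftExpo_psi_neg_one (hq : ‖qpow P 1‖ < 1) (hr : 0 < P.r) (hrs : 0 < P.rstar)
    (hk : P.k ≠ 0) (hkh : P.k + P.N ≠ 0) (hj : 1 ≤ j) (hji : j ≤ i) (hi : i < P.N) :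
    Exchange P (fun u => normExp P (curFLeftExpo P (-1) (P.k + j - 1) i j (2 * u))) (PsiVO P wt)
      fun _ => 1 := by
  refine exchange_normExp (.curFLeftExpo hq hr.ne' _ _ i j) (.psiTotal wt hq hrs.ne' hk hkh (by omega))
    (curFLeft_psi_modes_neg_one wt hq hk hkh hr hrs hj hji hi) fun u v => ?_
  rw [zeroContr_curFLeft_psi wt _ _ _ _ hkh hj hji hi, zeroContr_psi_curFLeft wt _ _ _ _ hkh hj hji hi,
    sgn_neg_one, neg_add_cancel, zero_mul, mul_zero]

theorem exchange_curFRightExpo_psi_one (hq : ‖qpow P 1‖ < 1) (hr : 0 < P.r) (hrs : 0 < P.rstar)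
    (hk : P.k ≠ 0) (hkh : P.k + P.N ≠ 0) (h1 : 1 ≤ i) (hij : i < j) (hj : j ≤ P.N) :
    Exchange P (fun u => normExp P (curFRightExpo P 1 (P.k + j) i j (2 * u))) (PsiVO P wt)
      fun _ => 1 := by
  refine exchange_normExp (.curFRightExpo hq hr.ne' _ _ i j) (.psiTotal wt hq hrs.ne' hk hkh (by omega))
    (curFRight_psi_modes_one wt hq hk hkh hr hrs h1 hij hj) fun u v => ?_
  rw [zeroContr_curFRight_psi wt _ _ _ _ hkh h1 hij hj, zeroContr_psi_curFRight wt _ _ _ _ hkh h1 hij hj,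
    sgn_one, sub_self, zero_mul, mul_zero]

theorem exchange_curFRightExpo_psi_neg_one (hq : ‖qpow P 1‖ < 1) (hr : 0 < P.r) (hrs : 0 < P.rstar)
    (hk : P.k ≠ 0) (hkh : P.k + P.N ≠ 0) (h1 : 1 ≤ i) (hij : i + 1 < j) (hj : j ≤ P.N) :
    Exchange P (fun u => normExp P (curFRightExpo P (-1) (P.k + j - 2) i j (2 * u))) (PsiVO P wt)
      fun _ => 1 := by
  refine exchange_normExp (.curFRightExpo hq hr.ne' _ _ i j) (.psiTotal wt hq hrs.ne' hk hkh (by omega))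
    (curFRight_psi_modes_neg_one wt hq hk hkh hr hrs h1 hij hj) fun u v => ?_
  rw [zeroContr_curFRight_psi wt _ _ _ _ hkh h1 (by omega) hj,
    zeroContr_psi_curFRight wt _ _ _ _ hkh h1 (by omega) hj,
    sgn_neg_one, psiShiftZero_of_pos wt (by omega), ← mul_one (qpow P _)]
  exact qpow_mul_exp (by ring) rfl

/-! ### Exchange relations of the currents -/

theorem exchange_curH_phi (hq : ‖qpow P 1‖ < 1) (hr : 0 < P.r) (hrs : 0 < P.rstar)
    (hk : P.k ≠ 0) (hkh : P.k + P.N ≠ 0) (h1 : 1 ≤ i) (hi : i < P.N) (ε : ℤˣ) :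
    Exchange P (curH P ε i) (PhiVO P wt) fun u =>
      theta P P.r (u + wt i / 2 - sgn ε * (P.k / 4)) / theta P P.r (u - wt i / 2 - sgn ε * (P.k / 4)) := by
  rw [funext (curH_eq P ε i)]
  have hX := RegularField.curHExpo hq hr.ne' hrs.ne' ε i
  have hY := RegularField.phiTotal wt hq hr.ne' hk hkh (by omega)
  have hr0 : (P.r : ℂ) ≠ 0 := Complex.ofReal_ne_zero.2 hr.ne'
  rcases Int.units_eq_one_or ε with rfl | rfl
  · refine exchange_normExp hX hY (curH_phi_modes_one wt hq hk hkh hr hrs h1 hi) fun u v => ?_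
    rw [zeroContr_curH_phi wt _ _ _ hkh h1 hi, zeroContr_phi_curH wt _ _ _ h1 hi, sgn_one]
    refine qpow_mul_exp (by field_simp; ring) ?_
    congr 2 <;> ring
  · refine exchange_normExp hX hY (curH_phi_modes_neg_one wt hq hk hkh hr hrs h1 hi) fun u v => ?_
    rw [zeroContr_curH_phi wt _ _ _ hkh h1 hi, zeroContr_phi_curH wt _ _ _ h1 hi, sgn_neg_one]
    refine qpow_mul_exp (by field_simp; ring) ?_
    congr 2 <;> ring

theorem exchange_curH_psi (hq : ‖qpow P 1‖ < 1) (hr : 0 < P.r) (hrs : 0 < P.rstar)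
    (hk : P.k ≠ 0) (hkh : P.k + P.N ≠ 0) (h1 : 1 ≤ i) (hi : i < P.N) (ε : ℤˣ) :
    Exchange P (curH P ε i) (PsiVO P wt) fun u =>
      theta P P.rstar (u - wt i / 2 + sgn ε * (P.k / 4)) /
        theta P P.rstar (u + wt i / 2 + sgn ε * (P.k / 4)) := by
  rw [funext (curH_eq P ε i)]
  have hX := RegularField.curHExpo hq hr.ne' hrs.ne' ε i
  have hY := RegularField.psiTotal wt hq hrs.ne' hk hkh (by omega)
  have hr0 : (P.rstar : ℂ) ≠ 0 := Complex.ofReal_ne_zero.2 hrs.ne'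
  -- The zero mode exponents contain r, the theta functions r*.
  have hrk : (P.r : ℂ) = P.rstar + P.k := by rw [Params.rstar, Complex.ofReal_sub, sub_add_cancel]
  rcases Int.units_eq_one_or ε with rfl | rfl
  · refine exchange_normExp hX hY (curH_psi_modes_one wt hq hk hkh hr hrs h1 hi) fun u v => ?_
    rw [zeroContr_curH_psi wt _ _ _ hkh h1 hi, zeroContr_psi_curH wt _ _ _ h1 hi, sgn_one, hrk]
    refine qpow_mul_exp (by field_simp; ring) ?_
    congr 2 <;> ring
  · refine exchange_normExp hX hY (curH_psi_modes_neg_one wt hq hk hkh hr hrs h1 hi) fun u v => ?_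
    rw [zeroContr_curH_psi wt _ _ _ hkh h1 hi, zeroContr_psi_curH wt _ _ _ h1 hi, sgn_neg_one, hrk]
    refine qpow_mul_exp (by field_simp; ring) ?_
    congr 2 <;> ring

/-- A sum inherits an exchange relation because its terms share one factor `c`. -/
theorem exchange_curE {B : ℂ → FockOp P.N} {c : ℂ → ℂ}
    (h : ∀ j, 1 ≤ j → j ≤ i → ∀ ε t, (ε = 1 ∧ t = (j : ℂ)) ∨ (ε = -1 ∧ t = j - 2) →
      Exchange P (fun u => normExp P (curEExpo P ε t i j (2 * u))) B c) :
    Exchange P (curE P i) B c := by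
  rw [funext (curE_eq P i)]
  refine (Exchange.sum_left _ fun j hj => ?_).smul_left (meromorphic_curCoeff P)
  rw [Finset.mem_Icc] at hj
  exact (h j hj.1 hj.2 _ _ (.inl ⟨rfl, rfl⟩)).sub_left (h j hj.1 hj.2 _ _ (.inr ⟨rfl, rfl⟩))

/-- The four ranges are those of the terms that actually occur: j = i is excluded for ε = 1 on the
left and j = i + 1 for ε = -1 on the right, where the relations with Ψ_Λ would need a separate
treatment. -/
theorem exchange_curF {B : ℂ → FockOp P.N} {c : ℂ → ℂ} (h1 : 1 ≤ i) (hi : i < P.N)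
    (hl : ∀ j, 1 ≤ j → j < i →
      Exchange P (fun u => normExp P (curFLeftExpo P 1 (P.k + j + 1) i j (2 * u))) B c)
    (hl' : ∀ j, 1 ≤ j → j ≤ i →
      Exchange P (fun u => normExp P (curFLeftExpo P (-1) (P.k + j - 1) i j (2 * u))) B c)
    (hr : ∀ j, i < j → j ≤ P.N →
      Exchange P (fun u => normExp P (curFRightExpo P 1 (P.k + j) i j (2 * u))) B c)
    (hr' : ∀ j, i + 1 < j → j ≤ P.N →
      Exchange P (fun u => normExp P (curFRightExpo P (-1) (P.k + j - 2) i j (2 * u))) B c) :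
    Exchange P (curF P i) B c := by
  rw [funext (curF_eq P i)]
  refine Exchange.smul_left (((Exchange.add_left (.sum_left _ fun j hj => ?_) (hl' i h1 le_rfl)).sub_left
    (hr (i + 1) (by omega) hi)).sub_left (.sum_left _ fun j hj => ?_)) (meromorphic_curCoeff P)
  · rw [Finset.mem_Icc] at hj
    exact (hl' j hj.1 (by omega)).sub_left (hl j hj.1 (by omega))
  · rw [Finset.mem_Icc] at hj
    exact (hr j (by omega) hj.2).sub_left (hr' j (by omega) hj.2)

end Terms

end
end EllipticVO

open EllipticVO in
theorem theorem5 (P : Params) (hN : 2 ≤ P.N) (hq : ‖qpow P 1‖ < 1)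
    (hr : 0 < P.r) (hrs : 0 < P.rstar) (hk : P.k ≠ 0) (hkh : P.k + P.N ≠ 0)
    (wt : ℕ → ℂ) (i : ℕ) (hi : 1 ≤ i) (hiN : i < P.N) :
    (∀ ε : ℤˣ, Exchange P (curH P ε i) (PhiVO P wt) (fun u =>
      theta P P.r (u + wt i / 2 - sgn ε * (P.k / 4)) /
        theta P P.r (u - wt i / 2 - sgn ε * (P.k / 4)))) ∧
    Exchange P (curE P i) (PhiVO P wt) (fun _ => 1) ∧
    Exchange P (curF P i) (PhiVO P wt) (fun u =>
      theta P P.r (u + wt i / 2) / theta P P.r (u - wt i / 2)) ∧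
    (∀ ε : ℤˣ, Exchange P (curH P ε i) (PsiVO P wt) (fun u =>
      theta P P.rstar (u - wt i / 2 + sgn ε * (P.k / 4)) /
        theta P P.rstar (u + wt i / 2 + sgn ε * (P.k / 4)))) ∧
    Exchange P (curE P i) (PsiVO P wt) (fun u =>
      theta P P.rstar (u - wt i / 2) / theta P P.rstar (u + wt i / 2)) ∧
    Exchange P (curF P i) (PsiVO P wt) (fun _ => 1) := by
  refine ⟨exchange_curH_phi wt hq hr hrs hk hkh hi hiN,
    exchange_curE fun j hj hji _ _ h => exchange_curEExpo_phi wt hq hr hrs hk hkh hj hji hiN h,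
    exchange_curF hi hiN
      (fun j hj hji => exchange_curFLeftExpo_phi wt hq hr hrs hk hkh hj hji.le hiN (.inl ⟨rfl, rfl⟩))
      (fun j hj hji => exchange_curFLeftExpo_phi wt hq hr hrs hk hkh hj hji hiN (.inr ⟨rfl, rfl⟩))
      (fun j hij hj => exchange_curFRightExpo_phi wt hq hr hrs hk hkh hi hij hj (.inl ⟨rfl, rfl⟩))
      fun j hij hj =>
        exchange_curFRightExpo_phi wt hq hr hrs hk hkh hi (by omega) hj (.inr ⟨rfl, rfl⟩),
    exchange_curH_psi wt hq hr hrs hk hkh hi hiN,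
    exchange_curE fun j hj hji _ _ h => exchange_curEExpo_psi wt hq hr hrs hk hkh hj hji hiN h,
    exchange_curF hi hiN (fun j hj hji => exchange_curFLeftExpo_psi_one wt hq hr hrs hk hkh hj hji hiN)
      (fun j hj hji => exchange_curFLeftExpo_psi_neg_one wt hq hr hrs hk hkh hj hji hiN)
      (fun j hij hj => exchange_curFRightExpo_psi_one wt hq hr hrs hk hkh hi hij hj)
      fun j hij hj => exchange_curFRightExpo_psi_neg_one wt hq hr hrs hk hkh hi hij hj⟩
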